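/- **Setting.** Let $(X,d)$ be a complete separable metric space, $T>0$, and let $\mathfrak m_n$ ($n\in\mathbb N$) and $\mathfrak m$ be Borel measures on $X$, finite on bounded sets, with $\mathfrak m_n\to\mathfrak m$ weakly, i.e. $\int v\,d\mathfrak m_n\to\int v\,d\mathfrak m$ for all bounded continuous $v$ with bounded support ($v\in C_{\rm bs}(X)$). $\mathrm{Lip}_b(X)$ and $\mathrm{Lip}_{bs}(X)$ are the bounded Lipschitz functions and the Lipschitz functions bounded with bounded support; $\mathrm{Lip}_a f(x)=\inf_{r>0}\mathrm{Lip}(f|_{B_r(x)})$. *Cheeger energy and slopes.* For $f\in L^2(X,\mathfrak m)$ let $\mathsf{Ch}(f)=\inf\liminf_k\frac12\int(\mathrm{Lip}_a f_k)^2d\mathfrak m$ over $f_k\in \mathrm{Lip}_b\cap L^2$ with $f_k\to f$ in $L^2$; $H^{1,2}(X,d,\mathfrak m)=\{\mathsf{Ch}<\infty\}$ with $\|f\|^2=\|f\|_{L^2}^2+2\mathsf{Ch}(f)$. For $f\in H^{1,2}$, $|Df|$ is the minimal ($\mathfrak m$-a.e. smallest) function in $L^2$ that is $\ge$ a weak $L^2$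 limit of $\mathrm{Lip}_a f_k$ for some such $f_k\to f$; for $f\in\mathrm{Lip}_b(X)$, $|Df|$ is defined by locality ($|Df|=|Du|$ a.e. on any ball where $f=u\in \mathrm{Lip}_{bs}(X)$). *Derivations.* A derivation is a linear map $b:\mathrm{Lip}_b(X)\to L^0(X,\mathfrak m)$ with $|b(f)|\le h|Df|$ $\mathfrak m$-a.e. for all $f$, for some $0\le h\in L^0(X,\mathfrak m)$; $|b|$ is the a.e. smallest such $h$. A time-dependent derivation is a family $b=(b_t)_{t\in(0,T)}$ of derivations with $|b_t|\in L^1_{\rm loc}(X,\mathfrak m)$ (integrable on bounded sets) such that every $b_t(f)$ has a jointly Borel representative in $(t,x)$. The divergence $\mathrm{div}\,b_t\in L^1_{\rm loc}$ is defined by $-\int b_t(f)\,d\mathfrak m=\int f\,\mathrm{div}\,b_t\,d\mathfrak m$ for all $f\in\mathrm{Lip}_{bs}(X)$. *Flows.* A Borel map $\mathbf X:[0,T]\times X\to X$ is a regular flow relative to $b$ (and $\mathfrak m$) if: (a) for some constant $C$, $\mathbf X(t,\cdot)_\#\mathfrak m\le C\mathfrak m$ for all $t\in[0,T]$; (b)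 for $\mathfrak m$-a.e. $x$, $\mathbf X(\cdot,x)$ is absolutely continuous and $\mathbf X(0,x)=x$; and for all $f\in\mathrm{Lip}_{bs}(X)$, $\frac{d}{dt}f(\mathbf X(t,x))=b_t(f)(\mathbf X(t,x))$ for a.e. $(t,x)\in(0,T)\times X$. The least constant in (a) is $C(\mathbf X,\mathfrak m)$. A Borel probability measure $\pi$ on $C([0,T];X)$ is a regular generalized flow relative to $b$ if $(\mathrm{ev}_t)_\#\pi\le C\mathfrak m$ for some $C$ and all $t\in[0,T]$, $\pi$ is concentrated on absolutely continuous curves, and for all $f\in \mathrm{Lip}_{bs}(X)$, $\frac{d}{dt}f(\gamma(t))=b_t(f)(\gamma(t))$ for $\mathscr L^1\times\pi$-a.e. $(t,\gamma)$. **Proposition (Stability for regular flows, general case).** Let $b_n=(b_{n,t})$ be time-dependent derivations on $(X,d,\mathfrak m_n)$, $b=(b_t)$ a time-dependent derivation on $(X,d,\mathfrak m)$. Assume: 1. (strong convergence) There is a class $\mathcal D\subset\mathrm{Lip}_b(X)$, dense for $\mathfrak m$-flat convergence (every $f\in\mathrm{Lip}_b(X)$ is the $\mathfrak m$-a.e.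 limit of functions $f_k\in\mathcal D$ with $\sup_k(\sup|f_k|+\mathrm{Lip}(f_k))<\infty$), such that for all $f\in\mathcal D$ $$\lim_{n\to\infty}\int_0^T\!\!\int_X b_{n,t}(f)\,v_n\,d\mathfrak m_n\,dt=\int_0^T\!\!\int_X b_t(f)\,v\,d\mathfrak m\,dt,$$ the limit integral being absolutely convergent, whenever $v_n,v$ are Borel on $(0,T)\times X$ with values in $[0,C]$ for some $C<\infty$, for all large $n$ the measures $v_n(t,\cdot)\mathfrak m_n$, $t\in(0,T)$, are probability measures, and for every $t\in(0,T)$ $v_n(t,\cdot)\mathfrak m_n$ converge weakly to the probability measure $v(t,\cdot)\mathfrak m$. 2. Either $H^{1,2}(X,d,\mathfrak m)$ is reflexive, or $b_t$ has a divergence in $L^1_{\rm loc}$ for a.e. $t$ and $\int_0^T\int_{B_R(\bar x)}|\mathrm{div}\,b_t|\,d\mathfrak m\,dt<\infty$ for all $\bar x\in X$, $R>0$. 3. $\mathbf X_n$ are regular flows relative to $b_n$ with $\sup_nC(\mathbf X_n,\mathfrak m_n)<\infty$. 4. $\sup_n\int_0^T\int_X\Theta(|b_{n,t}|)\,d\mathfrak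 m_n\,dt<\infty$ for some $\Theta:[0,\infty)\to[0,\infty]$ with $\Theta(z)/z\to\infty$ as $z\to\infty$. 5. $\mathbf X$ is a regular flow relative to $b$ that induces every regular generalized flow $\pi$ relative to $b$: $\pi=\int_X\delta_{\mathbf X(\cdot,x)}\,d(\mathrm{ev}_0)_\#\pi(x)$. Then $\mathbf X_n\to\mathbf X$ in measure as maps $X\to C([0,T];X)$: for every bounded continuous $\Phi:C([0,T];X)\to\mathbb R$ and every $v\in C_{\rm bs}(X)$, $$\lim_{n\to\infty}\int_X v(x)\,\Phi(\mathbf X_n(\cdot,x))\,d\mathfrak m_n(x)=\int_X v(x)\,\Phi(\mathbf X(\cdot,x))\,d\mathfrak m(x).$$ -/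

import Mathlib

open Set Filter Topology MeasureTheory
open scoped NNReal ENNReal BoundedContinuousFunction

noncomputable section

namespace MetricFlow

/-! ### Boundedly finite measures, Lipschitz functions -/

/-- Borel measures that are finite on bounded sets. -/
class BoundedlyFinite {X : Type*} [PseudoMetricSpace X] [MeasurableSpace X]
    (m : Measure X) : Prop where
  lt_top : ∀ s : Set X, Bornology.IsBounded s → m s < ∞

instance BoundedlyFinite.sigmaFinite {X : Type*} [PseudoMetricSpace X] [MeasurableSpace X]
    (m : Measure X) [BoundedlyFinite m] : SigmaFinite m := by
  rcases isEmpty_or_nonempty X with h | ⟨⟨x⟩⟩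
  · have : m = 0 := Measure.eq_zero_of_isEmpty m
    rw [this]
    infer_instance
  · refine ⟨⟨⟨fun n : ℕ => Metric.closedBall x n, fun _ => trivial,
      fun n => BoundedlyFinite.lt_top _ Metric.isBounded_closedBall, ?_⟩⟩⟩
    refine Set.eq_univ_of_forall fun y => Set.mem_iUnion.2 ?_
    obtain ⟨n, hn⟩ := exists_nat_ge (dist y x)
    exact ⟨n, Metric.mem_closedBall.2 hn⟩

/-- The space of bounded real-valued Lipschitz functions. -/
def LipB (X : Type*) [PseudoMetricSpace X] : Submodule ℝ (X → ℝ) where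
  carrier := {f | (∃ K : ℝ≥0, LipschitzWith K f) ∧ ∃ C : ℝ, ∀ x, |f x| ≤ C}
  zero_mem' := ⟨⟨0, LipschitzWith.const 0⟩, 0, fun _ => by simp⟩
  add_mem' := by
    rintro f g ⟨⟨K, hK⟩, C, hC⟩ ⟨⟨K', hK'⟩, C', hC'⟩
    exact ⟨⟨K + K', hK.add hK'⟩, C + C',
      fun x => (abs_add_le _ _).trans (add_le_add (hC x) (hC' x))⟩
  smul_mem' := by
    rintro c f ⟨⟨K, hK⟩, C, hC⟩
    refine ⟨⟨‖c‖₊ * K, LipschitzWith.of_dist_le_mul fun x y => ?_⟩, |c| * C, fun x => ?_⟩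
    · have := hK.dist_le_mul x y
      rw [Real.dist_eq] at this ⊢
      simp only [Pi.smul_apply, smul_eq_mul, ← mul_sub, abs_mul, NNReal.coe_mul, coe_nnnorm,
        Real.norm_eq_abs, mul_assoc]
      exact mul_le_mul_of_nonneg_left this (abs_nonneg c)
    · simp only [Pi.smul_apply, smul_eq_mul, abs_mul]
      exact mul_le_mul_of_nonneg_left (hC x) (abs_nonneg c)

/-- The function has bounded support. -/
def BddSupport {X : Type*} [PseudoMetricSpace X] (f : X → ℝ) : Prop :=
  Bornology.IsBounded (Function.support f)

/-- The Lipschitz constant of the restriction of `f` to `s`, in `[0, ∞]`. -/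
def lipOn {X : Type*} [MetricSpace X] (f : X → ℝ) (s : Set X) : ℝ≥0∞ :=
  ⨆ x ∈ s, ⨆ y ∈ s, edist (f x) (f y) / edist x y

/-- The asymptotic Lipschitz constant of `f` at `x`. -/
def asympLip {X : Type*} [MetricSpace X] (f : X → ℝ) (x : X) : ℝ≥0∞ :=
  ⨅ (r : ℝ) (_ : 0 < r), lipOn f (Metric.ball x r)

section asymp

variable {X : Type*} [MetricSpace X]

theorem lipOn_mono (f : X → ℝ) {s t : Set X} (h : s ⊆ t) : lipOn f s ≤ lipOn f t :=
  iSup₂_le fun x hx => iSup₂_le fun y hy =>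
    le_iSup₂_of_le x (h hx) (le_iSup₂_of_le y (h hy) le_rfl)

theorem lipOn_add_le (f g : X → ℝ) (s : Set X) : lipOn (f + g) s ≤ lipOn f s + lipOn g s := by
  refine iSup₂_le fun x hx => iSup₂_le fun y hy => ?_
  have h1 : edist (f x) (f y) / edist x y ≤ lipOn f s :=
    le_iSup₂_of_le x hx (le_iSup₂_of_le y hy le_rfl)
  have h2 : edist (g x) (g y) / edist x y ≤ lipOn g s :=
    le_iSup₂_of_le x hx (le_iSup₂_of_le y hy le_rfl)
  refine le_trans ?_ (add_le_add h1 h2)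
  rw [← ENNReal.add_div]
  exact ENNReal.div_le_div_right (edist_add_add_le _ _ _ _) _

theorem lipOn_smul (c : ℝ) (f : X → ℝ) (s : Set X) :
    lipOn (c • f) s = ENNReal.ofReal |c| * lipOn f s := by
  simp only [lipOn, ENNReal.mul_iSup]
  have : ∀ x y, edist ((c • f) x) ((c • f) y) = ENNReal.ofReal |c| * edist (f x) (f y) := by
    intro x y
    rw [edist_dist, edist_dist, Real.dist_eq, Real.dist_eq, ← ENNReal.ofReal_mul (abs_nonneg c),
      ← abs_mul, mul_sub]
    rfl
  simp only [this, mul_div_assoc]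

theorem asympLip_add_le (f g : X → ℝ) (x : X) :
    asympLip (f + g) x ≤ asympLip f x + asympLip g x := by
  simp only [asympLip]
  rw [ENNReal.iInf₂_add]
  refine le_iInf₂ fun r hr => ?_
  rw [ENNReal.add_iInf₂]
  refine le_iInf₂ fun r' hr' => ?_
  refine (iInf₂_le (min r r') (lt_min hr hr')).trans ((lipOn_add_le f g _).trans ?_)
  exact add_le_add (lipOn_mono f (Metric.ball_subset_ball (min_le_left _ _)))
    (lipOn_mono g (Metric.ball_subset_ball (min_le_right _ _)))

theorem asympLip_smul (c : ℝ) (f : X → ℝ) (x : X) :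
    asympLip (c • f) x = ENNReal.ofReal |c| * asympLip f x := by
  simp only [asympLip, lipOn_smul]
  have h1 : ∀ a : ℝ → ℝ≥0∞, (⨅ (r : ℝ) (_ : 0 < r), a r) = ⨅ r : Ioi (0 : ℝ), a r :=
    fun a => (iInf_subtype' (p := fun r : ℝ => 0 < r) (f := fun r _ => a r))
  rw [h1, h1]
  have : Nonempty (Ioi (0 : ℝ)) := ⟨⟨1, mem_Ioi.2 one_pos⟩⟩
  rw [ENNReal.mul_iInf' (by simp) (fun _ => inferInstance)]

theorem measurable_asympLip [MeasurableSpace X] [BorelSpace X] (f : X → ℝ) :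
    Measurable (asympLip f) := by
  refine measurable_of_Iio fun c => IsOpen.measurableSet ?_
  rw [Metric.isOpen_iff]
  intro x hx
  simp only [mem_preimage, mem_Iio, asympLip, iInf_lt_iff] at hx
  obtain ⟨r, hr, h⟩ := hx
  refine ⟨r / 2, by positivity, fun y hy => ?_⟩
  simp only [mem_preimage, mem_Iio, asympLip, iInf_lt_iff]
  refine ⟨r / 2, by positivity, (lipOn_mono f ?_).trans_lt h⟩
  refine Metric.ball_subset_ball' ?_
  have := Metric.mem_ball.1 hy
  linarith

end asymp

/-! ### The Cheeger energy and the Sobolev space `H^{1,2}` -/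

/-- `u n` are bounded Lipschitz functions in `L²` that converge to `f` in `L²`. -/
def LipApprox {X : Type*} [MetricSpace X] [MeasurableSpace X] (m : Measure X)
    (f : X → ℝ) (u : ℕ → X → ℝ) : Prop :=
  (∀ n, u n ∈ LipB X ∧ MemLp (u n) 2 m) ∧
    Tendsto (fun n => eLpNorm (u n - f) 2 m) atTop (𝓝 0)

/-- The Cheeger energy on `L²`: the relaxation of `u ↦ ½ ∫ (Lip_a u)² dm`. -/
def cheeger {X : Type*} [MetricSpace X] [MeasurableSpace X] (m : Measure X)
    (f : Lp ℝ 2 m) : ℝ≥0∞ :=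
  ⨅ (u : ℕ → X → ℝ) (_ : LipApprox m f u),
    liminf (fun n => 2⁻¹ * ∫⁻ x, asympLip (u n) x ^ 2 ∂m) atTop

section cheeger

variable {X : Type*} [MetricSpace X] [MeasurableSpace X] {m : Measure X}

theorem exists_approx_of_cheeger_lt {f : Lp ℝ 2 m} {c : ℝ≥0∞} (h : cheeger m f < c) :
    ∃ u, LipApprox m f u ∧ ∀ n, 2⁻¹ * ∫⁻ x, asympLip (u n) x ^ 2 ∂m < c := by
  simp only [cheeger, iInf_lt_iff] at h
  obtain ⟨u, hu, h⟩ := h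
  obtain ⟨φ, hφ, hlt⟩ := extraction_of_frequently_atTop (frequently_lt_of_liminf_lt (by isBoundedDefault) h)
  exact ⟨fun n => u (φ n), ⟨fun n => hu.1 _, hu.2.comp hφ.tendsto_atTop⟩, hlt⟩

theorem cheeger_le {f : Lp ℝ 2 m} {c : ℝ≥0∞} {u : ℕ → X → ℝ} (hu : LipApprox m f u)
    (h : ∀ n, 2⁻¹ * ∫⁻ x, asympLip (u n) x ^ 2 ∂m ≤ c) : cheeger m f ≤ c :=
  (iInf₂_le u hu).trans ((liminf_le_liminf (Eventually.of_forall h)).trans (liminf_const c).le)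

theorem LipApprox.add {f g : Lp ℝ 2 m} {u v : ℕ → X → ℝ} (hu : LipApprox m f u)
    (hv : LipApprox m g v) : LipApprox m (f + g : Lp ℝ 2 m) (fun n => u n + v n) := by
  refine ⟨fun n => ⟨(LipB X).add_mem (hu.1 n).1 (hv.1 n).1, (hu.1 n).2.add (hv.1 n).2⟩, ?_⟩
  refine tendsto_of_tendsto_of_tendsto_of_le_of_le tendsto_const_nhds
    (by simpa using hu.2.add hv.2) (fun _ => zero_le) fun n => ?_
  have h1 : eLpNorm (u n + v n - ((f + g : Lp ℝ 2 m) : X → ℝ)) 2 m = eLpNorm ((u n - (f : X → ℝ)) + (v n - (g : X → ℝ))) 2 m := by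
    refine eLpNorm_congr_ae ?_
    filter_upwards [Lp.coeFn_add f g] with x hx
    simp only [Pi.sub_apply, Pi.add_apply, hx]
    ring
  simp only [h1]
  exact eLpNorm_add_le ((hu.1 n).2.1.sub (Lp.aestronglyMeasurable f))
    ((hv.1 n).2.1.sub (Lp.aestronglyMeasurable g)) one_le_two

theorem LipApprox.smul {f : Lp ℝ 2 m} {u : ℕ → X → ℝ} (c : ℝ) (hu : LipApprox m f u) :
    LipApprox m (c • f : Lp ℝ 2 m) (fun n => c • u n) := by
  refine ⟨fun n => ⟨(LipB X).smul_mem c (hu.1 n).1, (hu.1 n).2.const_smul c⟩, ?_⟩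
  have h1 : ∀ n, eLpNorm (c • u n - ((c • f : Lp ℝ 2 m) : X → ℝ)) 2 m = ‖c‖ₑ * eLpNorm (u n - (f : X → ℝ)) 2 m := by
    intro n
    rw [← eLpNorm_const_smul]
    refine eLpNorm_congr_ae ?_
    filter_upwards [Lp.coeFn_smul c f] with x hx
    simp only [Pi.sub_apply, Pi.smul_apply, hx, smul_sub]
  simp only [h1]
  simpa using ENNReal.Tendsto.const_mul hu.2 (Or.inr enorm_ne_top)

theorem half_sq_lt_iff {a b : ℝ≥0∞} : 2⁻¹ * a < 2⁻¹ * b ^ 2 ↔ a ^ (1 / 2 : ℝ) < b := by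
  rw [ENNReal.mul_lt_mul_iff_right (by simp) (by simp), ← ENNReal.rpow_two,
    ← ENNReal.rpow_lt_rpow_iff (z := (1 / 2 : ℝ)) (by norm_num), ← ENNReal.rpow_mul]
  norm_num

theorem half_sq_le_iff {a b : ℝ≥0∞} : 2⁻¹ * a ≤ 2⁻¹ * b ^ 2 ↔ a ^ (1 / 2 : ℝ) ≤ b := by
  rw [ENNReal.mul_le_mul_iff_right (by simp) (by simp), ← ENNReal.rpow_two,
    ← ENNReal.rpow_le_rpow_iff (z := (1 / 2 : ℝ)) (by norm_num), ← ENNReal.rpow_mul]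
  norm_num

theorem energy_add_le [BorelSpace X] (u v : X → ℝ) :
    (∫⁻ x, asympLip (u + v) x ^ 2 ∂m) ^ (1 / 2 : ℝ) ≤
      (∫⁻ x, asympLip u x ^ 2 ∂m) ^ (1 / 2 : ℝ) + (∫⁻ x, asympLip v x ^ 2 ∂m) ^ (1 / 2 : ℝ) := by
  have h := ENNReal.lintegral_Lp_add_le (μ := m) (p := 2) (measurable_asympLip u).aemeasurable
    (measurable_asympLip v).aemeasurable one_le_two
  simp only [ENNReal.rpow_two] at h
  refine le_trans (ENNReal.rpow_le_rpow (lintegral_mono fun x => ?_) (by norm_num)) h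
  exact pow_le_pow_left' (asympLip_add_le u v x) 2

theorem cheeger_sqrt_add_le [BorelSpace X] (f g : Lp ℝ 2 m) :
    (2 * cheeger m (f + g)) ^ (1 / 2 : ℝ) ≤
      (2 * cheeger m f) ^ (1 / 2 : ℝ) + (2 * cheeger m g) ^ (1 / 2 : ℝ) := by
  have key : ∀ h : Lp ℝ 2 m, ∀ a, (2 * cheeger m h) ^ (1 / 2 : ℝ) < a ↔
      cheeger m h < 2⁻¹ * a ^ 2 := fun h a => by
    rw [← half_sq_lt_iff, ← mul_assoc, ENNReal.inv_mul_cancel (by simp) (by simp), one_mul]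
  have key' : ∀ h : Lp ℝ 2 m, ∀ a, (2 * cheeger m h) ^ (1 / 2 : ℝ) ≤ a ↔
      cheeger m h ≤ 2⁻¹ * a ^ 2 := fun h a => by
    rw [← half_sq_le_iff, ← mul_assoc, ENNReal.inv_mul_cancel (by simp) (by simp), one_mul]
  refine ENNReal.le_of_forall_pos_le_add fun ε hε hfin => ?_
  have hε2 : ((ε / 2 : ℝ≥0) : ℝ≥0∞) ≠ 0 := by simpa using hε.ne'
  have hf := (key f _).1 (ENNReal.lt_add_right (ENNReal.add_lt_top.1 hfin).1.ne hε2)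
  have hg := (key g _).1 (ENNReal.lt_add_right (ENNReal.add_lt_top.1 hfin).2.ne hε2)
  obtain ⟨u, hu, hu'⟩ := exists_approx_of_cheeger_lt hf
  obtain ⟨v, hv, hv'⟩ := exists_approx_of_cheeger_lt hg
  refine (key' _ _).2 (cheeger_le (hu.add hv) fun n => ?_)
  rw [half_sq_le_iff]
  refine (energy_add_le _ _).trans ((add_le_add (half_sq_lt_iff.1 (hu' n)).le
    (half_sq_lt_iff.1 (hv' n)).le).trans_eq ?_)
  rw [add_add_add_comm, ← ENNReal.coe_add, add_halves]

theorem cheeger_smul_le (c : ℝ) (f : Lp ℝ 2 m) :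
    cheeger m (c • f) ≤ ENNReal.ofReal |c| ^ 2 * cheeger m f := by
  have hc : ENNReal.ofReal |c| ^ 2 ≠ ∞ := by simp
  rcases eq_or_ne (cheeger m f) ∞ with h | h
  · rcases eq_or_ne c 0 with rfl | h0
    · have : cheeger m ((0 : ℝ) • f) ≤ 0 := by
        refine cheeger_le (u := fun _ => 0) ⟨fun n => ⟨(LipB X).zero_mem, MemLp.zero⟩, ?_⟩ ?_
        · have : ∀ n : ℕ, eLpNorm (0 - (((0 : ℝ) • f : Lp ℝ 2 m) : X → ℝ)) 2 m = 0 := fun n => by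
            rw [eLpNorm_congr_ae (g := 0), eLpNorm_zero]
            filter_upwards [Lp.coeFn_smul (0 : ℝ) f] with x hx
            simp only [Pi.sub_apply, hx]
            simp
          exact tendsto_const_nhds.congr fun n => (this n).symm
        · have h0 : ∀ x : X, asympLip (0 : X → ℝ) x = 0 := fun x => by
            have := asympLip_smul 0 (0 : X → ℝ) x
            simpa using this
          simp [h0]
      exact this.trans zero_le
    · rw [h, ENNReal.mul_top (by simpa using h0)]
      exact le_top
  · refine ENNReal.le_of_forall_pos_le_add fun ε hε _ => ?_
    obtain ⟨δ, hδ, hδε⟩ : ∃ δ : ℝ≥0∞, δ ≠ 0 ∧ ENNReal.ofReal |c| ^ 2 * δ ≤ ε := by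
      refine ⟨ε / (ENNReal.ofReal |c| ^ 2), ?_, ENNReal.mul_div_le⟩
      simpa [ENNReal.div_eq_zero_iff] using hε.ne'
    obtain ⟨u, hu, hu'⟩ := exists_approx_of_cheeger_lt (ENNReal.lt_add_right h hδ)
    refine (cheeger_le (hu.smul c) fun n => ?_).trans
      ((mul_add _ _ _).trans_le (add_le_add le_rfl hδε))
    simp only [asympLip_smul, mul_pow]
    rw [lintegral_const_mul' _ _ hc, mul_left_comm]
    gcongr
    exact (hu' n).le

end cheeger

/-- The finiteness domain of the Cheeger energy, as a linear subspace of `L²`. -/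
def H12Submodule {X : Type*} [MetricSpace X] [MeasurableSpace X] [BorelSpace X]
    (m : Measure X) : Submodule ℝ (Lp ℝ 2 m) where
  carrier := {f | cheeger m f ≠ ∞}
  zero_mem' := by
    have := cheeger_smul_le (m := m) (0 : ℝ) 0
    simp only [smul_zero, abs_zero, ENNReal.ofReal_zero, ne_eq, OfNat.ofNat_ne_zero,
      not_false_eq_true, zero_pow, zero_mul] at this
    exact (this.trans_lt ENNReal.zero_lt_top).ne
  add_mem' := by
    intro f g hf hg h
    have := cheeger_sqrt_add_le (m := m) f g
    rw [h, ENNReal.mul_top (by simp), ENNReal.top_rpow_of_pos (by norm_num), top_le_iff,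
      ENNReal.add_eq_top] at this
    rcases this with h | h
    · exact ENNReal.rpow_ne_top_of_nonneg (by norm_num) (ENNReal.mul_ne_top (by simp) hf) h
    · exact ENNReal.rpow_ne_top_of_nonneg (by norm_num) (ENNReal.mul_ne_top (by simp) hg) h
  smul_mem' := by
    intro c f hf
    exact ((cheeger_smul_le c f).trans_lt
      (ENNReal.mul_lt_top (by simp) (lt_top_iff_ne_top.2 hf))).ne

/-- The Sobolev space `H^{1,2}`, normed by `‖f‖² = ‖f‖²_{L²} + 2 Ch(f)`. -/
def H12 {X : Type*} [MetricSpace X] [MeasurableSpace X] [BorelSpace X]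
    (m : Measure X) : Type _ := ↥(H12Submodule m)

section H12

variable {X : Type*} [MetricSpace X] [MeasurableSpace X] [BorelSpace X] (m : Measure X)

instance H12.addCommGroup : AddCommGroup (H12 m) :=
  inferInstanceAs (AddCommGroup ↥(H12Submodule m))

instance H12.module : Module ℝ (H12 m) :=
  inferInstanceAs (Module ℝ ↥(H12Submodule m))

/-- The inclusion of `H^{1,2}` in `L²`. -/
def H12.toL2 : H12 m →ₗ[ℝ] Lp ℝ 2 m := (H12Submodule m).subtype

instance H12.norm : Norm (H12 m) where
  norm f := √(‖H12.toL2 m f‖ ^ 2 + 2 * (cheeger m (H12.toL2 m f)).toReal)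

variable {m}

theorem H12.norm_def (f : H12 m) :
    ‖f‖ = √(‖H12.toL2 m f‖ ^ 2 + 2 * (cheeger m (H12.toL2 m f)).toReal) := rfl

theorem H12.cheeger_ne_top (f : H12 m) : cheeger m (H12.toL2 m f) ≠ ∞ := f.2

theorem sqrt_add_sq_add_le (a b c d : ℝ) :
    √((a + c) ^ 2 + (b + d) ^ 2) ≤ √(a ^ 2 + b ^ 2) + √(c ^ 2 + d ^ 2) := by
  have h := norm_add_le (⟨a, b⟩ : ℂ) ⟨c, d⟩
  simpa [Complex.norm_eq_sqrt_sq_add_sq] using h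

theorem H12.core : NormedSpace.Core ℝ (H12 m) where
  norm_nonneg f := Real.sqrt_nonneg _
  norm_smul c f := by
    have h2 : (cheeger m (c • H12.toL2 m f)).toReal =
        |c| ^ 2 * (cheeger m (H12.toL2 m f)).toReal := by
      have hle : ∀ (c : ℝ) (f : H12 m), (cheeger m (c • H12.toL2 m f)).toReal ≤
          |c| ^ 2 * (cheeger m (H12.toL2 m f)).toReal := fun c f => by
        have := ENNReal.toReal_mono (ENNReal.mul_ne_top (by simp) (H12.cheeger_ne_top f))
          (cheeger_smul_le c (H12.toL2 m f))
        simpa [ENNReal.toReal_mul] using this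
      refine le_antisymm (hle c f) ?_
      rcases eq_or_ne c 0 with rfl | hc
      · simp
      · have h := hle c⁻¹ (c • f)
        rw [map_smul, inv_smul_smul₀ hc, abs_inv, inv_pow, ← div_eq_inv_mul,
          le_div_iff₀ (by positivity)] at h
        rwa [mul_comm]
    rw [H12.norm_def, H12.norm_def, map_smul, h2, _root_.norm_smul, Real.norm_eq_abs,
      ← Real.sqrt_sq (abs_nonneg c), ← Real.sqrt_mul (by positivity)]
    congr 1
    rw [Real.sqrt_sq (abs_nonneg c)]
    ring
  norm_triangle f g := by
    have hs : ∀ f : H12 m, 2 * (cheeger m (H12.toL2 m f)).toReal =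
        (((2 * cheeger m (H12.toL2 m f)) ^ (1 / 2 : ℝ)).toReal) ^ 2 := fun f => by
      rw [← ENNReal.toReal_pow, ← ENNReal.rpow_two, ← ENNReal.rpow_mul]
      norm_num
    have hfin : ∀ f : H12 m, (2 * cheeger m (H12.toL2 m f)) ^ (1 / 2 : ℝ) ≠ ∞ := fun f =>
      ENNReal.rpow_ne_top_of_nonneg (by norm_num) (ENNReal.mul_ne_top (by simp) f.2)
    rw [H12.norm_def, H12.norm_def, H12.norm_def, hs, hs, hs]
    refine le_trans (Real.sqrt_le_sqrt ?_) (sqrt_add_sq_add_le _ _ _ _)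
    gcongr
    · rw [map_add]
      exact norm_add_le _ _
    · rw [map_add, ← ENNReal.toReal_add (hfin f) (hfin g)]
      exact ENNReal.toReal_mono (ENNReal.add_ne_top.2 ⟨hfin f, hfin g⟩) (cheeger_sqrt_add_le _ _)
  norm_eq_zero_iff f := by
    refine ⟨fun h => ?_, ?_⟩
    · rw [H12.norm_def, Real.sqrt_eq_zero (by positivity)] at h
      have h0 : ‖H12.toL2 m f‖ = 0 := by
        have := ENNReal.toReal_nonneg (a := cheeger m (H12.toL2 m f))
        nlinarith [sq_nonneg ‖H12.toL2 m f‖]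
      exact Subtype.ext (norm_eq_zero.1 h0)
    · rintro rfl
      have := cheeger_smul_le (m := m) (0 : ℝ) 0
      rw [H12.norm_def, map_zero]
      simp at this
      simp [this]

instance H12.normedAddCommGroup : NormedAddCommGroup (H12 m) :=
  NormedAddCommGroup.ofCore H12.core

instance H12.normedSpace : NormedSpace ℝ (H12 m) :=
  NormedSpace.ofCore H12.core

end H12

/-! ### Minimal relaxed slopes -/

/-- Relaxed slopes of `f`: elements of `L²` above a weak `L²` limit of `Lip_a (u n)`, where
`u n` are bounded Lipschitz functions in `L²` with `u n → f` in `L²`. -/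
def relaxedSlopes {X : Type*} [MetricSpace X] [MeasurableSpace X] (m : Measure X)
    (f : X → ℝ) : Set (Lp ℝ 2 m) :=
  {g | ∃ (u : ℕ → X → ℝ) (hs : ∀ n, MemLp (fun x => (asympLip (u n) x).toReal) 2 m)
    (g₀ : Lp ℝ 2 m), LipApprox m f u ∧
      (∀ φ : Lp ℝ 2 m, Tendsto (fun n => inner ℝ φ ((hs n).toLp)) atTop (𝓝 (inner ℝ φ g₀))) ∧
      g₀ ≤ g}

open Classical in
/-- The minimal relaxed slope `|Df|` of `f ∈ H^{1,2}`: the `m`-a.e. smallest relaxed slope.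
(Relaxed slopes are closed under minima, so this is also the one of least `L²` norm.) -/
def minSlopeL2 {X : Type*} [MetricSpace X] [MeasurableSpace X] (m : Measure X)
    (f : X → ℝ) : Lp ℝ 2 m :=
  if h : ∃ g, IsLeast (relaxedSlopes m f) g then h.choose else 0

/-- `G` is the minimal relaxed slope of the bounded Lipschitz function `f`, which need not be
in `L²`: on each ball, `G` is the minimal relaxed slope of every bounded Lipschitz function with
bounded support that agrees with `f` on that ball. -/
def IsLocalSlope {X : Type*} [MetricSpace X] [MeasurableSpace X] (m : Measure X)
    (f : LipB X) (G : X →ₘ[m] ℝ) : Prop :=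
  ∀ (x : X) (r : ℝ) (u : LipB X), BddSupport u.1 → (∀ y ∈ Metric.ball x r, u.1 y = f.1 y) →
    ∀ᵐ y ∂(m.restrict (Metric.ball x r)), G y = minSlopeL2 m u.1 y

open Classical in
/-- The minimal relaxed slope `|Df|` of a bounded Lipschitz function. -/
def slope {X : Type*} [MetricSpace X] [MeasurableSpace X] (m : Measure X)
    (f : LipB X) : X →ₘ[m] ℝ :=
  if h : ∃ G, IsLocalSlope m f G then h.choose else 0

/-! ### Derivations -/

/-- Derivations: linear maps `b : Lip_b(X) → L⁰(X, m)` such that, for some `h ∈ L⁰(X, m)`,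
`|b(f)| ≤ h |Df|` `m`-a.e. for all `f`. -/
structure LipDerivation {X : Type*} [MetricSpace X] [MeasurableSpace X] (m : Measure X) where
  toLin : LipB X →ₗ[ℝ] (X →ₘ[m] ℝ)
  exists_bound : ∃ h : X →ₘ[m] ℝ, 0 ≤ h ∧ ∀ f, |toLin f| ≤ h * slope m f

namespace LipDerivation

variable {X : Type*} [MetricSpace X] [MeasurableSpace X] {m : Measure X}

/-- The nonnegative functions `h` with `|b(f)| ≤ h |Df|` for all `f`. -/
def bounds (b : LipDerivation m) : Set (X →ₘ[m] ℝ) :=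
  {h | 0 ≤ h ∧ ∀ f, |b.toLin f| ≤ h * slope m f}

theorem mem_bounds_iff (b : LipDerivation m) (h : X →ₘ[m] ℝ) : h ∈ b.bounds ↔
    (∀ᵐ x ∂m, 0 ≤ h x) ∧ ∀ f, ∀ᵐ x ∂m, |b.toLin f x| ≤ h x * slope m f x := by
  have h1 : (0 ≤ h) ↔ ∀ᵐ x ∂m, 0 ≤ h x := by
    rw [← AEEqFun.coeFn_le]
    constructor
    · intro H
      filter_upwards [H, AEEqFun.coeFn_zero (α := X) (β := ℝ) (μ := m)] with x hx hx0
      simpa [hx0] using hx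
    · intro H
      filter_upwards [H, AEEqFun.coeFn_zero (α := X) (β := ℝ) (μ := m)] with x hx hx0
      simpa [hx0] using hx
  have h2 : ∀ f, (|b.toLin f| ≤ h * slope m f) ↔
      ∀ᵐ x ∂m, |b.toLin f x| ≤ h x * slope m f x := by
    intro f
    rw [← AEEqFun.coeFn_le]
    constructor
    · intro H
      filter_upwards [H, AEEqFun.coeFn_abs (b.toLin f), AEEqFun.coeFn_mul h (slope m f)]
        with x hx hx1 hx2
      rw [hx1, hx2] at hx
      exact hx
    · intro H
      filter_upwards [H, AEEqFun.coeFn_abs (b.toLin f), AEEqFun.coeFn_mul h (slope m f)]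
        with x hx hx1 hx2
      rw [hx1, hx2]
      exact hx
  simp only [bounds, mem_ofPred_eq, h1, h2]

theorem exists_isLeast_bounds [SigmaFinite m] (b : LipDerivation m) :
    ∃ h, IsLeast b.bounds h := by
  set ν : Measure X := m.toFinite with hν
  have hac : ν ≪ m := toFinite_absolutelyContinuous m
  have hca : m ≪ ν := absolutelyContinuous_toFinite m
  have hint : ∀ h : X →ₘ[m] ℝ, Integrable (fun x => Real.arctan (h x)) ν := by
    intro h
    refine Integrable.of_bound (C := Real.pi / 2)
      (Real.measurable_arctan.comp_aemeasurable (AEEqFun.measurable h).aemeasurable).aestronglyMeasurable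
      (Eventually.of_forall fun x => ?_)
    rw [Real.norm_eq_abs, abs_le]
    exact ⟨(Real.neg_pi_div_two_lt_arctan _).le, (Real.arctan_lt_pi_div_two _).le⟩
  set Φ : (X →ₘ[m] ℝ) → ℝ := fun h => ∫ x, Real.arctan (h x) ∂ν with hΦ
  have hnonneg : ∀ h ∈ b.bounds, 0 ≤ Φ h := by
    intro h hh
    refine integral_nonneg_of_ae ?_
    filter_upwards [hac.ae_le ((b.mem_bounds_iff h).1 hh).1] with x hx
    exact Real.arctan_nonneg.2 hx
  have hbdd : BddBelow (Φ '' b.bounds) := ⟨0, by rintro _ ⟨h, hh, rfl⟩; exact hnonneg h hh⟩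
  have hne : (Φ '' b.bounds).Nonempty := by
    obtain ⟨h, hh⟩ := b.exists_bound
    exact ⟨_, h, hh, rfl⟩
  obtain ⟨a, -, ha, ham⟩ := exists_seq_tendsto_sInf hne hbdd
  choose h hh hha using ham
  have hmeas : Measurable (fun x => ⨅ n, h n x) := by
    exact Measurable.iInf fun n => (AEEqFun.measurable (h n))
  set g : X →ₘ[m] ℝ := AEEqFun.mk (fun x => ⨅ n, h n x) hmeas.aestronglyMeasurable with hg
  have hgx : ∀ᵐ x ∂m, g x = ⨅ n, h n x := AEEqFun.coeFn_mk _ _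
  have hpos : ∀ᵐ x ∂m, ∀ n, 0 ≤ h n x :=
    ae_all_iff.2 fun n => ((b.mem_bounds_iff _).1 (hh n)).1
  have hgb : g ∈ b.bounds := by
    refine (b.mem_bounds_iff g).2 ⟨?_, fun f => ?_⟩
    · filter_upwards [hgx, hpos] with x hx hp
      rw [hx]
      exact Real.iInf_nonneg hp
    · filter_upwards [hgx, hpos, ae_all_iff.2 fun n => ((b.mem_bounds_iff _).1 (hh n)).2 f]
        with x hx hp hb
      rw [hx]
      have hbd : BddBelow (range fun n => h n x) := ⟨0, by rintro _ ⟨n, rfl⟩; exact hp n⟩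
      rcases le_total 0 (slope m f x) with hs | hs
      · rw [Real.iInf_mul_of_nonneg hs]
        exact le_ciInf hb
      · exact (hb 0).trans (mul_le_mul_of_nonpos_right (ciInf_le hbd 0) hs)
  have hmin : ∀ k ∈ b.bounds, Φ g ≤ Φ k := by
    intro k hk
    have h1 : Φ g ≤ sInf (Φ '' b.bounds) := by
      refine ge_of_tendsto' ha fun n => ?_
      rw [← hha n]
      refine integral_mono_ae (hint g) (hint (h n)) ?_
      filter_upwards [hac.ae_le hgx, hac.ae_le hpos] with x hx hp
      refine Real.arctan_mono ?_
      rw [hx]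
      exact ciInf_le ⟨0, by rintro _ ⟨n, rfl⟩; exact hp n⟩ n
    exact h1.trans (csInf_le hbdd ⟨k, hk, rfl⟩)
  refine ⟨g, hgb, fun k hk => ?_⟩
  have hinf : g ⊓ k ∈ b.bounds := by
    refine (b.mem_bounds_iff _).2 ⟨?_, fun f => ?_⟩
    · filter_upwards [AEEqFun.coeFn_inf g k, ((b.mem_bounds_iff _).1 hgb).1,
        ((b.mem_bounds_iff _).1 hk).1] with x hx h1 h2
      rw [hx]
      exact le_inf h1 h2
    · filter_upwards [AEEqFun.coeFn_inf g k, ((b.mem_bounds_iff _).1 hgb).2 f,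
        ((b.mem_bounds_iff _).1 hk).2 f] with x hx h1 h2
      rw [hx]
      rcases min_choice (g x) (k x) with h | h
      · exact h.symm ▸ h1
      · exact h.symm ▸ h2
  have hle : ∀ᵐ x ∂ν, Real.arctan ((g ⊓ k : X →ₘ[m] ℝ) x) ≤ Real.arctan (g x) := by
    filter_upwards [hac.ae_le (AEEqFun.coeFn_inf g k)] with x hx
    rw [hx]
    exact Real.arctan_mono inf_le_left
  have heq := (integral_eq_iff_of_ae_le (hint _) (hint _) hle).1
    (le_antisymm (integral_mono_ae (hint _) (hint _) hle) (hmin _ hinf))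
  rw [← AEEqFun.coeFn_le]
  filter_upwards [hca.ae_le heq, AEEqFun.coeFn_inf g k] with x hx hx2
  have := Real.arctan_injective hx
  rw [← this, hx2]
  exact inf_le_right

/-- The (local) norm `|b|` of a derivation: the `m`-a.e. smallest `h ≥ 0` such that
`|b(f)| ≤ h |Df|` for all `f`. -/
def norm [SigmaFinite m] (b : LipDerivation m) : X →ₘ[m] ℝ :=
  b.exists_isLeast_bounds.choose

/-- `g ∈ L¹_loc` is the divergence of `b`. -/
def IsDivergence (b : LipDerivation m) (g : X → ℝ) : Prop :=
  (∀ (x : X) (r : ℝ), IntegrableOn g (Metric.ball x r) m) ∧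
    ∀ f : LipB X, BddSupport f.1 → -∫ x, b.toLin f x ∂m = ∫ x, f.1 x * g x ∂m

end LipDerivation

/-- Time-dependent derivations `(b_t)_{t ∈ (0,T)} ⊂ Der¹_loc(X, m)`, depending on time in a Borel
way: each `b_t(f)` has a representative `rep f t x` that is jointly measurable in `(t, x)`. The
values of `der` and `rep` outside `(0,T)` are irrelevant. -/
structure TimeDerivation {X : Type*} [MetricSpace X] [MeasurableSpace X] (T : ℝ)
    (m : Measure X) [BoundedlyFinite m] where
  der : ℝ → LipDerivation m
  locL1 : ∀ t ∈ Ioo 0 T, ∀ (x : X) (r : ℝ), IntegrableOn (der t).norm (Metric.ball x r) m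
  rep : LipB X → ℝ → X → ℝ
  measurable_rep : ∀ f, Measurable (Function.uncurry (rep f))
  rep_ae : ∀ f, ∀ t ∈ Ioo 0 T, rep f t =ᵐ[m] (der t).toLin f

/-! ### Convergence -/

/-- Weak convergence of boundedly finite measures, in duality with bounded continuous functions
with bounded support. -/
def WeakConv {X : Type*} [MetricSpace X] [MeasurableSpace X] (mn : ℕ → Measure X)
    (m : Measure X) : Prop :=
  ∀ v : X →ᵇ ℝ, BddSupport v → Tendsto (fun n => ∫ x, v x ∂(mn n)) atTop (𝓝 (∫ x, v x ∂m))

/-- Local convergence in measure of Borel (up to null sets) maps `fn n : (X, mn n) → Y` to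
`f : (X, m) → Y`, with varying reference measures. -/
def ConvInMeasure {X Y : Type*} [MetricSpace X] [MeasurableSpace X] [MetricSpace Y]
    [MeasurableSpace Y] (mn : ℕ → Measure X) (m : Measure X) (fn : ℕ → X → Y) (f : X → Y) :
    Prop :=
  (∀ n, AEMeasurable (fn n) (mn n)) ∧ AEMeasurable f m ∧
    ∀ (Φ : Y →ᵇ ℝ) (v : X →ᵇ ℝ), BddSupport v →
      Tendsto (fun n => ∫ x, v x * Φ (fn n x) ∂(mn n)) atTop (𝓝 (∫ x, v x * Φ (f x) ∂m))

/-- `D` is dense in `Lip_b(X)` with respect to `m`-flat convergence. -/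
def FlatDense {X : Type*} [MetricSpace X] [MeasurableSpace X] (m : Measure X)
    (D : Set (LipB X)) : Prop :=
  ∀ f : LipB X, ∃ u : ℕ → LipB X, (∀ k, u k ∈ D) ∧
    (∃ L : ℝ≥0, ∀ k, LipschitzWith L (u k).1 ∧ ∀ x, |(u k).1 x| ≤ L) ∧
    ∀ᵐ x ∂m, Tendsto (fun k => (u k).1 x) atTop (𝓝 (f.1 x))

/-- The measure `v m` with density `v ≥ 0`. -/
def densMeasure {X : Type*} [MeasurableSpace X] (m : Measure X) (v : X → ℝ) : Measure X :=
  m.withDensity fun x => ENNReal.ofReal (v x)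

/-- Strong convergence of `b_{n,t}` to `b_t`, tested with the functions `f ∈ D` and with
uniformly bounded probability densities `v n (t, ·)` such that, for all `t ∈ (0,T)`, the
probability measures `v n (t, ·) mn n` converge weakly to `w (t, ·) m`. -/
def StrongConv {X : Type*} [MetricSpace X] [MeasurableSpace X] {T : ℝ}
    {mn : ℕ → Measure X} {m : Measure X} [∀ n, BoundedlyFinite (mn n)] [BoundedlyFinite m]
    (bn : ∀ n, TimeDerivation T (mn n)) (b : TimeDerivation T m) (D : Set (LipB X)) : Prop :=
  ∀ f ∈ D, ∀ (C : ℝ) (v : ℕ → ℝ → X → ℝ) (w : ℝ → X → ℝ),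
    (∀ n, Measurable (Function.uncurry (v n))) → Measurable (Function.uncurry w) →
    (∀ n t x, 0 ≤ v n t x ∧ v n t x ≤ C) → (∀ t x, 0 ≤ w t x ∧ w t x ≤ C) →
    (∀ᶠ n in atTop, ∀ t ∈ Ioo 0 T, IsProbabilityMeasure (densMeasure (mn n) (v n t))) →
    (∀ t ∈ Ioo 0 T, IsProbabilityMeasure (densMeasure m (w t))) →
    (∀ t ∈ Ioo 0 T, WeakConv (fun n => densMeasure (mn n) (v n t)) (densMeasure m (w t))) →
    Integrable (fun p : ℝ × X => b.rep f p.1 p.2 * w p.1 p.2)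
        ((volume.restrict (Ioo 0 T)).prod m) ∧
      Tendsto (fun n => ∫ t in Ioo 0 T, ∫ x, (bn n).rep f t x * v n t x ∂(mn n)) atTop
        (𝓝 (∫ t in Ioo 0 T, ∫ x, b.rep f t x * w t x ∂m))

/-! ### Flows -/

/-- The space `C([0,T]; X)`, with the uniform distance and its Borel `σ`-algebra. -/
abbrev Curves (T : ℝ) (X : Type*) [MetricSpace X] : Type _ := C(Icc (0 : ℝ) T, X)

instance Curves.measurableSpace (T : ℝ) (X : Type*) [MetricSpace X] :
    MeasurableSpace (Curves T X) := borel _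

instance Curves.borelSpace (T : ℝ) (X : Type*) [MetricSpace X] : BorelSpace (Curves T X) := ⟨rfl⟩

/-- Absolutely continuous curves `[0,T] → X`. -/
def IsAC {X : Type*} [MetricSpace X] {T : ℝ} (γ : Icc (0 : ℝ) T → X) : Prop :=
  ∃ g : ℝ → ℝ, IntegrableOn g (Icc 0 T) ∧ (∀ r, 0 ≤ g r) ∧
    ∀ s t : Icc (0 : ℝ) T, s ≤ t → dist (γ s) (γ t) ≤ ∫ r in (s : ℝ)..t, g r

/-- `F(t, ·)_# m ≤ C m` for all `t ∈ [0,T]`. -/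
def Compresses {X : Type*} [MeasurableSpace X] {T : ℝ} (m : Measure X)
    (F : Icc (0 : ℝ) T → X → X) (C : ℝ≥0) : Prop :=
  ∀ t, m.map (F t) ≤ C • m

/-- `F : [0,T] × X → X` is a regular flow relative to `b`. -/
structure IsRegularFlow {X : Type*} [MetricSpace X] [MeasurableSpace X] {T : ℝ} (hT : 0 ≤ T)
    {m : Measure X} [BoundedlyFinite m] (b : TimeDerivation T m)
    (F : Icc (0 : ℝ) T → X → X) : Prop where
  measurable : Measurable (Function.uncurry F)
  compresses : ∃ C : ℝ≥0, Compresses m F C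
  ac : ∀ᵐ x ∂m, IsAC (fun t => F t x) ∧ F ⟨0, left_mem_Icc.2 hT⟩ x = x
  ode : ∀ f : LipB X, BddSupport f.1 → ∀ᵐ p ∂((volume.restrict (Ioo 0 T)).prod m),
    HasDerivAt (fun s => f.1 (IccExtend hT (fun r => F r p.2) s))
      (b.rep f p.1 (IccExtend hT (fun r => F r p.2) p.1)) p.1

/-- The Borel probability measure `π` on `C([0,T]; X)` is a regular generalized flow relative
to `b`. -/
structure IsRegularGenFlow {X : Type*} [MetricSpace X] [MeasurableSpace X] {T : ℝ} (hT : 0 ≤ T)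
    {m : Measure X} [BoundedlyFinite m] (b : TimeDerivation T m)
    (π : Measure (Curves T X)) : Prop where
  prob : IsProbabilityMeasure π
  compresses : ∃ C : ℝ≥0, ∀ t, π.map (fun γ => γ t) ≤ C • m
  ac : ∀ᵐ γ ∂π, IsAC (fun t => γ t)
  ode : ∀ f : LipB X, BddSupport f.1 → ∀ᵐ p ∂((volume.restrict (Ioo 0 T)).prod π),
    HasDerivAt (fun s => f.1 (IccExtend hT p.2 s)) (b.rep f p.1 (IccExtend hT p.2 p.1)) p.1

open Classical in
/-- The map `x ↦ F(·, x)` with values in `C([0,T]; X)`. For a regular flow, `F(·, x)` is continuous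
for `m`-a.e. `x`; at the other points the value is the constant curve. -/
def flowMap {X : Type*} [MetricSpace X] {T : ℝ} (F : Icc (0 : ℝ) T → X → X) (x : X) :
    Curves T X :=
  if h : Continuous (fun t => F t x) then ⟨fun t => F t x, h⟩ else ContinuousMap.const _ x

/-- `π = ∫ F(·, x) d((ev_0)_# π)(x)`. -/
def IsInducedBy {X : Type*} [MetricSpace X] [MeasurableSpace X] {T : ℝ} (hT : 0 ≤ T)
    (π : Measure (Curves T X)) (F : Icc (0 : ℝ) T → X → X) : Prop :=
  π = (π.map (fun γ => γ ⟨0, left_mem_Icc.2 hT⟩)).map (flowMap F)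

/-- Either `H^{1,2}(X, m)` is reflexive, or `b_t` has a divergence in `L¹_loc` with
`∫_0^T ∫_{B_R} |div b_t| dm dt < ∞` for all balls. -/
def ReflexiveOrDiv {X : Type*} [MetricSpace X] [MeasurableSpace X] [BorelSpace X] {T : ℝ}
    {m : Measure X} [BoundedlyFinite m] (b : TimeDerivation T m) : Prop :=
  Function.Surjective (NormedSpace.inclusionInDoubleDual ℝ (H12 m)) ∨
    ∃ g : ℝ → X → ℝ, Measurable (Function.uncurry g) ∧
      (∀ᵐ t ∂(volume.restrict (Ioo 0 T)), (b.der t).IsDivergence (g t)) ∧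
      ∀ (x : X) (R : ℝ), ∫⁻ t in Ioo 0 T, ∫⁻ y in Metric.ball x R, ‖g t y‖ₑ ∂m < ∞

end MetricFlow

end

open MetricFlow

open Set Filter Topology MeasureTheory
open scoped NNReal ENNReal BoundedContinuousFunction
set_option linter.unusedSectionVars false

namespace MetricFlow

/-! ### Limits of integrals -/

/-! For fixed `v` the assertion says that the images of `v mn n` under the maps `x ↦ Fn n (·, x)`
converge weakly, as measures on `C([0,T]; X)`, to the image of `v m` under the limit flow. After
splitting `v` by sign and normalising, these images are probability measures `π n`. It suffices that
every subsequence has a further subsequence with the right limit.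

Compactness. A countable family of truncated distance functions determines the metric, so the curves
have speed at most `|b_n|`. The superlinear bound makes the speeds uniformly integrable
(`exists_excess_le`), which gives a common modulus of absolute continuity up to small probability.
The marginals are dominated by a multiple of `mn n`, and these measures are tight on bounded sets.
Hence the `π n` are tight (`isTightMeasureSet_range_of_speed`). A limit `π₀` has marginals bounded
by a multiple of `m` and an integrable speed bound (`exists_hasSpeedBound_of_tendsto`).

Identification. For a test function `f` let the defect be `(f ∘ γ)'(r) - b_r(f)(γ_r)`; it vanishes
for the approximating flows. Strong convergence can only be tested with densities that have mass one
at every time. Comparing the weight `ψ(γ) / ∫ ψ` on a time interval with the weight `1` shows that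
the integrated defect of `π₀` is uncorrelated with every `ψ`. So for `f ∈ D` the defect depends on
time only (`StrongConv.ae_defect_eq_integral`). Reflexivity or the divergence makes `u ↦ b(u)`
weakly continuous under flat convergence, and the property extends to all bounded Lipschitz
functions (`ae_exists_defect_eq`).

Vanishing (`isRegularGenFlow_of_defect`). If the law of `γ_r` is not a point mass, localise `f` to a
small ball: the defect of the localised function is zero far away, hence zero everywhere, and it
agrees with that of `f` on the ball. If the law is a point mass at `p`, then `p` is an atom of `m`.
The regular flow `F` cannot move atoms, so `b_r(f)(p) = 0`, and the derivative of `f ∘ γ` vanishes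
a.e. on its level sets. Thus `π₀` is a regular generalized flow and is induced by `F`, with initial
law the normalised `v m`.

Passing to subsequences needs care, because strong convergence concerns full sequences of densities.
The missing indices are filled with a recovery sequence (`exists_recovery`, `StrongConv.comp`). -/

theorem tendsto_of_forall_approx {ι : Type*} {l : Filter ι} {a : ι → ℝ} {a₀ : ℝ}
    (h : ∀ ε > 0, ∃ (b : ι → ℝ) (b₀ : ℝ), Tendsto b l (𝓝 b₀) ∧ (∀ i, |a i - b i| ≤ ε) ∧
      |a₀ - b₀| ≤ ε) : Tendsto a l (𝓝 a₀) := by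
  rw [Metric.tendsto_nhds]
  intro ε hε
  obtain ⟨b, b₀, hb, h1, h2⟩ := h (ε / 4) (by positivity)
  filter_upwards [Metric.tendsto_nhds.1 hb (ε / 4) (by positivity)] with i hi
  rw [Real.dist_eq] at hi ⊢
  have h1 := abs_le.1 (h1 i)
  have h2 := abs_le.1 h2
  have hi := abs_lt.1 hi
  rw [abs_lt]
  constructor <;> linarith [h1.1, h1.2]

/-- The sets along which the integrals converge form a Dynkin system: complements use `huniv`, and
disjoint unions use dominated convergence of series, with the integrals of `G` over the pieces as
majorants. -/
theorem tendsto_setIntegral_of_isPiSystem {Ω : Type*} {mΩ : MeasurableSpace Ω} {μ : Measure Ω}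
    {S : Set (Set Ω)} (hgen : mΩ = MeasurableSpace.generateFrom S) (hpi : IsPiSystem S)
    {g : ℕ → Ω → ℝ} {g₀ G : Ω → ℝ} (hg : ∀ n, AEStronglyMeasurable (g n) μ)
    (hg₀ : AEStronglyMeasurable g₀ μ) (hG : Integrable G μ)
    (hb : ∀ n, ∀ᵐ x ∂μ, ‖g n x‖ ≤ G x) (hb₀ : ∀ᵐ x ∂μ, ‖g₀ x‖ ≤ G x)
    (huniv : Tendsto (fun n => ∫ x, g n x ∂μ) atTop (𝓝 (∫ x, g₀ x ∂μ)))
    (hS : ∀ A ∈ S, Tendsto (fun n => ∫ x in A, g n x ∂μ) atTop (𝓝 (∫ x in A, g₀ x ∂μ)))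
    {A : Set Ω} (hA : MeasurableSet A) :
    Tendsto (fun n => ∫ x in A, g n x ∂μ) atTop (𝓝 (∫ x in A, g₀ x ∂μ)) := by
  have hgi : ∀ n, Integrable (g n) μ := fun n => hG.mono' (hg n) (hb n)
  have hgi₀ : Integrable g₀ μ := hG.mono' hg₀ hb₀
  induction A, hA using MeasurableSpace.induction_on_inter hgen hpi with
  | empty => simp
  | basic A hA => exact hS A hA
  | compl A hA ih =>
    have h1 : ∀ f : Ω → ℝ, Integrable f μ →
        ∫ x in Aᶜ, f x ∂μ = ∫ x, f x ∂μ - ∫ x in A, f x ∂μ := fun f hf => by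
      rw [← integral_add_compl hA hf]; ring
    simp only [h1 _ (hgi _), h1 _ hgi₀]
    exact huniv.sub ih
  | iUnion A hd hA ih =>
    simp only [integral_iUnion hA hd (hgi _).integrableOn,
      integral_iUnion hA hd hgi₀.integrableOn]
    refine tendsto_tsum_of_dominated_convergence (bound := fun i => ∫ x in A i, G x ∂μ)
      (hasSum_integral_iUnion hA hd hG.integrableOn).summable ih
      (Eventually.of_forall fun n i => ?_)
    exact norm_integral_le_of_norm_le hG.integrableOn (ae_restrict_of_ae (hb n))

/-- Simple weights follow by linearity from the case of sets. The common majorant `G` makes the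
error of replacing `w` by a simple function uniform in `n`. -/
theorem tendsto_integral_mul_of_isPiSystem {Ω : Type*} {mΩ : MeasurableSpace Ω} {μ : Measure Ω}
    {S : Set (Set Ω)} (hgen : mΩ = MeasurableSpace.generateFrom S) (hpi : IsPiSystem S)
    {g : ℕ → Ω → ℝ} {g₀ G : Ω → ℝ} (hg : ∀ n, AEStronglyMeasurable (g n) μ)
    (hg₀ : AEStronglyMeasurable g₀ μ) (hG : Integrable G μ)
    (hb : ∀ n, ∀ᵐ x ∂μ, ‖g n x‖ ≤ G x) (hb₀ : ∀ᵐ x ∂μ, ‖g₀ x‖ ≤ G x)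
    (huniv : Tendsto (fun n => ∫ x, g n x ∂μ) atTop (𝓝 (∫ x, g₀ x ∂μ)))
    (hS : ∀ A ∈ S, Tendsto (fun n => ∫ x in A, g n x ∂μ) atTop (𝓝 (∫ x in A, g₀ x ∂μ)))
    {w : Ω → ℝ} (hw : Measurable w) {C : ℝ} (hC : ∀ x, |w x| ≤ C) :
    Tendsto (fun n => ∫ x, w x * g n x ∂μ) atTop (𝓝 (∫ x, w x * g₀ x ∂μ)) := by
  have hgi : ∀ n, Integrable (g n) μ := fun n => hG.mono' (hg n) (hb n)
  have hgi₀ : Integrable g₀ μ := hG.mono' hg₀ hb₀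
  have hsimple : ∀ s : SimpleFunc Ω ℝ,
      Tendsto (fun n => ∫ x, s x * g n x ∂μ) atTop (𝓝 (∫ x, s x * g₀ x ∂μ)) := by
    intro s
    induction s using SimpleFunc.induction with
    | const c hs =>
      rename_i A
      have h1 : ∀ f : Ω → ℝ, ∫ x, (SimpleFunc.piecewise A hs (SimpleFunc.const Ω c)
          (SimpleFunc.const Ω 0)) x * f x ∂μ = c * ∫ x in A, f x ∂μ := fun f => by
        rw [← integral_const_mul, ← integral_indicator hs]
        refine integral_congr_ae (Eventually.of_forall fun x => ?_)
        by_cases hx : x ∈ A <;> simp [hx]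
      simp only [h1]
      exact (tendsto_setIntegral_of_isPiSystem hgen hpi hg hg₀ hG hb hb₀ huniv hS hs).const_mul c
    | add hd hs ht =>
      rename_i s t
      have hm : ∀ (s : SimpleFunc Ω ℝ) (f : Ω → ℝ), Integrable f μ →
          Integrable (fun x => s x * f x) μ := fun s f hf => by
        obtain ⟨c, hc⟩ := s.exists_forall_norm_le
        exact hf.bdd_mul s.aestronglyMeasurable (Eventually.of_forall hc)
      simp only [SimpleFunc.coe_add, Pi.add_apply, add_mul, integral_add (hm s _ (hgi _))
        (hm t _ (hgi _)), integral_add (hm s _ hgi₀) (hm t _ hgi₀)]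
      exact hs.add ht
  refine tendsto_of_forall_approx fun ε hε => ?_
  -- The approximation starts from the value `0`, so its error is at most `|w| ≤ C`.
  set s : ℕ → SimpleFunc Ω ℝ := SimpleFunc.approxOn w hw univ 0 (mem_univ _)
  have hs : ∀ j x, ‖w x - s j x‖ ≤ C := fun j x => by
    have := SimpleFunc.edist_approxOn_le hw (mem_univ (0 : ℝ)) x j
    rw [edist_dist, edist_dist, ENNReal.ofReal_le_ofReal_iff dist_nonneg, dist_comm,
      Real.dist_eq, Real.dist_eq, zero_sub, abs_neg] at this
    exact this.trans (hC x)
  have hlim : Tendsto (fun j => ∫ x, ‖w x - s j x‖ * G x ∂μ) atTop (𝓝 0) := by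
    have : ∫ x, (0 : ℝ) ∂μ = 0 := by simp
    rw [← this]
    refine tendsto_integral_of_dominated_convergence (fun x => C * ‖G x‖)
      (fun j => ?_) (hG.norm.const_mul C) (fun j => Eventually.of_forall fun x => ?_)
      (Eventually.of_forall fun x => ?_)
    · exact ((hw.sub (s j).measurable).norm.aestronglyMeasurable).mul hG.1
    · rw [norm_mul, norm_norm]
      exact mul_le_mul_of_nonneg_right (hs j x) (norm_nonneg _)
    · have h1 : Tendsto (fun j => s j x) atTop (𝓝 (w x)) :=
        SimpleFunc.tendsto_approxOn hw (mem_univ _) (by simp)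
      simpa using ((tendsto_const_nhds (x := w x)).sub h1).norm.mul_const (G x)
  obtain ⟨j, hj⟩ := ((tendsto_order.1 hlim).2 ε hε).exists
  have key : ∀ f : Ω → ℝ, AEStronglyMeasurable f μ → (∀ᵐ x ∂μ, ‖f x‖ ≤ G x) →
      |∫ x, w x * f x ∂μ - ∫ x, s j x * f x ∂μ| ≤ ε := by
    intro f hf hfG
    have hfi : Integrable f μ := hG.mono' hf hfG
    obtain ⟨c, hc⟩ := (s j).exists_forall_norm_le
    rw [← integral_sub (hfi.bdd_mul hw.aestronglyMeasurable (Eventually.of_forall hC))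
      (hfi.bdd_mul (s j).aestronglyMeasurable (Eventually.of_forall hc)), ← Real.norm_eq_abs]
    refine (norm_integral_le_of_norm_le (g := fun x => ‖w x - s j x‖ * G x) ?_ ?_).trans hj.le
    · exact hG.bdd_mul (c := C) ((hw.sub (s j).measurable).norm.aestronglyMeasurable)
        (Eventually.of_forall fun x => by rw [norm_norm]; exact hs j x)
    · filter_upwards [hfG] with x hx
      rw [← sub_mul, norm_mul]
      exact mul_le_mul_of_nonneg_left hx (norm_nonneg _)
  exact ⟨_, _, hsimple (s j), fun n => key _ (hg n) (hb n), key _ hg₀ hb₀⟩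

/-- Diagonal choice: `j n` is the largest `j ≤ n` whose threshold `N j` is at most `n`. The default
value `0` of `Nat.findGreatest` is harmless once `n ≥ N 0`. -/
theorem exists_tendsto_atTop_eventually {P : ℕ → ℕ → Prop} (h : ∀ j, ∀ᶠ n in atTop, P j n) :
    ∃ j : ℕ → ℕ, Tendsto j atTop atTop ∧ ∀ᶠ n in atTop, P (j n) n := by
  classical
  choose N hN using fun j => eventually_atTop.1 (h j)
  refine ⟨fun n => Nat.findGreatest (fun j => N j ≤ n) n, tendsto_atTop.2 fun k => ?_, ?_⟩
  · filter_upwards [eventually_ge_atTop (max k (N k))] with n hn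
    exact Nat.le_findGreatest ((le_max_left _ _).trans hn) ((le_max_right _ _).trans hn)
  · filter_upwards [eventually_ge_atTop (N 0)] with n hn
    exact hN _ _ (Nat.findGreatest_spec (P := fun j => N j ≤ n) (Nat.zero_le n) hn)

/-! ### Absolutely continuous curves -/

/-- This form is symmetric in `s` and `t`: the curve is `1`-Lipschitz with respect to the primitive
of `g`, and so inherits its continuity and absolute continuity. -/
theorem dist_le_dist_primitive {X : Type*} [PseudoMetricSpace X] {T : ℝ}
    (hT : 0 ≤ T) {γ : ℝ → X} {g : ℝ → ℝ} (hg : IntegrableOn g (Icc 0 T))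
    (h : ∀ s ∈ Icc 0 T, ∀ t ∈ Icc 0 T, s ≤ t → dist (γ s) (γ t) ≤ ∫ r in s..t, g r)
    {s t : ℝ} (hs : s ∈ Icc 0 T) (ht : t ∈ Icc 0 T) :
    dist (γ s) (γ t) ≤ dist (∫ r in (0 : ℝ)..s, g r) (∫ r in (0 : ℝ)..t, g r) := by
  have hgi : IntervalIntegrable g volume 0 T :=
    (intervalIntegrable_iff_integrableOn_Icc_of_le hT).2 hg
  have hsub : ∀ a ∈ Icc 0 T, IntervalIntegrable g volume 0 a := fun a ha =>
    hgi.mono_set (by rw [uIcc_of_le hT, uIcc_of_le ha.1]; exact Icc_subset_Icc_right ha.2)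
  rw [Real.dist_eq, intervalIntegral.integral_interval_sub_left (hsub _ hs) (hsub _ ht)]
  rcases le_total s t with hle | hle
  · rw [intervalIntegral.integral_symm, abs_neg]
    exact (h _ hs _ ht hle).trans (le_abs_self _)
  · rw [dist_comm]
    exact (h _ ht _ hs hle).trans (le_abs_self _)

theorem absolutelyContinuousOnInterval_of_dist_le {X : Type*} [PseudoMetricSpace X] {T : ℝ}
    (hT : 0 ≤ T) {γ : ℝ → X} {g : ℝ → ℝ} (hg : IntegrableOn g (Icc 0 T))
    (h : ∀ s ∈ Icc 0 T, ∀ t ∈ Icc 0 T, s ≤ t → dist (γ s) (γ t) ≤ ∫ r in s..t, g r) :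
    AbsolutelyContinuousOnInterval γ 0 T := by
  have hgi : IntervalIntegrable g volume 0 T :=
    (intervalIntegrable_iff_integrableOn_Icc_of_le hT).2 hg
  have hac := hgi.absolutelyContinuousOnInterval_intervalIntegral (c := 0) (by simp)
  refine squeeze_zero' (Eventually.of_forall fun E => Finset.sum_nonneg fun _ _ => dist_nonneg)
    ?_ hac
  refine eventually_inf_principal.2 (Eventually.of_forall fun E hE => ?_)
  refine Finset.sum_le_sum fun i hi => ?_
  have hmem := hE.1 i hi
  rw [uIcc_of_le hT] at hmem
  exact dist_le_dist_primitive hT hg h hmem.1 hmem.2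

/-- At a differentiability point of both `φ` and the primitive of `g`, the right difference
quotients of `φ` are bounded by those of the primitive. -/
theorem ae_differentiableAt_deriv_le {T : ℝ} (hT : 0 ≤ T) {φ g : ℝ → ℝ}
    (hg : IntegrableOn g (Icc 0 T))
    (h : ∀ s ∈ Icc 0 T, ∀ t ∈ Icc 0 T, s ≤ t → dist (φ s) (φ t) ≤ ∫ r in s..t, g r) :
    ∀ᵐ r ∂(volume.restrict (Ioo 0 T)), DifferentiableAt ℝ φ r ∧ |deriv φ r| ≤ g r := by
  have hgi : IntervalIntegrable g volume 0 T :=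
    (intervalIntegrable_iff_integrableOn_Icc_of_le hT).2 hg
  have h1 := (absolutelyContinuousOnInterval_of_dist_le hT hg h).ae_differentiableAt
  have h2 := hgi.ae_hasDerivAt_integral
  rw [ae_restrict_iff' measurableSet_Ioo]
  filter_upwards [h1, h2] with r hr1 hr2 hr
  have hrT : r ∈ uIcc 0 T := by rw [uIcc_of_le hT]; exact Ioo_subset_Icc_self hr
  refine ⟨hr1 hrT, ?_⟩
  have hd := (hr1 hrT).hasDerivAt
  have hG := hr2 hrT r hrT
  have h3 : Tendsto (fun t => |_root_.slope φ r t|) (𝓝[>] r) (𝓝 |deriv φ r|) :=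
    ((hasDerivAt_iff_tendsto_slope.1 hd).mono_left
      (nhdsWithin_mono _ fun x hx => (ne_of_gt hx))).abs
  have h4 : Tendsto (_root_.slope (fun x => ∫ v in r..x, g v) r) (𝓝[>] r) (𝓝 (g r)) :=
    (hasDerivAt_iff_tendsto_slope.1 hG).mono_left (nhdsWithin_mono _ fun x hx => (ne_of_gt hx))
  refine le_of_tendsto_of_tendsto h3 h4 ?_
  filter_upwards [Ioo_mem_nhdsGT hr.2] with t ht
  have h5 := h r (Ioo_subset_Icc_self hr) t ⟨hr.1.le.trans ht.1.le, ht.2.le⟩ ht.1.le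
  have h6 : 0 < t - r := sub_pos.2 ht.1
  rw [slope_def_field, slope_def_field, intervalIntegral.integral_same, sub_zero, abs_div,
    abs_of_pos h6]
  rw [Real.dist_eq, abs_sub_comm] at h5
  gcongr

section curves

variable {X : Type*} [MetricSpace X] {T : ℝ}

/-- The integral bound in the definition of absolute continuity, for a curve extended to `ℝ`. -/
theorem dist_extend_le (hT : 0 ≤ T) {γ : Icc (0 : ℝ) T → X} {g : ℝ → ℝ}
    (h : ∀ s t : Icc (0 : ℝ) T, s ≤ t → dist (γ s) (γ t) ≤ ∫ r in (s : ℝ)..t, g r)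
    {f : X → ℝ} {K : ℝ≥0} (hf : LipschitzWith K f) :
    ∀ s ∈ Icc 0 T, ∀ t ∈ Icc 0 T, s ≤ t →
      dist (f (IccExtend hT γ s)) (f (IccExtend hT γ t)) ≤ ∫ r in s..t, K * g r := by
  intro s hs t ht hst
  rw [IccExtend_of_mem hT _ hs, IccExtend_of_mem hT _ ht, intervalIntegral.integral_const_mul]
  exact (hf.dist_le_mul _ _).trans (mul_le_mul_of_nonneg_left (h _ _ hst) K.2)

theorem IsAC.continuous (hT : 0 ≤ T) {γ : Icc (0 : ℝ) T → X} (h : IsAC γ) : Continuous γ := by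
  obtain ⟨g, hg, -, h⟩ := h
  have hgi : IntervalIntegrable g volume 0 T :=
    (intervalIntegrable_iff_integrableOn_Icc_of_le hT).2 hg
  have h1 : ContinuousOn (fun x => ∫ r in (0 : ℝ)..x, g r) (uIcc 0 T) :=
    (hgi.absolutelyContinuousOnInterval_intervalIntegral (c := 0) (by simp)).continuousOn
  have h2 : Continuous fun t : Icc (0 : ℝ) T => ∫ r in (0 : ℝ)..t, g r :=
    h1.comp_continuous continuous_subtype_val fun t => by
      rw [uIcc_of_le hT]; exact t.2
  rw [Metric.continuous_iff] at h2 ⊢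
  intro t ε hε
  obtain ⟨δ, hδ, H⟩ := h2 t ε hε
  refine ⟨δ, hδ, fun s hs => lt_of_le_of_lt ?_ (H s hs)⟩
  have h3 := dist_le_dist_primitive (γ := IccExtend hT γ) hT hg (fun s hs t ht hst => by
    rw [IccExtend_of_mem hT _ hs, IccExtend_of_mem hT _ ht]
    exact h _ _ hst) s.2 t.2
  simpa only [IccExtend_val] using h3

theorem IsAC.absolutelyContinuousOnInterval (hT : 0 ≤ T) {γ : Icc (0 : ℝ) T → X} (h : IsAC γ)
    {f : X → ℝ} {K : ℝ≥0} (hf : LipschitzWith K f) :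
    AbsolutelyContinuousOnInterval (fun s => f (IccExtend hT γ s)) 0 T := by
  obtain ⟨g, hg, -, h⟩ := h
  exact absolutelyContinuousOnInterval_of_dist_le hT (hg.const_mul (K : ℝ))
    (dist_extend_le hT h hf)

theorem IsAC.ae_differentiableAt (hT : 0 ≤ T) {γ : Icc (0 : ℝ) T → X} (h : IsAC γ)
    {f : X → ℝ} {K : ℝ≥0} (hf : LipschitzWith K f) :
    ∀ᵐ r ∂(volume.restrict (Ioo 0 T)), DifferentiableAt ℝ (fun s => f (IccExtend hT γ s)) r := by
  rw [ae_restrict_iff' measurableSet_Ioo]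
  filter_upwards [(h.absolutelyContinuousOnInterval hT hf).ae_differentiableAt] with r hr hrT
  exact hr (by rw [uIcc_of_le hT]; exact Ioo_subset_Icc_self hrT)

theorem IsAC.integral_deriv (hT : 0 ≤ T) {γ : Icc (0 : ℝ) T → X} (h : IsAC γ)
    {f : X → ℝ} {K : ℝ≥0} (hf : LipschitzWith K f) {s t : ℝ} (hs : s ∈ Icc 0 T)
    (ht : t ∈ Icc 0 T) :
    ∫ r in s..t, deriv (fun s => f (IccExtend hT γ s)) r =
      f (IccExtend hT γ t) - f (IccExtend hT γ s) :=
  ((h.absolutelyContinuousOnInterval hT hf).mono (by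
    rw [uIcc_of_le hT]; exact uIcc_subset_Icc hs ht)).integral_deriv_eq_sub

/-- The function `|φ - c|` has a minimum at `r`, so its derivative is zero there; its difference
quotients at `r` have the same absolute values as those of `φ`. -/
theorem deriv_eq_zero_of_differentiableAt_abs {φ : ℝ → ℝ} {c r : ℝ}
    (h1 : DifferentiableAt ℝ φ r) (h2 : DifferentiableAt ℝ (fun s => |φ s - c|) r)
    (hc : φ r = c) : deriv φ r = 0 := by
  have hmin : IsLocalMin (fun s => |φ s - c|) r := by
    refine Eventually.of_forall fun s => ?_
    simp only [hc, sub_self, abs_zero]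
    exact abs_nonneg _
  have h4 := h2.hasDerivAt
  rw [hmin.deriv_eq_zero, hasDerivAt_iff_tendsto_slope_zero] at h4
  have h5 := hasDerivAt_iff_tendsto_slope_zero.1 h1.hasDerivAt
  have h7 := h4.abs
  rw [abs_zero] at h7
  have h6 : Tendsto (fun t => |t⁻¹ • (φ (r + t) - φ r)|) (𝓝[≠] 0) (𝓝 0) := by
    refine h7.congr fun t => ?_
    simp only [hc, sub_self, abs_zero, sub_zero, smul_eq_mul, abs_mul, abs_abs]
  exact abs_eq_zero.1 (tendsto_nhds_unique h5.abs h6)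

/-- The derivative of `f ∘ γ` vanishes a.e. on the level sets of `f ∘ γ`. -/
theorem IsAC.ae_deriv_eq_zero (hT : 0 ≤ T) {γ : Icc (0 : ℝ) T → X} (h : IsAC γ)
    {f : X → ℝ} {K : ℝ≥0} (hf : LipschitzWith K f) (c : ℝ) :
    ∀ᵐ r ∂(volume.restrict (Ioo 0 T)), f (IccExtend hT γ r) = c →
      deriv (fun s => f (IccExtend hT γ s)) r = 0 := by
  -- Since `|f - c|` is Lipschitz as well, it is also differentiable along the curve at a.e. time.
  have hf' : LipschitzWith K (fun x => |f x - c|) := by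
    refine LipschitzWith.of_dist_le_mul fun x y => ?_
    refine le_trans ?_ (hf.dist_le_mul x y)
    rw [Real.dist_eq, Real.dist_eq]
    refine (abs_abs_sub_abs_le_abs_sub _ _).trans_eq ?_
    congr 1
    ring
  filter_upwards [h.ae_differentiableAt hT hf, h.ae_differentiableAt hT hf'] with r h1 h2 hc
  exact deriv_eq_zero_of_differentiableAt_abs h1 h2 hc

theorem continuous_uncurry_extend (hT : 0 ≤ T) :
    Continuous fun p : ℝ × Curves T X => IccExtend hT p.2 p.1 := by
  simp only [IccExtend, Function.comp_def]
  exact (continuous_eval (F := C(Icc (0 : ℝ) T, X))).comp (continuous_snd.prodMk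
    ((continuous_projIcc (h := hT)).comp continuous_fst))

theorem measurable_deriv_extend (hT : 0 ≤ T) {f : X → ℝ} (hf : Continuous f) :
    Measurable fun p : ℝ × Curves T X => deriv (fun s => f (IccExtend hT p.2 s)) p.1 := by
  have h : Continuous (Function.uncurry fun (γ : Curves T X) s => f (IccExtend hT γ s)) :=
    hf.comp ((continuous_uncurry_extend hT).comp continuous_swap)
  exact (measurable_deriv_with_param h).comp measurable_swap

theorem measurableSet_differentiableAt_extend (hT : 0 ≤ T) {f : X → ℝ} (hf : Continuous f) :
    MeasurableSet {p : ℝ × Curves T X |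
      DifferentiableAt ℝ (fun s => f (IccExtend hT p.2 s)) p.1} := by
  have h : Continuous (Function.uncurry fun (γ : Curves T X) s => f (IccExtend hT γ s)) :=
    hf.comp ((continuous_uncurry_extend hT).comp continuous_swap)
  exact measurable_swap (measurableSet_of_differentiableAt_with_param ℝ h)

variable [SecondCountableTopology X] [MeasurableSpace X] [BorelSpace X]

/-- Open sets of curves are countable unions of closed balls, and membership in a closed ball is
decided on a countable dense set of times. -/
theorem measurable_curves {Ω : Type*} [MeasurableSpace Ω] {G : Ω → Curves T X}
    (h : ∀ t, Measurable fun ω => G ω t) : Measurable G := by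
  obtain ⟨D, hDc, hD⟩ := TopologicalSpace.exists_countable_dense (Icc (0 : ℝ) T)
  have hball : ∀ γ (r : ℝ), 0 ≤ r → MeasurableSet (G ⁻¹' Metric.closedBall γ r) := by
    intro γ r hr
    have : G ⁻¹' Metric.closedBall γ r = ⋂ t ∈ D, {ω | dist (G ω t) (γ t) ≤ r} := by
      ext ω
      simp only [mem_preimage, Metric.mem_closedBall, ContinuousMap.dist_le hr, mem_iInter,
        mem_ofPred_eq]
      refine ⟨fun H t _ => H t, fun H t => ?_⟩
      have hcl : IsClosed {t | dist (G ω t) (γ t) ≤ r} :=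
        isClosed_le (by fun_prop) continuous_const
      exact hcl.closure_subset_iff.2 H (hD t)
    rw [this]
    exact MeasurableSet.biInter hDc fun t _ =>
      measurableSet_le ((h t).dist measurable_const) measurable_const
  refine measurable_of_isOpen fun U hU => ?_
  choose! r hr hrU using fun γ (hγ : γ ∈ U) => Metric.nhds_basis_closedBall.mem_iff.1 (hU.mem_nhds hγ)
  obtain ⟨S, hS, hSU⟩ := TopologicalSpace.isOpen_iUnion_countable
    (fun γ : U => Metric.ball γ.1 (r γ.1)) fun _ => Metric.isOpen_ball
  have : U = ⋃ γ ∈ S, Metric.closedBall γ.1 (r γ.1) := by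
    refine Subset.antisymm (fun γ hγ => ?_) (iUnion₂_subset fun γ _ => hrU _ γ.2)
    have : γ ∈ ⋃ γ ∈ S, Metric.ball γ.1 (r γ.1) := by
      rw [hSU]
      exact mem_iUnion.2 ⟨⟨γ, hγ⟩, Metric.mem_ball_self (hr _ hγ)⟩
    obtain ⟨i, hi, h⟩ := mem_iUnion₂.1 this
    exact mem_iUnion₂.2 ⟨i, hi, Metric.ball_subset_closedBall h⟩
  rw [this, preimage_iUnion₂]
  exact MeasurableSet.biUnion hS fun γ _ => hball _ _ (hr _ γ.2).le

/-- The set of points with a discontinuous trajectory need not be measurable. It is enlarged to a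
measurable null set, on which the map is replaced by constant curves. -/
theorem aemeasurable_flowMap {m : Measure X} {F : Icc (0 : ℝ) T → X → X}
    (hF : Measurable (Function.uncurry F)) (hc : ∀ᵐ x ∂m, Continuous fun t => F t x) :
    AEMeasurable (flowMap F) m := by
  classical
  obtain ⟨N, hN, hNm, hN0⟩ := exists_measurable_superset_of_null hc
  have hNc : ∀ x, x ∉ N → Continuous fun t => F t x := fun x hx => by
    by_contra h
    exact hx (hN h)
  refine ⟨fun x => if x ∈ N then ContinuousMap.const _ x else flowMap F x,
    measurable_curves fun t => ?_, ?_⟩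
  · have : (fun x => (if x ∈ N then ContinuousMap.const _ x else flowMap F x : Curves T X) t) =
        N.piecewise (fun x => x) (fun x => F t x) := by
      ext1 x
      by_cases hx : x ∈ N
      · simp [hx]
      · simp [hx, flowMap, hNc x hx]
    rw [this]
    exact Measurable.piecewise hNm measurable_id (hF.of_uncurry_left)
  · filter_upwards [compl_mem_ae_iff.2 hN0] with x hx
    rw [if_neg hx]

theorem measurable_rep_extend (hT : 0 ≤ T) {ρ : ℝ → X → ℝ}
    (hρ : Measurable (Function.uncurry ρ)) :
    Measurable fun p : ℝ × Curves T X => ρ p.1 (IccExtend hT p.2 p.1) :=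
  hρ.comp (measurable_fst.prodMk (continuous_uncurry_extend hT).measurable)

theorem hasDerivAt_iff_deriv {φ : ℝ → ℝ} {a r : ℝ} :
    HasDerivAt φ a r ↔ DifferentiableAt ℝ φ r ∧ deriv φ r = a :=
  ⟨fun h => ⟨h.differentiableAt, h.deriv⟩, fun h => h.2 ▸ h.1.hasDerivAt⟩

theorem measurableSet_hasDerivAt_extend (hT : 0 ≤ T) {f : X → ℝ} (hf : Continuous f)
    {ρ : ℝ → X → ℝ} (hρ : Measurable (Function.uncurry ρ)) :
    MeasurableSet {p : ℝ × Curves T X |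
      HasDerivAt (fun s => f (IccExtend hT p.2 s)) (ρ p.1 (IccExtend hT p.2 p.1)) p.1} := by
  simp only [hasDerivAt_iff_deriv]
  exact (measurableSet_differentiableAt_extend hT hf).inter
    (measurableSet_eq_fun (measurable_deriv_extend hT hf) (measurable_rep_extend hT hρ))

end curves

/-! ### Lipschitz functions and asymptotic Lipschitz constants -/

section lip

variable {X : Type*} [MetricSpace X]

theorem continuous_lipB (f : LipB X) : Continuous f.1 := f.2.1.choose_spec.continuous

/-- The product of two bounded Lipschitz functions. -/
noncomputable def lipMul (f g : LipB X) : LipB X :=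
  ⟨fun x => f.1 x * g.1 x, by
    obtain ⟨⟨K, hK⟩, C, hC⟩ := f.2
    obtain ⟨⟨K', hK'⟩, C', hC'⟩ := g.2
    refine ⟨⟨Real.toNNReal C * K' + Real.toNNReal C' * K, LipschitzWith.of_dist_le_mul
      fun x y => ?_⟩, Real.toNNReal C * C', fun x => ?_⟩
    · rw [Real.dist_eq]
      have h1 := hK.dist_le_mul x y
      have h2 := hK'.dist_le_mul x y
      rw [Real.dist_eq] at h1 h2
      have h3 : |f.1 x| ≤ Real.toNNReal C := (hC x).trans (Real.le_coe_toNNReal C)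
      have h4 : |g.1 y| ≤ Real.toNNReal C' := (hC' y).trans (Real.le_coe_toNNReal C')
      calc |f.1 x * g.1 x - f.1 y * g.1 y|
          = |f.1 x * (g.1 x - g.1 y) + g.1 y * (f.1 x - f.1 y)| := by congr 1; ring
        _ ≤ |f.1 x| * |g.1 x - g.1 y| + |g.1 y| * |f.1 x - f.1 y| := by
          rw [← abs_mul, ← abs_mul]; exact abs_add_le _ _
        _ ≤ Real.toNNReal C * (K' * dist x y) + Real.toNNReal C' * (K * dist x y) := by gcongr
        _ = _ := by push_cast; ring
    · rw [abs_mul]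
      exact mul_le_mul ((hC x).trans (Real.le_coe_toNNReal C)) (hC' x) (abs_nonneg _) (by simp)⟩

@[simp] theorem lipMul_apply (f g : LipB X) (x : X) : (lipMul f g).1 x = f.1 x * g.1 x := rfl

theorem BddSupport.mul_right {f : LipB X} (hf : BddSupport f.1) (g : LipB X) :
    BddSupport (lipMul f g).1 :=
  hf.subset fun x hx h => hx (by rw [lipMul_apply, h, zero_mul])

theorem BddSupport.mul_left {f : LipB X} (hf : BddSupport f.1) (g : LipB X) :
    BddSupport (lipMul g f).1 :=
  hf.subset fun x hx h => hx (by rw [lipMul_apply, h, mul_zero])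

theorem lipschitzWith_clamp {f : X → ℝ} {K : ℝ≥0} (hf : LipschitzWith K f) (a b : ℝ) :
    LipschitzWith K fun x => max a (min b (f x)) :=
  (hf.const_min b).const_max a

/-- The `1`-Lipschitz function that is `1` on the ball of radius `R` around `x` and vanishes outside
the ball of radius `R + 1`. -/
noncomputable def cutoff (x : X) (R : ℝ) : LipB X :=
  ⟨fun y => max 0 (min 1 (R + 1 - dist y x)), by
    refine ⟨⟨1, lipschitzWith_clamp (LipschitzWith.of_dist_le_mul fun y z => ?_) 0 1⟩, 1,
      fun y => ?_⟩
    · rw [Real.dist_eq, sub_sub_sub_cancel_left, NNReal.coe_one, one_mul, dist_comm y z]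
      exact abs_dist_sub_le z y x
    · rw [abs_of_nonneg (le_max_left _ _)]
      exact max_le zero_le_one (min_le_left _ _)⟩

theorem cutoff_apply (x : X) (R : ℝ) (y : X) :
    (cutoff x R).1 y = max 0 (min 1 (R + 1 - dist y x)) := rfl

theorem cutoff_nonneg (x : X) (R : ℝ) (y : X) : 0 ≤ (cutoff x R).1 y := le_max_left _ _

theorem cutoff_le_one (x : X) (R : ℝ) (y : X) : (cutoff x R).1 y ≤ 1 :=
  max_le zero_le_one (min_le_left _ _)

theorem abs_cutoff_le_one (x : X) (R : ℝ) (y : X) : |(cutoff x R).1 y| ≤ 1 := by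
  rw [abs_of_nonneg (cutoff_nonneg _ _ _)]
  exact cutoff_le_one _ _ _

theorem cutoff_eq_one {x y : X} {R : ℝ} (h : dist y x ≤ R) : (cutoff x R).1 y = 1 := by
  rw [cutoff_apply, min_eq_left (by linarith), max_eq_right zero_le_one]

theorem cutoff_eq_zero {x y : X} {R : ℝ} (h : R + 1 ≤ dist y x) : (cutoff x R).1 y = 0 := by
  rw [cutoff_apply, max_eq_left ((min_le_right _ _).trans (by linarith))]

theorem bddSupport_cutoff (x : X) (R : ℝ) : BddSupport (cutoff x R).1 := by
  refine Bornology.IsBounded.subset (Metric.isBounded_ball (x := x) (r := R + 1)) fun y hy => ?_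
  by_contra h
  exact hy (cutoff_eq_zero (not_lt.1 h))

theorem lipOn_le {f : X → ℝ} {K : ℝ≥0} (hf : LipschitzWith K f) (s : Set X) : lipOn f s ≤ K :=
  iSup₂_le fun x _ => iSup₂_le fun y _ => ENNReal.div_le_of_le_mul (hf x y)

theorem asympLip_le {f : X → ℝ} {K : ℝ≥0} (hf : LipschitzWith K f) (x : X) : asympLip f x ≤ K :=
  (iInf₂_le 1 one_pos).trans (lipOn_le hf _)

theorem asympLip_ne_top (f : LipB X) (x : X) : asympLip f.1 x ≠ ∞ :=
  ((asympLip_le f.2.1.choose_spec x).trans_lt ENNReal.coe_lt_top).ne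

theorem asympLip_toReal_le {f : X → ℝ} {K : ℝ≥0} (hf : LipschitzWith K f) (x : X) :
    (asympLip f x).toReal ≤ K := ENNReal.toReal_le_coe_of_le_coe (asympLip_le hf x)

theorem asympLip_le_of_eqOn {f g : X → ℝ} {x : X} {U : Set X} (hU : U ∈ 𝓝 x)
    (h : ∀ y ∈ U, f y = g y) : asympLip f x ≤ asympLip g x := by
  obtain ⟨ε, hε, hεU⟩ := Metric.mem_nhds_iff.1 hU
  refine le_iInf₂ fun r hr => (iInf₂_le (min r ε) (lt_min hr hε)).trans ?_
  refine le_trans ?_ (lipOn_mono g (Metric.ball_subset_ball (min_le_left r ε)))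
  refine iSup₂_le fun y hy => iSup₂_le fun z hz => ?_
  rw [h y (hεU (Metric.ball_subset_ball (min_le_right _ _) hy)),
    h z (hεU (Metric.ball_subset_ball (min_le_right _ _) hz))]
  exact le_iSup₂_of_le y hy (le_iSup₂_of_le z hz le_rfl)

theorem asympLip_congr {f g : X → ℝ} {x : X} {U : Set X} (hU : U ∈ 𝓝 x)
    (h : ∀ y ∈ U, f y = g y) : asympLip f x = asympLip g x :=
  le_antisymm (asympLip_le_of_eqOn hU h) (asympLip_le_of_eqOn hU fun y hy => (h y hy).symm)

theorem asympLip_const (c : ℝ) (x : X) : asympLip (fun _ => c) x = 0 := by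
  have := asympLip_le (LipschitzWith.const (α := X) c) x
  simpa using this

theorem asympLip_eq_zero_of_notMem_closure {f : X → ℝ} {x : X}
    (hx : x ∉ closure (Function.support f)) : asympLip f x = 0 := by
  rw [asympLip_congr (g := fun _ => (0 : ℝ)) (isClosed_closure.isOpen_compl.mem_nhds hx),
    asympLip_const]
  intro y hy
  by_contra h
  exact hy (subset_closure h)

/-- On a ball of radius `r` the values of `u` and `v` differ from those at `x` by `O(r)`. The
product rule on that ball gives the bound as `r → 0`. -/
theorem asympLip_mul_le {u v : X → ℝ} {K K' : ℝ≥0} (hu : LipschitzWith K u)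
    (hv : LipschitzWith K' v) (x : X) :
    asympLip (fun y => u y * v y) x ≤ ENNReal.ofReal (|u x| * K' + |v x| * K) := by
  have h1 : ∀ r : ℝ, 0 < r → asympLip (fun y => u y * v y) x ≤
      ENNReal.ofReal ((|u x| + K * r) * K' + (|v x| + K' * r) * K) := by
    intro r hr
    refine (iInf₂_le r hr).trans (iSup₂_le fun y hy => iSup₂_le fun z hz => ?_)
    refine ENNReal.div_le_of_le_mul ?_
    rw [edist_dist, edist_dist, ← ENNReal.ofReal_mul (by positivity)]
    refine ENNReal.ofReal_le_ofReal ?_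
    have e1 := hu.dist_le_mul y z
    have e2 := hv.dist_le_mul y z
    have e3 := hu.dist_le_mul y x
    have e4 := hv.dist_le_mul z x
    rw [Real.dist_eq] at e1 e2 e3 e4 ⊢
    have e5 : |u y| ≤ |u x| + K * r := by
      have : |u y| ≤ |u x| + |u y - u x| := by
        have := abs_add_le (u x) (u y - u x); rwa [add_sub_cancel] at this
      refine this.trans (add_le_add le_rfl (e3.trans ?_))
      exact mul_le_mul_of_nonneg_left (Metric.mem_ball.1 hy).le K.2
    have e6 : |v z| ≤ |v x| + K' * r := by
      have : |v z| ≤ |v x| + |v z - v x| := by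
        have := abs_add_le (v x) (v z - v x); rwa [add_sub_cancel] at this
      refine this.trans (add_le_add le_rfl (e4.trans ?_))
      exact mul_le_mul_of_nonneg_left (Metric.mem_ball.1 hz).le K'.2
    calc |u y * v y - u z * v z| = |u y * (v y - v z) + v z * (u y - u z)| := by congr 1; ring
      _ ≤ |u y| * |v y - v z| + |v z| * |u y - u z| := by
        rw [← abs_mul, ← abs_mul]; exact abs_add_le _ _
      _ ≤ (|u x| + K * r) * (K' * dist y z) + (|v x| + K' * r) * (K * dist y z) := by gcongr
      _ = _ := by ring
  have h2 : Tendsto (fun r : ℝ => ENNReal.ofReal ((|u x| + K * r) * K' + (|v x| + K' * r) * K))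
      (𝓝[>] 0) (𝓝 (ENNReal.ofReal (|u x| * K' + |v x| * K))) := by
    have : Continuous fun r : ℝ =>
        ENNReal.ofReal ((|u x| + K * r) * K' + (|v x| + K' * r) * K) :=
      ENNReal.continuous_ofReal.comp (by fun_prop)
    have h3 := (this.tendsto 0).mono_left (nhdsWithin_le_nhds (s := Ioi 0))
    simpa using h3
  exact ge_of_tendsto h2 (eventually_nhdsWithin_of_forall h1)

end lip

/-! ### Slopes and derivations -/

section slopes

variable {X : Type*} [MetricSpace X] [MeasurableSpace X] [BorelSpace X] {m : Measure X}

theorem memLp_of_bddSupport [BoundedlyFinite m] (u : LipB X) (hu : BddSupport u.1)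
    (p : ℝ≥0∞) : MemLp u.1 p m := by
  obtain ⟨C, hC⟩ := u.2.2
  have h1 : MemLp u.1 p (m.restrict (closure (Function.support u.1))) := by
    have : IsFiniteMeasure (m.restrict (closure (Function.support u.1))) :=
      ⟨by rw [Measure.restrict_apply_univ]; exact BoundedlyFinite.lt_top _ hu.closure⟩
    exact MemLp.of_bound (continuous_lipB u).measurable.aestronglyMeasurable C (Eventually.of_forall hC)
  rw [← memLp_indicator_iff_restrict isClosed_closure.measurableSet] at h1
  convert h1 using 1
  exact (indicator_eq_self.2 subset_closure).symm

theorem memLp_asympLip [BoundedlyFinite m] (u : LipB X) (hu : BddSupport u.1) (p : ℝ≥0∞) :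
    MemLp (fun x => (asympLip u.1 x).toReal) p m := by
  obtain ⟨K, hK⟩ := u.2.1
  have h1 : MemLp (fun x => (asympLip u.1 x).toReal) p
      (m.restrict (closure (Function.support u.1))) := by
    have : IsFiniteMeasure (m.restrict (closure (Function.support u.1))) :=
      ⟨by rw [Measure.restrict_apply_univ]; exact BoundedlyFinite.lt_top _ hu.closure⟩
    refine MemLp.of_bound (measurable_asympLip u.1).ennreal_toReal.aestronglyMeasurable K
      (Eventually.of_forall fun x => ?_)
    rw [Real.norm_of_nonneg ENNReal.toReal_nonneg]
    exact asympLip_toReal_le hK x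
  rw [← memLp_indicator_iff_restrict isClosed_closure.measurableSet] at h1
  convert h1 using 1
  refine (indicator_eq_self.2 fun x hx => ?_).symm
  by_contra h
  exact hx (by simp only [asympLip_eq_zero_of_notMem_closure h, ENNReal.toReal_zero])

theorem asympLip_mem_relaxedSlopes [BoundedlyFinite m] (u : LipB X) (hu : BddSupport u.1) :
    (memLp_asympLip (m := m) u hu 2).toLp ∈ relaxedSlopes m u.1 := by
  refine ⟨fun _ => u.1, fun _ => memLp_asympLip u hu 2, _,
    ⟨fun _ => ⟨u.2, memLp_of_bddSupport u hu 2⟩, ?_⟩, fun φ => tendsto_const_nhds, le_rfl⟩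
  simp

/-- The hypothesis `hg0` takes care of the default value `0` that `slope` and `minSlopeL2` have when
no minimal slope exists. -/
theorem slope_le_of_mem_relaxedSlopes (f u : LipB X) (hu : BddSupport u.1) {x : X} {r : ℝ}
    (huf : ∀ y ∈ Metric.ball x r, u.1 y = f.1 y) {g : Lp ℝ 2 m} (hg : g ∈ relaxedSlopes m u.1)
    (hg0 : 0 ≤ᵐ[m] g) : ∀ᵐ y ∂(m.restrict (Metric.ball x r)), slope m f y ≤ g y := by
  unfold slope
  split_ifs with h
  · have key : minSlopeL2 m u.1 ≤ᵐ[m] g := by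
      unfold minSlopeL2
      split_ifs with h'
      · exact (Lp.coeFn_le _ _).2 (h'.choose_spec.2 hg)
      · filter_upwards [hg0, Lp.coeFn_zero ℝ 2 m] with y h0 hz
        rw [hz]
        exact h0
    filter_upwards [h.choose_spec x r u hu huf, ae_restrict_of_ae key] with y hy h1
    rw [hy]
    exact h1
  · filter_upwards [ae_restrict_of_ae hg0, ae_restrict_of_ae
      (AEEqFun.coeFn_zero (α := X) (β := ℝ) (μ := m))] with y h0 hz
    rw [hz]
    exact h0

theorem ae_of_forall_ball {p : X → Prop} (x : X)
    (h : ∀ n : ℕ, ∀ᵐ y ∂(m.restrict (Metric.ball x n)), p y) : ∀ᵐ y ∂m, p y := by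
  have h1 := ae_all_iff.2 fun n => (ae_restrict_iff' (Metric.isOpen_ball.measurableSet)).1 (h n)
  filter_upwards [h1] with y hy
  obtain ⟨n, hn⟩ := exists_nat_gt (dist y x)
  exact hy n (Metric.mem_ball.2 hn)

/-- Multiplying by a cutoff gives a function with bounded support that coincides with `f` on a ball,
and there has the same asymptotic Lipschitz constant. That constant is one of its relaxed slopes. -/
theorem slope_le_asympLip [BoundedlyFinite m] (f : LipB X) :
    ∀ᵐ y ∂m, slope m f y ≤ (asympLip f.1 y).toReal := by
  rcases isEmpty_or_nonempty X with hX | ⟨⟨x⟩⟩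
  · exact Eventually.of_forall fun y => (hX.false y).elim
  refine ae_of_forall_ball x fun n => ?_
  have hu : BddSupport (lipMul f (cutoff x n)).1 := (bddSupport_cutoff x n).mul_left f
  have huf : ∀ y ∈ Metric.ball x n, (lipMul f (cutoff x n)).1 y = f.1 y := fun y hy => by
    rw [lipMul_apply, cutoff_eq_one (Metric.mem_ball.1 hy).le, mul_one]
  have hc := (memLp_asympLip (m := m) _ hu 2).coeFn_toLp
  have h1 := slope_le_of_mem_relaxedSlopes f _ hu huf (asympLip_mem_relaxedSlopes _ hu) (by
    filter_upwards [hc] with y hy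
    rw [hy]
    exact ENNReal.toReal_nonneg)
  filter_upwards [h1, ae_restrict_of_ae hc, ae_restrict_mem Metric.isOpen_ball.measurableSet]
    with y h1 h2 hy
  rwa [h2, asympLip_congr (Metric.isOpen_ball.mem_nhds hy) huf] at h1

namespace LipDerivation

variable [BoundedlyFinite m] (b : LipDerivation m)

theorem norm_mem_bounds : b.norm ∈ b.bounds := b.exists_isLeast_bounds.choose_spec.1

theorem norm_nonneg : ∀ᵐ x ∂m, 0 ≤ b.norm x := ((b.mem_bounds_iff _).1 b.norm_mem_bounds).1

theorem abs_toLin_le_slope (f : LipB X) : ∀ᵐ x ∂m, |b.toLin f x| ≤ b.norm x * slope m f x :=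
  ((b.mem_bounds_iff _).1 b.norm_mem_bounds).2 f

theorem abs_toLin_le_asympLip (f : LipB X) :
    ∀ᵐ x ∂m, |b.toLin f x| ≤ b.norm x * (asympLip f.1 x).toReal := by
  filter_upwards [b.norm_nonneg, b.abs_toLin_le_slope f, slope_le_asympLip f] with x h1 h2 h3
  exact h2.trans (mul_le_mul_of_nonneg_left h3 h1)

theorem abs_toLin_le (f : LipB X) {K : ℝ≥0} (hK : LipschitzWith K f.1) :
    ∀ᵐ x ∂m, |b.toLin f x| ≤ b.norm x * K := by
  filter_upwards [b.norm_nonneg, b.abs_toLin_le_asympLip f] with x h1 h2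
  exact h2.trans (mul_le_mul_of_nonneg_left (asympLip_toReal_le hK x) h1)

theorem abs_toLin_le_relaxed (u : LipB X) (hu : BddSupport u.1) {g : Lp ℝ 2 m}
    (hg : g ∈ relaxedSlopes m u.1) (hg0 : 0 ≤ᵐ[m] g) :
    ∀ᵐ x ∂m, |b.toLin u x| ≤ b.norm x * g x := by
  rcases isEmpty_or_nonempty X with hX | ⟨⟨x⟩⟩
  · exact Eventually.of_forall fun y => (hX.false y).elim
  have h := ae_of_forall_ball x fun n => slope_le_of_mem_relaxedSlopes (x := x) (r := n) u u hu
    (fun _ _ => rfl) hg hg0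
  filter_upwards [b.norm_nonneg, b.abs_toLin_le_slope u, h] with x h1 h2 h3
  exact h2.trans (mul_le_mul_of_nonneg_left h3 h1)

theorem toLin_sub (f g : LipB X) :
    ∀ᵐ x ∂m, b.toLin (f - g) x = b.toLin f x - b.toLin g x := by
  rw [map_sub]
  exact AEEqFun.coeFn_sub _ _

theorem toLin_smul (c : ℝ) (f : LipB X) : ∀ᵐ x ∂m, b.toLin (c • f) x = c * b.toLin f x := by
  rw [map_smul]
  exact AEEqFun.coeFn_smul c _

/-- Derivations are local on open sets. -/
theorem toLin_congr {f g : LipB X} {U : Set X} (hU : IsOpen U) (h : ∀ y ∈ U, f.1 y = g.1 y) :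
    ∀ᵐ x ∂m, x ∈ U → b.toLin f x = b.toLin g x := by
  filter_upwards [b.toLin_sub f g, b.abs_toLin_le_asympLip (f - g)] with x h1 h2 hx
  have h3 : asympLip (f - g).1 x = 0 := by
    rw [asympLip_congr (g := fun _ => (0 : ℝ)) (hU.mem_nhds hx), asympLip_const]
    intro y hy
    simp [h y hy]
  rw [h3, ENNReal.toReal_zero, mul_zero] at h2
  have := abs_nonpos_iff.1 h2
  linarith

/-- The chain rule is avoided: `fg - c g - d f` equals `(f - c)(g - d)` up to a constant, so its
asymptotic Lipschitz constant at `x` is small when `c` is near `f x` and `d` near `g x`. The null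
sets allow only countably many `(c, d)`, so rational ones are used. At a fixed point the inequality
is continuous in `(c, d)`, hence holds for `c = f x` and `d = g x`, where the right-hand side is
zero. -/
theorem leibniz (f g : LipB X) :
    ∀ᵐ x ∂m, b.toLin (lipMul f g) x = f.1 x * b.toLin g x + g.1 x * b.toLin f x := by
  obtain ⟨K, hK⟩ := f.2.1
  obtain ⟨K', hK'⟩ := g.2.1
  have key : ∀ c d : ℚ, ∀ᵐ x ∂m, |b.toLin (lipMul f g) x - c * b.toLin g x - d * b.toLin f x| ≤
      b.norm x * (|f.1 x - c| * K' + |g.1 x - d| * K) := by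
    intro c d
    set k : LipB X := lipMul f g - (c : ℝ) • g - (d : ℝ) • f with hk
    have hkx : ∀ x, asympLip k.1 x ≤ ENNReal.ofReal (|f.1 x - c| * K' + |g.1 x - d| * K) := by
      intro x
      have hk' : k.1 = fun y => ((f.1 y - c) * (g.1 y - d)) + -(c * d) := by
        ext y
        simp only [hk, AddSubgroupClass.coe_sub, SetLike.val_smul, Pi.sub_apply, Pi.smul_apply,
          smul_eq_mul, lipMul_apply]
        ring
      have h1 : LipschitzWith K fun y => f.1 y - c := by
        simpa using hK.sub (LipschitzWith.const (c : ℝ))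
      have h2 : LipschitzWith K' fun y => g.1 y - d := by
        simpa using hK'.sub (LipschitzWith.const (d : ℝ))
      rw [hk']
      refine (asympLip_add_le _ (fun _ => -((c : ℝ) * d)) x).trans ?_
      rw [asympLip_const, add_zero]
      exact asympLip_mul_le h1 h2 x
    filter_upwards [b.abs_toLin_le_asympLip k, b.norm_nonneg,
      b.toLin_sub (lipMul f g - (c : ℝ) • g) ((d : ℝ) • f), b.toLin_sub (lipMul f g) ((c : ℝ) • g),
      b.toLin_smul c g, b.toLin_smul d f] with x h1 h2 h3 h4 h5 h6
    rw [h3, h4, h5, h6] at h1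
    exact h1.trans (mul_le_mul_of_nonneg_left (ENNReal.toReal_le_of_le_ofReal (by positivity)
      (hkx x)) h2)
  have key' : ∀ᵐ x ∂m, ∀ c d : ℚ,
      |b.toLin (lipMul f g) x - c * b.toLin g x - d * b.toLin f x| ≤
      b.norm x * (|f.1 x - c| * K' + |g.1 x - d| * K) :=
    ae_all_iff.2 fun c => ae_all_iff.2 fun d => key c d
  filter_upwards [key'] with x hx
  have hdense : DenseRange (Prod.map ((↑) : ℚ → ℝ) ((↑) : ℚ → ℝ)) :=
    Rat.denseRange_cast.prodMap Rat.denseRange_cast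
  have hcl : IsClosed {p : ℝ × ℝ |
      |b.toLin (lipMul f g) x - p.1 * b.toLin g x - p.2 * b.toLin f x| ≤
      b.norm x * (|f.1 x - p.1| * K' + |g.1 x - p.2| * K)} :=
    isClosed_le (by fun_prop) (by fun_prop)
  have h := hcl.closure_subset_iff.2 (by rintro _ ⟨⟨c, d⟩, rfl⟩; exact hx c d)
    (hdense (f.1 x, g.1 x))
  simp only [mem_ofPred_eq, sub_self, abs_zero, zero_mul, add_zero, mul_zero] at h
  have := abs_nonpos_iff.1 h
  linarith

end LipDerivation

/-- Slopes that are almost optimal for the Cheeger energy. -/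
theorem exists_mem_relaxedSlopes [BoundedlyFinite m] [SecondCountableTopology X]
    (u : LipB X) (hu : BddSupport u.1) {c : ℝ≥0}
    (hc : cheeger m (memLp_of_bddSupport (m := m) u hu 2).toLp < 2⁻¹ * (c : ℝ≥0∞) ^ 2) :
    ∃ g ∈ relaxedSlopes m u.1, 0 ≤ᵐ[m] g ∧ ‖g‖ ≤ c := by
  obtain ⟨v, hv, hvc⟩ := exists_approx_of_cheeger_lt hc
  have hmeas : ∀ n, Measurable fun x => (asympLip (v n) x).toReal := fun n =>
    (measurable_asympLip (v n)).ennreal_toReal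
  have hnorm : ∀ n, eLpNorm (fun x => (asympLip (v n) x).toReal) 2 m ≤ c := fun n => by
    rw [eLpNorm_eq_lintegral_rpow_enorm_toReal (by simp) (by simp)]
    have h1 := (half_sq_lt_iff.1 (hvc n)).le
    refine le_trans (le_of_eq ?_) h1
    simp only [ENNReal.toReal_ofNat, ENNReal.rpow_two]
    congr 2
    ext x
    rw [Real.enorm_of_nonneg ENNReal.toReal_nonneg,
      ENNReal.ofReal_toReal (asympLip_ne_top ⟨v n, (hv.1 n).1⟩ x)]
  have hs : ∀ n, MemLp (fun x => (asympLip (v n) x).toReal) 2 m := fun n =>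
    ⟨(hmeas n).aestronglyMeasurable, (hnorm n).trans_lt ENNReal.coe_lt_top⟩
  have hsn : ∀ n, ‖(hs n).toLp‖ ≤ c := fun n => by
    rw [Lp.norm_toLp]
    exact ENNReal.toReal_le_coe_of_le_coe (hnorm n)
  have : Fact ((2 : ℝ≥0∞) ≠ ∞) := ⟨by simp⟩
  -- Sequential Banach–Alaoglu in the separable space `L²`; the Riesz isomorphism turns it into weak
  -- compactness of the slopes.
  have hcompact := WeakDual.isSeqCompact_closedBall ℝ (Lp ℝ 2 m) 0 c
  set L : ℕ → WeakDual ℝ (Lp ℝ 2 m) := fun n =>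
    StrongDual.toWeakDual (InnerProductSpace.toDual ℝ (Lp ℝ 2 m) (hs n).toLp) with hL
  have hLmem : ∀ n, L n ∈ WeakDual.toStrongDual ⁻¹'
      Metric.closedBall (0 : StrongDual ℝ (Lp ℝ 2 m)) c := fun n => by
    rw [mem_preimage, Metric.mem_closedBall, dist_zero_right]
    exact (LinearIsometryEquiv.norm_map (InnerProductSpace.toDual ℝ (Lp ℝ 2 m)) _).trans_le (hsn n)
  obtain ⟨a, ha, φ, hφ, hlim⟩ := hcompact hLmem
  set g : Lp ℝ 2 m := (InnerProductSpace.toDual ℝ (Lp ℝ 2 m)).symm (WeakDual.toStrongDual a)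
  have hga : ∀ ψ, a ψ = inner ℝ g ψ := fun ψ =>
    (InnerProductSpace.toDual_symm_apply (𝕜 := ℝ) (y := WeakDual.toStrongDual a)).symm
  have hweak : ∀ ψ : Lp ℝ 2 m,
      Tendsto (fun n => inner ℝ ψ ((hs (φ n)).toLp)) atTop (𝓝 (inner ℝ ψ g)) := fun ψ => by
    have h1 := (WeakDual.eval_continuous (𝕜 := ℝ) (E := Lp ℝ 2 m) ψ).tendsto a
    have h2 := h1.comp hlim
    rw [real_inner_comm, ← hga]
    refine h2.congr fun n => ?_
    rw [real_inner_comm]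
    rfl
  refine ⟨g, ⟨fun n => v (φ n), fun n => hs (φ n), g, ⟨fun n => hv.1 _, ?_⟩, hweak, le_rfl⟩,
    ?_, ?_⟩
  · refine (hv.2.comp hφ.tendsto_atTop).congr fun n => eLpNorm_congr_ae ?_
    filter_upwards [(memLp_of_bddSupport (m := m) u hu 2).coeFn_toLp] with x hx
    simp only [Pi.sub_apply, hx]
  -- Nonnegativity of the weak limit: its pairing with its own negative part is a limit of
  -- nonnegative numbers, yet equals minus the square of the norm of that part.
  · have hneg := (Lp.memLp g).neg_part
    have h0 : ∀ n, 0 ≤ inner ℝ (hneg.toLp) ((hs (φ n)).toLp) := fun n => by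
      rw [L2.inner_def]
      refine integral_nonneg_of_ae ?_
      filter_upwards [hneg.coeFn_toLp, (hs (φ n)).coeFn_toLp] with x h1 h2
      simp only [h1, h2, RCLike.inner_apply, conj_trivial, Pi.zero_apply]
      exact mul_nonneg ENNReal.toReal_nonneg (le_max_right _ _)
    have h1 := ge_of_tendsto' (hweak hneg.toLp) h0
    rw [L2.inner_def] at h1
    have h2 : ∀ᵐ x ∂m, inner ℝ ((hneg.toLp : Lp ℝ 2 m) x) (g x) = -(max (-g x) 0) ^ 2 := by
      filter_upwards [hneg.coeFn_toLp] with x h1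
      simp only [h1, RCLike.inner_apply, conj_trivial]
      rcases le_total 0 (g x) with h | h
      · simp [max_eq_right (neg_nonpos.2 h)]
      · rw [max_eq_left (neg_nonneg.2 h)]; ring
    rw [integral_congr_ae h2, integral_neg, neg_nonneg] at h1
    have h3 : Integrable (fun x => (max (-g x) 0) ^ 2) m := hneg.integrable_sq
    have h4 := (integral_eq_zero_iff_of_nonneg (fun x => sq_nonneg _) h3).1
      (le_antisymm h1 (integral_nonneg fun x => sq_nonneg _))
    filter_upwards [h4] with x hx
    have := pow_eq_zero_iff (two_ne_zero) |>.1 hx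
    have := (max_eq_right_iff.1 this)
    simpa using this
  · have h1 : ‖WeakDual.toStrongDual a‖ ≤ c := by
      rw [← dist_zero_right]
      exact Metric.mem_closedBall.1 ha
    exact (LinearIsometryEquiv.norm_map (InnerProductSpace.toDual ℝ (Lp ℝ 2 m)).symm _).trans_le h1

end slopes

/-! ### Reflexivity and weak convergence -/

section functional

variable {E F : Type*} [NormedAddCommGroup E] [NormedSpace ℝ E] [NormedAddCommGroup F]
  [NormedSpace ℝ F]

/-- In a reflexive space, a bounded sequence converges weakly as soon as its image under an
injective operator converges. -/
theorem tendsto_apply_of_reflexive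
    (hrefl : Function.Surjective (NormedSpace.inclusionInDoubleDual ℝ E)) (J : E →L[ℝ] F)
    (hJ : Function.Injective J) {h : ℕ → E} {h₀ : E} {M : ℝ} (hM : ∀ k, ‖h k‖ ≤ M)
    (hlim : Tendsto (fun k => J (h k)) atTop (𝓝 (J h₀))) (φ : StrongDual ℝ E) :
    Tendsto (fun k => φ (h k)) atTop (𝓝 (φ h₀)) := by
  rw [tendsto_iff_ultrafilter]
  intro U hU
  set Ψ : ℕ → WeakDual ℝ (StrongDual ℝ E) := fun k =>
    StrongDual.toWeakDual (NormedSpace.inclusionInDoubleDual ℝ E (h k)) with hΨ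
  -- Weak-star compactness in the bidual gives a limit along the ultrafilter, and reflexivity makes
  -- it a point `e` of `E`.
  have hcomp := WeakDual.isCompact_closedBall (𝕜 := ℝ) (E := StrongDual ℝ E) 0 M
  obtain ⟨a, -, ha⟩ := hcomp.ultrafilter_le_nhds' (U.map Ψ) (by
    refine Ultrafilter.mem_map.2 (Filter.univ_mem' fun k => ?_)
    rw [mem_preimage, mem_preimage, Metric.mem_closedBall, dist_zero_right]
    exact (NormedSpace.double_dual_bound ℝ E (h k)).trans (hM k))
  obtain ⟨e, he⟩ := hrefl (WeakDual.toStrongDual a)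
  have key : ∀ ψ : StrongDual ℝ E, Tendsto (fun k => ψ (h k)) U (𝓝 (ψ e)) := fun ψ => by
    have h1 := (WeakDual.eval_continuous (𝕜 := ℝ) (E := StrongDual ℝ E) ψ).tendsto a
    have h2 : a ψ = ψ e := by
      rw [← NormedSpace.dual_def ℝ E e ψ, he]
      rfl
    rw [← h2]
    exact h1.comp ha
  -- The limit is identified through `J`: functionals of the form `g ∘ J` separate points of the
  -- image.
  have heq : J e = J h₀ := by
    refine SeparatingDual.eq_iff_forall_dual_eq (R := ℝ) |>.2 fun g => ?_
    exact tendsto_nhds_unique (key (g.comp J)) ((g.continuous.tendsto _).comp (hlim.mono_left hU))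
  rw [← hJ heq]
  exact key φ

/-- The bound lets `l` factor through the range of `j`, and Hahn–Banach extends the resulting
bounded functional. -/
theorem exists_dual_comp_eq {S : Type*} [AddCommGroup S] [Module ℝ S] (j : S →ₗ[ℝ] E)
    (l : S →ₗ[ℝ] ℝ) {M : ℝ} (hM : ∀ s, |l s| ≤ M * ‖j s‖) :
    ∃ φ : StrongDual ℝ E, ∀ s, φ (j s) = l s := by
  have hker : LinearMap.ker j ≤ LinearMap.ker l := fun s hs => by
    have := hM s
    rw [LinearMap.mem_ker.1 hs, _root_.norm_zero, mul_zero] at this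
    exact LinearMap.mem_ker.2 (abs_nonpos_iff.1 this)
  set l' : LinearMap.range j →ₗ[ℝ] ℝ :=
    ((LinearMap.ker j).liftQ l hker).comp j.quotKerEquivRange.symm.toLinearMap with hl'
  have h1 : ∀ s, l' ⟨j s, LinearMap.mem_range_self j s⟩ = l s := fun s => by
    rw [hl', LinearMap.comp_apply]
    have : j.quotKerEquivRange.symm.toLinearMap ⟨j s, LinearMap.mem_range_self j s⟩ =
        (LinearMap.ker j).mkQ s := by
      rw [LinearEquiv.coe_coe, LinearEquiv.symm_apply_eq]
      rfl
    rw [this, Submodule.mkQ_apply, Submodule.liftQ_apply]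
  obtain ⟨φ, hφ, -⟩ := exists_extension_norm_eq (LinearMap.range j) (l'.mkContinuous M (by
    rintro ⟨_, s, rfl⟩
    rw [h1]
    exact hM s))
  refine ⟨φ, fun s => ?_⟩
  rw [← h1]
  exact hφ ⟨j s, LinearMap.mem_range_self j s⟩

end functional

/-! ### Bounded functionals on `H^{1,2}` given by derivations -/

section extension

variable {X : Type*} [MetricSpace X] [MeasurableSpace X] [BorelSpace X] {m : Measure X}

/-- The inclusion of `H^{1,2}` in `L²`, as a bounded operator. -/
noncomputable def H12.toL2L (m : Measure X) : H12 m →L[ℝ] Lp ℝ 2 m :=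
  (H12.toL2 m).mkContinuous 1 fun f => by
    rw [one_mul, H12.norm_def]
    exact Real.le_sqrt_of_sq_le (le_add_of_nonneg_right (by positivity))

theorem H12.toL2L_injective : Function.Injective (H12.toL2L m) := Subtype.val_injective

/-- The bounded Lipschitz functions with bounded support. -/
def LipBS (X : Type*) [MetricSpace X] : Submodule ℝ (LipB X) where
  carrier := {f | BddSupport f.1}
  zero_mem' := by
    change Bornology.IsBounded (Function.support (0 : X → ℝ))
    simp
  add_mem' := by
    intro f g hf hg
    exact (Bornology.IsBounded.union hf hg).subset (Function.support_add f.1 g.1)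
  smul_mem' := by
    intro c f hf
    exact Bornology.IsBounded.subset hf (Function.support_const_smul_subset c f.1)

theorem lipApprox_self [BoundedlyFinite m] (u : LipB X) (hu : BddSupport u.1) :
    LipApprox m ((memLp_of_bddSupport (m := m) u hu 2).toLp : Lp ℝ 2 m) fun _ => u.1 := by
  refine ⟨fun _ => ⟨u.2, memLp_of_bddSupport u hu 2⟩, ?_⟩
  refine tendsto_const_nhds.congr fun _ => ?_
  rw [eLpNorm_congr_ae (g := 0), eLpNorm_zero]
  filter_upwards [(memLp_of_bddSupport (m := m) u hu 2).coeFn_toLp] with x hx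
  simp [hx]

theorem cheeger_le_energy [BoundedlyFinite m] (u : LipB X) (hu : BddSupport u.1) :
    cheeger m ((memLp_of_bddSupport (m := m) u hu 2).toLp : Lp ℝ 2 m) ≤
      2⁻¹ * ∫⁻ x, asympLip u.1 x ^ 2 ∂m :=
  cheeger_le (lipApprox_self u hu) fun _ => le_rfl

theorem lintegral_asympLip_sq_ne_top [BoundedlyFinite m] (u : LipB X) (hu : BddSupport u.1) :
    ∫⁻ x, asympLip u.1 x ^ 2 ∂m ≠ ∞ := by
  have h := (memLp_asympLip (m := m) u hu 2).integrable_sq.2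
  rw [hasFiniteIntegral_iff_enorm] at h
  refine ne_of_lt (lt_of_eq_of_lt (lintegral_congr fun x => ?_) h)
  rw [enorm_pow, Real.enorm_of_nonneg ENNReal.toReal_nonneg,
    ENNReal.ofReal_toReal (asympLip_ne_top u x)]

/-- The inclusion of the Lipschitz functions with bounded support in `H^{1,2}`. -/
noncomputable def LipBS.toH12 (m : Measure X) [BoundedlyFinite m] : LipBS X →ₗ[ℝ] H12 m where
  toFun u := ⟨(memLp_of_bddSupport (m := m) u.1 u.2 2).toLp, ((cheeger_le_energy u.1 u.2).trans_lt
    (ENNReal.mul_lt_top (by simp) (lt_top_iff_ne_top.2 (lintegral_asympLip_sq_ne_top u.1 u.2)))).ne⟩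
  map_add' u v := Subtype.ext rfl
  map_smul' c u := Subtype.ext rfl

theorem LipBS.toL2_toH12 [BoundedlyFinite m] (u : LipBS X) :
    H12.toL2 m (LipBS.toH12 m u) = (memLp_of_bddSupport (m := m) u.1 u.2 2).toLp := rfl

theorem two_mul_cheeger_le_norm_sq (f : H12 m) :
    2 * (cheeger m (H12.toL2 m f)).toReal ≤ ‖f‖ ^ 2 := by
  rw [H12.norm_def, Real.sq_sqrt (by positivity)]
  exact le_add_of_nonneg_left (by positivity)

/-- The slack `ε` provides the strict inequality between the Cheeger energy and half the squared
bound that the construction of the slope requires. -/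
theorem exists_relaxedSlope_norm_le [BoundedlyFinite m] [SecondCountableTopology X]
    (u : LipBS X) {ε : ℝ} (hε : 0 < ε) :
    ∃ g ∈ relaxedSlopes m u.1.1, 0 ≤ᵐ[m] g ∧ ‖g‖ ≤ ‖LipBS.toH12 m u‖ + ε := by
  have h0 : 0 ≤ ‖LipBS.toH12 m u‖ := norm_nonneg _
  have h1 := two_mul_cheeger_le_norm_sq (LipBS.toH12 m u)
  have h2 := H12.cheeger_ne_top (LipBS.toH12 m u)
  rw [LipBS.toL2_toH12] at h1 h2
  have hc : ((Real.toNNReal (‖LipBS.toH12 m u‖ + ε) : ℝ≥0) : ℝ) = ‖LipBS.toH12 m u‖ + ε :=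
    Real.coe_toNNReal _ (by positivity)
  rw [← hc]
  refine exists_mem_relaxedSlopes u.1 u.2 ?_
  rw [← ENNReal.ofReal_toReal h2]
  have h3 : (2⁻¹ : ℝ≥0∞) * ((Real.toNNReal (‖LipBS.toH12 m u‖ + ε) : ℝ≥0) : ℝ≥0∞) ^ 2 =
      ENNReal.ofReal (2⁻¹ * (‖LipBS.toH12 m u‖ + ε) ^ 2) := by
    rw [ENNReal.ofReal_mul (by norm_num), ENNReal.ofReal_pow (by positivity),
      ENNReal.ofReal_inv_of_pos two_pos, ENNReal.ofReal_ofNat]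
    rfl
  rw [h3, ENNReal.ofReal_lt_ofReal_iff (by positivity)]
  nlinarith

theorem integrable_norm_of_le [BoundedlyFinite m] {b : LipDerivation m}
    (hloc : ∀ (x : X) (r : ℝ), IntegrableOn b.norm (Metric.ball x r) m) {μ : Measure X} {C : ℝ≥0}
    {x : X} {R : ℝ} (hμ : μ ≤ C • m.restrict (Metric.ball x R)) : Integrable b.norm μ :=
  Integrable.mono_measure (Integrable.smul_measure_nnreal (hloc x R)) hμ

theorem isFiniteMeasure_of_le_ball [BoundedlyFinite m] {μ : Measure X} {C : ℝ≥0}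
    {x : X} {R : ℝ} (hμ : μ ≤ C • m.restrict (Metric.ball x R)) : IsFiniteMeasure μ := by
  have h1 : IsFiniteMeasure (m.restrict (Metric.ball x R)) :=
    ⟨by rw [Measure.restrict_apply_univ]; exact BoundedlyFinite.lt_top _ Metric.isBounded_ball⟩
  exact isFiniteMeasure_of_le _ hμ

/-- The truncated functional `u ↦ ∫_{|b| ≤ N} b(u) dμ` is bounded on `H^{1,2}`. -/
theorem exists_dual_toH12_eq [BoundedlyFinite m] [SecondCountableTopology X]
    (b : LipDerivation m) {μ : Measure X} {C : ℝ≥0} {x : X} {R : ℝ}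
    (hμ : μ ≤ C • m.restrict (Metric.ball x R)) (N : ℝ) (hN : 0 ≤ N) :
    ∃ φ : StrongDual ℝ (H12 m), ∀ u : LipBS X,
      φ (LipBS.toH12 m u) = ∫ y in {y | b.norm y ≤ N}, b.toLin u.1 y ∂μ := by
  have hfin := isFiniteMeasure_of_le_ball hμ
  have hac : μ ≪ m := (Measure.absolutelyContinuous_of_le_smul (c := (C : ℝ≥0∞)) hμ).trans
    Measure.restrict_le_self.absolutelyContinuous
  set A : Set X := {y | b.norm y ≤ N} with hA
  have hAm : MeasurableSet A := measurableSet_le (AEEqFun.measurable _) measurable_const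
  have hint : ∀ u : LipB X, Integrable (b.toLin u) (μ.restrict A) := fun u => by
    obtain ⟨K, hK⟩ := u.2.1
    refine Integrable.of_bound (C := N * K) (AEEqFun.measurable _).aestronglyMeasurable ?_
    rw [ae_restrict_iff' hAm]
    filter_upwards [hac.ae_le (b.abs_toLin_le u hK)] with y hy hyA
    exact hy.trans (mul_le_mul_of_nonneg_right hyA K.2)
  set l : LipBS X →ₗ[ℝ] ℝ :=
    { toFun := fun u => ∫ y in A, b.toLin u.1 y ∂μ
      map_add' := fun u v => by
        rw [← integral_add (hint _) (hint _)]
        refine integral_congr_ae (ae_restrict_of_ae ?_)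
        have : b.toLin ((u + v : LipBS X) : LipB X) = b.toLin u.1 + b.toLin v.1 := map_add b.toLin _ _
        rw [this]
        exact hac.ae_le (AEEqFun.coeFn_add _ _)
      map_smul' := fun c u => by
        rw [RingHom.id_apply, smul_eq_mul, ← integral_const_mul]
        refine integral_congr_ae (ae_restrict_of_ae ?_)
        exact hac.ae_le (b.toLin_smul c u.1) } with hl
  have hball : m (Metric.ball x R) < ∞ := BoundedlyFinite.lt_top _ Metric.isBounded_ball
  refine exists_dual_comp_eq (S := LipBS X) (LipBS.toH12 m) l
    (M := N * (C * (m (Metric.ball x R)).toReal ^ (1 / 2 : ℝ))) fun u => ?_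
  -- On `A` the derivation is at most `N` times any nonnegative relaxed slope. Cauchy–Schwarz on the
  -- ball bounds the integral of the slope by its `L²` norm, and a near-optimal slope has norm at
  -- most `‖u‖ + ε`.
  have key : ∀ ε > 0, |l u| ≤ N * (C * (m (Metric.ball x R)).toReal ^ (1 / 2 : ℝ)) *
      (‖LipBS.toH12 m u‖ + ε) := by
    intro ε hε
    obtain ⟨g, hg, hg0, hgn⟩ := exists_relaxedSlope_norm_le (m := m) u hε
    have hg1 : IntegrableOn g (Metric.ball x R) m :=
      have : IsFiniteMeasure (m.restrict (Metric.ball x R)) :=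
        ⟨by rwa [Measure.restrict_apply_univ]⟩
      ((Lp.memLp g).mono_measure Measure.restrict_le_self).integrable one_le_two
    have hgμ : Integrable g μ :=
      Integrable.mono_measure (Integrable.smul_measure_nnreal (c := C) hg1) hμ
    have h1 : |l u| ≤ N * ∫ y in A, g y ∂μ := by
      rw [← integral_const_mul, ← Real.norm_eq_abs]
      refine norm_integral_le_of_norm_le (hgμ.restrict.const_mul N) ?_
      rw [ae_restrict_iff' hAm]
      filter_upwards [hac.ae_le (b.abs_toLin_le_relaxed u.1 u.2 hg hg0), hac.ae_le hg0]
        with y hy h0 hyA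
      exact hy.trans (mul_le_mul_of_nonneg_right hyA h0)
    have h2 : ∫ y in A, g y ∂μ ≤ C * ∫ y in Metric.ball x R, g y ∂m := by
      refine (setIntegral_le_integral hgμ (hac.ae_le hg0)).trans ?_
      have h5 : C * ∫ y in Metric.ball x R, g y ∂m =
          ∫ y, g y ∂(C • m.restrict (Metric.ball x R)) := by
        rw [integral_smul_nnreal_measure, NNReal.smul_def, smul_eq_mul]
      rw [h5]
      refine integral_mono_measure hμ ?_ (Integrable.smul_measure_nnreal (c := C) hg1)
      exact (Measure.absolutelyContinuous_of_le_smul (c := (C : ℝ≥0∞)) le_rfl).ae_le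
        (ae_restrict_of_ae hg0)
    have h3 : ∫ y in Metric.ball x R, g y ∂m ≤ (m (Metric.ball x R)).toReal ^ (1 / 2 : ℝ) * ‖g‖ := by
      have h4 := L2.inner_indicatorConstLp_one (𝕜 := ℝ) (μ := m)
        (Metric.isOpen_ball.measurableSet : MeasurableSet (Metric.ball x R)) hball.ne g
      rw [← h4]
      refine (real_inner_le_norm _ _).trans_eq ?_
      rw [norm_indicatorConstLp (by simp) (by simp)]
      simp [Measure.real]
    calc |l u| ≤ N * (C * ((m (Metric.ball x R)).toReal ^ (1 / 2 : ℝ) * ‖g‖)) := by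
          refine h1.trans (mul_le_mul_of_nonneg_left (h2.trans ?_) hN)
          exact mul_le_mul_of_nonneg_left h3 C.2
      _ ≤ N * (C * ((m (Metric.ball x R)).toReal ^ (1 / 2 : ℝ) * (‖LipBS.toH12 m u‖ + ε))) := by
          gcongr
      _ = _ := by ring
  have hlim : Tendsto (fun ε : ℝ => N * (C * (m (Metric.ball x R)).toReal ^ (1 / 2 : ℝ)) *
      (‖LipBS.toH12 m u‖ + ε)) (𝓝[>] 0) (𝓝 (N * (C * (m (Metric.ball x R)).toReal ^ (1 / 2 : ℝ)) *
      (‖LipBS.toH12 m u‖ + 0))) := by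
    refine Tendsto.mono_left ?_ nhdsWithin_le_nhds
    exact Continuous.tendsto (by fun_prop) 0
  rw [add_zero] at hlim
  exact ge_of_tendsto hlim (eventually_nhdsWithin_of_forall key)

end extension

/-! ### Continuity of derivations under flat convergence -/

section continuity

variable {X : Type*} [MetricSpace X] [MeasurableSpace X] [BorelSpace X] {m : Measure X}
  [BoundedlyFinite m]

theorem tendsto_eLpNorm_two_of_dominated {Ω : Type*} {mΩ : MeasurableSpace Ω} {μ : Measure Ω}
    {f : ℕ → Ω → ℝ} {g : Ω → ℝ} (hf : ∀ k, MemLp (f k) 2 μ) (hg : MemLp g 2 μ)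
    (hb : ∀ k, ∀ᵐ x ∂μ, |f k x| ≤ g x) (hlim : ∀ᵐ x ∂μ, Tendsto (fun k => f k x) atTop (𝓝 0)) :
    Tendsto (fun k => eLpNorm (f k) 2 μ) atTop (𝓝 0) := by
  have h1 : Tendsto (fun k => ∫ x, f k x ^ 2 ∂μ) atTop (𝓝 (∫ _, (0 : ℝ) ^ 2 ∂μ)) := by
    refine tendsto_integral_of_dominated_convergence (fun x => g x ^ 2)
      (fun k => (hf k).1.pow 2) hg.integrable_sq (fun k => ?_) ?_
    · filter_upwards [hb k] with x hx
      rw [Real.norm_eq_abs, abs_pow]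
      exact pow_le_pow_left₀ (abs_nonneg _) hx 2
    · filter_upwards [hlim] with x hx
      exact hx.pow 2
  have h2 : ∀ k, eLpNorm (f k) 2 μ = ENNReal.ofReal (√(∫ x, f k x ^ 2 ∂μ)) := fun k => by
    rw [(hf k).eLpNorm_eq_integral_rpow_norm (by simp) (by simp), Real.sqrt_eq_rpow]
    simp
  simp only [h2]
  have h3 := (ENNReal.continuous_ofReal.comp Real.continuous_sqrt).tendsto
    (∫ _, (0 : ℝ) ^ 2 ∂μ)
  have h4 := h3.comp h1
  simpa [Function.comp_def] using h4

/-- Both terms of the squared norm are at most `A² m(s)`. For the second one the constant sequence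
`u` is a competitor in the Cheeger energy. -/
theorem norm_toH12_le (u : LipBS X) {s : Set X} (hs : IsClosed s) (hfin : m s ≠ ∞)
    (hsupp : Function.support u.1.1 ⊆ s) {A : ℝ≥0} (hA : ∀ x, |u.1.1 x| ≤ A)
    (hK : ∀ x, asympLip u.1.1 x ≤ A) :
    ‖LipBS.toH12 m u‖ ≤ √(A ^ 2 * (m s).toReal + A ^ 2 * (m s).toReal) := by
  rw [H12.norm_def, LipBS.toL2_toH12]
  refine Real.sqrt_le_sqrt (add_le_add ?_ ?_)
  · have h1 := (memLp_of_bddSupport (m := m) u.1 u.2 2).eLpNorm_eq_integral_rpow_norm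
      (by simp) (by simp)
    have h2 : ∫ x, u.1.1 x ^ 2 ∂m ≤ A ^ 2 * (m s).toReal := by
      have h3 : ∫ x, u.1.1 x ^ 2 ∂m ≤ ∫ x, s.indicator (fun _ => (A : ℝ) ^ 2) x ∂m := by
        refine integral_mono_of_nonneg (Eventually.of_forall fun x => sq_nonneg _)
          ((integrable_indicator_iff hs.measurableSet).2 (integrableOn_const hfin))
          (Eventually.of_forall fun x => ?_)
        by_cases hx : x ∈ s
        · simp only [indicator_of_mem hx]
          rw [← sq_abs]
          exact pow_le_pow_left₀ (abs_nonneg _) (hA x) 2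
        · have : u.1.1 x = 0 := by
            by_contra h
            exact hx (hsupp h)
          simp [indicator_of_notMem hx, this]
      rw [integral_indicator hs.measurableSet, setIntegral_const, smul_eq_mul, mul_comm] at h3
      exact h3
    rw [Lp.norm_toLp, h1, ENNReal.toReal_ofReal (by positivity)]
    refine le_of_eq_of_le ?_ h2
    have h4 : 0 ≤ ∫ x, u.1.1 x ^ 2 ∂m := integral_nonneg fun x => sq_nonneg _
    simp only [ENNReal.toReal_ofNat, Real.rpow_ofNat, Real.norm_eq_abs, sq_abs]
    rw [← Real.rpow_natCast, ← Real.rpow_mul h4]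
    norm_num
  · have h1 := cheeger_le_energy (m := m) u.1 u.2
    have h2 : ∫⁻ x, asympLip u.1.1 x ^ 2 ∂m ≤ (A : ℝ≥0∞) ^ 2 * m s := by
      rw [← lintegral_indicator_const hs.measurableSet]
      refine lintegral_mono fun x => ?_
      by_cases hx : x ∈ s
      · rw [indicator_of_mem hx]
        exact pow_le_pow_left' (hK x) 2
      · rw [asympLip_eq_zero_of_notMem_closure
          (fun h => hx (closure_minimal hsupp hs h))]
        simp
    have h3 := h1.trans (mul_le_mul_right h2 _)
    have h4 := ENNReal.toReal_mono (ENNReal.mul_ne_top (by simp)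
      (ENNReal.mul_ne_top (by simp) hfin)) h3
    simp only [ENNReal.toReal_mul, ENNReal.toReal_pow, ENNReal.coe_toReal, ENNReal.toReal_inv,
      ENNReal.toReal_ofNat] at h4
    linarith

variable {b : LipDerivation m} {μ : Measure X} {C : ℝ≥0} {x : X} {R : ℝ}

theorem ae_mem_ball_of_le (hμ : μ ≤ C • m.restrict (Metric.ball x R)) :
    ∀ᵐ y ∂μ, y ∈ Metric.ball x R :=
  (Measure.absolutelyContinuous_of_le_smul (c := (C : ℝ≥0∞)) hμ).ae_le
    (ae_restrict_mem Metric.isOpen_ball.measurableSet)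

theorem ac_of_le_ball (hμ : μ ≤ C • m.restrict (Metric.ball x R)) : μ ≪ m :=
  (Measure.absolutelyContinuous_of_le_smul (c := (C : ℝ≥0∞)) hμ).trans
    Measure.restrict_le_self.absolutelyContinuous

theorem integrable_toLin (hloc : ∀ (x : X) (r : ℝ), IntegrableOn b.norm (Metric.ball x r) m)
    (hμ : μ ≤ C • m.restrict (Metric.ball x R)) (u : LipB X) : Integrable (b.toLin u) μ := by
  obtain ⟨K, hK⟩ := u.2.1
  refine Integrable.mono' ((integrable_norm_of_le hloc hμ).mul_const K)
    (AEEqFun.measurable _).aestronglyMeasurable ?_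
  exact (ac_of_le_ball hμ).ae_le (b.abs_toLin_le u hK)

theorem tendsto_setIntegral_gt_zero {Ω : Type*} {mΩ : MeasurableSpace Ω} {μ : Measure Ω}
    {h : Ω → ℝ} (hm : Measurable h) (hi : Integrable h μ) :
    Tendsto (fun N : ℕ => ∫ y in {y | (N : ℝ) < h y}, h y ∂μ) atTop (𝓝 0) := by
  have h1 := Antitone.tendsto_setIntegral (μ := μ) (f := h) (s := fun N : ℕ => {y | (N : ℝ) < h y})
    (fun N => measurableSet_lt measurable_const hm) (fun N M hNM y (hy : (M : ℝ) < h y) =>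
      show (N : ℝ) < h y from lt_of_le_of_lt (Nat.cast_le.2 hNM) hy) hi.integrableOn
  have h2 : ⋂ N : ℕ, {y | (N : ℝ) < h y} = ∅ := by
    refine eq_empty_of_forall_notMem fun y hy => ?_
    obtain ⟨N, hN⟩ := exists_nat_ge (h y)
    exact absurd (mem_iInter.1 hy N) (not_lt.2 hN)
  simpa [h2] using h1

/-- Continuity of `u ↦ ∫ b(u) dμ` under flat convergence, when `H^{1,2}` is reflexive. -/
theorem tendsto_integral_toLin_of_reflexive [SecondCountableTopology X]
    (hrefl : Function.Surjective (NormedSpace.inclusionInDoubleDual ℝ (H12 m)))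
    (hloc : ∀ (x : X) (r : ℝ), IntegrableOn b.norm (Metric.ball x r) m)
    (hμ : μ ≤ C • m.restrict (Metric.ball x R)) {u : ℕ → LipB X} {f : LipB X} {L : ℝ≥0}
    (hu : ∀ k, LipschitzWith L (u k).1 ∧ ∀ x, |(u k).1 x| ≤ L)
    (hlim : ∀ᵐ x ∂m, Tendsto (fun k => (u k).1 x) atTop (𝓝 (f.1 x))) :
    Tendsto (fun k => ∫ y, b.toLin (u k) y ∂μ) atTop (𝓝 (∫ y, b.toLin f y ∂μ)) := by
  have hac := ac_of_le_ball hμ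
  obtain ⟨Kf, hKf⟩ := f.2.1
  -- The cutoff brings every function into `H^{1,2}` without changing `b(g)` almost everywhere for
  -- `μ`, which lives on the ball.
  set w : LipB X → LipBS X := fun g => ⟨lipMul g (cutoff x R), (bddSupport_cutoff x R).mul_left g⟩
    with hw
  have hwsupp : ∀ g, Function.support (w g).1.1 ⊆ Metric.closedBall x (R + 1) := fun g y hy => by
    by_contra h
    refine hy ?_
    rw [hw, lipMul_apply, cutoff_eq_zero, mul_zero]
    exact (not_le.1 fun h' => h (Metric.mem_closedBall.2 h')).le
  have hwb : ∀ g : LipB X, ∀ᵐ y ∂μ, b.toLin g y = b.toLin (w g).1 y := fun g => by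
    filter_upwards [ae_mem_ball_of_le hμ, hac.ae_le (b.toLin_congr (f := g) (g := (w g).1)
      Metric.isOpen_ball (U := Metric.ball x R) fun y hy => by
        rw [hw, lipMul_apply, cutoff_eq_one (Metric.mem_ball.1 hy).le, mul_one])] with y hy h
    exact h hy
  have hB : m (Metric.closedBall x (R + 1)) ≠ ∞ :=
    (BoundedlyFinite.lt_top _ Metric.isBounded_closedBall).ne
  -- The constant `2L` comes from the product rule: `|u k| ≤ L` times the Lipschitz constant `1` of
  -- the cutoff, plus the cutoff times `L`.
  have hbound : ∀ k, ‖LipBS.toH12 m (w (u k))‖ ≤ √((2 * L : ℝ≥0) ^ 2 *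
      (m (Metric.closedBall x (R + 1))).toReal + (2 * L : ℝ≥0) ^ 2 *
      (m (Metric.closedBall x (R + 1))).toReal) := fun k => by
    refine norm_toH12_le _ Metric.isClosed_closedBall hB (hwsupp _) (fun y => ?_) fun y => ?_
    · rw [hw, lipMul_apply, abs_mul]
      have h1 := (hu k).2 y
      have h2 := abs_cutoff_le_one x R y
      have h3 := abs_nonneg ((u k).1 y)
      push_cast
      nlinarith [abs_nonneg ((cutoff x R).1 y)]
    · have hc1 : LipschitzWith 1 (cutoff x R).1 := by
        refine lipschitzWith_clamp (LipschitzWith.of_dist_le_mul fun y z => ?_) 0 1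
        rw [Real.dist_eq, sub_sub_sub_cancel_left, NNReal.coe_one, one_mul, dist_comm y z]
        exact abs_dist_sub_le z y x
      refine (asympLip_mul_le (hu k).1 hc1 y).trans ?_
      rw [← ENNReal.ofReal_coe_nnreal]
      refine ENNReal.ofReal_le_ofReal ?_
      have h1 := (hu k).2 y
      have h2 := abs_cutoff_le_one x R y
      push_cast
      nlinarith [L.2, abs_nonneg ((cutoff x R).1 y)]
  have hL2 : Tendsto (fun k => H12.toL2L m (LipBS.toH12 m (w (u k)))) atTop
      (𝓝 (H12.toL2L m (LipBS.toH12 m (w f)))) := by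
    refine (Lp.tendsto_Lp_iff_tendsto_eLpNorm'' (fun k => (w (u k)).1.1)
      (fun k => memLp_of_bddSupport _ (w (u k)).2 2) (w f).1.1
      (memLp_of_bddSupport _ (w f).2 2)).2 ?_
    have hcl : MemLp ((Metric.closedBall x (R + 1)).indicator fun _ => (L + L : ℝ)) 2 m :=
      memLp_indicator_const 2 Metric.isClosed_closedBall.measurableSet _ (Or.inr hB)
    refine tendsto_eLpNorm_two_of_dominated
      (fun k => (memLp_of_bddSupport _ (w (u k)).2 2).sub (memLp_of_bddSupport _ (w f).2 2))
      hcl (fun k => ?_) ?_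
    · filter_upwards [hlim] with y hy
      have hfy : |f.1 y| ≤ L := le_of_tendsto' hy.abs fun k => (hu k).2 y
      rw [Pi.sub_apply]
      by_cases hyB : y ∈ Metric.closedBall x (R + 1)
      · rw [indicator_of_mem hyB, hw, lipMul_apply, lipMul_apply, ← sub_mul, abs_mul]
        have h1 := abs_sub ((u k).1 y) (f.1 y)
        have h2 := abs_cutoff_le_one x R y
        have h3 := (hu k).2 y
        nlinarith [abs_nonneg ((cutoff x R).1 y), abs_nonneg ((u k).1 y - f.1 y)]
      · have : ∀ g, (w g).1.1 y = 0 := fun g => by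
          by_contra h
          exact hyB (hwsupp g h)
        rw [this, this, indicator_of_notMem hyB]
        simp
    · filter_upwards [hlim] with y hy
      simp only [Pi.sub_apply, hw, lipMul_apply]
      have := (hy.mul_const ((cutoff x R).1 y)).sub_const (f.1 y * (cutoff x R).1 y)
      rwa [sub_self] at this
  -- The part of the integral where `|b| > N` is small, uniformly over functions with Lipschitz
  -- constant at most `max L Kf`. The truncated functional is continuous by reflexivity.
  have htail := (tendsto_setIntegral_gt_zero (AEEqFun.measurable b.norm)
    (integrable_norm_of_le hloc hμ)).const_mul ((max L Kf : ℝ≥0) : ℝ)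
  rw [mul_zero] at htail
  refine tendsto_of_forall_approx fun ε hε => ?_
  obtain ⟨N, hN⟩ := ((tendsto_order.1 htail).2 ε hε).exists
  obtain ⟨φ, hφ⟩ := exists_dual_toH12_eq b hμ N N.cast_nonneg
  have happrox : ∀ g : LipB X, LipschitzWith (max L Kf) g.1 →
      |∫ y, b.toLin g y ∂μ - φ (LipBS.toH12 m (w g))| ≤ ε := fun g hg => by
    have hA : MeasurableSet {y | (N : ℝ) < b.norm y} :=
      measurableSet_lt measurable_const (AEEqFun.measurable _)
    have hAc : {y | b.norm y ≤ (N : ℝ)} = {y | (N : ℝ) < b.norm y}ᶜ := by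
      ext y; simp
    rw [hφ, ← integral_congr_ae (ae_restrict_of_ae (hwb g)), hAc,
      ← integral_add_compl hA (integrable_toLin hloc hμ g), add_sub_cancel_right,
      ← Real.norm_eq_abs]
    refine le_trans (norm_integral_le_of_norm_le
      (((integrable_norm_of_le hloc hμ).restrict).const_mul ((max L Kf : ℝ≥0) : ℝ))
      (ae_restrict_of_ae ?_)) ?_
    · filter_upwards [hac.ae_le (b.abs_toLin_le g hg)] with y hy
      rw [Real.norm_eq_abs, mul_comm]
      exact hy
    · rw [integral_const_mul]
      exact hN.le
  refine ⟨fun k => φ (LipBS.toH12 m (w (u k))), φ (LipBS.toH12 m (w f)), ?_, fun k => ?_, ?_⟩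
  · exact tendsto_apply_of_reflexive hrefl (H12.toL2L m) H12.toL2L_injective hbound hL2 φ
  · exact happrox _ ((hu k).1.weaken (le_max_left _ _))
  · exact happrox _ (hKf.weaken (le_max_right _ _))


theorem integrable_mul_toLin (hloc : ∀ (x : X) (r : ℝ), IntegrableOn b.norm (Metric.ball x r) m)
    (x : X) {η : LipB X} (hη : BddSupport η.1) (u : LipB X) :
    Integrable (fun y => η.1 y * b.toLin u y) m := by
  obtain ⟨A, hA⟩ := η.2.2
  obtain ⟨r, hr⟩ := hη.subset_ball x
  have h1 : Integrable (b.toLin u) (m.restrict (Metric.ball x r)) :=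
    integrable_toLin (C := 1) (x := x) (R := r) hloc (by rw [one_smul]) u
  have h2 : IntegrableOn (fun y => η.1 y * b.toLin u y) (Metric.ball x r) m :=
    h1.bdd_mul (c := A) (continuous_lipB η).measurable.aestronglyMeasurable
      (Eventually.of_forall hA)
  refine (integrableOn_iff_integrable_of_support_subset fun y hy => hr ?_).1 h2
  exact left_ne_zero_of_mul hy

/-- Since `b(η)` vanishes where the asymptotic Lipschitz constant does, it lives on the closure of
the support of `η`; the margin `1` in the radius leaves room for this closure. -/
theorem integrable_toLin_of_bddSupport
    (hloc : ∀ (x : X) (r : ℝ), IntegrableOn b.norm (Metric.ball x r) m)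
    (x : X) {η : LipB X} (hη : BddSupport η.1) : Integrable (b.toLin η) m := by
  obtain ⟨r, hr⟩ := hη.subset_ball x
  have hs : Function.support η.1 ⊆ Metric.closedBall x r := hr.trans Metric.ball_subset_closedBall
  have h1 : Integrable (b.toLin η) (m.restrict (Metric.ball x (r + 1))) :=
    integrable_toLin (C := 1) (x := x) (R := r + 1) hloc (by rw [one_smul]) η
  rw [← IntegrableOn, ← integrable_indicator_iff Metric.isOpen_ball.measurableSet] at h1
  refine h1.congr ?_
  filter_upwards [b.abs_toLin_le_asympLip η] with y hy
  by_cases hyB : y ∈ Metric.ball x (r + 1)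
  · rw [indicator_of_mem hyB]
  · rw [indicator_of_notMem hyB]
    have : y ∉ closure (Function.support η.1) := fun h => by
      have := Metric.mem_closedBall.1 (closure_minimal hs Metric.isClosed_closedBall h)
      exact hyB (Metric.mem_ball.2 (by linarith))
    rw [asympLip_eq_zero_of_notMem_closure this, ENNReal.toReal_zero, mul_zero] at hy
    exact (abs_nonpos_iff.1 hy).symm

/-- The Leibniz rule and the divergence of `b` give `∫ η b(v) = -∫ v η g - ∫ v b(η)`. No derivative
falls on `v` on the right, so dominated convergence applies. -/
theorem tendsto_integral_lip_mul_toLin {g : X → ℝ} (hg : b.IsDivergence g)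
    (hloc : ∀ (x : X) (r : ℝ), IntegrableOn b.norm (Metric.ball x r) m)
    (x : X) {η : LipB X} (hη : BddSupport η.1) {u : ℕ → LipB X} {f : LipB X} {L : ℝ≥0}
    (hu : ∀ k, LipschitzWith L (u k).1 ∧ ∀ x, |(u k).1 x| ≤ L)
    (hlim : ∀ᵐ x ∂m, Tendsto (fun k => (u k).1 x) atTop (𝓝 (f.1 x))) :
    Tendsto (fun k => ∫ y, η.1 y * b.toLin (u k) y ∂m) atTop
      (𝓝 (∫ y, η.1 y * b.toLin f y ∂m)) := by
  obtain ⟨A, hA⟩ := η.2.2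
  obtain ⟨r, hr⟩ := hη.subset_ball x
  have hηg : Integrable (fun y => η.1 y * g y) m := by
    have h2 : IntegrableOn (fun y => η.1 y * g y) (Metric.ball x r) m :=
      (hg.1 x r).bdd_mul (c := A) (continuous_lipB η).measurable.aestronglyMeasurable
        (Eventually.of_forall hA)
    exact (integrableOn_iff_integrable_of_support_subset fun y hy =>
      hr (left_ne_zero_of_mul hy)).1 h2
  have hbη := integrable_toLin_of_bddSupport hloc x hη
  have hmul : ∀ (v : LipB X) {a : X → ℝ}, Integrable a m → Integrable (fun y => v.1 y * a y) m := by
    intro v a ha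
    obtain ⟨A', hA'⟩ := v.2.2
    exact ha.bdd_mul (c := A') (continuous_lipB v).measurable.aestronglyMeasurable
      (Eventually.of_forall hA')
  have key : ∀ v : LipB X, ∫ y, η.1 y * b.toLin v y ∂m =
      -(∫ y, v.1 y * (η.1 y * g y) ∂m) - ∫ y, v.1 y * b.toLin η y ∂m := fun v => by
    have h1 := hg.2 (lipMul η v) (hη.mul_right v)
    rw [integral_congr_ae (b.leibniz η v), integral_add (integrable_mul_toLin hloc x hη v)
      (hmul v hbη)] at h1
    have h2 : ∫ y, (lipMul η v).1 y * g y ∂m = ∫ y, v.1 y * (η.1 y * g y) ∂m := by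
      refine integral_congr_ae (Eventually.of_forall fun y => ?_)
      simp only [lipMul_apply]
      ring
    rw [h2] at h1
    linarith
  simp only [key]
  have hdom : ∀ {a : X → ℝ}, Integrable a m → Tendsto (fun k => ∫ y, (u k).1 y * a y ∂m) atTop
      (𝓝 (∫ y, f.1 y * a y ∂m)) := fun {a} ha => by
    refine tendsto_integral_of_dominated_convergence (fun y => L * |a y|)
      (fun k => (hmul (u k) ha).1) (ha.abs.const_mul _) (fun k => Eventually.of_forall fun y => ?_) ?_
    · rw [norm_mul, Real.norm_eq_abs, Real.norm_eq_abs]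
      exact mul_le_mul_of_nonneg_right ((hu k).2 y) (abs_nonneg _)
    · filter_upwards [hlim] with y hy
      exact hy.mul_const _
  exact (hdom hηg).neg.sub (hdom hbη)

/-- Lipschitz functions with bounded support approximating the indicator of `F` from above. -/
noncomputable def lipIndicator (F : Set X) (j : ℕ) : LipB X :=
  ⟨fun y => max 0 (min 1 (1 - (j + 1) * Metric.infDist y F)), by
    refine ⟨⟨(j + 1 : ℝ≥0), lipschitzWith_clamp (LipschitzWith.of_dist_le_mul fun y z => ?_) 0 1⟩, 1,
      fun y => ?_⟩
    · have h := (Metric.lipschitz_infDist_pt F).dist_le_mul y z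
      rw [NNReal.coe_one, one_mul, Real.dist_eq] at h
      rw [Real.dist_eq, sub_sub_sub_cancel_left, ← mul_sub, abs_mul,
        abs_of_nonneg (by positivity : (0 : ℝ) ≤ j + 1), abs_sub_comm]
      push_cast
      exact mul_le_mul_of_nonneg_left h (by positivity)
    · rw [abs_of_nonneg (le_max_left _ _)]
      exact max_le zero_le_one (min_le_left _ _)⟩

theorem lipIndicator_apply (F : Set X) (j : ℕ) (y : X) :
    (lipIndicator F j).1 y = max 0 (min 1 (1 - (j + 1) * Metric.infDist y F)) := rfl

theorem lipIndicator_nonneg (F : Set X) (j : ℕ) (y : X) : 0 ≤ (lipIndicator F j).1 y :=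
  le_max_left _ _

theorem lipIndicator_le_one (F : Set X) (j : ℕ) (y : X) : (lipIndicator F j).1 y ≤ 1 :=
  max_le zero_le_one (min_le_left _ _)

theorem lipIndicator_eq_one {F : Set X} (j : ℕ) {y : X} (hy : y ∈ F) :
    (lipIndicator F j).1 y = 1 := by
  rw [lipIndicator_apply, Metric.infDist_zero_of_mem hy]
  simp

theorem lipIndicator_eq_zero {F : Set X} {j : ℕ} {y : X}
    (hy : 1 ≤ (j + 1) * Metric.infDist y F) : (lipIndicator F j).1 y = 0 := by
  rw [lipIndicator_apply, max_eq_left ((min_le_right _ _).trans (by linarith))]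

theorem support_lipIndicator_subset {F : Set X} (hF : F.Nonempty) {x : X} {R : ℝ}
    (hFx : F ⊆ Metric.closedBall x R) (j : ℕ) :
    Function.support (lipIndicator F j).1 ⊆ Metric.ball x (R + 1) := by
  intro y hy
  have h1 : Metric.infDist y F < 1 := by
    by_contra h
    refine hy (lipIndicator_eq_zero ?_)
    have := not_lt.1 h
    nlinarith [(Nat.cast_nonneg j : (0 : ℝ) ≤ j)]
  obtain ⟨z, hz, hyz⟩ := (Metric.infDist_lt_iff hF).1 h1
  have := Metric.mem_closedBall.1 (hFx hz)
  exact Metric.mem_ball.2 (by linarith [dist_triangle y z x])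

theorem tendsto_lipIndicator {F : Set X} (hF : F.Nonempty) (hFc : IsClosed F) (y : X) :
    Tendsto (fun j => (lipIndicator F j).1 y) atTop (𝓝 (F.indicator (fun _ => (1 : ℝ)) y)) := by
  by_cases hy : y ∈ F
  · simp only [lipIndicator_eq_one _ hy, indicator_of_mem hy]
    exact tendsto_const_nhds
  · rw [indicator_of_notMem hy]
    have hd := (hFc.notMem_iff_infDist_pos hF).1 hy
    refine tendsto_const_nhds.congr' ?_
    obtain ⟨N, hN⟩ := exists_nat_ge (Metric.infDist y F)⁻¹
    filter_upwards [eventually_ge_atTop N] with j hj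
    refine (lipIndicator_eq_zero ?_).symm
    have h1 : (Metric.infDist y F)⁻¹ ≤ j + 1 := by
      have : (N : ℝ) ≤ j := by exact_mod_cast hj
      linarith
    calc (1 : ℝ) = (Metric.infDist y F)⁻¹ * Metric.infDist y F := (inv_mul_cancel₀ hd.ne').symm
      _ ≤ _ := mul_le_mul_of_nonneg_right h1 hd.le

/-- Continuity of `u ↦ ∫ b(u) dμ` under flat convergence, when `b` has a divergence. -/
theorem tendsto_integral_toLin_of_isDivergence {g : X → ℝ} (hg : b.IsDivergence g)
    (hloc : ∀ (x : X) (r : ℝ), IntegrableOn b.norm (Metric.ball x r) m)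
    (hμ : μ ≤ C • m.restrict (Metric.ball x R)) {u : ℕ → LipB X} {f : LipB X} {L : ℝ≥0}
    (hu : ∀ k, LipschitzWith L (u k).1 ∧ ∀ x, |(u k).1 x| ≤ L)
    (hlim : ∀ᵐ x ∂m, Tendsto (fun k => (u k).1 x) atTop (𝓝 (f.1 x))) :
    Tendsto (fun k => ∫ y, b.toLin (u k) y ∂μ) atTop (𝓝 (∫ y, b.toLin f y ∂μ)) := by
  obtain ⟨Kf, hKf⟩ := f.2.1
  have hsub : ∀ F ⊆ Metric.closedBall x R, IsClosed F →
      Tendsto (fun k => ∫ y in F, b.toLin (u k) y ∂m) atTop (𝓝 (∫ y in F, b.toLin f y ∂m)) := by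
    intro F hF hFc
    rcases F.eq_empty_or_nonempty with rfl | hne
    · simp
    have hfin : Integrable ((Metric.ball x (R + 1)).indicator b.norm) m :=
      (integrable_indicator_iff Metric.isOpen_ball.measurableSet).2 (hloc x (R + 1))
    -- The integral of this error bounds the effect of replacing the indicator of `F` by a Lipschitz
    -- function, uniformly over test functions with a common Lipschitz constant.
    set e : ℕ → X → ℝ := fun j y => |(lipIndicator F j).1 y - F.indicator (fun _ => (1 : ℝ)) y| *
      b.norm y with he
    have hem : ∀ j, AEStronglyMeasurable (e j) m := fun j =>
      ((((continuous_lipB _).measurable).sub (measurable_const.indicator hFc.measurableSet)).abs.mul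
        (AEEqFun.measurable b.norm)).aestronglyMeasurable
    have heb : ∀ j, ∀ᵐ y ∂m, ‖e j y‖ ≤ (Metric.ball x (R + 1)).indicator b.norm y := fun j => by
      filter_upwards [b.norm_nonneg] with y hy
      rw [he, Real.norm_eq_abs, abs_mul, abs_abs, abs_of_nonneg hy]
      by_cases hyB : y ∈ Metric.ball x (R + 1)
      · rw [indicator_of_mem hyB]
        refine mul_le_of_le_one_left hy ?_
        have h1 := lipIndicator_nonneg F j y
        have h2 := lipIndicator_le_one F j y
        by_cases hyF : y ∈ F
        · rw [indicator_of_mem hyF, lipIndicator_eq_one j hyF]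
          simp
        · rw [indicator_of_notMem hyF, sub_zero, abs_of_nonneg h1]
          exact h2
      · have h1 : (lipIndicator F j).1 y = 0 := by
          by_contra h
          exact hyB (support_lipIndicator_subset hne hF j h)
        have h2 : y ∉ F := fun h => by
          have := Metric.mem_closedBall.1 (hF h)
          exact hyB (Metric.mem_ball.2 (by linarith))
        rw [h1, indicator_of_notMem h2, indicator_of_notMem hyB]
        simp
    have hei : ∀ j, Integrable (e j) m := fun j => hfin.mono' (hem j) (heb j)
    have hlim0 : Tendsto (fun j => ((max L Kf : ℝ≥0) : ℝ) * ∫ y, e j y ∂m) atTop (𝓝 0) := by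
      have h1 : Tendsto (fun j => ∫ y, e j y ∂m) atTop (𝓝 (∫ _, (0 : ℝ) ∂m)) := by
        refine tendsto_integral_of_dominated_convergence _ hem hfin heb
          (Eventually.of_forall fun y => ?_)
        have h2 := ((tendsto_lipIndicator hne hFc y).sub_const
          (F.indicator (fun _ => (1 : ℝ)) y)).abs.mul_const (b.norm y)
        simpa using h2
      simpa using h1.const_mul ((max L Kf : ℝ≥0) : ℝ)
    refine tendsto_of_forall_approx fun ε hε => ?_
    obtain ⟨j, hj⟩ := ((tendsto_order.1 hlim0).2 ε hε).exists
    have hηs : BddSupport (lipIndicator F j).1 :=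
      Metric.isBounded_ball.subset (support_lipIndicator_subset hne hF j)
    have happrox : ∀ v : LipB X, LipschitzWith (max L Kf) v.1 →
        |∫ y in F, b.toLin v y ∂m - ∫ y, (lipIndicator F j).1 y * b.toLin v y ∂m| ≤ ε := by
      intro v hv
      have hvF : Integrable (F.indicator (b.toLin v)) m := by
        rw [integrable_indicator_iff hFc.measurableSet]
        refine (integrable_toLin (b := b) (C := 1) (x := x) (R := R + 1) hloc ?_ v)
        rw [one_smul]
        exact Measure.restrict_mono (hF.trans fun y hy => Metric.mem_ball.2
          (by have := Metric.mem_closedBall.1 hy; linarith)) le_rfl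
      rw [← integral_indicator hFc.measurableSet, ← integral_sub hvF
        (integrable_mul_toLin hloc x hηs v), ← Real.norm_eq_abs]
      refine (norm_integral_le_of_norm_le ((hei j).const_mul ((max L Kf : ℝ≥0) : ℝ)) ?_).trans ?_
      · filter_upwards [b.abs_toLin_le v hv] with y hy
        have h1 : F.indicator (b.toLin v) y - (lipIndicator F j).1 y * b.toLin v y =
            (F.indicator (fun _ => (1 : ℝ)) y - (lipIndicator F j).1 y) * b.toLin v y := by
          by_cases hyF : y ∈ F
          · simp only [indicator_of_mem hyF]; ring
          · simp only [indicator_of_notMem hyF]; ring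
        rw [h1, norm_mul, Real.norm_eq_abs, Real.norm_eq_abs, abs_sub_comm, he, mul_left_comm]
        refine mul_le_mul_of_nonneg_left ?_ (abs_nonneg _)
        rw [mul_comm]
        exact hy
      · rw [integral_const_mul]
        exact hj.le
    exact ⟨_, _, tendsto_integral_lip_mul_toLin hg hloc x hηs hu hlim,
      fun k => happrox _ ((hu k).1.weaken (le_max_left _ _)),
      happrox _ (hKf.weaken (le_max_right _ _))⟩
  set ν := m.restrict (Metric.closedBall x R) with hν
  have hνf : IsFiniteMeasure ν :=
    ⟨by rw [hν, Measure.restrict_apply_univ]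
        exact BoundedlyFinite.lt_top _ Metric.isBounded_closedBall⟩
  have hμf := isFiniteMeasure_of_le_ball hμ
  have hμν : μ ≤ C • ν := hμ.trans (by
    intro s
    exact mul_le_mul_right (Measure.restrict_mono Metric.ball_subset_closedBall le_rfl s) _)
  have hacν : μ ≪ ν := Measure.absolutelyContinuous_of_le_smul (c := (C : ℝ≥0∞)) hμν
  -- The density of `μ` is at most `C` almost everywhere; the minimum makes the bound hold
  -- everywhere.
  set w : X → ℝ := fun y => (min (C : ℝ≥0∞) (μ.rnDeriv ν y)).toReal with hw
  have hwm : Measurable w := (measurable_const.min (Measure.measurable_rnDeriv μ ν)).ennreal_toReal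
  have hle : μ.rnDeriv ν ≤ᵐ[ν] fun _ => (C : ℝ≥0∞) := by
    refine ae_le_of_forall_setLIntegral_le_of_sigmaFinite (Measure.measurable_rnDeriv μ ν)
      fun s hs _ => ?_
    rw [Measure.setLIntegral_rnDeriv hacν, setLIntegral_const]
    exact hμν s
  have hrep : ∀ v : LipB X, ∫ y, b.toLin v y ∂μ = ∫ y, w y * b.toLin v y ∂ν := fun v => by
    rw [← integral_rnDeriv_smul hacν]
    refine integral_congr_ae ?_
    filter_upwards [hle] with y hy
    simp only [hw, min_eq_right hy, smul_eq_mul]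
  simp only [hrep]
  have hmax : ∀ v : LipB X, LipschitzWith (max L Kf) v.1 → ∀ᵐ y ∂ν, ‖b.toLin v y‖ ≤
      b.norm y * (max L Kf : ℝ≥0) := fun v hv =>
    ae_restrict_of_ae (b.abs_toLin_le v hv)
  have hνint : Integrable (fun y => b.norm y * (max L Kf : ℝ≥0)) ν :=
    (integrable_norm_of_le (C := 1) (x := x) (R := R + 1) hloc (by
      rw [one_smul]
      exact Measure.restrict_mono (fun y hy => Metric.mem_ball.2
          (by have := Metric.mem_closedBall.1 hy; linarith)) le_rfl)).mul_const _
  -- Closed sets form a π-system generating the Borel sets, so convergence along them yields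
  -- convergence against the bounded density `w`.
  refine tendsto_integral_mul_of_isPiSystem (S := {F : Set X | IsClosed F})
    (G := fun y => b.norm y * (max L Kf : ℝ≥0)) ?_ isPiSystem_isClosed
    (fun k => (AEEqFun.measurable _).aestronglyMeasurable)
    (AEEqFun.measurable _).aestronglyMeasurable hνint
    (fun k => hmax _ ((hu k).1.weaken (le_max_left _ _))) (hmax _ (hKf.weaken (le_max_right _ _)))
    ?_ (fun F hF => ?_) hwm (C := C) fun y => ?_
  · rw [BorelSpace.measurable_eq (α := X), borel_eq_generateFrom_isClosed]
  · exact hsub _ Subset.rfl Metric.isClosed_closedBall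
  · simp only [hν, Measure.restrict_restrict (IsClosed.measurableSet hF)]
    exact hsub _ inter_subset_right (IsClosed.inter hF Metric.isClosed_closedBall)
  · rw [hw, abs_of_nonneg ENNReal.toReal_nonneg]
    exact ENNReal.toReal_le_coe_of_le_coe (min_le_left _ _)

theorem tendsto_integral_toLin [SecondCountableTopology X]
    (h : Function.Surjective (NormedSpace.inclusionInDoubleDual ℝ (H12 m)) ∨
      ∃ g, b.IsDivergence g)
    (hloc : ∀ (x : X) (r : ℝ), IntegrableOn b.norm (Metric.ball x r) m)
    (hμ : μ ≤ C • m.restrict (Metric.ball x R)) {u : ℕ → LipB X} {f : LipB X} {L : ℝ≥0}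
    (hu : ∀ k, LipschitzWith L (u k).1 ∧ ∀ x, |(u k).1 x| ≤ L)
    (hlim : ∀ᵐ x ∂m, Tendsto (fun k => (u k).1 x) atTop (𝓝 (f.1 x))) :
    Tendsto (fun k => ∫ y, b.toLin (u k) y ∂μ) atTop (𝓝 (∫ y, b.toLin f y ∂μ)) := by
  rcases h with h | ⟨g, hg⟩
  · exact tendsto_integral_toLin_of_reflexive h hloc hμ hu hlim
  · exact tendsto_integral_toLin_of_isDivergence hg hloc hμ hu hlim

end continuity

/-! ### Recovery sequences of densities, and strong convergence along subsequences -/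

section recovery

variable {X : Type*} [MetricSpace X] [MeasurableSpace X] [BorelSpace X]

theorem integrable_of_isBounded_support {m : Measure X} [BoundedlyFinite m] {f : X → ℝ}
    (hf : AEStronglyMeasurable f m) {B : ℝ} (hB : ∀ x, |f x| ≤ B) (hs : BddSupport f) :
    Integrable f m := by
  have hc : m (closure (Function.support f)) < ∞ := BoundedlyFinite.lt_top _ hs.closure
  have : IsFiniteMeasure (m.restrict (closure (Function.support f))) :=
    ⟨by rwa [Measure.restrict_apply_univ]⟩
  have h1 : IntegrableOn f (closure (Function.support f)) m :=
    Integrable.of_bound hf.restrict B (Eventually.of_forall hB)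
  exact (integrableOn_iff_integrable_of_support_subset subset_closure).1 h1

theorem integral_densMeasure {Ω : Type*} [MeasurableSpace Ω] {m : Measure Ω} {v : Ω → ℝ}
    (hv : Measurable v) (h0 : ∀ x, 0 ≤ v x) (g : Ω → ℝ) : ∫ x, g x ∂(densMeasure m v) = ∫ x, g x * v x ∂m := by
  have h1 : densMeasure m v = m.withDensity fun x => ((Real.toNNReal (v x) : ℝ≥0) : ℝ≥0∞) := rfl
  rw [h1, integral_withDensity_eq_integral_smul hv.real_toNNReal]
  refine integral_congr_ae (Eventually.of_forall fun x => ?_)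
  simp only [NNReal.smul_def, smul_eq_mul, Real.coe_toNNReal _ (h0 x), mul_comm]

theorem lintegral_densMeasure_univ {m : Measure X} (v : X → ℝ) :
    densMeasure m v univ = ∫⁻ x, ENNReal.ofReal (v x) ∂m := by
  rw [densMeasure, withDensity_apply _ MeasurableSet.univ, Measure.restrict_univ]

theorem integrable_of_isProbabilityMeasure_dens {m : Measure X} {v : X → ℝ} (hv : Measurable v)
    (h0 : ∀ x, 0 ≤ v x) (h : IsProbabilityMeasure (densMeasure m v)) : Integrable v m := by
  refine ⟨hv.aestronglyMeasurable, ?_⟩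
  rw [hasFiniteIntegral_iff_ofReal (Eventually.of_forall h0), ← lintegral_densMeasure_univ,
    h.measure_univ]
  exact ENNReal.one_lt_top

theorem integral_of_isProbabilityMeasure_dens {m : Measure X} {v : X → ℝ} (hv : Measurable v)
    (h0 : ∀ x, 0 ≤ v x) (h : IsProbabilityMeasure (densMeasure m v)) : ∫ x, v x ∂m = 1 := by
  rw [integral_eq_lintegral_of_nonneg_ae (Eventually.of_forall h0) hv.aestronglyMeasurable,
    ← lintegral_densMeasure_univ, h.measure_univ, ENNReal.toReal_one]

theorem isProbabilityMeasure_dens {m : Measure X} {v : X → ℝ} (hv : Integrable v m)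
    (h0 : ∀ x, 0 ≤ v x) (h : ∫ x, v x ∂m = 1) : IsProbabilityMeasure (densMeasure m v) :=
  ⟨by rw [lintegral_densMeasure_univ, ← ofReal_integral_eq_lintegral_ofReal hv
    (Eventually.of_forall h0), h, ENNReal.ofReal_one]⟩

/-- Weak convergence to a probability measure can be tested with Lipschitz functions. -/
theorem tendsto_integral_of_forall_lipschitz {μ : ℕ → Measure X} {μ₀ : Measure X}
    (hμ : ∀ᶠ n in atTop, IsProbabilityMeasure (μ n)) [hμ₀ : IsProbabilityMeasure μ₀]
    (H : ∀ f : LipB X, Tendsto (fun n => ∫ x, f.1 x ∂(μ n)) atTop (𝓝 (∫ x, f.1 x ∂μ₀)))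
    (g : X →ᵇ ℝ) : Tendsto (fun n => ∫ x, g x ∂(μ n)) atTop (𝓝 (∫ x, g x ∂μ₀)) := by
  obtain ⟨N, hN⟩ := eventually_atTop.1 hμ
  -- The index shift discards the finitely many measures that may fail to be probabilities.
  set P : ℕ → ProbabilityMeasure X := fun n => ⟨μ (n + N), hN _ (Nat.le_add_left _ _)⟩ with hP
  have h1 : Tendsto P atTop (𝓝 ⟨μ₀, hμ₀⟩) := by
    refine tendsto_iff_forall_lipschitz_integral_tendsto.2 fun f hfb hfL => ?_
    rcases isEmpty_or_nonempty X with hX | ⟨⟨x₀⟩⟩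
    · have : ∀ ν : Measure X, ∫ x, f x ∂ν = 0 := fun ν => by
        rw [Measure.eq_zero_of_isEmpty ν]; simp
      simp only [this]
      exact tendsto_const_nhds
    obtain ⟨A, hA⟩ := hfb
    have hf : f ∈ LipB X := ⟨hfL, A + |f x₀|, fun x => by
      have h2 := hA x x₀
      rw [Real.dist_eq] at h2
      have h3 := abs_sub_abs_le_abs_sub (f x) (f x₀)
      linarith⟩
    exact (tendsto_add_atTop_iff_nat (f := fun n => ∫ x, f x ∂(μ n)) N).2 (H ⟨f, hf⟩)
  exact (tendsto_add_atTop_iff_nat (f := fun n => ∫ x, g x ∂(μ n)) N).1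
    (ProbabilityMeasure.tendsto_iff_forall_integral_tendsto.1 h1 g)

/-- Continuous partitions into small pieces with bounded support. -/
theorem exists_cells [TopologicalSpace.SeparableSpace X] [Nonempty X] (m : Measure X)
    [SigmaFinite m] :
    ∃ (I : ℕ → ℕ) (c : ℕ → ℕ → X → ℝ), (∀ j i, Continuous (c j i)) ∧ (∀ j i, BddSupport (c j i)) ∧
      (∀ j i x, 0 ≤ c j i x) ∧ (∀ j x, ∑ i ∈ Finset.range (I j), c j i x ≤ 1) ∧
      (∀ j i x y, c j i x ≠ 0 → c j i y ≠ 0 → dist x y ≤ 4 / (j + 1)) ∧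
      ∀ᵐ x ∂m, ∀ᶠ j in atTop, ∑ i ∈ Finset.range (I j), c j i x = 1 := by
  set z : ℕ → X := TopologicalSpace.denseSeq X with hz
  -- A bump equal to `1` within distance `1 / (j + 1)` of the dense point `z i` and zero beyond `2 /
  -- (j + 1)`.
  set τ : ℕ → ℕ → X → ℝ := fun j i x => max 0 (min 1 (2 - (j + 1) * dist x (z i))) with hτ
  have hτ0 : ∀ j i x, 0 ≤ τ j i x := fun j i x => le_max_left _ _
  have hτ1 : ∀ j i x, τ j i x ≤ 1 := fun j i x => max_le zero_le_one (min_le_left _ _)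
  have hτc : ∀ j i, Continuous (τ j i) := fun j i => by simp only [hτ]; fun_prop
  have hτs : ∀ j i x, τ j i x ≠ 0 → dist x (z i) ≤ 2 / (j + 1) := fun j i x h => by
    by_contra h'
    rw [not_le, div_lt_iff₀ (by positivity)] at h'
    exact h (max_eq_left ((min_le_right _ _).trans (by linarith)))
  have hprod0 : ∀ j i x, 0 ≤ ∏ k ∈ Finset.range i, (1 - τ j k x) := fun j i x =>
    Finset.prod_nonneg fun k _ => sub_nonneg.2 (hτ1 j k x)
  -- The `i`-th cell takes the share of `τ j i` left over by the earlier bumps; the sums telescope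
  -- to `1 - ∏ (1 - τ)`.
  set c : ℕ → ℕ → X → ℝ := fun j i x => τ j i x * ∏ k ∈ Finset.range i, (1 - τ j k x) with hc
  have hsum : ∀ j I x, ∑ i ∈ Finset.range I, c j i x = 1 - ∏ k ∈ Finset.range I, (1 - τ j k x) := by
    intro j I x
    induction I with
    | zero => simp
    | succ I ih =>
      rw [Finset.sum_range_succ, ih, Finset.prod_range_succ, hc]
      ring
  have hcs : ∀ j i x, c j i x ≠ 0 → dist x (z i) ≤ 2 / (j + 1) := fun j i x h =>
    hτs j i x (left_ne_zero_of_mul h)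
  set A : ℕ → ℕ → Set X := fun j I => {x | ∀ k < I, τ j k x ≠ 1} with hA
  have hAm : ∀ j I, MeasurableSet (A j I) := fun j I => by
    have : A j I = ⋂ (k : ℕ) (_ : k < I), {x | τ j k x ≠ 1} := by ext x; simp [hA]
    rw [this]
    refine MeasurableSet.iInter fun k => MeasurableSet.iInter fun _ => ?_
    exact (measurableSet_eq_fun (hτc j k).measurable measurable_const).compl
  -- The set where none of the first `I` bumps equals `1` decreases to the empty set. Finitely many
  -- bumps leave mass at most `2⁻ʲ` uncovered, for a finite measure with the same null sets.
  have hAI : ∀ j, ∃ I, m.toFinite (A j I) ≤ (1 / 2 : ℝ≥0∞) ^ j := fun j => by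
    have h1 : Tendsto (m.toFinite ∘ A j) atTop (𝓝 (m.toFinite (⋂ I, A j I))) :=
      tendsto_measure_iInter_atTop (fun I => (hAm j I).nullMeasurableSet)
        (fun I I' hI x hx k hk => hx k (lt_of_lt_of_le hk hI)) ⟨0, measure_ne_top _ _⟩
    have h2 : ⋂ I, A j I = ∅ := by
      refine eq_empty_of_forall_notMem fun x hx => ?_
      obtain ⟨k, hk⟩ := (TopologicalSpace.denseRange_denseSeq X).exists_dist_lt x
        (ε := 1 / (j + 1)) (by positivity)
      refine mem_iInter.1 hx (k + 1) k (Nat.lt_succ_self k) ?_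
      rw [lt_div_iff₀ (by positivity)] at hk
      change max 0 (min 1 (2 - ((j : ℝ) + 1) * dist x (z k))) = 1
      rw [min_eq_left (by linarith), max_eq_right zero_le_one]
    rw [h2, measure_empty] at h1
    exact ((h1.eventually (eventually_le_nhds (by
      exact ENNReal.pow_pos (by simp) j))).exists)
  choose I hI using hAI
  refine ⟨I, c, fun j i => ?_, fun j i => ?_, fun j i x => mul_nonneg (hτ0 j i x) (hprod0 j i x),
    fun j x => ?_, fun j i x y hx hy => ?_, ?_⟩
  · exact (hτc j i).mul (continuous_finsetProd _ fun k _ => continuous_const.sub (hτc j k))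
  · exact (Metric.isBounded_closedBall (x := z i) (r := 2 / (j + 1))).subset fun x hx => hcs j i x hx
  · rw [hsum]
    linarith [hprod0 j (I j) x]
  · have h1 := hcs j i x hx
    have h2 := hcs j i y hy
    have h3 : (4 : ℝ) / (j + 1) = 2 / (j + 1) + 2 / (j + 1) := by ring
    linarith [dist_triangle_right x y (z i)]
  -- Borel–Cantelli: almost every point is covered at all but finitely many scales.
  · have h1 : ∑' j, m.toFinite (A j (I j)) ≠ ∞ := by
      refine ne_top_of_le_ne_top ?_ (ENNReal.tsum_le_tsum hI)
      rw [ENNReal.tsum_geometric]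
      simp
    have h2 := ae_eventually_notMem h1
    filter_upwards [(absolutelyContinuous_toFinite m).ae_le h2] with x hx
    filter_upwards [hx] with j hj
    simp only [hA, mem_ofPred_eq, not_forall, not_not] at hj
    obtain ⟨k, hk, hk1⟩ := hj
    rw [hsum, Finset.prod_eq_zero (Finset.mem_range.2 hk) (by rw [hk1, sub_self]), sub_zero]

theorem abs_integral_mul_sub_le {μ : Measure X} {c g : X → ℝ} (hc : ∀ x, 0 ≤ c x)
    (hci : Integrable c μ) (hgi : Integrable (fun x => g x * c x) μ) {a ε : ℝ}
    (h : ∀ x, c x ≠ 0 → |g x - a| ≤ ε) : |∫ x, g x * c x ∂μ - a * ∫ x, c x ∂μ| ≤ ε * ∫ x, c x ∂μ := by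
  rw [← integral_const_mul, ← integral_sub hgi (hci.const_mul a), ← integral_const_mul,
    ← Real.norm_eq_abs]
  refine norm_integral_le_of_norm_le (hci.const_mul ε) (Eventually.of_forall fun x => ?_)
  rw [← sub_mul, norm_mul, Real.norm_eq_abs, Real.norm_eq_abs, abs_of_nonneg (hc x)]
  rcases eq_or_ne (c x) 0 with h0 | h0
  · simp [h0]
  · exact mul_le_mul_of_nonneg_right (h x h0) (hc x)

set_option maxHeartbeats 1000000 in
/-- Bounded densities for `m` are weak limits of bounded densities for `mn n`. -/
theorem exists_recovery [TopologicalSpace.SeparableSpace X] {mn : ℕ → Measure X} {m : Measure X}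
    [∀ n, BoundedlyFinite (mn n)] [BoundedlyFinite m] (hm : WeakConv mn m) {T : ℝ} (hT : 0 < T)
    {C : ℝ} {w : ℝ → X → ℝ} (hw : Measurable (Function.uncurry w))
    (hwC : ∀ t x, 0 ≤ w t x ∧ w t x ≤ C)
    (hprob : ∀ t ∈ Ioo 0 T, IsProbabilityMeasure (densMeasure m (w t))) :
    ∃ (u : ℕ → ℝ → X → ℝ) (C' : ℝ), (∀ n, Measurable (Function.uncurry (u n))) ∧
      (∀ n t x, 0 ≤ u n t x ∧ u n t x ≤ C') ∧
      (∀ᶠ n in atTop, ∀ t ∈ Ioo 0 T, IsProbabilityMeasure (densMeasure (mn n) (u n t))) ∧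
      ∀ t ∈ Ioo 0 T, WeakConv (fun n => densMeasure (mn n) (u n t)) (densMeasure m (w t)) := by
  have hwm : ∀ t, Measurable (w t) := fun t => hw.comp measurable_prodMk_left
  have hwi : ∀ t ∈ Ioo 0 T, Integrable (w t) m := fun t ht =>
    integrable_of_isProbabilityMeasure_dens (hwm t) (fun x => (hwC t x).1) (hprob t ht)
  have hw1 : ∀ t ∈ Ioo 0 T, ∫ x, w t x ∂m = 1 := fun t ht =>
    integral_of_isProbabilityMeasure_dens (hwm t) (fun x => (hwC t x).1) (hprob t ht)
  have hT2 : T / 2 ∈ Ioo 0 T := ⟨by linarith, by linarith⟩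
  have hm0 : m ≠ 0 := fun h => by
    have := hw1 _ hT2
    rw [h] at this
    simp at this
  have hne : Nonempty X := by
    by_contra h
    rw [not_nonempty_iff] at h
    exact hm0 (Measure.eq_zero_of_isEmpty m)
  obtain ⟨x₀⟩ := id hne
  have hC0 : 0 ≤ C := (hwC 0 x₀).1.trans (hwC 0 x₀).2
  obtain ⟨I, c, hcc, hcs, hc0, hc1, hcd, hcae⟩ := exists_cells m
  -- This cutoff, of positive mass, will carry the mass that the cells miss.
  have hη : ∃ R : ℝ, 0 < ∫ x, (cutoff x₀ R).1 x ∂m := by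
    by_contra! h
    refine hm0 (Measure.measure_univ_eq_zero.1 ?_)
    rw [← Metric.iUnion_ball_nat x₀, measure_iUnion_null_iff]
    intro R
    have h1 : ∫ x, (cutoff x₀ R).1 x ∂m = 0 :=
      le_antisymm (h R) (integral_nonneg (cutoff_nonneg x₀ R))
    rw [integral_eq_zero_iff_of_nonneg (cutoff_nonneg x₀ R)
      (integrable_of_isBounded_support (continuous_lipB _).measurable.aestronglyMeasurable
        (abs_cutoff_le_one x₀ R) (bddSupport_cutoff x₀ R))] at h1
    refine measure_mono_null (fun x hx => ?_) (ae_iff.1 h1)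
    rw [mem_ofPred_eq, cutoff_eq_one (Metric.mem_ball.1 hx).le]
    exact one_ne_zero
  obtain ⟨R, hR⟩ := hη
  set η : X → ℝ := (cutoff x₀ R).1 with hηdef
  have hηc : Continuous η := continuous_lipB _
  have hηs : BddSupport η := bddSupport_cutoff x₀ R
  have hc1' : ∀ j, ∀ i ∈ Finset.range (I j), ∀ x, c j i x ≤ 1 := fun j i hi x =>
    (Finset.single_le_sum (fun k _ => hc0 j k x) hi).trans (hc1 j x)
  have hci : ∀ (μ : Measure X) [BoundedlyFinite μ], ∀ j, ∀ i ∈ Finset.range (I j),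
      Integrable (c j i) μ := fun μ _ j i hi =>
    integrable_of_isBounded_support (hcc j i).measurable.aestronglyMeasurable (B := 1)
      (fun x => by rw [abs_of_nonneg (hc0 j i x)]; exact hc1' j i hi x) (hcs j i)
  have hηi : ∀ (μ : Measure X) [BoundedlyFinite μ], Integrable η μ := fun μ _ =>
    integrable_of_isBounded_support hηc.measurable.aestronglyMeasurable (B := 1)
      (abs_cutoff_le_one x₀ R) hηs
  -- The factor `2` allows for the error in weak convergence. When the limit integral is zero the
  -- inequality is trivial.
  have hconv : ∀ g : X → ℝ, Continuous g → BddSupport g → (∀ x, 0 ≤ g x) → (∀ x, g x ≤ 1) →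
      ∀ᶠ n in atTop, ∫ x, g x ∂m ≤ 2 * ∫ x, g x ∂(mn n) := by
    intro g hg hgs hg0 hg1
    have h1 := hm (BoundedContinuousFunction.ofNormedAddCommGroup g hg 1 fun x => by
      rw [Real.norm_eq_abs, abs_of_nonneg (hg0 x)]; exact hg1 x) hgs
    simp only [BoundedContinuousFunction.coe_ofNormedAddCommGroup] at h1
    have h2 : 0 ≤ ∫ x, g x ∂m := integral_nonneg hg0
    rcases h2.eq_or_lt with h3 | h3
    · refine Eventually.of_forall fun n => ?_
      rw [← h3]
      exact mul_nonneg two_pos.le (integral_nonneg hg0)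
    · filter_upwards [(tendsto_order.1 h1).1 ((∫ x, g x ∂m) / 2) (by linarith)] with n hn
      linarith
  -- Diagonal choice of the scale: at scale `J n` the comparison holds for all of the finitely many
  -- cells at once.
  obtain ⟨J, hJ, hJev⟩ := exists_tendsto_atTop_eventually
    (P := fun j n => ∀ i ∈ Finset.range (I j), ∫ x, c j i x ∂m ≤ 2 * ∫ x, c j i x ∂(mn n))
    (fun j => (Finset.eventually_all _).2 fun i hi =>
      hconv (c j i) (hcc j i) (hcs j i) (hc0 j i) (hc1' j i hi))
  set e := ∫ x, η x ∂m with he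
  set p : ℕ → ℕ → ℝ → ℝ := fun j i t => ∫ x, c j i x * w t x ∂m with hp
  have hpm : ∀ j i, Measurable (p j i) := fun j i => by
    refine (StronglyMeasurable.integral_prod_right (f := fun t x => c j i x * w t x)
      (Measurable.stronglyMeasurable ?_)).measurable
    exact ((hcc j i).measurable.comp measurable_snd).mul hw
  -- The term `2C` bounds the cell averages through the comparison with factor `2`. The term `2 / e`
  -- bounds the leftover mass, at most `1`, divided by the mass of `η` for `mn n`, at least `e / 2`.
  set C' : ℝ := 2 * C + 2 / e with hC'
  have hC'0 : 0 ≤ C' := by positivity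
  -- Each cell keeps its mass under `w t m`, spread in proportion to the cell function with respect
  -- to `mn n`; the remaining mass goes to `η`.
  set u₀ : ℕ → ℝ → X → ℝ := fun n t x =>
    ∑ i ∈ Finset.range (I (J n)), p (J n) i t / (∫ y, c (J n) i y ∂(mn n)) * c (J n) i x +
      (1 - ∑ i ∈ Finset.range (I (J n)), p (J n) i t) / (∫ y, η y ∂(mn n)) * η x with hu₀
  have hu₀m : ∀ n, Measurable (Function.uncurry (u₀ n)) := fun n => by
    refine Measurable.add (Finset.measurable_fun_sum _ fun i _ => ?_) ?_
    · exact (((hpm _ i).comp measurable_fst).div_const _).mul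
        ((hcc _ i).measurable.comp measurable_snd)
    · exact ((measurable_const.sub (Finset.measurable_fun_sum _ fun i _ =>
        (hpm _ i).comp measurable_fst)).div_const _).mul (hηc.measurable.comp measurable_snd)
  have hp0 : ∀ j i t, 0 ≤ p j i t := fun j i t =>
    integral_nonneg fun x => mul_nonneg (hc0 j i x) (hwC t x).1
  have hcw : ∀ j, ∀ i ∈ Finset.range (I j), ∀ t ∈ Ioo 0 T,
      Integrable (fun x => c j i x * w t x) m := fun j i hi t ht =>
    (hwi t ht).bdd_mul (c := 1) (hcc j i).measurable.aestronglyMeasurable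
      (Eventually.of_forall fun x => by
        rw [Real.norm_eq_abs, abs_of_nonneg (hc0 j i x)]; exact hc1' j i hi x)
  have hsumcw : ∀ j, ∀ t ∈ Ioo 0 T, 1 - ∑ i ∈ Finset.range (I j), p j i t =
      ∫ x, (1 - ∑ i ∈ Finset.range (I j), c j i x) * w t x ∂m := fun j t ht => by
    simp only [sub_mul, one_mul, Finset.sum_mul, hp]
    rw [integral_sub (hwi t ht) (integrable_finsetSum _ fun i hi => hcw j i hi t ht),
      integral_finsetSum _ fun i hi => hcw j i hi t ht, hw1 t ht]
  have hl0 : ∀ j, ∀ t ∈ Ioo 0 T, 0 ≤ 1 - ∑ i ∈ Finset.range (I j), p j i t := fun j t ht => by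
    rw [hsumcw j t ht]
    exact integral_nonneg fun x => mul_nonneg (sub_nonneg.2 (hc1 j x)) (hwC t x).1
  have hpC : ∀ j, ∀ i ∈ Finset.range (I j), ∀ t, p j i t ≤ C * ∫ x, c j i x ∂m := by
    intro j i hi t
    rw [← integral_const_mul]
    refine integral_mono_of_nonneg (Eventually.of_forall fun x =>
      mul_nonneg (hc0 j i x) (hwC t x).1) ((hci m j i hi).const_mul C)
      (Eventually.of_forall fun x => ?_)
    simp only
    rw [mul_comm]
    exact mul_le_mul_of_nonneg_right (hwC t x).2 (hc0 j i x)
  have hηev := hconv η hηc hηs (cutoff_nonneg x₀ R) (cutoff_le_one x₀ R)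
  have hgood : ∀ᶠ n in atTop, ∀ t ∈ Ioo 0 T, (∀ x, 0 ≤ u₀ n t x ∧ u₀ n t x ≤ C') ∧
      (∀ i ∈ Finset.range (I (J n)), p (J n) i t / (∫ y, c (J n) i y ∂(mn n)) *
        ∫ y, c (J n) i y ∂(mn n) = p (J n) i t) ∧
      0 < ∫ y, η y ∂(mn n) := by
    filter_upwards [hJev, hηev] with n hn hn' t ht
    have hηn : 0 < ∫ y, η y ∂(mn n) := by
      have : 0 < 2 * ∫ y, η y ∂(mn n) := lt_of_lt_of_le hR hn'
      linarith
    have han : ∀ i, 0 ≤ ∫ y, c (J n) i y ∂(mn n) := fun i => integral_nonneg (hc0 _ i)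
    refine ⟨fun x => ⟨?_, ?_⟩, fun i hi => ?_, hηn⟩
    · refine add_nonneg (Finset.sum_nonneg fun i _ => ?_) ?_
      · exact mul_nonneg (div_nonneg (hp0 _ i t) (han i)) (hc0 _ i x)
      · exact mul_nonneg (div_nonneg (hl0 _ t ht) hηn.le) (cutoff_nonneg x₀ R x)
    · refine add_le_add ?_ ?_
      · calc _ ≤ ∑ i ∈ Finset.range (I (J n)), (2 * C) * c (J n) i x := by
              refine Finset.sum_le_sum fun i hi => mul_le_mul_of_nonneg_right ?_ (hc0 _ i x)
              refine div_le_of_le_mul₀ (han i) (by positivity) ?_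
              calc _ ≤ C * ∫ x, c (J n) i x ∂m := hpC _ i hi t
                _ ≤ C * (2 * ∫ x, c (J n) i x ∂(mn n)) :=
                  mul_le_mul_of_nonneg_left (hn i hi) hC0
                _ = _ := by ring
          _ ≤ 2 * C * 1 := by
              rw [← Finset.mul_sum]
              exact mul_le_mul_of_nonneg_left (hc1 _ x) (by positivity)
          _ = _ := mul_one _
      · have h1 : (1 - ∑ i ∈ Finset.range (I (J n)), p (J n) i t) / (∫ y, η y ∂(mn n)) ≤ 2 / e := by
          rw [div_le_div_iff₀ hηn hR]
          have h2 := Finset.sum_nonneg fun i (_ : i ∈ Finset.range (I (J n))) => hp0 (J n) i t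
          nlinarith
        have h3 := cutoff_nonneg x₀ R x
        have h4 := cutoff_le_one x₀ R x
        have h5 := div_nonneg (hl0 (J n) t ht) hηn.le
        calc _ ≤ (1 - ∑ i ∈ Finset.range (I (J n)), p (J n) i t) / (∫ y, η y ∂(mn n)) * 1 :=
              mul_le_mul_of_nonneg_left h4 h5
          _ ≤ _ := by rw [mul_one]; exact h1
    -- If the cell has no mass for `mn n`, the comparison forces `p` to vanish too, so the
    -- convention for division by zero does no harm.
    · rcases (han i).eq_or_lt with h0 | h0
      · have h1 := hn i hi
        rw [← h0, mul_zero] at h1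
        have h2 := hpC (J n) i hi t
        have h3 : p (J n) i t = 0 := le_antisymm (h2.trans
          (mul_nonpos_of_nonneg_of_nonpos hC0 h1)) (hp0 _ _ _)
        rw [h3]
        simp
      · exact div_mul_cancel₀ _ h0.ne'
  -- The bounds on `u₀` hold only for large `n` and for `t` in `(0,T)`. Clamping makes them hold
  -- always and changes nothing in that range.
  set u : ℕ → ℝ → X → ℝ := fun n t x => max 0 (min C' (u₀ n t x)) with hu
  have hum : ∀ n, Measurable (Function.uncurry (u n)) := fun n =>
    measurable_const.max (measurable_const.min (hu₀m n))
  have hub : ∀ n t x, 0 ≤ u n t x ∧ u n t x ≤ C' := fun n t x =>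
    ⟨le_max_left _ _, max_le hC'0 (min_le_left _ _)⟩
  have hint : ∀ n t (g : X → ℝ), Measurable g → (∃ B, ∀ x, |g x| ≤ B) →
      ∫ x, g x * u₀ n t x ∂(mn n) = ∑ i ∈ Finset.range (I (J n)),
        p (J n) i t / (∫ y, c (J n) i y ∂(mn n)) * (∫ x, g x * c (J n) i x ∂(mn n)) +
        (1 - ∑ i ∈ Finset.range (I (J n)), p (J n) i t) / (∫ y, η y ∂(mn n)) *
          ∫ x, g x * η x ∂(mn n) := by
    intro n t g hg ⟨B, hB⟩
    have h1 : ∀ i ∈ Finset.range (I (J n)), Integrable (fun x => g x * c (J n) i x) (mn n) :=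
      fun i hi => (hci (mn n) _ i hi).bdd_mul (c := B) hg.aestronglyMeasurable
        (Eventually.of_forall hB)
    have h2 : Integrable (fun x => g x * η x) (mn n) :=
      (hηi (mn n)).bdd_mul (c := B) hg.aestronglyMeasurable (Eventually.of_forall hB)
    have h3 : ∀ x, g x * u₀ n t x = ∑ i ∈ Finset.range (I (J n)),
        p (J n) i t / (∫ y, c (J n) i y ∂(mn n)) * (g x * c (J n) i x) +
        (1 - ∑ i ∈ Finset.range (I (J n)), p (J n) i t) / (∫ y, η y ∂(mn n)) * (g x * η x) :=
      fun x => by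
        simp only [hu₀, mul_add, Finset.mul_sum]
        congr 1
        · exact Finset.sum_congr rfl fun i _ => mul_left_comm _ _ _
        · exact mul_left_comm _ _ _
    simp only [h3]
    rw [integral_add (integrable_finsetSum _ fun i hi => (h1 i hi).const_mul _) (h2.const_mul _),
      integral_finsetSum _ fun i hi => (h1 i hi).const_mul _, integral_const_mul]
    simp only [integral_const_mul]
  have huint : ∀ n t, Integrable (u₀ n t) (mn n) := fun n t => by
    refine Integrable.add (integrable_finsetSum _ fun i hi => (hci (mn n) _ i hi).const_mul _)
      ((hηi (mn n)).const_mul _)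
  have huprob : ∀ᶠ n in atTop, ∀ t ∈ Ioo 0 T,
      IsProbabilityMeasure (densMeasure (mn n) (u n t)) := by
    filter_upwards [hgood] with n hn t ht
    obtain ⟨h1, h2, h3⟩ := hn t ht
    have h4 : u n t = u₀ n t := by
      ext x
      simp only [hu]
      rw [min_eq_right (h1 x).2, max_eq_right (h1 x).1]
    rw [h4]
    refine isProbabilityMeasure_dens (huint n t) (fun x => (h1 x).1) ?_
    have h5 := hint n t (fun _ => 1) measurable_const ⟨1, fun x => by simp⟩
    simp only [one_mul] at h5
    rw [h5, div_mul_cancel₀ _ h3.ne', Finset.sum_congr rfl h2]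
    ring
  refine ⟨u, C', hum, hub, huprob, fun t ht g _ => ?_⟩
  have := hprob t ht
  refine tendsto_integral_of_forall_lipschitz (huprob.mono fun n hn => hn t ht) (fun g => ?_) g
  obtain ⟨⟨L, hL⟩, B, hB⟩ := g.2
  have hB0 : 0 ≤ B := (abs_nonneg _).trans (hB x₀)
  have hgm := (continuous_lipB g).measurable
  simp only [integral_densMeasure (hwm t) (fun x => (hwC t x).1),
    fun n => integral_densMeasure (m := mn n) (v := u n t) ((hum n).comp measurable_prodMk_left)
      (fun x => (hub n t x).1) g.1]
  have hleft : Tendsto (fun j => 1 - ∑ i ∈ Finset.range (I j), p j i t) atTop (𝓝 0) := by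
    simp only [hsumcw _ t ht]
    have h1 : ∫ x, (0 : ℝ) ∂m = 0 := by simp
    rw [← h1]
    refine tendsto_integral_of_dominated_convergence (w t) (fun j => ?_) (hwi t ht)
      (fun j => Eventually.of_forall fun x => ?_) ?_
    · exact ((measurable_const.sub (Finset.measurable_fun_sum _ fun i _ =>
        (hcc j i).measurable)).mul (hwm t)).aestronglyMeasurable
    · rw [Real.norm_eq_abs, abs_of_nonneg (mul_nonneg (sub_nonneg.2 (hc1 j x)) (hwC t x).1)]
      refine mul_le_of_le_one_left (hwC t x).1 ?_
      linarith [Finset.sum_nonneg fun i (_ : i ∈ Finset.range (I j)) => hc0 j i x]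
    · filter_upwards [hcae] with x hx
      refine tendsto_const_nhds.congr' ?_
      filter_upwards [hx] with j hj
      rw [hj, sub_self, zero_mul]
  -- The first term is the oscillation of a Lipschitz function on cells of diameter `4 / (j + 1)`,
  -- the second the leftover mass; each counts once for `mn n` and once for `m`.
  have hbound : Tendsto (fun n => 2 * (L * (4 / ((J n : ℝ) + 1))) +
      2 * B * (1 - ∑ i ∈ Finset.range (I (J n)), p (J n) i t)) atTop (𝓝 0) := by
    have h1 : Tendsto (fun j : ℕ => (4 : ℝ) / ((j : ℝ) + 1)) atTop (𝓝 0) :=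
      tendsto_const_nhds.div_atTop (tendsto_atTop_add_const_right _ _ tendsto_natCast_atTop_atTop)
    have h2 := ((h1.comp hJ).const_mul (L : ℝ)).const_mul 2
    have h3 := (hleft.comp hJ).const_mul (2 * B)
    simpa using h2.add h3
  rw [tendsto_iff_dist_tendsto_zero]
  refine squeeze_zero' (Eventually.of_forall fun _ => dist_nonneg) ?_ hbound
  filter_upwards [hgood] with n hn
  obtain ⟨h1, h2, h3⟩ := hn t ht
  have h4 : u n t = u₀ n t := by
    ext x
    simp only [hu]
    rw [min_eq_right (h1 x).2, max_eq_right (h1 x).1]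
  set j := J n with hj
  have hgw : ∀ i ∈ Finset.range (I j), Integrable (fun x => g.1 x * (c j i x * w t x)) m :=
    fun i hi => (hcw j i hi t ht).bdd_mul (c := B) hgm.aestronglyMeasurable
      (Eventually.of_forall hB)
  have hsplit : ∫ x, g.1 x * w t x ∂m = ∑ i ∈ Finset.range (I j),
      (∫ x, g.1 x * (c j i x * w t x) ∂m) +
      ∫ x, g.1 x * ((1 - ∑ i ∈ Finset.range (I j), c j i x) * w t x) ∂m := by
    rw [← integral_finsetSum _ hgw, ← integral_add (integrable_finsetSum _ hgw)]
    · refine integral_congr_ae (Eventually.of_forall fun x => ?_)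
      simp only
      rw [← Finset.mul_sum, ← Finset.sum_mul]
      ring
    · refine Integrable.bdd_mul (c := B) ?_ hgm.aestronglyMeasurable (Eventually.of_forall hB)
      simp only [sub_mul, one_mul, Finset.sum_mul]
      exact (hwi t ht).sub (integrable_finsetSum _ fun i hi => hcw j i hi t ht)
  -- With a reference value `a` of `g` on the cell, both integrals are within the oscillation times
  -- `p` of `a p`.
  have hcell : ∀ i ∈ Finset.range (I j), |p j i t / (∫ y, c j i y ∂(mn n)) *
      (∫ x, g.1 x * c j i x ∂(mn n)) - ∫ x, g.1 x * (c j i x * w t x) ∂m| ≤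
      2 * (L * (4 / ((j : ℝ) + 1))) * p j i t := by
    intro i hi
    have hex : ∃ a : ℝ, ∀ x, c j i x ≠ 0 → |g.1 x - a| ≤ L * (4 / ((j : ℝ) + 1)) := by
      by_cases hy : ∃ y, c j i y ≠ 0
      · obtain ⟨y, hy⟩ := hy
        refine ⟨g.1 y, fun x hx => ?_⟩
        rw [← Real.dist_eq]
        exact (hL.dist_le_mul x y).trans (mul_le_mul_of_nonneg_left (hcd j i x y hx hy) L.2)
      · push Not at hy
        exact ⟨0, fun x hx => absurd (hy x) hx⟩
    obtain ⟨a, ha⟩ := hex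
    have e1 := abs_integral_mul_sub_le (hc0 j i) (hci (mn n) j i hi)
      ((hci (mn n) j i hi).bdd_mul (c := B) hgm.aestronglyMeasurable (Eventually.of_forall hB)) ha
    have e2 := abs_integral_mul_sub_le (c := fun x => c j i x * w t x)
      (fun x => mul_nonneg (hc0 j i x) (hwC t x).1) (hcw j i hi t ht) (hgw i hi) (a := a)
      (fun x hx => ha x (left_ne_zero_of_mul hx))
    have hq : 0 ≤ p j i t / ∫ y, c j i y ∂(mn n) :=
      div_nonneg (hp0 j i t) (integral_nonneg (hc0 j i))
    have e3 := mul_le_mul_of_nonneg_left e1 hq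
    rw [← abs_of_nonneg hq, ← abs_mul, abs_of_nonneg hq, mul_sub, mul_left_comm, h2 i hi,
      mul_left_comm (p j i t / _), h2 i hi] at e3
    have e4 := abs_sub_le (p j i t / (∫ y, c j i y ∂(mn n)) * (∫ x, g.1 x * c j i x ∂(mn n)))
      (a * p j i t) (∫ x, g.1 x * (c j i x * w t x) ∂m)
    rw [abs_sub_comm (a * p j i t)] at e4
    have e5 : ∫ x, c j i x * w t x ∂m = p j i t := rfl
    rw [e5] at e2
    linarith
  have hrest1 : |(1 - ∑ i ∈ Finset.range (I j), p j i t) / (∫ y, η y ∂(mn n)) *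
      ∫ x, g.1 x * η x ∂(mn n)| ≤ B * (1 - ∑ i ∈ Finset.range (I j), p j i t) := by
    have e1 := abs_integral_mul_sub_le (a := 0) (cutoff_nonneg x₀ R) (hηi (mn n))
      ((hηi (mn n)).bdd_mul (c := B) hgm.aestronglyMeasurable (Eventually.of_forall hB))
      (ε := B) (fun x _ => by rw [sub_zero]; exact hB x)
    rw [zero_mul, sub_zero] at e1
    rw [abs_mul, abs_of_nonneg (div_nonneg (hl0 j t ht) h3.le)]
    refine (mul_le_mul_of_nonneg_left e1 (div_nonneg (hl0 j t ht) h3.le)).trans_eq ?_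
    rw [mul_left_comm, div_mul_cancel₀ _ h3.ne']
  have hrest2 : |∫ x, g.1 x * ((1 - ∑ i ∈ Finset.range (I j), c j i x) * w t x) ∂m| ≤
      B * (1 - ∑ i ∈ Finset.range (I j), p j i t) := by
    have hi : Integrable (fun x => (1 - ∑ i ∈ Finset.range (I j), c j i x) * w t x) m := by
      simp only [sub_mul, one_mul, Finset.sum_mul]
      exact (hwi t ht).sub (integrable_finsetSum _ fun i hi => hcw j i hi t ht)
    have e1 := abs_integral_mul_sub_le (a := 0)
      (fun x => mul_nonneg (sub_nonneg.2 (hc1 j x)) (hwC t x).1) hi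
      (hi.bdd_mul (c := B) hgm.aestronglyMeasurable (Eventually.of_forall hB))
      (ε := B) (fun x _ => by rw [sub_zero]; exact hB x)
    rw [zero_mul, sub_zero, ← hsumcw j t ht] at e1
    exact e1
  rw [h4, Real.dist_eq, hint n t g.1 hgm ⟨B, hB⟩, hsplit, add_sub_add_comm,
    ← Finset.sum_sub_distrib]
  refine (abs_add_le _ _).trans (add_le_add ?_ ?_)
  · refine (Finset.abs_sum_le_sum_abs _ _).trans ((Finset.sum_le_sum hcell).trans ?_)
    rw [← Finset.mul_sum]
    refine mul_le_of_le_one_right (by positivity) ?_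
    linarith [hl0 j t ht]
  · refine (abs_sub _ _).trans ((add_le_add hrest1 hrest2).trans_eq ?_)
    ring

open Classical in
/-- Strong convergence passes to subsequences. -/
theorem StrongConv.comp [TopologicalSpace.SeparableSpace X] {mn : ℕ → Measure X} {m : Measure X}
    [∀ n, BoundedlyFinite (mn n)] [BoundedlyFinite m] (hm : WeakConv mn m) {T : ℝ} (hT : 0 < T)
    {bn : ∀ n, TimeDerivation T (mn n)} {b : TimeDerivation T m} {D : Set (LipB X)}
    (h : StrongConv bn b D) {φ : ℕ → ℕ} (hφ : StrictMono φ) :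
    StrongConv (fun n => bn (φ n)) b D := by
  intro f hf C v w hv hw hvC hwC hvp hwp hvw
  obtain ⟨u, C', hum, huC, hup, huw⟩ := exists_recovery hm hT hw hwC hwp
  -- The given densities sit at the indices `φ n`, and the recovery sequence fills the others, so
  -- that strong convergence of the full sequence applies.
  set v' : ℕ → ℝ → X → ℝ := fun N => if hN : ∃ n, φ n = N then v hN.choose else u N with hv'
  have hv'φ : ∀ n, v' (φ n) = v n := fun n => by
    have hN : ∃ n', φ n' = φ n := ⟨n, rfl⟩
    simp only [hv', dif_pos hN]
    rw [hφ.injective hN.choose_spec]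
  have hcases : ∀ N, (∃ n, φ n = N) ∨ v' N = u N := fun N => by
    by_cases hN : ∃ n, φ n = N
    · exact Or.inl hN
    · exact Or.inr (by simp only [hv', dif_neg hN])
  -- An eventual property of the merged sequence is checked separately on the range of `φ` and off
  -- it.
  have hev : ∀ P : ℕ → Prop, (∀ᶠ n in atTop, P (φ n)) → (∀ᶠ N in atTop, v' N = u N → P N) →
      ∀ᶠ N in atTop, P N := by
    intro P h1 h2
    obtain ⟨n₀, hn₀⟩ := eventually_atTop.1 h1
    filter_upwards [h2, eventually_ge_atTop (φ n₀)] with N hN hN'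
    rcases hcases N with ⟨n, rfl⟩ | h3
    · exact hn₀ n (hφ.le_iff_le.1 hN')
    · exact hN h3
  have key := h f hf (max C C') v' w (fun N => ?_) hw (fun N t x => ?_)
    (fun t x => ⟨(hwC t x).1, (hwC t x).2.trans (le_max_left _ _)⟩) ?_ hwp fun t ht g hg => ?_
  · refine ⟨key.1, ?_⟩
    have := key.2.comp hφ.tendsto_atTop
    simpa only [Function.comp_def, hv'φ] using this
  · rcases hcases N with ⟨n, rfl⟩ | h3
    · rw [hv'φ]; exact hv n
    · rw [h3]; exact hum N
  · rcases hcases N with ⟨n, rfl⟩ | h3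
    · rw [hv'φ]; exact ⟨(hvC n t x).1, (hvC n t x).2.trans (le_max_left _ _)⟩
    · rw [h3]; exact ⟨(huC N t x).1, (huC N t x).2.trans (le_max_right _ _)⟩
  · refine hev _ ?_ ?_
    · simp only [hv'φ]; exact hvp
    · filter_upwards [hup] with N hN h3
      rw [h3]; exact hN
  · refine tendsto_def.2 fun s hs => hev _ ?_ ?_
    · simp only [hv'φ]
      exact (hvw t ht g hg) hs
    · filter_upwards [(huw t ht g hg) hs] with N hN h3
      rw [h3]; exact hN

end recovery

/-! ### Integrable speed bounds for random curves -/

section speed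

variable {X : Type*} [MetricSpace X] {T : ℝ}

/-- `G` is an integrable bound for the speed of `π`-a.e. curve. -/
structure HasSpeedBound (hT : 0 ≤ T) (π : Measure (Curves T X)) (G : ℝ × Curves T X → ℝ≥0∞) :
    Prop where
  measurable : Measurable G
  lintegral_ne_top : ∫⁻ p, G p ∂((volume.restrict (Ioo 0 T)).prod π) ≠ ∞
  edist_le : ∀ᵐ γ : Curves T X ∂π, ∀ s ∈ Icc 0 T, ∀ t ∈ Icc 0 T, s ≤ t →
    edist (IccExtend hT γ s) (IccExtend hT γ t) ≤ ∫⁻ r in Ioo s t, G (r, γ)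

variable {hT : 0 ≤ T} {π : Measure (Curves T X)} [SFinite π] {G : ℝ × Curves T X → ℝ≥0∞}

theorem HasSpeedBound.ae_lintegral_ne_top (h : HasSpeedBound hT π G) :
    ∀ᵐ γ : Curves T X ∂π, ∫⁻ r in Ioo 0 T, G (r, γ) ≠ ∞ := by
  have h1 := h.lintegral_ne_top
  rw [lintegral_prod_symm' _ h.measurable] at h1
  filter_upwards [ae_lt_top (Measurable.lintegral_prod_left' h.measurable) h1] with γ hγ
  exact hγ.ne

theorem HasSpeedBound.ae_dist_le (h : HasSpeedBound hT π G) :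
    ∀ᵐ γ : Curves T X ∂π, IntegrableOn (fun r => (G (r, γ)).toReal) (Icc 0 T) ∧
      ∀ s ∈ Icc 0 T, ∀ t ∈ Icc 0 T, s ≤ t →
        dist (IccExtend hT γ s) (IccExtend hT γ t) ≤ ∫ r in s..t, (G (r, γ)).toReal := by
  filter_upwards [h.ae_lintegral_ne_top, h.edist_le] with γ h1 h2
  have hm : Measurable fun r => G (r, γ) := h.measurable.comp measurable_prodMk_right
  have hint : IntegrableOn (fun r => (G (r, γ)).toReal) (Ioo 0 T) :=
    integrable_toReal_of_lintegral_ne_top hm.aemeasurable h1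
  have hfin : ∀ᵐ r ∂(volume.restrict (Ioo 0 T)), G (r, γ) < ∞ := ae_lt_top hm h1
  refine ⟨(integrableOn_Icc_iff_integrableOn_Ioo (by simp) (by simp)).2 hint, fun s hs t ht hst => ?_⟩
  have hsub : Ioo s t ⊆ Ioo 0 T := Ioo_subset_Ioo hs.1 ht.2
  have h3 := h2 s hs t ht hst
  rw [edist_dist] at h3
  rw [intervalIntegral.integral_of_le hst, integral_Ioc_eq_integral_Ioo,
    integral_toReal hm.aemeasurable (ae_restrict_of_ae_restrict_of_subset hsub hfin)]
  rwa [← ENNReal.ofReal_le_iff_le_toReal]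
  exact ((lintegral_mono_set hsub).trans_lt (lt_top_iff_ne_top.2 h1)).ne

theorem HasSpeedBound.ae_isAC (h : HasSpeedBound hT π G) : ∀ᵐ γ : Curves T X ∂π, IsAC (fun t => γ t) := by
  filter_upwards [h.ae_dist_le] with γ h1
  refine ⟨_, h1.1, fun r => ENNReal.toReal_nonneg, fun s t hst => ?_⟩
  have h2 := h1.2 s s.2 t t.2 hst
  rwa [IccExtend_val, IccExtend_val] at h2

/-- The condition is measurable in `(r, γ)`, so Fubini reduces it to a.e. time along a.e. fixed
curve, where the increments are bounded by an integral. -/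
theorem HasSpeedBound.ae_abs_deriv_le (h : HasSpeedBound hT π G) {f : X → ℝ} {K : ℝ≥0}
    (hf : LipschitzWith K f) : ∀ᵐ p ∂((volume.restrict (Ioo 0 T)).prod π),
      DifferentiableAt ℝ (fun s => f (IccExtend hT p.2 s)) p.1 ∧
      |deriv (fun s => f (IccExtend hT p.2 s)) p.1| ≤ K * (G p).toReal := by
  have hms : MeasurableSet {p : ℝ × Curves T X |
      DifferentiableAt ℝ (fun s => f (IccExtend hT p.2 s)) p.1 ∧
      |deriv (fun s => f (IccExtend hT p.2 s)) p.1| ≤ K * (G p).toReal} :=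
    (measurableSet_differentiableAt_extend hT hf.continuous).inter
      (measurableSet_le (measurable_deriv_extend hT hf.continuous).abs
        (measurable_const.mul h.measurable.ennreal_toReal))
  rw [Measure.ae_prod_iff_ae_ae hms,
    Measure.ae_ae_comm (p := fun r (γ : Curves T X) => DifferentiableAt ℝ (fun s => f (IccExtend hT γ s)) r ∧
      |deriv (fun s => f (IccExtend hT γ s)) r| ≤ K * (G (r, γ)).toReal) hms]
  filter_upwards [h.ae_dist_le] with γ h1
  refine ae_differentiableAt_deriv_le hT (h1.1.const_mul (K : ℝ)) fun s hs t ht hst => ?_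
  rw [intervalIntegral.integral_const_mul]
  exact (hf.dist_le_mul _ _).trans (mul_le_mul_of_nonneg_left (h1.2 s hs t ht hst) K.2)

theorem HasSpeedBound.integrable (h : HasSpeedBound hT π G) :
    Integrable (fun p => (G p).toReal) ((volume.restrict (Ioo 0 T)).prod π) :=
  integrable_toReal_of_lintegral_ne_top h.measurable.aemeasurable h.lintegral_ne_top

theorem HasSpeedBound.integrable_deriv (h : HasSpeedBound hT π G) {f : X → ℝ} {K : ℝ≥0}
    (hf : LipschitzWith K f) :
    Integrable (fun p : ℝ × Curves T X => deriv (fun s => f (IccExtend hT p.2 s)) p.1)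
      ((volume.restrict (Ioo 0 T)).prod π) := by
  refine (h.integrable.const_mul (K : ℝ)).mono'
    (measurable_deriv_extend hT hf.continuous).aestronglyMeasurable ?_
  filter_upwards [h.ae_abs_deriv_le hf] with p hp
  exact hp.2

end speed

/-! ### A countable family of test functions recovering the distance -/

section distances

variable (X : Type*) [MetricSpace X] [TopologicalSpace.SeparableSpace X] [Nonempty X]

/-- A countable family of `1`-Lipschitz functions with bounded support that determine the
distance. -/
noncomputable def distFun (i : ℕ) : LipB X :=
  ⟨fun y => max 0 (min (i.unpair.2 : ℝ)
    (i.unpair.2 - dist y (TopologicalSpace.denseSeq X i.unpair.1))), by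
    refine ⟨⟨1, lipschitzWith_clamp (LipschitzWith.of_dist_le_mul fun y z => ?_) 0 _⟩,
      i.unpair.2, fun y => ?_⟩
    · rw [Real.dist_eq, sub_sub_sub_cancel_left, NNReal.coe_one, one_mul, dist_comm y z]
      exact abs_dist_sub_le z y _
    · rw [abs_of_nonneg (le_max_left _ _)]
      exact max_le (Nat.cast_nonneg _) (min_le_left _ _)⟩

variable {X}

theorem lipschitzWith_distFun (i : ℕ) : LipschitzWith 1 (distFun X i).1 := by
  refine lipschitzWith_clamp (LipschitzWith.of_dist_le_mul fun y z => ?_) 0 _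
  rw [Real.dist_eq, sub_sub_sub_cancel_left, NNReal.coe_one, one_mul, dist_comm y z]
  exact abs_dist_sub_le z y _

theorem bddSupport_distFun (i : ℕ) : BddSupport (distFun X i).1 := by
  refine (Metric.isBounded_closedBall (x := TopologicalSpace.denseSeq X i.unpair.1)
    (r := i.unpair.2)).subset fun y hy => ?_
  by_contra h
  refine hy (max_eq_left ((min_le_right _ _).trans ?_))
  have := not_le.1 fun h' => h (Metric.mem_closedBall.2 h')
  linarith

/-- Take a dense point `z` within `ε / 2` of `x` and a truncation level so high that it is inactive
at both points. The increment is then `d(y,z) - d(x,z)`, at least `d(x,y) - ε`. -/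
theorem edist_le_iSup_distFun (x y : X) :
    edist x y ≤ ⨆ i, edist ((distFun X i).1 x) ((distFun X i).1 y) := by
  refine ENNReal.le_of_forall_pos_le_add fun ε hε _ => ?_
  obtain ⟨k, hk⟩ := (TopologicalSpace.denseRange_denseSeq X).exists_dist_lt x
    (ε := ε / 2) (by positivity)
  obtain ⟨N, hN⟩ := exists_nat_ge (max (dist x (TopologicalSpace.denseSeq X k))
    (dist y (TopologicalSpace.denseSeq X k)))
  have hval : ∀ z, dist z (TopologicalSpace.denseSeq X k) ≤ N →
      (distFun X (Nat.pair k N)).1 z = N - dist z (TopologicalSpace.denseSeq X k) := by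
    intro z hz
    simp only [distFun, Nat.unpair_pair]
    rw [min_eq_right (by linarith [dist_nonneg (x := z) (y := TopologicalSpace.denseSeq X k)]),
      max_eq_right (by linarith)]
  have h1 : dist x y ≤ dist ((distFun X (Nat.pair k N)).1 x) ((distFun X (Nat.pair k N)).1 y)
      + ε := by
    rw [hval x ((le_max_left _ _).trans hN), hval y ((le_max_right _ _).trans hN), Real.dist_eq,
      sub_sub_sub_cancel_left]
    have h2 := le_abs_self (dist y (TopologicalSpace.denseSeq X k) -
      dist x (TopologicalSpace.denseSeq X k))
    have h3 := dist_triangle_right x y (TopologicalSpace.denseSeq X k)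
    linarith
  calc edist x y = ENNReal.ofReal (dist x y) := edist_dist _ _
    _ ≤ ENNReal.ofReal (dist ((distFun X (Nat.pair k N)).1 x) ((distFun X (Nat.pair k N)).1 y)
      + ε) := ENNReal.ofReal_le_ofReal h1
    _ = edist ((distFun X (Nat.pair k N)).1 x) ((distFun X (Nat.pair k N)).1 y) + ε := by
      rw [ENNReal.ofReal_add dist_nonneg NNReal.zero_le_coe, ← edist_dist,
        ENNReal.ofReal_coe_nnreal]
    _ ≤ _ := add_le_add_left (le_iSup (fun i =>
      edist ((distFun X i).1 x) ((distFun X i).1 y)) (Nat.pair k N)) _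

end distances

/-! ### Derivations evaluated along random curves -/

section genflow

variable {X : Type*} [MetricSpace X] [MeasurableSpace X] [BorelSpace X] {T : ℝ} (hT : 0 ≤ T)
  {m : Measure X}

/-- Properties that hold `m`-a.e. at each time hold along a.e. curve of `π`. -/
theorem ae_extend_of_forall_ae [SecondCountableTopology X] {π : Measure (Curves T X)} [SFinite π]
    (hπ : ∀ t, π.map (fun γ => γ t) ≪ m)
    {p : Set (ℝ × X)} (hp : MeasurableSet p) (h : ∀ r ∈ Ioo 0 T, ∀ᵐ x ∂m, (r, x) ∈ p) :
    ∀ᵐ q ∂((volume.restrict (Ioo 0 T)).prod π), (q.1, IccExtend hT q.2 q.1) ∈ p := by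
  have hms : MeasurableSet {q : ℝ × Curves T X | (q.1, IccExtend hT q.2 q.1) ∈ p} :=
    (measurable_fst.prodMk (continuous_uncurry_extend hT).measurable) hp
  rw [Measure.ae_prod_iff_ae_ae hms, ae_restrict_iff' measurableSet_Ioo]
  refine Eventually.of_forall fun r hr => ?_
  have h1 := (hπ ⟨r, Ioo_subset_Icc_self hr⟩).ae_le (h r hr)
  have h2 : Measurable fun γ : Curves T X => γ ⟨r, Ioo_subset_Icc_self hr⟩ :=
    (continuous_eval_const _).measurable
  filter_upwards [ae_of_ae_map h2.aemeasurable h1] with γ hγ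
  simpa only [IccExtend_of_mem hT _ (Ioo_subset_Icc_self hr)] using hγ

variable [SecondCountableTopology X] [BoundedlyFinite m] {b : TimeDerivation T m}

theorem ae_rep_congr {π : Measure (Curves T X)} [SFinite π]
    (hπ : ∀ t, π.map (fun γ => γ t) ≪ m) {f g : LipB X} {U : Set X}
    (hU : IsOpen U) (hfg : ∀ y ∈ U, f.1 y = g.1 y) :
    ∀ᵐ q ∂((volume.restrict (Ioo 0 T)).prod π), IccExtend hT q.2 q.1 ∈ U →
      b.rep f q.1 (IccExtend hT q.2 q.1) = b.rep g q.1 (IccExtend hT q.2 q.1) := by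
  refine ae_extend_of_forall_ae hT hπ (p := {q | q.2 ∈ U → b.rep f q.1 q.2 = b.rep g q.1 q.2})
    ?_ fun r hr => ?_
  · exact (measurable_snd hU.measurableSet).himp
      (measurableSet_eq_fun (b.measurable_rep f) (b.measurable_rep g))
  · filter_upwards [b.rep_ae f r hr, b.rep_ae g r hr, (b.der r).toLin_congr hU hfg]
      with x h1 h2 h3 hx
    rw [h1, h2, h3 hx]

theorem extend_eventuallyEq_of_mem {f g : X → ℝ} {U : Set X} (hU : IsOpen U)
    (hfg : ∀ y ∈ U, f y = g y) {γ : Curves T X} {r : ℝ} (hr : IccExtend hT γ r ∈ U) :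
    (fun s => f (IccExtend hT γ s)) =ᶠ[𝓝 r] fun s => g (IccExtend hT γ s) := by
  have h1 : Continuous (IccExtend hT γ) := γ.continuous.Icc_extend'
  filter_upwards [h1.continuousAt.preimage_mem_nhds (hU.mem_nhds hr)] with s hs
  exact hfg _ hs

/-- The differential equation holds for all bounded Lipschitz functions. -/
theorem ode_lipB {π : Measure (Curves T X)} [SFinite π] (hπ : ∀ t, π.map (fun γ => γ t) ≪ m)
    (h : ∀ f : LipB X, BddSupport f.1 → ∀ᵐ p ∂((volume.restrict (Ioo 0 T)).prod π),
      HasDerivAt (fun s => f.1 (IccExtend hT p.2 s)) (b.rep f p.1 (IccExtend hT p.2 p.1)) p.1)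
    (f : LipB X) : ∀ᵐ p ∂((volume.restrict (Ioo 0 T)).prod π),
      HasDerivAt (fun s => f.1 (IccExtend hT p.2 s)) (b.rep f p.1 (IccExtend hT p.2 p.1)) p.1 := by
  rcases isEmpty_or_nonempty X with hX | ⟨⟨x⟩⟩
  · exact Eventually.of_forall fun p => (hX.false (IccExtend hT p.2 p.1)).elim
  -- Near a given point of the curve, `f` agrees with a product with bounded support, and both sides
  -- of the equation are local.
  have hfg : ∀ R : ℕ, ∀ y ∈ Metric.ball x R, f.1 y = (lipMul f (cutoff x R)).1 y :=
    fun R y hy => by rw [lipMul_apply, cutoff_eq_one (Metric.mem_ball.1 hy).le, mul_one]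
  have h1 := ae_all_iff.2 fun R : ℕ => h (lipMul f (cutoff x R))
    ((bddSupport_cutoff x R).mul_left f)
  have h2 := ae_all_iff.2 fun R : ℕ => ae_rep_congr hT (b := b) hπ Metric.isOpen_ball
    (hfg R)
  filter_upwards [h1, h2] with p h1 h2
  obtain ⟨R, hR⟩ := exists_nat_gt (dist (IccExtend hT p.2 p.1) x)
  have hmem : IccExtend hT p.2 p.1 ∈ Metric.ball x R := Metric.mem_ball.2 hR
  rw [h2 R hmem]
  exact (h1 R).congr_of_eventuallyEq
    (extend_eventuallyEq_of_mem hT Metric.isOpen_ball (hfg R) hmem)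

/-- By continuity of the curves, countably many conditions at rational times suffice. -/
theorem measurableSet_edist_le {G : ℝ × Curves T X → ℝ≥0∞} (hG : Measurable G) :
    MeasurableSet {γ : Curves T X | ∀ s ∈ Icc 0 T, ∀ t ∈ Icc 0 T, s ≤ t →
      edist (IccExtend hT γ s) (IccExtend hT γ t) ≤ ∫⁻ r in Ioo s t, G (r, γ)} := by
  have h1 : {γ : Curves T X | ∀ s ∈ Icc 0 T, ∀ t ∈ Icc 0 T, s ≤ t →
      edist (IccExtend hT γ s) (IccExtend hT γ t) ≤ ∫⁻ r in Ioo s t, G (r, γ)} =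
      ⋂ (p : ℚ) (q : ℚ), {γ : Curves T X | (p : ℝ) ∈ Icc 0 T → (q : ℝ) ∈ Icc 0 T → (p : ℝ) ≤ q →
        edist (IccExtend hT γ p) (IccExtend hT γ q) ≤ ∫⁻ r in Ioo (p : ℝ) q, G (r, γ)} := by
    ext γ
    simp only [mem_iInter, mem_ofPred_eq]
    refine ⟨fun h p q hp hq hpq => h p hp q hq hpq, fun h s hs t ht hst => ?_⟩
    rcases hst.eq_or_lt with rfl | hst
    · simp
    have hc : Continuous (IccExtend hT γ) := γ.continuous.Icc_extend'
    have h2 : ∀ p : ℚ, s < p → ∀ q : ℚ, (p : ℝ) ≤ q → (q : ℝ) < t →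
        edist (IccExtend hT γ p) (IccExtend hT γ q) ≤ ∫⁻ r in Ioo s t, G (r, γ) := by
      intro p hp q hpq hq
      refine (h p q ⟨hs.1.trans hp.le, (hpq.trans hq.le).trans ht.2⟩
        ⟨hs.1.trans (hp.le.trans hpq), hq.le.trans ht.2⟩ hpq).trans ?_
      exact lintegral_mono_set (Ioo_subset_Ioo hp.le hq.le)
    have hcl : IsClosed {x : ℝ × ℝ | edist (IccExtend hT γ x.1) (IccExtend hT γ x.2) ≤
        ∫⁻ r in Ioo s t, G (r, γ)} :=
      isClosed_le ((hc.comp continuous_fst).edist (hc.comp continuous_snd)) continuous_const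
    -- The rational endpoints approach from inside `(s,t)`, so the integral over the smaller
    -- interval is bounded by the one over `(s,t)`.
    obtain ⟨u, -, hu, hulim⟩ := Real.exists_seq_rat_strictAnti_tendsto s
    obtain ⟨v, -, hv, hvlim⟩ := Real.exists_seq_rat_strictMono_tendsto t
    refine hcl.mem_of_tendsto (hulim.prodMk_nhds hvlim) ?_
    filter_upwards [(hulim.eventually_lt hvlim hst)] with n hn
    exact h2 _ (hu n) _ hn.le (hv n)
  rw [h1]
  refine MeasurableSet.iInter fun p => MeasurableSet.iInter fun q => ?_
  by_cases hpq : (p : ℝ) ∈ Icc 0 T ∧ (q : ℝ) ∈ Icc 0 T ∧ (p : ℝ) ≤ q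
  · simp only [hpq.1, hpq.2.1, hpq.2.2, forall_const]
    have hev : ∀ s : ℝ, Measurable fun γ : Curves T X => IccExtend hT γ s := fun s =>
      (continuous_eval_const (projIcc 0 T hT s)).measurable
    exact measurableSet_le ((hev p).edist (hev q)) hG.lintegral_prod_left'
  · have : {γ : Curves T X | (p : ℝ) ∈ Icc 0 T → (q : ℝ) ∈ Icc 0 T → (p : ℝ) ≤ q →
        edist (IccExtend hT γ p) (IccExtend hT γ q) ≤ ∫⁻ r in Ioo (p : ℝ) q, G (r, γ)} = univ :=
      eq_univ_of_forall fun γ hp hq hle => absurd ⟨hp, hq, hle⟩ hpq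
    rw [this]
    exact MeasurableSet.univ

/-- The supremum of `|b_t(f)|` over the functions `f` of a countable family that determines the
distance. It bounds the speed of the curves driven by `b`. -/
noncomputable def TimeDerivation.speed [Nonempty X] (b : TimeDerivation T m) (p : ℝ × X) :
    ℝ≥0∞ := ⨆ i, ‖b.rep (distFun X i) p.1 p.2‖ₑ

theorem TimeDerivation.measurable_speed [Nonempty X] (b : TimeDerivation T m) :
    Measurable b.speed :=
  Measurable.iSup fun i => (b.measurable_rep (distFun X i)).enorm

theorem TimeDerivation.speed_le_norm [Nonempty X] (b : TimeDerivation T m) {r : ℝ}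
    (hr : r ∈ Ioo 0 T) : ∀ᵐ x ∂m, b.speed (r, x) ≤ ENNReal.ofReal ((b.der r).norm x) := by
  have h1 := ae_all_iff.2 fun i => b.rep_ae (distFun X i) r hr
  have h2 := ae_all_iff.2 fun i => (b.der r).abs_toLin_le _ (lipschitzWith_distFun (X := X) i)
  filter_upwards [h1, h2] with x h1 h2
  refine iSup_le fun i => ?_
  rw [h1 i, Real.enorm_eq_ofReal_abs]
  refine ENNReal.ofReal_le_ofReal ((h2 i).trans_eq ?_)
  rw [NNReal.coe_one, mul_one]

theorem TimeDerivation.measurable_speed_extend [Nonempty X] (b : TimeDerivation T m) :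
    Measurable fun p : ℝ × Curves T X => b.speed (p.1, IccExtend hT p.2 p.1) :=
  b.measurable_speed.comp (measurable_fst.prodMk (continuous_uncurry_extend hT).measurable)

/-- Each test function of the family is absolutely continuous along the curve with derivative `b_r`
of it. Its increments are thus bounded by the integral of the supremum, and together they recover
the distance. -/
theorem IsAC.edist_le_lintegral_speed [Nonempty X] {γ : Icc (0 : ℝ) T → X} (h : IsAC γ)
    (hode : ∀ i, ∀ᵐ r ∂(volume.restrict (Ioo 0 T)),
      HasDerivAt (fun s => (distFun X i).1 (IccExtend hT γ s))
        (b.rep (distFun X i) r (IccExtend hT γ r)) r) :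
    ∀ s ∈ Icc 0 T, ∀ t ∈ Icc 0 T, s ≤ t → edist (IccExtend hT γ s) (IccExtend hT γ t) ≤
      ∫⁻ r in Ioo s t, b.speed (r, IccExtend hT γ r) := by
  intro s hs t ht hst
  refine (edist_le_iSup_distFun _ _).trans (iSup_le fun i => ?_)
  have h1 := h.integral_deriv hT (lipschitzWith_distFun (X := X) i) hs ht
  rw [edist_comm, edist_dist, Real.dist_eq, ← h1, ← Real.norm_eq_abs, ofReal_norm,
    intervalIntegral.integral_of_le hst, integral_Ioc_eq_integral_Ioo]
  refine (enorm_integral_le_lintegral_enorm _).trans (lintegral_mono_ae ?_)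
  filter_upwards [ae_restrict_of_ae_restrict_of_subset (Ioo_subset_Ioo hs.1 ht.2) (hode i)]
    with r hr
  rw [hr.deriv]
  exact le_iSup (fun i => ‖b.rep (distFun X i) r (IccExtend hT γ r)‖ₑ) i

/-- The measure on curves given by a regular flow and a bounded density. -/
theorem IsRegularFlow.map_flowMap [Nonempty X] {F : Icc (0 : ℝ) T → X → X}
    (hF : IsRegularFlow hT b F)
    {C : ℝ≥0} (hC : Compresses m F C) {ρ : Measure X} [hρ : IsProbabilityMeasure ρ] {V : ℝ≥0}
    (hV : ρ ≤ V • m) : AEMeasurable (flowMap F) ρ ∧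
      (∀ t, (ρ.map (flowMap F)).map (fun γ => γ t) ≤ (V * C) • m) ∧
      (∀ f : LipB X, BddSupport f.1 →
        ∀ᵐ p ∂((volume.restrict (Ioo 0 T)).prod (ρ.map (flowMap F))),
          HasDerivAt (fun s => f.1 (IccExtend hT p.2 s))
            (b.rep f p.1 (IccExtend hT p.2 p.1)) p.1) ∧
      (ρ.map (flowMap F)).map (fun γ => γ ⟨0, left_mem_Icc.2 hT⟩) = ρ ∧
      ∀ᵐ γ : Curves T X ∂(ρ.map (flowMap F)), ∀ s ∈ Icc 0 T, ∀ t ∈ Icc 0 T, s ≤ t →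
        edist (IccExtend hT γ s) (IccExtend hT γ t) ≤
          ∫⁻ r in Ioo s t, b.speed (r, IccExtend hT γ r) := by
  have hac : ρ ≪ m := Measure.absolutelyContinuous_of_le_smul (c := (V : ℝ≥0∞)) hV
  have hcont : ∀ᵐ x ∂ρ, Continuous fun t => F t x := by
    filter_upwards [hac.ae_le hF.ac] with x hx
    exact hx.1.continuous hT
  have haem : AEMeasurable (flowMap F) ρ := aemeasurable_flowMap hF.measurable hcont
  have hval : ∀ᵐ x ∂ρ, ((flowMap F x : Curves T X) : Icc (0 : ℝ) T → X) = fun t => F t x := by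
    filter_upwards [hcont] with x hx
    ext t
    simp [flowMap, hx]
  have hev : ∀ t, Measurable fun γ : Curves T X => γ t := fun t =>
    (continuous_eval_const t).measurable
  have hFt : ∀ t, Measurable (F t) := fun t => hF.measurable.comp measurable_prodMk_left
  have hmapt : ∀ t, (ρ.map (flowMap F)).map (fun γ => γ t) = ρ.map (F t) := fun t => by
    rw [AEMeasurable.map_map_of_aemeasurable (hev t).aemeasurable haem]
    refine Measure.map_congr ?_
    filter_upwards [hval] with x hx
    exact congrFun hx t
  have hode : ∀ f : LipB X, BddSupport f.1 → ∀ᵐ x ∂ρ, ∀ᵐ r ∂(volume.restrict (Ioo 0 T)),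
      HasDerivAt (fun s => f.1 (IccExtend hT (fun r => F r x) s))
            (b.rep f r (IccExtend hT (fun r => F r x) r)) r := fun f hf => by
    have h3 : ∀ᵐ p ∂(m.prod (volume.restrict (Ioo 0 T))),
        HasDerivAt (fun s => f.1 (IccExtend hT (fun r => F r p.1) s))
          (b.rep f p.2 (IccExtend hT (fun r => F r p.1) p.2)) p.2 :=
      (Measure.measurePreserving_swap).quasiMeasurePreserving.ae (hF.ode f hf)
    exact hac.ae_le (Measure.ae_ae_of_ae_prod h3)
  refine ⟨haem, fun t => ?_, fun f hf => ?_, ?_, ?_⟩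
  · rw [hmapt]
    refine (Measure.map_mono hV (hFt t)).trans ?_
    rw [Measure.map_smul, mul_smul]
    intro s
    exact mul_le_mul_right (hC t s) _
  · have := Measure.isProbabilityMeasure_map haem
    have hms := measurableSet_hasDerivAt_extend hT (continuous_lipB f) (b.measurable_rep f)
    -- The set of good curves must be measurable to transport an a.e. statement along the merely
    -- a.e. measurable map `flowMap F`.
    have hms' : MeasurableSet {γ : Curves T X | ∀ᵐ r ∂(volume.restrict (Ioo 0 T)),
        HasDerivAt (fun s => f.1 (IccExtend hT γ s)) (b.rep f r (IccExtend hT γ r)) r} :=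
      measurable_measure_prodMk_right hms.compl (measurableSet_singleton 0)
    rw [Measure.ae_prod_iff_ae_ae hms, Measure.ae_ae_comm (p := fun r (γ : Curves T X) =>
      HasDerivAt (fun s => f.1 (IccExtend hT γ s)) (b.rep f r (IccExtend hT γ r)) r) hms,
      ae_map_iff haem hms']
    filter_upwards [hode f hf, hval] with x hx hv
    rw [hv]
    exact hx
  · rw [hmapt]
    conv_rhs => rw [← Measure.map_id (μ := ρ)]
    refine Measure.map_congr ?_
    filter_upwards [hac.ae_le hF.ac] with x hx
    exact hx.2
  · rw [ae_map_iff haem (measurableSet_edist_le hT (b.measurable_speed_extend hT))]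
    filter_upwards [hac.ae_le hF.ac, hval, ae_all_iff.2 fun i =>
      hode (distFun X i) (bddSupport_distFun i)] with x h1 hv h2
    rw [hv]
    exact h1.1.edist_le_lintegral_speed hT h2

/-! ### Uniform integrability of the speeds -/

section excess

variable [Nonempty X]

/-- Superlinear integrability of `|b_n|` gives uniform integrability of the speeds. -/
theorem exists_excess_le {mn : ℕ → Measure X} [∀ n, BoundedlyFinite (mn n)]
    {bn : ∀ n, TimeDerivation T (mn n)} {Θ : ℝ≥0 → ℝ≥0∞}
    (hΘ : Tendsto (fun z : ℝ≥0 => Θ z / z) atTop (𝓝 ∞))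
    (hΘb : ⨆ n, ∫⁻ t in Ioo 0 T, ∫⁻ x, Θ (((bn n).der t).norm x).toNNReal ∂(mn n) < ∞)
    {ε : ℝ≥0∞} (hε : ε ≠ 0) : ∃ z : ℝ≥0, ∀ n,
      ∫⁻ t in Ioo 0 T, ∫⁻ x, ((bn n).speed (t, x) - z) ∂(mn n) ≤ ε := by
  set A := ⨆ n, ∫⁻ t in Ioo 0 T, ∫⁻ x, Θ (((bn n).der t).norm x).toNNReal ∂(mn n) with hA
  -- De la Vallée-Poussin: `M` is chosen so that `A / M ≤ ε`, and `z` so that `Θ y ≥ M y` for `y ≥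
  -- z` (with `y ≠ 0`).
  obtain ⟨M, hM0, hM⟩ : ∃ M : ℝ≥0, M ≠ 0 ∧ (M : ℝ≥0∞)⁻¹ * A ≤ ε := by
    have h1 : Tendsto (fun M : ℝ≥0 => (M : ℝ≥0∞)⁻¹ * A) atTop (𝓝 (∞⁻¹ * A)) := by
      refine ENNReal.Tendsto.mul_const ?_ (Or.inr hΘb.ne)
      exact tendsto_inv_iff.2 (ENNReal.tendsto_coe_nhds_top.2 tendsto_id)
    rw [ENNReal.inv_top, zero_mul] at h1
    obtain ⟨M, h2, h3⟩ := ((h1.eventually (eventually_le_nhds (pos_iff_ne_zero.2 hε))).and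
      (eventually_gt_atTop 0)).exists
    exact ⟨M, h3.ne', h2⟩
  obtain ⟨z, hz⟩ := eventually_atTop.1 (hΘ.eventually (eventually_ge_nhds
    (ENNReal.coe_lt_top (r := M))))
  refine ⟨z, fun n => le_trans ?_ hM⟩
  have hM0' : (M : ℝ≥0∞) ≠ 0 := by simpa using hM0
  have hpt : ∀ y : ℝ, ENNReal.ofReal y - z ≤ (M : ℝ≥0∞)⁻¹ * Θ y.toNNReal := fun y => by
    rcases le_total (ENNReal.ofReal y) z with h | h
    · rw [tsub_eq_zero_of_le h]
      exact zero_le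
    · refine tsub_le_self.trans ?_
      have h1 : z ≤ y.toNNReal := ENNReal.coe_le_coe.1 h
      -- The value `0` is treated apart, as the quotient `Θ z / z` says nothing about `Θ` there.
      rcases eq_or_ne y.toNNReal 0 with h0 | h0
      · have : ENNReal.ofReal y = 0 := by rw [ENNReal.ofReal, h0]; rfl
        rw [this]
        exact zero_le
      have h2 := hz _ h1
      rw [ENNReal.le_div_iff_mul_le (Or.inl (by simpa using h0)) (Or.inl (by simp))] at h2
      rw [← ENNReal.div_eq_inv_mul, ENNReal.le_div_iff_mul_le (Or.inl hM0') (Or.inl (by simp)),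
        mul_comm]
      exact h2
  calc ∫⁻ t in Ioo 0 T, ∫⁻ x, ((bn n).speed (t, x) - z) ∂(mn n)
      ≤ ∫⁻ t in Ioo 0 T, (M : ℝ≥0∞)⁻¹ * ∫⁻ x, Θ (((bn n).der t).norm x).toNNReal ∂(mn n) := by
        refine lintegral_mono_ae ?_
        refine (ae_restrict_iff' measurableSet_Ioo).2 (Eventually.of_forall fun t ht => ?_)
        rw [← lintegral_const_mul' _ _ (by simpa using hM0)]
        refine lintegral_mono_ae ?_
        filter_upwards [(bn n).speed_le_norm ht] with x hx
        exact (tsub_le_tsub_right hx _).trans (hpt _)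
    _ = (M : ℝ≥0∞)⁻¹ * ∫⁻ t in Ioo 0 T, ∫⁻ x, Θ (((bn n).der t).norm x).toNNReal ∂(mn n) :=
        lintegral_const_mul' _ _ (by simpa using hM0)
    _ ≤ _ := mul_le_mul_right (le_iSup (fun n => ∫⁻ t in Ioo 0 T,
        ∫⁻ x, Θ (((bn n).der t).norm x).toNNReal ∂(mn n)) n) _

/-- At each time the law of the curve is at most `K m`, so estimates on `X` transfer to the space of
curves. -/
theorem lintegral_speed_sub_le {π : Measure (Curves T X)} [SFinite π] {K : ℝ≥0}
    (hπ : ∀ t, π.map (fun γ => γ t) ≤ K • m) (z : ℝ≥0) :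
    ∫⁻ p, (b.speed (p.1, IccExtend hT p.2 p.1) - z) ∂((volume.restrict (Ioo 0 T)).prod π) ≤
      K * ∫⁻ t in Ioo 0 T, ∫⁻ x, (b.speed (t, x) - z) ∂m := by
  have hms := (b.measurable_speed_extend hT).sub_const (z : ℝ≥0∞)
  rw [lintegral_prod _ hms.aemeasurable, ← lintegral_const_mul' _ _ (by simp)]
  refine lintegral_mono_ae ?_
  refine (ae_restrict_iff' measurableSet_Ioo).2 (Eventually.of_forall fun r hr => ?_)
  have hm1 : Measurable fun x => b.speed (r, x) - z :=
    (b.measurable_speed.comp measurable_prodMk_left).sub_const _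
  have h1 : ∫⁻ γ : Curves T X, (b.speed (r, IccExtend hT γ r) - z) ∂π =
      ∫⁻ x, (b.speed (r, x) - z) ∂(π.map (fun γ => γ ⟨r, Ioo_subset_Icc_self hr⟩)) := by
    rw [lintegral_map hm1 (continuous_eval_const _).measurable]
    simp only [IccExtend_of_mem hT _ (Ioo_subset_Icc_self hr)]
  simp only
  rw [h1]
  refine (lintegral_mono' (hπ _) le_rfl).trans_eq ?_
  rw [lintegral_smul_measure]
  rfl

/-- The speed is at most its excess over `z` plus `z`, and the constant is integrable because
`(0,T)` and `π` are finite. -/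
theorem hasSpeedBound_of_lintegral_speed_sub {π : Measure (Curves T X)} [IsFiniteMeasure π]
    {z : ℝ≥0}
    (h : ∫⁻ p, (b.speed (p.1, IccExtend hT p.2 p.1) - z) ∂((volume.restrict (Ioo 0 T)).prod π) ≠ ∞)
    (hle : ∀ᵐ γ : Curves T X ∂π, ∀ s ∈ Icc 0 T, ∀ t ∈ Icc 0 T, s ≤ t →
        edist (IccExtend hT γ s) (IccExtend hT γ t) ≤
          ∫⁻ r in Ioo s t, b.speed (r, IccExtend hT γ r)) :
    HasSpeedBound hT π fun p => b.speed (p.1, IccExtend hT p.2 p.1) := by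
  refine ⟨b.measurable_speed_extend hT, ?_, hle⟩
  have h1 : ∫⁻ p, b.speed (p.1, IccExtend hT p.2 p.1) ∂((volume.restrict (Ioo 0 T)).prod π) ≤
      ∫⁻ p, ((b.speed (p.1, IccExtend hT p.2 p.1) - z) + z) ∂((volume.restrict (Ioo 0 T)).prod π) :=
    lintegral_mono fun p => le_tsub_add
  refine ne_top_of_le_ne_top ?_ h1
  rw [lintegral_add_right _ measurable_const, lintegral_const]
  exact ENNReal.add_ne_top.2 ⟨h, ENNReal.mul_ne_top (by simp) (measure_ne_top _ _)⟩

end excess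

end genflow

/-! ### Moduli of absolute continuity, compactness and tightness criteria -/

section modulus

variable {X : Type*} [MetricSpace X] {T : ℝ} (hT : 0 ≤ T)

/-- Curves with a quantitative modulus of absolute continuity. -/
def modulusSet (z δ : ℝ≥0) : Set (Curves T X) :=
  {γ | ∀ E ∈ AbsolutelyContinuousOnInterval.disjWithin 0 T,
    ∑ i ∈ Finset.range E.1, dist (IccExtend hT γ (E.2 i).1) (IccExtend hT γ (E.2 i).2) ≤
      z * ∑ i ∈ Finset.range E.1, dist (E.2 i).1 (E.2 i).2 + δ}

/-- Each condition involves finitely many evaluations of the curve. Closedness makes the complement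
open, as the passage to weak limits requires. -/
theorem isClosed_modulusSet (z δ : ℝ≥0) : IsClosed (modulusSet (X := X) hT z δ) := by
  have : modulusSet (X := X) hT z δ = ⋂ E ∈ AbsolutelyContinuousOnInterval.disjWithin 0 T,
      {γ : Curves T X | ∑ i ∈ Finset.range E.1,
        dist (IccExtend hT γ (E.2 i).1) (IccExtend hT γ (E.2 i).2) ≤
      z * ∑ i ∈ Finset.range E.1, dist (E.2 i).1 (E.2 i).2 + δ} := by
    ext γ
    simp [modulusSet]
  rw [this]
  refine isClosed_biInter fun E _ => isClosed_le (continuous_finsetSum _ fun i _ => ?_)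
    continuous_const
  exact (continuous_eval_const (projIcc 0 T hT (E.2 i).1)).dist
    (continuous_eval_const (projIcc 0 T hT (E.2 i).2))

theorem dist_le_of_mem_modulusSet {z δ : ℝ≥0} {γ : Curves T X} (h : γ ∈ modulusSet hT z δ)
    (s t : Icc (0 : ℝ) T) : dist (γ s) (γ t) ≤ z * dist s t + δ := by
  have h1 := h (1, fun _ => ((s : ℝ), (t : ℝ))) (by
    refine ⟨fun i _ => ?_, ?_⟩
    · rw [uIcc_of_le hT]
      exact ⟨s.2, t.2⟩
    · simp)
  simpa [Subtype.dist_eq] using h1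

/-- The error `δ` is added once to the whole sum and not once per interval. So first `δ` is chosen
with `K δ ≤ ε / 2`, then the total length small enough to absorb `K z`. The constants `K + 1` and `z
+ 1` avoid division by zero. -/
theorem absolutelyContinuousOnInterval_of_mem_modulusSet {γ : Curves T X}
    (h : ∀ δ : ℝ≥0, 0 < δ → ∃ z, γ ∈ modulusSet hT z δ) {f : X → ℝ} {K : ℝ≥0}
    (hf : LipschitzWith K f) :
    AbsolutelyContinuousOnInterval (fun s => f (IccExtend hT γ s)) 0 T := by
  rw [absolutelyContinuousOnInterval_iff]
  intro ε hε
  obtain ⟨z, hz⟩ := h (Real.toNNReal (ε / (2 * (K + 1)))) (by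
    rw [Real.toNNReal_pos]
    positivity)
  refine ⟨ε / (2 * (K + 1) * (z + 1)), by positivity, fun E hE hlt => ?_⟩
  have h1 := hz E hE
  rw [Real.coe_toNNReal _ (by positivity)] at h1
  have h2 : ∑ i ∈ Finset.range E.1, dist (f (IccExtend hT γ (E.2 i).1))
      (f (IccExtend hT γ (E.2 i).2)) ≤ K * ∑ i ∈ Finset.range E.1,
      dist (IccExtend hT γ (E.2 i).1) (IccExtend hT γ (E.2 i).2) := by
    rw [Finset.mul_sum]
    exact Finset.sum_le_sum fun i _ => hf.dist_le_mul _ _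
  rw [lt_div_iff₀ (by positivity)] at hlt
  set S := ∑ i ∈ Finset.range E.1, dist (E.2 i).1 (E.2 i).2 with hS
  have hS0 : 0 ≤ S := Finset.sum_nonneg fun i _ => dist_nonneg
  have hK : (0 : ℝ) ≤ K := K.2
  have hz0 : (0 : ℝ) ≤ z := z.2
  have h3 : (K + 1) * (ε / (2 * (K + 1))) = ε / 2 := by
    field_simp
  calc _ ≤ K * (z * S + ε / (2 * (K + 1))) := h2.trans (mul_le_mul_of_nonneg_left h1 hK)
    _ ≤ (K + 1) * (z * S + ε / (2 * (K + 1))) :=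
        mul_le_mul_of_nonneg_right (by linarith) (by positivity)
    _ = (K + 1) * (z * S) + ε / 2 := by rw [mul_add, h3]
    _ < ε := by nlinarith [mul_nonneg hS0 hK]

/-- Arzelà–Ascoli. -/
theorem isCompact_of_modulus [CompleteSpace X] {z δ : ℕ → ℝ≥0} {K : ℕ → Set X}
    {G : ℕ → Set (Icc (0 : ℝ) T)} {ρ : ℕ → ℝ} (hδ : Tendsto δ atTop (𝓝 0))
    (hK : ∀ k, IsCompact (K k)) (hG : ∀ k t, ∃ q ∈ G k, dist t q < ρ k)
    (hρ : ∀ k, z k * ρ k ≤ δ k) :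
    IsCompact {γ : Curves T X | (∀ k s t, dist (γ s) (γ t) ≤ z k * dist s t + δ k) ∧
      ∀ k, ∀ q ∈ G k, γ q ∈ K k} := by
  set P : (Icc (0 : ℝ) T → X) → Prop := fun γ =>
    (∀ k s t, dist (γ s) (γ t) ≤ z k * dist s t + δ k) ∧ ∀ k, ∀ q ∈ G k, γ q ∈ K k with hP
  have hδ' : Tendsto (fun k => (δ k : ℝ)) atTop (𝓝 0) := by
    have := NNReal.tendsto_coe.2 hδ
    rwa [NNReal.coe_zero] at this
  have hequi : ∀ (t : Icc (0 : ℝ) T) (ε : ℝ), 0 < ε → ∃ η > 0, ∀ s, dist s t < η →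
      ∀ γ, P γ → dist (γ t) (γ s) < ε := by
    intro t ε hε
    obtain ⟨k, hk⟩ := ((tendsto_order.1 hδ').2 (ε / 2) (by positivity)).exists
    refine ⟨ε / (2 * (z k + 1)), by positivity, fun s hs γ hγ => ?_⟩
    have h1 := hγ.1 k t s
    rw [dist_comm t s] at h1
    rw [lt_div_iff₀ (by positivity)] at hs
    nlinarith [dist_nonneg (x := s) (y := t), (z k).2]
  have hcont : ∀ γ, P γ → Continuous γ := fun γ hγ => by
    rw [Metric.continuous_iff]
    intro t ε hε
    obtain ⟨η, hη, h⟩ := hequi t ε hε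
    exact ⟨η, hη, fun s hs => by rw [dist_comm]; exact h s hs γ hγ⟩
  -- The value at `t` is within `2 δ k` of a value at a net point, which lies in `K k`. As `δ k → 0`
  -- this gives total boundedness, and completeness of `X` gives relative compactness.
  have htb : ∀ t : Icc (0 : ℝ) T, TotallyBounded {x | ∃ γ, P γ ∧ γ t = x} := by
    intro t
    rw [Metric.totallyBounded_iff]
    intro ε hε
    obtain ⟨k, hk⟩ := ((tendsto_order.1 hδ').2 (ε / 4) (by positivity)).exists
    obtain ⟨F, hF, hFK⟩ := Metric.totallyBounded_iff.1 (hK k).totallyBounded (ε / 2) (by positivity)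
    refine ⟨F, hF, ?_⟩
    rintro x ⟨γ, hγ, rfl⟩
    obtain ⟨q, hq, hqt⟩ := hG k t
    obtain ⟨y, hy, hyq⟩ := mem_iUnion₂.1 (hFK (hγ.2 k q hq))
    refine mem_iUnion₂.2 ⟨y, hy, Metric.mem_ball.2 ?_⟩
    have h1 := hγ.1 k t q
    have h2 : z k * dist t q ≤ δ k :=
      (mul_le_mul_of_nonneg_left hqt.le (z k).2).trans (hρ k)
    have h3 := Metric.mem_ball.1 hyq
    have h4 := dist_triangle (γ t) (γ q) y
    linarith
  refine ArzelaAscoli.isCompact_of_equicontinuous _ ?_ ?_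
  · have himg : ContinuousMap.toFun '' {γ : Curves T X |
        (∀ k s t, dist (γ s) (γ t) ≤ z k * dist s t + δ k) ∧ ∀ k, ∀ q ∈ G k, γ q ∈ K k} =
        {γ | P γ} := by
      ext γ
      constructor
      · rintro ⟨γ, hγ, rfl⟩
        exact hγ
      · intro hγ
        exact ⟨⟨γ, hcont γ hγ⟩, hγ, rfl⟩
    rw [himg]
    refine (isCompact_univ_pi fun t => (htb t).closure.isCompact_of_isClosed
      isClosed_closure).of_isClosed_subset ?_ fun γ hγ t _ => subset_closure ⟨γ, hγ, rfl⟩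
    have : {γ | P γ} = (⋂ (k) (s) (t), {γ : Icc (0 : ℝ) T → X |
        dist (γ s) (γ t) ≤ z k * dist s t + δ k}) ∩ ⋂ (k) (q ∈ G k), {γ | γ q ∈ K k} := by
      ext γ
      simp only [hP, mem_inter_iff, mem_iInter, mem_ofPred_eq]
    rw [this]
    refine IsClosed.inter (isClosed_iInter fun k => isClosed_iInter fun s => isClosed_iInter
      fun t => isClosed_le ((continuous_apply s).dist (continuous_apply t)) continuous_const)
      (isClosed_iInter fun k => isClosed_biInter fun q _ =>
        (hK k).isClosed.preimage (continuous_apply q))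
  · intro t
    rw [Metric.equicontinuousAt_iff_right]
    intro ε hε
    obtain ⟨η, hη, h⟩ := hequi t ε hε
    filter_upwards [Metric.ball_mem_nhds t hη] with s hs γ
    exact h s hs γ.1 γ.2

variable [MeasurableSpace X] [BorelSpace X]

/-- For each `k` one imposes the modulus with error `δ k = 1 / (k + 1)` and compactness of the
values on a finite net of times. The discarded probabilities are summable, and Arzelà–Ascoli makes
the remaining set compact. -/
theorem isTightMeasureSet_of_modulus [CompleteSpace X] {S : Set (Measure (Curves T X))}
    (h1 : ∀ ε : ℝ≥0∞, ε ≠ 0 → ∀ δ : ℝ≥0, 0 < δ → ∃ z, ∀ μ ∈ S, μ (modulusSet hT z δ)ᶜ ≤ ε)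
    (h2 : ∀ ε : ℝ≥0∞, ε ≠ 0 → ∃ K : Set X, IsCompact K ∧ ∀ μ ∈ S, ∀ t, μ {γ | γ t ∉ K} ≤ ε) :
    IsTightMeasureSet S := by
  rw [isTightMeasureSet_iff_exists_isCompact_measure_compl_le]
  intro ε hε
  obtain ⟨ε', hε'0, hε'⟩ := ENNReal.exists_pos_sum_of_countable' (ENNReal.half_pos hε.ne').ne' ℕ
  set δ : ℕ → ℝ≥0 := fun k => 1 / ((k : ℝ≥0) + 1) with hδ
  have hδ0 : ∀ k, 0 < δ k := fun k => by positivity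
  choose z hz using fun k => h1 (ε' k) (hε'0 k).ne' (δ k) (hδ0 k)
  have hfin : ∀ k, ∃ G : Set (Icc (0 : ℝ) T), G.Finite ∧
      ∀ t, ∃ q ∈ G, dist t q < (δ k : ℝ) / (z k + 1) := fun k => by
    obtain ⟨G, hGf, hG⟩ := Metric.totallyBounded_iff.1
      (isCompact_univ (X := Icc (0 : ℝ) T)).totallyBounded ((δ k : ℝ) / (z k + 1)) (by
        have := hδ0 k
        positivity)
    refine ⟨G, hGf, fun t => ?_⟩
    obtain ⟨q, hq, hqt⟩ := mem_iUnion₂.1 (hG (mem_univ t))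
    exact ⟨q, hq, hqt⟩
  choose G hGf hG using hfin
  -- The allowed error is shared among the points of the net; the extra `1` keeps the denominator
  -- positive.
  choose K hKc hK using fun k => h2 (ε' k / ((hGf k).toFinset.card + 1)) (by
    refine (ENNReal.div_pos (hε'0 k).ne' ?_).ne'
    exact ENNReal.add_ne_top.2 ⟨ENNReal.natCast_ne_top _, ENNReal.one_ne_top⟩)
  refine ⟨_, isCompact_of_modulus (z := z) (δ := δ) (K := K) (G := G)
    (ρ := fun k => (δ k : ℝ) / (z k + 1)) ?_ hKc hG fun k => ?_, fun μ hμ => ?_⟩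
  · exact NNReal.tendsto_coe.1 (by simpa [hδ] using tendsto_one_div_add_atTop_nhds_zero_nat (𝕜 := ℝ))
  · rw [mul_div_assoc', div_le_iff₀ (by positivity)]
    nlinarith [(δ k).2, (z k).2]
  have hsub : {γ : Curves T X | (∀ k s t, dist (γ s) (γ t) ≤ z k * dist s t + δ k) ∧
      ∀ k, ∀ q ∈ G k, γ q ∈ K k}ᶜ ⊆ (⋃ k, (modulusSet hT (z k) (δ k))ᶜ) ∪
      ⋃ k, ⋃ q ∈ (hGf k).toFinset, {γ | γ q ∉ K k} := by
    intro γ hγ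
    by_contra h
    simp only [mem_union, mem_iUnion, not_or, not_exists, mem_compl_iff, not_not,
      Finite.mem_toFinset, mem_ofPred_eq] at h
    exact hγ ⟨fun k s t => dist_le_of_mem_modulusSet hT (h.1 k) s t, fun k q hq => h.2 k q hq⟩
  refine (measure_mono hsub).trans ((measure_union_le _ _).trans ?_)
  rw [← ENNReal.add_halves ε]
  refine add_le_add ?_ ?_
  · exact (measure_iUnion_le _).trans ((ENNReal.tsum_le_tsum fun k => hz k μ hμ).trans hε'.le)
  · refine (measure_iUnion_le _).trans ((ENNReal.tsum_le_tsum fun k => ?_).trans hε'.le)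
    refine (measure_biUnion_finset_le _ _).trans
      ((Finset.sum_le_sum fun q _ => hK k μ hμ q).trans ?_)
    rw [Finset.sum_const, nsmul_eq_mul]
    refine (mul_le_mul_left (le_add_right le_rfl : ((hGf k).toFinset.card : ℝ≥0∞) ≤ _ + 1) _).trans ?_
    exact ENNReal.mul_div_le

/-- Split `G ≤ (G - z) + z`. Over disjoint intervals the excess integrates to at most `δ` in total,
and the constant contributes `z` times the total length. -/
theorem mem_modulusSet_of_edist_le {γ : Curves T X} {G : ℝ → ℝ≥0∞}
    (hG : ∀ s ∈ Icc 0 T, ∀ t ∈ Icc 0 T, s ≤ t →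
      edist (IccExtend hT γ s) (IccExtend hT γ t) ≤ ∫⁻ r in Ioo s t, G r) {z δ : ℝ≥0}
    (hz : ∫⁻ r in Ioo 0 T, (G r - z) ≤ δ) : γ ∈ modulusSet hT z δ := by
  intro E hE
  have hu : ∀ i ∈ Finset.range E.1, edist (IccExtend hT γ (E.2 i).1) (IccExtend hT γ (E.2 i).2) ≤
      (∫⁻ r in uIoc (E.2 i).1 (E.2 i).2, (G r - z)) + z * edist (E.2 i).1 (E.2 i).2 := by
    intro i hi
    have hmem := hE.1 i hi
    rw [uIcc_of_le hT] at hmem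
    have key : ∀ s ∈ Icc 0 T, ∀ t ∈ Icc 0 T, s ≤ t →
        edist (IccExtend hT γ s) (IccExtend hT γ t) ≤
        (∫⁻ r in uIoc s t, (G r - z)) + z * edist s t := fun s hs t ht hst => by
      rw [uIoc_of_le hst, edist_comm s t, edist_dist t s, Real.dist_eq,
        abs_of_nonneg (sub_nonneg.2 hst)]
      calc _ ≤ ∫⁻ r in Ioo s t, G r := hG s hs t ht hst
        _ ≤ ∫⁻ r in Ioc s t, G r := lintegral_mono_set Ioo_subset_Ioc_self
        _ ≤ ∫⁻ r in Ioc s t, ((G r - z) + z) := lintegral_mono fun r => le_tsub_add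
        _ = _ := by
          rw [lintegral_add_right _ measurable_const, setLIntegral_const, Real.volume_Ioc]
    rcases le_total (E.2 i).1 (E.2 i).2 with hle | hle
    · exact key _ hmem.1 _ hmem.2 hle
    · rw [edist_comm, uIoc_comm, edist_comm (E.2 i).1]
      exact key _ hmem.2 _ hmem.1 hle
  have h1 := Finset.sum_le_sum hu
  rw [Finset.sum_add_distrib, ← lintegral_biUnion_finset hE.2 fun i _ => measurableSet_uIoc,
    ← Finset.mul_sum] at h1
  have h2 : ∫⁻ r in ⋃ i ∈ Finset.range E.1, uIoc (E.2 i).1 (E.2 i).2, (G r - z) ≤ δ := by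
    refine (lintegral_mono_set (AbsolutelyContinuousOnInterval.biUnion_uIoc_subset_of_mem_disjWithin
      hE)).trans ?_
    rw [uIoc_of_le hT, ← restrict_Ioo_eq_restrict_Ioc]
    exact hz
  have h3 := h1.trans (add_le_add_left h2 _)
  simp only [edist_dist] at h3
  rw [← ENNReal.ofReal_sum_of_nonneg fun _ _ => dist_nonneg,
    ← ENNReal.ofReal_sum_of_nonneg fun _ _ => dist_nonneg, ← ENNReal.ofReal_coe_nnreal,
    ← ENNReal.ofReal_coe_nnreal, ← ENNReal.ofReal_mul NNReal.zero_le_coe,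
    ← ENNReal.ofReal_add NNReal.zero_le_coe (mul_nonneg NNReal.zero_le_coe
      (Finset.sum_nonneg fun _ _ => dist_nonneg)), ENNReal.ofReal_le_ofReal_iff
      (add_nonneg NNReal.zero_le_coe (mul_nonneg NNReal.zero_le_coe
      (Finset.sum_nonneg fun _ _ => dist_nonneg))), add_comm] at h3
  exact h3

/-- Markov's inequality for the excess integrated along each curve. -/
theorem measure_compl_modulusSet_le {π : Measure (Curves T X)} [SFinite π]
    {G : ℝ × Curves T X → ℝ≥0∞} (hGm : Measurable G)
    (hG : ∀ᵐ γ : Curves T X ∂π, ∀ s ∈ Icc 0 T, ∀ t ∈ Icc 0 T, s ≤ t →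
      edist (IccExtend hT γ s) (IccExtend hT γ t) ≤ ∫⁻ r in Ioo s t, G (r, γ)) {z δ : ℝ≥0}
    (hδ : 0 < δ) {ε : ℝ≥0∞}
    (hz : ∫⁻ p, (G p - z) ∂((volume.restrict (Ioo 0 T)).prod π) ≤ δ * ε) :
    π (modulusSet hT z δ)ᶜ ≤ ε := by
  have hm : Measurable fun p => G p - z := hGm.sub_const _
  rw [lintegral_prod_symm' _ hm] at hz
  have h1 : π (modulusSet hT z δ)ᶜ ≤ π {γ | (δ : ℝ≥0∞) ≤ ∫⁻ r in Ioo 0 T, (G (r, γ) - z)} := by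
    refine measure_mono_ae ?_
    filter_upwards [hG] with γ hγ hγ'
    by_contra h
    exact hγ' (mem_modulusSet_of_edist_le hT hγ (not_le.1 h).le)
  have hδ' : (δ : ℝ≥0∞) ≠ 0 := by simpa using hδ.ne'
  refine h1.trans ((meas_ge_le_lintegral_div hm.lintegral_prod_left'.aemeasurable hδ'
    ENNReal.coe_ne_top).trans ?_)
  rw [ENNReal.div_le_iff hδ' ENNReal.coe_ne_top, mul_comm]
  exact hz

end modulus

/-! ### Tightness of the laws of the flow curves -/

section tightness

variable {X : Type*} [MetricSpace X] [CompleteSpace X] [SecondCountableTopology X]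
  [MeasurableSpace X] [BorelSpace X] {mn : ℕ → Measure X} {m : Measure X}
  [∀ n, BoundedlyFinite (mn n)] [BoundedlyFinite m]

/-- Weakly converging measures are uniformly tight on bounded sets. -/
theorem exists_isCompact_measure_diff_le (hm : WeakConv mn m) (x : X) (R : ℝ) {ε : ℝ≥0∞}
    (hε : ε ≠ 0) : ∃ K : Set X, IsCompact K ∧ ∀ n, mn n (Metric.closedBall x R \ K) ≤ ε := by
  set χ : X → ℝ := (cutoff x R).1 with hχ
  have hχc : Continuous χ := continuous_lipB _
  have hχi : ∀ (μ : Measure X) [BoundedlyFinite μ], Integrable χ μ := fun μ _ =>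
    integrable_of_isBounded_support hχc.measurable.aestronglyMeasurable (abs_cutoff_le_one x R)
      (bddSupport_cutoff x R)
  have hχ0 : ∀ y, 0 ≤ χ y := cutoff_nonneg x R
  set A : Measure X → ℝ := fun μ => ∫ y, χ y ∂μ with hA
  have hA0 : ∀ μ, 0 ≤ A μ := fun μ => integral_nonneg hχ0
  -- Cutting off and normalising gives probability measures; the added Dirac mass keeps the total
  -- mass positive even when the measures vanish near the ball.
  set Q : Measure X → Measure X := fun μ =>
    ENNReal.ofReal (1 + A μ)⁻¹ • (Measure.dirac x + densMeasure μ χ) with hQ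
  have hmass : ∀ (μ : Measure X) [BoundedlyFinite μ], densMeasure μ χ univ = ENNReal.ofReal (A μ) :=
    fun μ _ => by
      rw [lintegral_densMeasure_univ, ofReal_integral_eq_lintegral_ofReal (hχi μ)
        (Eventually.of_forall hχ0)]
  have hQp : ∀ (μ : Measure X) [BoundedlyFinite μ], IsProbabilityMeasure (Q μ) := fun μ _ => ⟨by
    rw [hQ, Measure.smul_apply, Measure.add_apply, measure_univ, hmass, smul_eq_mul,
      ← ENNReal.ofReal_one, ← ENNReal.ofReal_add zero_le_one (hA0 μ),
      ← ENNReal.ofReal_mul (by have := hA0 μ; positivity), inv_mul_cancel₀ (by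
        have := hA0 μ; positivity)]⟩
  have hQint : ∀ (μ : Measure X) [BoundedlyFinite μ] (g : X →ᵇ ℝ), ∫ y, g y ∂(Q μ) =
      (1 + A μ)⁻¹ * (g x + ∫ y, g y * χ y ∂μ) := fun μ _ g => by
    have hf : IsFiniteMeasure (densMeasure μ χ) := ⟨by rw [hmass]; exact ENNReal.ofReal_lt_top⟩
    rw [hQ, integral_smul_measure, integral_add_measure (g.integrable _) (g.integrable _),
      integral_dirac, integral_densMeasure hχc.measurable hχ0, ENNReal.toReal_ofReal (by
        have := hA0 μ; positivity), smul_eq_mul]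
  have hconv : ∀ g : X →ᵇ ℝ, Tendsto (fun n => ∫ y, g y * χ y ∂(mn n)) atTop
      (𝓝 (∫ y, g y * χ y ∂m)) := fun g => by
    have h1 := hm (g * BoundedContinuousFunction.ofNormedAddCommGroup χ hχc 1
      (abs_cutoff_le_one x R)) ((bddSupport_cutoff x R).subset fun y hy =>
        right_ne_zero_of_mul hy)
    simpa using h1
  have hAconv : Tendsto (fun n => A (mn n)) atTop (𝓝 (A m)) := by
    have := hconv 1
    simpa [hA] using this
  set P : ℕ → ProbabilityMeasure X := fun n => ⟨Q (mn n), hQp _⟩ with hP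
  have hPlim : Tendsto P atTop (𝓝 ⟨Q m, hQp m⟩) := by
    refine ProbabilityMeasure.tendsto_iff_forall_integral_tendsto.2 fun g => ?_
    simp only [hP, ProbabilityMeasure.coe_mk, hQint]
    refine ((tendsto_const_nhds.add hAconv).inv₀ ?_).mul (tendsto_const_nhds.add (hconv g))
    have := hA0 m
    positivity
  -- A convergent sequence together with its limit is compact, and in a complete separable space
  -- relative compactness implies tightness.
  have hcomp : IsCompact (closure (range P)) :=
    hPlim.isCompact_insert_range.closure_of_subset (subset_insert _ _)
  have htight := isTightMeasureSet_of_isCompact_closure hcomp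
  obtain ⟨B, hB⟩ := hAconv.bddAbove_range
  have hB' : ∀ n, A (mn n) ≤ B := fun n => hB ⟨n, rfl⟩
  have hB0 : 0 ≤ B := (hA0 _).trans (hB' 0)
  obtain ⟨K, hK, hKε⟩ := isTightMeasureSet_iff_exists_isCompact_measure_compl_le.1 htight
    (ENNReal.ofReal (1 + B)⁻¹ * ε) (ENNReal.mul_pos (by simp; positivity) hε)
  refine ⟨K, hK, fun n => ?_⟩
  have h1 : Q (mn n) Kᶜ ≤ ENNReal.ofReal (1 + B)⁻¹ * ε := hKε _ ⟨P n, mem_range_self n, rfl⟩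
  have h2 : mn n (Metric.closedBall x R \ K) ≤ densMeasure (mn n) χ Kᶜ := by
    rw [densMeasure, withDensity_apply _ hK.measurableSet.compl]
    have hms : MeasurableSet (Metric.closedBall x R \ K) :=
      Metric.isClosed_closedBall.measurableSet.diff hK.measurableSet
    calc mn n (Metric.closedBall x R \ K) = ∫⁻ y in Metric.closedBall x R \ K, 1 ∂(mn n) := by
          rw [setLIntegral_one]
      _ ≤ ∫⁻ y in Metric.closedBall x R \ K, ENNReal.ofReal (χ y) ∂(mn n) := by
          refine setLIntegral_mono' hms fun y hy => ?_
          rw [hχ, cutoff_eq_one (Metric.mem_closedBall.1 hy.1), ENNReal.ofReal_one]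
      _ ≤ _ := lintegral_mono_set fun y hy => hy.2
  have h3 : ENNReal.ofReal (1 + B)⁻¹ * densMeasure (mn n) χ Kᶜ ≤ ENNReal.ofReal (1 + B)⁻¹ * ε := by
    refine le_trans ?_ h1
    rw [hQ, Measure.smul_apply, Measure.add_apply, smul_eq_mul]
    refine mul_le_mul' (ENNReal.ofReal_le_ofReal ?_) le_add_self
    have := hA0 (mn n)
    gcongr
    exact hB' n
  refine h2.trans ((ENNReal.mul_le_mul_iff_right ?_ ENNReal.ofReal_ne_top).1 h3)
  simp
  positivity

variable {T : ℝ} (hT : 0 ≤ T)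

/-- Curves with modulus `(z, 1)` that start in the ball of radius `R` stay in a larger ball. There
the measures `mn n`, which dominate the marginals up to the factor `K`, are uniformly tight. -/
theorem isTightMeasureSet_range_of_speed {π : ℕ → Measure (Curves T X)}
    [∀ n, IsProbabilityMeasure (π n)] (hm : WeakConv mn m)
    {K : ℝ≥0} (hK : ∀ n t, (π n).map (fun γ => γ t) ≤ K • mn n) {x : X} {R : ℝ}
    (hR : ∀ n, ∀ᵐ γ ∂(π n), γ ⟨0, left_mem_Icc.2 hT⟩ ∈ Metric.closedBall x R)
    {G : ℕ → ℝ × Curves T X → ℝ≥0∞} (hGm : ∀ n, Measurable (G n))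
    (hG : ∀ n, ∀ᵐ γ : Curves T X ∂(π n), ∀ s ∈ Icc 0 T, ∀ t ∈ Icc 0 T, s ≤ t →
      edist (IccExtend hT γ s) (IccExtend hT γ t) ≤ ∫⁻ r in Ioo s t, G n (r, γ))
    (hUI : ∀ ε : ℝ≥0∞, ε ≠ 0 → ∃ z : ℝ≥0, ∀ n,
      ∫⁻ p, (G n p - z) ∂((volume.restrict (Ioo 0 T)).prod (π n)) ≤ ε) :
    IsTightMeasureSet (range π) := by
  have h1 : ∀ ε : ℝ≥0∞, ε ≠ 0 → ∀ δ : ℝ≥0, 0 < δ →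
      ∃ z, ∀ μ ∈ range π, μ (modulusSet hT z δ)ᶜ ≤ ε := fun ε hε δ hδ => by
    obtain ⟨z, hz⟩ := hUI (δ * ε) (mul_ne_zero (by simpa using hδ.ne') hε)
    refine ⟨z, ?_⟩
    rintro _ ⟨n, rfl⟩
    exact measure_compl_modulusSet_le hT (hGm n) (hG n) hδ (hz n)
  refine isTightMeasureSet_of_modulus hT h1 fun ε hε => ?_
  have hε2 : ε / 2 ≠ 0 := (ENNReal.half_pos hε).ne'
  obtain ⟨z, hz⟩ := h1 (ε / 2) hε2 1 one_pos
  -- In time `T` a curve with modulus `(z, 1)` moves by at most `z T + 1`.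
  obtain ⟨C, hC, hCε⟩ := exists_isCompact_measure_diff_le hm x (R + z * T + 1)
    (ε := ε / 2 / (K + 1)) (ENNReal.div_pos hε2 (by simp)).ne'
  refine ⟨C, hC, ?_⟩
  rintro _ ⟨n, rfl⟩ t
  have hev : Measurable fun γ : Curves T X => γ t := (continuous_eval_const t).measurable
  have hms : MeasurableSet (Metric.closedBall x (R + z * T + 1) \ C) :=
    Metric.isClosed_closedBall.measurableSet.diff hC.measurableSet
  have hsub : (π n) {γ | γ t ∉ C} ≤ (π n) ((modulusSet hT z 1)ᶜ ∪
      (fun γ : Curves T X => γ t) ⁻¹' (Metric.closedBall x (R + z * T + 1) \ C)) := by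
    refine measure_mono_ae ?_
    filter_upwards [hR n] with γ hγ hγC
    by_cases h : γ ∈ modulusSet hT z 1
    · refine Or.inr ⟨?_, hγC⟩
      have h2 := dist_le_of_mem_modulusSet hT h t ⟨0, left_mem_Icc.2 hT⟩
      rw [Subtype.dist_eq, Real.dist_eq, sub_zero, abs_of_nonneg t.2.1, NNReal.coe_one] at h2
      have h3 := Metric.mem_closedBall.1 hγ
      have h4 : z * (t : ℝ) ≤ z * T := mul_le_mul_of_nonneg_left t.2.2 z.2
      exact Metric.mem_closedBall.2 (by
        linarith [dist_triangle (γ t) (γ ⟨0, left_mem_Icc.2 hT⟩) x])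
    · exact Or.inl h
  refine hsub.trans ((measure_union_le _ _).trans ?_)
  rw [← ENNReal.add_halves ε]
  refine add_le_add (hz _ (mem_range_self n)) ?_
  rw [← Measure.map_apply hev hms]
  refine (hK n t _).trans ?_
  have h5 : (K • mn n) (Metric.closedBall x (R + z * T + 1) \ C) =
      K * mn n (Metric.closedBall x (R + z * T + 1) \ C) := rfl
  rw [h5]
  refine (mul_le_mul' (le_add_right le_rfl) (hCε n)).trans (ENNReal.mul_div_le (a := (K : ℝ≥0∞) + 1))

end tightness

/-! ### Densities and limits of measures on curves -/

section density

variable {X : Type*} [MetricSpace X] [SecondCountableTopology X] [MeasurableSpace X] [BorelSpace X]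

/-- Jointly measurable bounded densities of a family of measures. -/
theorem exists_measurable_density_kernel {m : Measure X} [SigmaFinite m]
    (κ : ProbabilityTheory.Kernel ℝ X) [ProbabilityTheory.IsFiniteKernel κ] {K : ℝ≥0}
    (h : ∀ t, κ t ≤ K • m) :
    ∃ v : ℝ → X → ℝ, Measurable (Function.uncurry v) ∧ (∀ t x, 0 ≤ v t x ∧ v t x ≤ K) ∧
      ∀ t, κ t = densMeasure m (v t) := by
  -- Jointly measurable densities are taken between finite kernels, so `m` is first replaced by an
  -- equivalent finite measure and its density is multiplied back afterwards.
  set η : ProbabilityTheory.Kernel ℝ X := ProbabilityTheory.Kernel.const ℝ m.toFinite with hη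
  have hac : ∀ t, κ t ≪ m := fun t =>
    Measure.absolutelyContinuous_of_le_smul (c := (K : ℝ≥0∞)) (h t)
  have hd := ProbabilityTheory.Kernel.measurable_rnDeriv κ η
  have hdt : ∀ t, Measurable (ProbabilityTheory.Kernel.rnDeriv κ η t) := fun t =>
    hd.comp measurable_prodMk_left
  have hrn : Measurable (m.toFinite.rnDeriv m) := Measure.measurable_rnDeriv _ _
  have hmf : m.withDensity (m.toFinite.rnDeriv m) = m.toFinite :=
    Measure.withDensity_rnDeriv_eq _ _ (toFinite_absolutelyContinuous m)
  set u : ℝ → X → ℝ≥0∞ := fun t x => m.toFinite.rnDeriv m x * ProbabilityTheory.Kernel.rnDeriv κ η t x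
    with hu
  have hκu : ∀ t, κ t = m.withDensity (u t) := fun t => by
    have h1 := ProbabilityTheory.Kernel.withDensity_rnDeriv_eq (κ := κ) (η := η) (a := t)
      ((hac t).trans (absolutelyContinuous_toFinite m))
    rw [ProbabilityTheory.Kernel.withDensity_apply _ hd] at h1
    have h2 : m.withDensity (u t) = (m.withDensity (m.toFinite.rnDeriv m)).withDensity
        (ProbabilityTheory.Kernel.rnDeriv κ η t) := withDensity_mul m hrn (hdt t)
    rw [h2, hmf, ← h1]
    rfl
  have hule : ∀ t, ∀ᵐ x ∂m, u t x ≤ K := fun t => by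
    refine ae_le_of_forall_setLIntegral_le_of_sigmaFinite (hrn.mul (hdt t)) fun s hs _ => ?_
    have h1 := h t s
    rw [hκu, withDensity_apply _ hs] at h1
    rw [setLIntegral_const]
    exact h1
  -- The bound `K` holds only almost everywhere; the minimum makes it pointwise without changing the
  -- measures.
  refine ⟨fun t x => (min (u t x) K).toReal, ?_, fun t x => ⟨ENNReal.toReal_nonneg, ?_⟩,
    fun t => ?_⟩
  · exact (((hrn.comp measurable_snd).mul hd).min measurable_const).ennreal_toReal
  · exact ENNReal.toReal_le_coe_of_le_coe (min_le_right _ _)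
  · rw [hκu, densMeasure]
    refine withDensity_congr_ae ?_
    filter_upwards [hule t] with x hx
    rw [min_eq_left hx, ENNReal.ofReal_toReal (hx.trans_lt ENNReal.coe_lt_top).ne]

/-- Jointly measurable bounded densities of the marginals of a weighted process. -/
theorem exists_measurable_density {Ω : Type*} [MeasurableSpace Ω] {ν : Measure Ω}
    [IsFiniteMeasure ν] {m : Measure X} [SigmaFinite m] {e : ℝ → Ω → X}
    (he : Measurable (Function.uncurry e)) {K B : ℝ≥0} (h : ∀ t, ν.map (e t) ≤ K • m)
    {W : ℝ → Ω → ℝ} (hW : Measurable (Function.uncurry W)) (hWB : ∀ t ω, W t ω ≤ B) :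
    ∃ v : ℝ → X → ℝ, Measurable (Function.uncurry v) ∧
      (∀ t x, 0 ≤ v t x ∧ v t x ≤ (B * K : ℝ≥0)) ∧
      ∀ t, (densMeasure ν (W t)).map (e t) = densMeasure m (v t) := by
  have het : ∀ t, Measurable (e t) := fun t => he.comp measurable_prodMk_left
  set κ : ProbabilityTheory.Kernel ℝ X := ⟨fun t => (densMeasure ν (W t)).map (e t), by
    refine Measure.measurable_of_measurable_coe _ fun s hs => ?_
    have h1 : ∀ t, ((densMeasure ν (W t)).map (e t)) s =
        ∫⁻ ω, (Function.uncurry e ⁻¹' s).indicator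
          (fun p => ENNReal.ofReal (Function.uncurry W p)) (t, ω) ∂ν := fun t => by
      rw [Measure.map_apply (het t) hs, densMeasure, withDensity_apply _ (het t hs),
        ← lintegral_indicator (het t hs)]
      rfl
    simp only [h1]
    exact (hW.ennreal_ofReal.indicator (he hs)).lintegral_prod_right'⟩ with hκ
  have hle : ∀ t, densMeasure ν (W t) ≤ B • ν := fun t => by
    refine (withDensity_mono (g := fun _ => (B : ℝ≥0∞)) (Eventually.of_forall fun ω => ?_)).trans_eq
      (withDensity_const _)
    exact (ENNReal.ofReal_le_ofReal (hWB t ω)).trans_eq (ENNReal.ofReal_coe_nnreal)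
  have hκt : ∀ t, κ t = (densMeasure ν (W t)).map (e t) := fun t => rfl
  have hfin : ProbabilityTheory.IsFiniteKernel κ := ⟨⟨B * ν univ,
    ENNReal.mul_lt_top ENNReal.coe_lt_top (measure_lt_top _ _), fun t => by
    rw [hκt, Measure.map_apply (het t) MeasurableSet.univ, preimage_univ]
    exact hle t univ⟩⟩
  refine exists_measurable_density_kernel κ fun t => ?_
  rw [hκt]
  refine (Measure.map_mono (hle t) (het t)).trans ?_
  rw [Measure.map_smul, mul_smul]
  refine Measure.le_iff'.2 fun A => ?_
  exact mul_le_mul_right (h t A) (B : ℝ≥0∞)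

end density

/-! ### Marginals and speed bounds of weak limits -/

section limits

variable {X : Type*} [MetricSpace X] [SecondCountableTopology X] [MeasurableSpace X] [BorelSpace X]
  {T : ℝ} {hT : 0 ≤ T}

/-- A finite Borel measure is inner regular for closed sets, and a closed set is exhausted by its
bounded closed parts. -/
theorem measure_le_of_forall_isClosed_bounded {X : Type*} [MetricSpace X] [MeasurableSpace X]
    [BorelSpace X] {μ ν : Measure X} [IsFiniteMeasure μ]
    (h : ∀ F : Set X, IsClosed F → Bornology.IsBounded F → F.Nonempty → μ F ≤ ν F) : μ ≤ ν := by
  rcases isEmpty_or_nonempty X with hX | ⟨⟨x⟩⟩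
  · rw [Measure.eq_zero_of_isEmpty μ]
    exact Measure.zero_le _
  have hcl : ∀ F : Set X, IsClosed F → μ F ≤ ν F := fun F hF => by
    have hun : F = ⋃ n : ℕ, F ∩ Metric.closedBall x n := by
      rw [← inter_iUnion, Metric.iUnion_closedBall_nat, inter_univ]
    have hmono : Monotone fun n : ℕ => F ∩ Metric.closedBall x n := fun a b hab =>
      inter_subset_inter_right _ (Metric.closedBall_subset_closedBall (Nat.cast_le.2 hab))
    conv_lhs => rw [hun]
    rw [hmono.measure_iUnion]
    refine iSup_le fun n => ?_
    rcases (F ∩ Metric.closedBall x n).eq_empty_or_nonempty with h0 | h0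
    · rw [h0, measure_empty]
      exact zero_le
    · exact (h _ (hF.inter Metric.isClosed_closedBall) (Metric.isBounded_closedBall.subset
        inter_subset_right) h0).trans (measure_mono inter_subset_left)
  refine Measure.le_iff.2 fun A hA => ?_
  rw [hA.measure_eq_iSup_isClosed_of_ne_top (measure_ne_top μ A)]
  exact iSup₂_le fun F hFA => iSup_le fun hF => (hcl F hF).trans (measure_mono hFA)

/-- Marginal bounds pass to weak limits. -/
theorem map_eval_le_of_tendsto {mn : ℕ → Measure X} {m : Measure X}
    [∀ n, BoundedlyFinite (mn n)] [BoundedlyFinite m] (hm : WeakConv mn m)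
    {π : ℕ → Measure (Curves T X)} {π₀ : Measure (Curves T X)} [∀ n, IsProbabilityMeasure (π n)]
    [IsProbabilityMeasure π₀]
    (hlim : ∀ Φ : Curves T X →ᵇ ℝ, Tendsto (fun n => ∫ γ, Φ γ ∂(π n)) atTop (𝓝 (∫ γ, Φ γ ∂π₀)))
    {K : ℝ≥0} (hK : ∀ n t, (π n).map (fun γ => γ t) ≤ K • mn n) (t : Icc (0 : ℝ) T) :
    π₀.map (fun γ => γ t) ≤ K • m := by
  have hev : Continuous fun γ : Curves T X => γ t := continuous_eval_const t
  -- For such `g` both weak convergences apply, the one on curves and the one of `mn n`. Closed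
  -- bounded sets follow by approximating their indicators.
  have hint : ∀ g : LipB X, BddSupport g.1 → (∀ x, 0 ≤ g.1 x) →
      ∫ x, g.1 x ∂(π₀.map fun γ => γ t) ≤ K * ∫ x, g.1 x ∂m := fun g hg hg0 => by
    have hgc := continuous_lipB g
    obtain ⟨B, hB⟩ := g.2.2
    have hi : ∀ (μ : Measure X) [BoundedlyFinite μ], Integrable g.1 μ := fun μ _ =>
      integrable_of_isBounded_support hgc.measurable.aestronglyMeasurable hB hg
    have h1 := hlim (BoundedContinuousFunction.ofNormedAddCommGroup (fun γ : Curves T X => g.1 (γ t))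
      (hgc.comp hev) B fun γ => hB _)
    have h2 := (hm (BoundedContinuousFunction.ofNormedAddCommGroup g.1 hgc B hB) hg).const_mul (K : ℝ)
    simp only [BoundedContinuousFunction.coe_ofNormedAddCommGroup] at h1 h2
    rw [integral_map hev.measurable.aemeasurable hgc.measurable.aestronglyMeasurable]
    refine le_of_tendsto_of_tendsto' h1 h2 fun n => ?_
    rw [← integral_map (f := g.1) hev.measurable.aemeasurable hgc.measurable.aestronglyMeasurable]
    refine (integral_mono_measure (hK n t) (Eventually.of_forall hg0)
      ((hi (mn n)).smul_measure ENNReal.coe_ne_top)).trans_eq ?_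
    exact integral_smul_nnreal_measure _ K
  have hpm : IsProbabilityMeasure (π₀.map fun γ => γ t) :=
    Measure.isProbabilityMeasure_map hev.measurable.aemeasurable
  refine measure_le_of_forall_isClosed_bounded fun F hF hFb hne => ?_
  obtain ⟨x, hx⟩ := hne
  obtain ⟨R, hR⟩ := hFb.subset_closedBall x
  have hsupp : ∀ j, BddSupport (lipIndicator F j).1 := fun j =>
    Metric.isBounded_ball.subset (support_lipIndicator_subset ⟨x, hx⟩ hR j)
  have hmeas : ∀ j, Measurable (lipIndicator F j).1 := fun j => (continuous_lipB _).measurable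
  have hlimF : ∀ (μ : Measure X) [BoundedlyFinite μ],
      Tendsto (fun j => ∫ y, (lipIndicator F j).1 y ∂μ) atTop (𝓝 (μ.real F)) := fun μ _ => by
    rw [← integral_indicator_one hF.measurableSet]
    refine tendsto_integral_of_dominated_convergence ((Metric.ball x (R + 1)).indicator fun _ => 1)
      (fun j => (hmeas j).aestronglyMeasurable) ?_ (fun j => Eventually.of_forall fun y => ?_)
      (Eventually.of_forall fun y => tendsto_lipIndicator ⟨x, hx⟩ hF y)
    · refine (integrable_indicator_iff measurableSet_ball).2 (integrableOn_const ?_)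
      exact (BoundedlyFinite.lt_top _ Metric.isBounded_ball).ne
    · rw [Real.norm_of_nonneg (lipIndicator_nonneg F j y)]
      by_cases h : y ∈ Metric.ball x (R + 1)
      · rw [indicator_of_mem h]
        exact lipIndicator_le_one F j y
      · rw [indicator_of_notMem h]
        exact (Function.notMem_support.1 fun h' =>
          h (support_lipIndicator_subset ⟨x, hx⟩ hR j h')).le
  have hbf : BoundedlyFinite (π₀.map fun γ => γ t) := ⟨fun s _ => measure_lt_top _ s⟩
  have h1 := le_of_tendsto_of_tendsto' (hlimF (π₀.map fun γ => γ t))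
    ((hlimF m).const_mul (K : ℝ)) fun j => hint _ (hsupp j) (lipIndicator_nonneg F j)
  have h2 := ENNReal.ofReal_le_ofReal h1
  have hfinF : m F ≠ ∞ := (BoundedlyFinite.lt_top _ hFb).ne
  rw [ENNReal.ofReal_mul NNReal.zero_le_coe, ENNReal.ofReal_coe_nnreal, measureReal_def,
    measureReal_def, ENNReal.ofReal_toReal (measure_ne_top _ _), ENNReal.ofReal_toReal hfinF] at h2
  exact h2

variable {π : ℕ → Measure (Curves T X)} {π₀ : Measure (Curves T X)}
    [∀ n, IsProbabilityMeasure (π n)] [IsProbabilityMeasure π₀]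

theorem measure_le_liminf_of_tendsto
    (hlim : ∀ Φ : Curves T X →ᵇ ℝ, Tendsto (fun n => ∫ γ, Φ γ ∂(π n)) atTop (𝓝 (∫ γ, Φ γ ∂π₀)))
    {U : Set (Curves T X)} (hU : IsOpen U) : π₀ U ≤ liminf (fun n => π n U) atTop := by
  set P : ℕ → ProbabilityMeasure (Curves T X) := fun n => ⟨π n, inferInstance⟩
  set P₀ : ProbabilityMeasure (Curves T X) := ⟨π₀, inferInstance⟩
  have h : Tendsto P atTop (𝓝 P₀) := ProbabilityMeasure.tendsto_iff_forall_integral_tendsto.2 hlim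
  exact ProbabilityMeasure.le_liminf_measure_open_of_tendsto h hU

/-- Absolute continuity on coordinates passes to weak limits. -/
theorem ae_absolutelyContinuous_of_tendsto
    (hlim : ∀ Φ : Curves T X →ᵇ ℝ, Tendsto (fun n => ∫ γ, Φ γ ∂(π n)) atTop (𝓝 (∫ γ, Φ γ ∂π₀)))
    {G : ℕ → ℝ × Curves T X → ℝ≥0∞} (hG : ∀ n, HasSpeedBound hT (π n) (G n))
    (hUI : ∀ ε : ℝ≥0∞, ε ≠ 0 → ∃ z : ℝ≥0, ∀ n,
      ∫⁻ p, (G n p - z) ∂((volume.restrict (Ioo 0 T)).prod (π n)) ≤ ε) :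
    ∀ᵐ γ : Curves T X ∂π₀, ∀ (f : X → ℝ) (K : ℝ≥0), LipschitzWith K f →
      AbsolutelyContinuousOnInterval (fun s => f (IccExtend hT γ s)) 0 T := by
  -- The complement of a modulus set is open, so the portmanteau inequality carries the uniform
  -- bound to the limit.
  have h1 : ∀ k : ℕ, ∀ᵐ γ : Curves T X ∂π₀, ∃ z, γ ∈ modulusSet hT z (1 / ((k : ℝ≥0) + 1)) := by
    intro k
    have hδ : 0 < 1 / ((k : ℝ≥0) + 1) := by positivity
    refine le_antisymm (ENNReal.le_of_forall_pos_le_add fun ε hε _ => ?_) zero_le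
    obtain ⟨z, hz⟩ := hUI (((1 / ((k : ℝ≥0) + 1) : ℝ≥0) : ℝ≥0∞) * ε)
      (mul_ne_zero (ENNReal.coe_ne_zero.2 hδ.ne') (ENNReal.coe_ne_zero.2 hε.ne'))
    rw [zero_add]
    calc π₀ {γ : Curves T X | ∃ z, γ ∈ modulusSet hT z (1 / ((k : ℝ≥0) + 1))}ᶜ
        ≤ π₀ (modulusSet hT z (1 / ((k : ℝ≥0) + 1)))ᶜ := 
          measure_mono (compl_subset_compl.2 fun γ hγ => ⟨z, hγ⟩)
      _ ≤ liminf (fun n => π n (modulusSet hT z (1 / ((k : ℝ≥0) + 1)))ᶜ) atTop :=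
        measure_le_liminf_of_tendsto hlim (isClosed_modulusSet hT _ _).isOpen_compl
      _ ≤ liminf (fun _ : ℕ => (ε : ℝ≥0∞)) atTop := liminf_le_liminf (Eventually.of_forall fun n =>
        measure_compl_modulusSet_le hT (hG n).measurable (hG n).edist_le hδ (hz n))
      _ = ε := liminf_const _
  filter_upwards [ae_all_iff.2 h1] with γ hγ f K hf
  refine absolutelyContinuousOnInterval_of_mem_modulusSet hT (fun δ hδ => ?_) hf
  obtain ⟨k, hk⟩ := exists_nat_one_div_lt (show (0 : ℝ) < δ from hδ)
  obtain ⟨z, hz⟩ := hγ k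
  refine ⟨z, fun E hE => (hz E hE).trans (add_le_add_right ?_ _)⟩
  push_cast
  exact hk.le

/-- By Fubini, each time `u` lies in `(r, r + h)` for a set of `r` of length at most `h`. -/
theorem lintegral_edist_extend_le {π : Measure (Curves T X)} [SFinite π]
    {G : ℝ × Curves T X → ℝ≥0∞} (hG : HasSpeedBound hT π G) {h : ℝ} (hh : 0 < h) :
    ∫⁻ r in Ioo 0 T, ∫⁻ γ : Curves T X, edist (IccExtend hT γ r) (IccExtend hT γ (r + h)) ∂π ≤
      ENNReal.ofReal h * ∫⁻ p, G p ∂((volume.restrict (Ioo 0 T)).prod π) := by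
  have hmeas : Measurable fun p : ℝ × Curves T X =>
      edist (IccExtend hT p.2 p.1) (IccExtend hT p.2 (p.1 + h)) :=
    (continuous_uncurry_extend hT).measurable.edist ((continuous_uncurry_extend hT).measurable.comp
      ((measurable_fst.add_const h).prodMk measurable_snd))
  rw [lintegral_lintegral_swap hmeas.aemeasurable, lintegral_prod_symm _ hG.measurable.aemeasurable,
    ← lintegral_const_mul' _ _ ENNReal.ofReal_ne_top]
  refine lintegral_mono_ae ?_
  filter_upwards [hG.edist_le] with γ hγ
  have hGγ : Measurable fun u => G (u, γ) := hG.measurable.comp measurable_prodMk_right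
  calc ∫⁻ r in Ioo 0 T, edist (IccExtend hT γ r) (IccExtend hT γ (r + h))
      ≤ ∫⁻ r in Ioo 0 T, ∫⁻ u in Ioo 0 T, (Ioo r (r + h)).indicator (fun u => G (u, γ)) u := by
        refine setLIntegral_mono' measurableSet_Ioo fun r hr => ?_
        -- Past the time `T` the extended curve stays at its endpoint.
        have h1 : IccExtend hT γ (r + h) = IccExtend hT γ (min (r + h) T) := by
          rcases le_total (r + h) T with h1 | h1
          · rw [min_eq_left h1]
          · rw [min_eq_right h1, IccExtend_of_right_le hT _ h1, IccExtend_right]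
        rw [h1]
        refine (hγ r (Ioo_subset_Icc_self hr) _ ⟨le_min (by linarith [hr.1]) hT, min_le_right _ _⟩
          (le_min (by linarith) hr.2.le)).trans ?_
        rw [lintegral_indicator measurableSet_Ioo, Measure.restrict_restrict measurableSet_Ioo]
        exact lintegral_mono_set fun u hu => ⟨⟨hu.1, hu.2.trans_le (min_le_left _ _)⟩,
          hr.1.trans hu.1, hu.2.trans_le (min_le_right _ _)⟩
    _ = ∫⁻ u in Ioo 0 T, ∫⁻ r in Ioo 0 T, (Ioo r (r + h)).indicator (fun u => G (u, γ)) u := by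
        refine lintegral_lintegral_swap (Measurable.aemeasurable ?_)
        have hs : MeasurableSet {p : ℝ × ℝ | p.2 ∈ Ioo p.1 (p.1 + h)} :=
          (measurableSet_lt measurable_fst measurable_snd).inter
            (measurableSet_lt measurable_snd (measurable_fst.add_const h))
        exact (hGγ.comp measurable_snd).indicator hs
    _ ≤ ∫⁻ u in Ioo 0 T, ENNReal.ofReal h * G (u, γ) := by
        refine lintegral_mono fun u => ?_
        calc _ ≤ ∫⁻ r, (Ioo r (r + h)).indicator (fun u => G (u, γ)) u :=
              setLIntegral_le_lintegral _ _
          _ = ∫⁻ r, (Ioo (u - h) u).indicator (fun _ => G (u, γ)) r := by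
              refine lintegral_congr fun r => ?_
              by_cases hr : r ∈ Ioo (u - h) u
              · rw [indicator_of_mem hr, indicator_of_mem (s := Ioo r (r + h)) ⟨hr.2, by linarith [hr.1]⟩]
              · rw [indicator_of_notMem hr, indicator_of_notMem fun h' => hr
                  ⟨by linarith [h'.2], h'.1⟩]
          _ = _ := by
              rw [lintegral_indicator_const measurableSet_Ioo, Real.volume_Ioo, mul_comm]
              congr 2
              ring
    _ = _ := lintegral_const_mul' _ _ ENNReal.ofReal_ne_top

set_option maxHeartbeats 1000000 in
/-- Uniformly integrable speed bounds pass to weak limits. -/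
theorem exists_hasSpeedBound_of_tendsto [Nonempty X]
    (hlim : ∀ Φ : Curves T X →ᵇ ℝ, Tendsto (fun n => ∫ γ, Φ γ ∂(π n)) atTop (𝓝 (∫ γ, Φ γ ∂π₀)))
    {G : ℕ → ℝ × Curves T X → ℝ≥0∞} (hG : ∀ n, HasSpeedBound hT (π n) (G n))
    (hUI : ∀ ε : ℝ≥0∞, ε ≠ 0 → ∃ z : ℝ≥0, ∀ n,
      ∫⁻ p, (G n p - z) ∂((volume.restrict (Ioo 0 T)).prod (π n)) ≤ ε) :
    ∃ G₀, HasSpeedBound hT π₀ G₀ := by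
  have hac := ae_absolutelyContinuous_of_tendsto hlim hG hUI
  set q : ℕ → ℝ × Curves T X → ℝ := fun i p => deriv (fun s => (distFun X i).1 (IccExtend hT p.2 s)) p.1
    with hq
  have hqm : ∀ i, Measurable (q i) := fun i => measurable_deriv_extend hT (continuous_lipB _)
  -- The limit speed is the supremum of the derivatives of the test functions along the curve; it
  -- dominates increments by absolute continuity.
  set G₀ : ℝ × Curves T X → ℝ≥0∞ := fun p => ⨆ i, ‖q i p‖ₑ with hG₀
  have hG₀m : Measurable G₀ := Measurable.iSup fun i => (hqm i).enorm
  refine ⟨G₀, hG₀m, ?_, ?_⟩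
  · obtain ⟨z, hz⟩ := hUI 1 one_ne_zero
    -- A uniform bound on the total speed: excess over `z` at most `1`, plus `z` over a time span of
    -- length `T`.
    set S : ℝ≥0∞ := 1 + z * ENNReal.ofReal T with hS
    have hSn : ∀ n, ∫⁻ p, G n p ∂((volume.restrict (Ioo 0 T)).prod (π n)) ≤ S := fun n => by
      refine (lintegral_mono fun p => le_tsub_add (a := (z : ℝ≥0∞))).trans ?_
      rw [lintegral_add_right _ measurable_const, lintegral_const, ← univ_prod_univ,
        Measure.prod_prod, Measure.restrict_apply_univ, measure_univ, Real.volume_Ioo, mul_one,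
        sub_zero]
      exact add_le_add_left (hz n) _
    set η : ℕ → ℝ := fun k => 1 / ((k : ℝ) + 1) with hη
    have hη0 : ∀ k, 0 < η k := fun k => by positivity
    have hηt : Tendsto η atTop (𝓝[>] 0) := tendsto_nhdsWithin_of_tendsto_nhds_of_eventually_within _
      tendsto_one_div_add_atTop_nhds_zero_nat (Eventually.of_forall hη0)
    set D : ℕ → ℝ × Curves T X → ℝ≥0∞ := fun k p => (ENNReal.ofReal (η k))⁻¹ *
      edist (IccExtend hT p.2 p.1) (IccExtend hT p.2 (p.1 + η k)) with hD
    have hDc : ∀ k, Continuous fun p : ℝ × Curves T X =>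
        edist (IccExtend hT p.2 p.1) (IccExtend hT p.2 (p.1 + η k)) := fun k =>
      (continuous_uncurry_extend hT).edist ((continuous_uncurry_extend hT).comp
        ((continuous_fst.add continuous_const).prodMk continuous_snd))
    have hDm : ∀ k, Measurable (D k) := fun k => (hDc k).measurable.const_mul _
    -- Each test function is `1`-Lipschitz, so its derivative is bounded by the lower limit of the
    -- metric difference quotients.
    have hle : ∀ᵐ p ∂((volume.restrict (Ioo 0 T)).prod π₀), G₀ p ≤ liminf (fun k => D k p) atTop := by
      have hms : MeasurableSet {p : ℝ × Curves T X | ∀ i,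
          DifferentiableAt ℝ (fun s => (distFun X i).1 (IccExtend hT p.2 s)) p.1} := by
        rw [ofPred_forall]
        exact MeasurableSet.iInter fun i =>
          measurableSet_differentiableAt_extend hT (continuous_lipB (distFun X i))
      have hdiff : ∀ᵐ p ∂((volume.restrict (Ioo 0 T)).prod π₀), ∀ i,
          DifferentiableAt ℝ (fun s => (distFun X i).1 (IccExtend hT p.2 s)) p.1 := by
        refine (Measure.ae_prod_iff_ae_ae hms).2 ((Measure.ae_ae_comm (p := fun r (γ : Curves T X) =>
          ∀ i, DifferentiableAt ℝ (fun s => (distFun X i).1 (IccExtend hT γ s)) r) hms).2 ?_)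
        filter_upwards [hac] with γ hγ
        refine ae_all_iff.2 fun i => ?_
        have h1 := (hγ (distFun X i).1 1 (lipschitzWith_distFun i)).ae_differentiableAt
        rw [uIcc_of_le hT] at h1
        refine (ae_restrict_iff' measurableSet_Ioo).2 (h1.mono fun r hr hr' => ?_)
        exact hr (Ioo_subset_Icc_self hr')
      filter_upwards [hdiff] with p hp
      refine iSup_le fun i => ?_
      have h1 := ((hp i).hasDerivAt.tendsto_slope_zero_right.comp hηt).enorm
      rw [← h1.liminf_eq]
      refine liminf_le_liminf (Eventually.of_forall fun k => ?_)
      simp only [Function.comp_apply, hD, smul_eq_mul]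
      rw [enorm_mul, Real.enorm_eq_ofReal (inv_nonneg.2 (hη0 k).le), ENNReal.ofReal_inv_of_pos (hη0 k)]
      gcongr
      rw [← edist_eq_enorm_sub, edist_comm]
      simpa using (lipschitzWith_distFun (X := X) i) (IccExtend hT p.2 p.1)
        (IccExtend hT p.2 (p.1 + η k))
    have hDk : ∀ k, ∫⁻ p, D k p ∂((volume.restrict (Ioo 0 T)).prod π₀) ≤ S := fun k => by
      have hη1 : ENNReal.ofReal (η k) ≠ 0 := by simpa using hη0 k
      have hηtop : (ENNReal.ofReal (η k))⁻¹ ≠ ∞ := ENNReal.inv_ne_top.2 hη1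
      simp only [hD]
      rw [lintegral_const_mul' _ _ hηtop, lintegral_prod _ (hDc k).measurable.aemeasurable]
      -- Lower semicontinuity: the integrand is continuous and nonnegative but possibly unbounded,
      -- so only an inequality survives in the limit.
      have hpt : ∀ r : ℝ, ∫⁻ γ : Curves T X, edist (IccExtend hT γ r) (IccExtend hT γ (r + η k)) ∂π₀ ≤
          liminf (fun n => ∫⁻ γ : Curves T X, edist (IccExtend hT γ r)
            (IccExtend hT γ (r + η k)) ∂(π n)) atTop := fun r => by
        simp only [edist_dist]
        refine lintegral_le_liminf_lintegral_of_forall_isOpen_measure_le_liminf_measure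
          (f := fun γ : Curves T X => dist (IccExtend hT γ r) (IccExtend hT γ (r + η k)))
          ?_ (fun γ => dist_nonneg) fun U hU => measure_le_liminf_of_tendsto hlim hU
        exact ((continuous_uncurry_extend hT).comp (continuous_const.prodMk continuous_id)).dist
          ((continuous_uncurry_extend hT).comp (continuous_const.prodMk continuous_id))
      calc _ ≤ (ENNReal.ofReal (η k))⁻¹ * ∫⁻ r in Ioo 0 T, liminf (fun n => ∫⁻ γ : Curves T X,
            edist (IccExtend hT γ r) (IccExtend hT γ (r + η k)) ∂(π n)) atTop := by
            gcongr with r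
            exact hpt r
        _ ≤ (ENNReal.ofReal (η k))⁻¹ * liminf (fun n => ∫⁻ r in Ioo 0 T, ∫⁻ γ : Curves T X,
            edist (IccExtend hT γ r) (IccExtend hT γ (r + η k)) ∂(π n)) atTop := by
            gcongr
            exact lintegral_liminf_le fun n => (hDc k).measurable.lintegral_prod_right'
        _ ≤ (ENNReal.ofReal (η k))⁻¹ * liminf (fun n : ℕ => ENNReal.ofReal (η k) * S) atTop := by
            refine mul_le_mul_right (liminf_le_liminf (Eventually.of_forall fun n => ?_)) _
            exact (lintegral_edist_extend_le (hG n) (hη0 k)).trans (mul_le_mul_right (hSn n) _)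
        _ = S := by
            rw [liminf_const, ← mul_assoc, ENNReal.inv_mul_cancel hη1 ENNReal.ofReal_ne_top, one_mul]
    refine ne_top_of_le_ne_top (b := S) (by simp [hS, ENNReal.mul_eq_top]) ?_
    calc _ ≤ ∫⁻ p, liminf (fun k => D k p) atTop ∂((volume.restrict (Ioo 0 T)).prod π₀) :=
          lintegral_mono_ae hle
      _ ≤ liminf (fun k => ∫⁻ p, D k p ∂((volume.restrict (Ioo 0 T)).prod π₀)) atTop :=
          lintegral_liminf_le hDm
      _ ≤ liminf (fun _ : ℕ => S) atTop := liminf_le_liminf (Eventually.of_forall hDk)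
      _ = S := liminf_const _
  · filter_upwards [hac] with γ hγ s hs t ht hst
    refine (edist_le_iSup_distFun _ _).trans (iSup_le fun i => ?_)
    have h1 := ((hγ (distFun X i).1 1 (lipschitzWith_distFun i)).mono (by
      rw [uIcc_of_le hT, uIcc_of_le hst]
      exact Icc_subset_Icc hs.1 ht.2 : uIcc s t ⊆ uIcc 0 T)).integral_deriv_eq_sub
    rw [edist_comm, edist_dist, Real.dist_eq, ← h1, ← Real.norm_eq_abs, ofReal_norm,
      intervalIntegral.integral_of_le hst, integral_Ioc_eq_integral_Ioo]
    exact (enorm_integral_le_lintegral_enorm _).trans (lintegral_mono fun r =>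
      le_iSup (fun i => ‖q i (r, γ)‖ₑ) i)

end limits

/-! ### The limit of the differential equations -/

section limitODE

variable {X : Type*} [MetricSpace X] [SecondCountableTopology X] [MeasurableSpace X] [BorelSpace X]
  {T : ℝ} (hT : 0 ≤ T) {mn : ℕ → Measure X} {m : Measure X} [∀ n, BoundedlyFinite (mn n)]
  [BoundedlyFinite m] {bn : ∀ n, TimeDerivation T (mn n)} {b : TimeDerivation T m} {D : Set (LipB X)}
  {π : ℕ → Measure (Curves T X)} {π₀ : Measure (Curves T X)}
  [∀ n, IsProbabilityMeasure (π n)] [IsProbabilityMeasure π₀]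

/-- The defect of a curve in the differential equation tested with `f`. -/
noncomputable def TimeDerivation.defect (b : TimeDerivation T m) (f : LipB X)
    (p : ℝ × Curves T X) : ℝ :=
  deriv (fun s => f.1 (IccExtend hT p.2 s)) p.1 - b.rep f p.1 (IccExtend hT p.2 p.1)

theorem TimeDerivation.measurable_defect (b : TimeDerivation T m) (f : LipB X) :
    Measurable (b.defect hT f) :=
  (measurable_deriv_extend hT (continuous_lipB f)).sub
    (measurable_rep_extend hT (b.measurable_rep f))

/-- Strong convergence tested with weighted measures on curves. -/
theorem StrongConv.tendsto_curves (h : StrongConv bn b D) {f : LipB X} (hf : f ∈ D) {K : ℝ≥0}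
    (hK : ∀ n t, (π n).map (fun γ => γ t) ≤ K • mn n) (hK₀ : ∀ t, π₀.map (fun γ => γ t) ≤ K • m)
    {W : ℕ → ℝ → Curves T X → ℝ} {W₀ : ℝ → Curves T X → ℝ} {B : ℝ≥0}
    (hW : ∀ n, Measurable (Function.uncurry (W n))) (hW₀ : Measurable (Function.uncurry W₀))
    (hWB : ∀ n r γ, 0 ≤ W n r γ ∧ W n r γ ≤ B) (hWB₀ : ∀ r γ, 0 ≤ W₀ r γ ∧ W₀ r γ ≤ B)
    (h1 : ∀ n, ∀ r ∈ Ioo 0 T, ∫ γ, W n r γ ∂(π n) = 1)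
    (h1₀ : ∀ r ∈ Ioo 0 T, ∫ γ, W₀ r γ ∂π₀ = 1)
    (hlim : ∀ r ∈ Ioo 0 T, ∀ g : X →ᵇ ℝ, Tendsto
      (fun n => ∫ γ : Curves T X, g (IccExtend hT γ r) * W n r γ ∂(π n)) atTop
      (𝓝 (∫ γ : Curves T X, g (IccExtend hT γ r) * W₀ r γ ∂π₀))) :
    Integrable (fun p : ℝ × Curves T X => b.rep f p.1 (IccExtend hT p.2 p.1) * W₀ p.1 p.2)
      ((volume.restrict (Ioo 0 T)).prod π₀) ∧
    Tendsto (fun n => ∫ r in Ioo 0 T, ∫ γ : Curves T X,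
        (bn n).rep f r (IccExtend hT γ r) * W n r γ ∂(π n)) atTop
      (𝓝 (∫ r in Ioo 0 T, ∫ γ : Curves T X, b.rep f r (IccExtend hT γ r) * W₀ r γ ∂π₀)) := by
  set e : ℝ → Curves T X → X := fun r γ => IccExtend hT γ r with he
  have hem : Measurable (Function.uncurry e) := (continuous_uncurry_extend hT).measurable
  have het : ∀ r, Measurable (e r) := fun r => hem.comp measurable_prodMk_left
  -- The weights on curves are pushed to `X` at each time. Strong convergence needs the resulting
  -- bounded densities to be measurable in `(t, x)`.
  choose v hvm hvB hv using fun n => exists_measurable_density (ν := π n) (m := mn n) hem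
    (fun t => hK n (projIcc 0 T hT t)) (hW n) (fun r γ => (hWB n r γ).2)
  obtain ⟨w, hwm, hwB, hw⟩ := exists_measurable_density (ν := π₀) (m := m) hem
    (fun t => hK₀ (projIcc 0 T hT t)) hW₀ (fun r γ => (hWB₀ r γ).2)
  have hint : ∀ {μ : Measure X} {ν : Measure (Curves T X)} {u : X → ℝ} {U : Curves T X → ℝ} (r : ℝ),
      Measurable u → Measurable U → (∀ x, 0 ≤ u x) → (∀ γ, 0 ≤ U γ) →
      (densMeasure ν U).map (e r) = densMeasure μ u → ∀ g : X → ℝ, Measurable g →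
      ∫ x, g x * u x ∂μ = ∫ γ, g (e r γ) * U γ ∂ν := fun r hu hU hu0 hU0 hd g hg => by
    rw [← integral_densMeasure hu hu0 g, ← hd, integral_map (het r).aemeasurable
      hg.aestronglyMeasurable, integral_densMeasure hU hU0]
  have hprob : ∀ {μ : Measure X} {ν : Measure (Curves T X)} {u : X → ℝ} {U : Curves T X → ℝ} (r : ℝ),
      IsProbabilityMeasure ν → Measurable U → (∀ γ, 0 ≤ U γ ∧ U γ ≤ B) → ∫ γ, U γ ∂ν = 1 →
      (densMeasure ν U).map (e r) = densMeasure μ u →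
      IsProbabilityMeasure (densMeasure μ u) := fun {μ ν u U} r hν hU hU0 h1 hd => by
    have hi : Integrable U ν := Integrable.of_bound hU.aestronglyMeasurable B
      (Eventually.of_forall fun γ => by rw [Real.norm_of_nonneg (hU0 γ).1]; exact (hU0 γ).2)
    have := isProbabilityMeasure_dens hi (fun γ => (hU0 γ).1) h1
    rw [← hd]
    exact Measure.isProbabilityMeasure_map (het r).aemeasurable
  have hWr : ∀ n r, Measurable (W n r) := fun n r => (hW n).comp measurable_prodMk_left
  have hW₀r : ∀ r, Measurable (W₀ r) := fun r => hW₀.comp measurable_prodMk_left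
  have hvr : ∀ n r, Measurable (v n r) := fun n r => (hvm n).comp measurable_prodMk_left
  have hwr : ∀ r, Measurable (w r) := fun r => hwm.comp measurable_prodMk_left
  have hIn : ∀ n r (g : X → ℝ), Measurable g →
      ∫ x, g x * v n r x ∂(mn n) = ∫ γ, g (e r γ) * W n r γ ∂(π n) := fun n r =>
    hint r (hvr n r) (hWr n r) (fun x => (hvB n r x).1) (fun γ => (hWB n r γ).1) (hv n r)
  have hI₀ : ∀ r (g : X → ℝ), Measurable g →
      ∫ x, g x * w r x ∂m = ∫ γ, g (e r γ) * W₀ r γ ∂π₀ := fun r =>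
    hint r (hwr r) (hW₀r r) (fun x => (hwB r x).1) (fun γ => (hWB₀ r γ).1) (hw r)
  have key := h f hf ((B * K : ℝ≥0) : ℝ) v w hvm hwm hvB hwB
    (Eventually.of_forall fun n r hr => hprob r inferInstance (hWr n r) (hWB n r) (h1 n r hr) (hv n r))
    (fun r hr => hprob r inferInstance (hW₀r r) (hWB₀ r) (h1₀ r hr) (hw r)) (fun r hr g _ => by
      rw [integral_densMeasure (hwr r) (fun x => (hwB r x).1), hI₀ r _ g.continuous.measurable]
      refine (hlim r hr g).congr fun n => ?_
      rw [integral_densMeasure (hvr n r) (fun x => (hvB n r x).1), hIn n r _ g.continuous.measurable])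
  have hrep : ∀ n r, Measurable ((bn n).rep f r) := fun n r =>
    ((bn n).measurable_rep f).comp measurable_prodMk_left
  have hrep₀ : ∀ r, Measurable (b.rep f r) := fun r =>
    (b.measurable_rep f).comp measurable_prodMk_left
  refine ⟨⟨((measurable_rep_extend hT (b.measurable_rep f)).mul hW₀).aestronglyMeasurable, ?_⟩, ?_⟩
  -- Absolute convergence is known on `X`. It is carried back to curves by integrating `|b_r(f)|`
  -- against the two descriptions of the same measure.
  · have h2 := key.1.2
    have hm1 : Measurable fun p : ℝ × X => b.rep f p.1 p.2 * w p.1 p.2 :=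
      (b.measurable_rep f).mul hwm
    have hm2 : Measurable fun p : ℝ × Curves T X =>
        b.rep f p.1 (IccExtend hT p.2 p.1) * W₀ p.1 p.2 :=
      (measurable_rep_extend hT (b.measurable_rep f)).mul hW₀
    rw [hasFiniteIntegral_iff_enorm, lintegral_prod _ hm1.enorm.aemeasurable] at h2
    rw [hasFiniteIntegral_iff_enorm, lintegral_prod _ hm2.enorm.aemeasurable]
    refine (le_of_eq (lintegral_congr fun r => ?_)).trans_lt h2
    have hen : ∀ {a c : ℝ}, 0 ≤ c → ‖a * c‖ₑ = ENNReal.ofReal c * ‖a‖ₑ := fun hc => by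
      rw [enorm_mul, Real.enorm_eq_ofReal hc, mul_comm]
    have h3 := congrArg (fun μ => ∫⁻ x, ‖b.rep f r x‖ₑ ∂μ) (hw r)
    simp only [densMeasure] at h3
    rw [lintegral_map (hrep₀ r).enorm (het r), lintegral_withDensity_eq_lintegral_mul _
      (hW₀r r).ennreal_ofReal (g := fun γ => ‖b.rep f r (e r γ)‖ₑ) ((hrep₀ r).comp (het r)).enorm,
      lintegral_withDensity_eq_lintegral_mul _
      (hwr r).ennreal_ofReal (hrep₀ r).enorm] at h3
    simp only [hen (hWB₀ r _).1, hen (hwB r _).1]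
    exact h3
  · have h2 := key.2
    simp only [hI₀ _ _ (hrep₀ _), hIn _ _ _ (hrep _ _)] at h2
    exact h2

/-- Outside `(s,t)` the two weights coincide and cancel, so the difference isolates the contribution
of that interval. -/
theorem integral_weight_sub {π : Measure (Curves T X)} [IsProbabilityMeasure π]
    {ρ : ℝ × Curves T X → ℝ}
    (hρ : Integrable ρ ((volume.restrict (Ioo 0 T)).prod π)) {s t : ℝ} (hs : 0 ≤ s) (ht : t ≤ T)
    {ψ : Curves T X → ℝ} (hψ : Measurable ψ) {C : ℝ} (hψC : ∀ γ, |ψ γ| ≤ C) :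
    (∫ r in Ioo 0 T, ∫ γ : Curves T X, ρ (r, γ) * (if r ∈ Ioo s t then ψ γ else 1) ∂π) -
      ∫ r in Ioo 0 T, ∫ γ : Curves T X, ρ (r, γ) ∂π =
    ∫ γ : Curves T X, (ψ γ - 1) * (∫ r in Ioo s t, ρ (r, γ)) ∂π := by
  have hm1 : MeasurableSet {p : ℝ × Curves T X | p.1 ∈ Ioo s t} := measurable_fst measurableSet_Ioo
  have hi1 : Integrable (fun p : ℝ × Curves T X => ρ p * (if p.1 ∈ Ioo s t then ψ p.2 else 1))
      ((volume.restrict (Ioo 0 T)).prod π) := by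
    refine hρ.mul_bdd (c := max C 1) (Measurable.ite hm1 (hψ.comp measurable_snd)
      measurable_const).aestronglyMeasurable (Eventually.of_forall fun p => ?_)
    split_ifs
    · exact (hψC _).trans (le_max_left _ _)
    · simp
  have hi2 : Integrable (fun p : ℝ × Curves T X => ρ p * (if p.1 ∈ Ioo s t then ψ p.2 else 1) - ρ p)
      ((volume.restrict (Ioo 0 T)).prod π) := hi1.sub hρ
  rw [← integral_prod _ hi1, ← integral_prod _ hρ, ← integral_sub hi1 hρ, integral_prod_symm _
    hi2]
  refine integral_congr_ae (Eventually.of_forall fun γ => ?_)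
  simp only
  rw [← integral_const_mul]
  have h1 : (volume : Measure ℝ).restrict (Ioo s t) =
      (volume.restrict (Ioo 0 T)).restrict (Ioo s t) := by
    rw [Measure.restrict_restrict measurableSet_Ioo, inter_eq_left.2 (Ioo_subset_Ioo hs ht)]
  rw [h1, ← integral_indicator (measurableSet_Ioo : MeasurableSet (Ioo s t))]
  refine integral_congr_ae (Eventually.of_forall fun r => ?_)
  by_cases hr : r ∈ Ioo s t
  · simp only [if_pos hr, indicator_of_mem hr]
    ring
  · simp only [if_neg hr, indicator_of_notMem hr]
    ring

set_option maxHeartbeats 1000000 in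
/-- The integrated defect of the limit is uncorrelated with continuous functions. -/
theorem StrongConv.integral_mul_defect (h : StrongConv bn b D) {f : LipB X} (hf : f ∈ D) {K : ℝ≥0}
    (hK : ∀ n t, (π n).map (fun γ => γ t) ≤ K • mn n) (hK₀ : ∀ t, π₀.map (fun γ => γ t) ≤ K • m)
    (hlim : ∀ Φ : Curves T X →ᵇ ℝ, Tendsto (fun n => ∫ γ, Φ γ ∂(π n)) atTop (𝓝 (∫ γ, Φ γ ∂π₀)))
    {G : ℕ → ℝ × Curves T X → ℝ≥0∞} (hG : ∀ n, HasSpeedBound hT (π n) (G n))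
    {G₀ : ℝ × Curves T X → ℝ≥0∞} (hG₀ : HasSpeedBound hT π₀ G₀)
    (hode : ∀ n, ∀ᵐ p ∂((volume.restrict (Ioo 0 T)).prod (π n)),
      HasDerivAt (fun s => f.1 (IccExtend hT p.2 s)) ((bn n).rep f p.1 (IccExtend hT p.2 p.1)) p.1) :
    Integrable (b.defect hT f) ((volume.restrict (Ioo 0 T)).prod π₀) ∧
    ∀ s t : ℝ, 0 ≤ s → s ≤ t → t ≤ T → ∀ ψ : Curves T X →ᵇ ℝ, (∀ γ, 1 ≤ ψ γ ∧ ψ γ ≤ 2) →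
      ∫ γ : Curves T X, ψ γ * (∫ r in Ioo s t, b.defect hT f (r, γ)) ∂π₀ =
        (∫ γ, ψ γ ∂π₀) * ∫ γ : Curves T X, (∫ r in Ioo s t, b.defect hT f (r, γ)) ∂π₀ := by
  have hcontE : ∀ r : ℝ, Continuous fun γ : Curves T X => IccExtend hT γ r := fun r =>
    (continuous_uncurry_extend hT).comp (continuous_const.prodMk continuous_id)
  obtain ⟨L, hL⟩ := f.2.1
  obtain ⟨C, hC⟩ := f.2.2
  have hdi : ∀ n, Integrable (fun p : ℝ × Curves T X => deriv (fun s => f.1 (IccExtend hT p.2 s)) p.1)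
      ((volume.restrict (Ioo 0 T)).prod (π n)) := fun n => (hG n).integrable_deriv hL
  have hdi₀ : Integrable (fun p : ℝ × Curves T X => deriv (fun s => f.1 (IccExtend hT p.2 s)) p.1)
      ((volume.restrict (Ioo 0 T)).prod π₀) := hG₀.integrable_deriv hL
  have hri : ∀ n, Integrable (fun p : ℝ × Curves T X => (bn n).rep f p.1 (IccExtend hT p.2 p.1))
      ((volume.restrict (Ioo 0 T)).prod (π n)) := fun n => (hdi n).congr (by
    filter_upwards [hode n] with p hp
    exact hp.deriv)
  have hbc : ∀ (r : ℝ) (g : X →ᵇ ℝ), ∃ g' : Curves T X →ᵇ ℝ, ∀ γ, g' γ = g (IccExtend hT γ r) :=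
    fun r g => ⟨g.compContinuous ⟨_, hcontE r⟩, fun γ => rfl⟩
  -- the constant weight
  have hone := h.tendsto_curves hT hf (W := fun _ _ _ => 1) (W₀ := fun _ _ => 1) (B := 1) hK hK₀
    (fun _ => measurable_const) measurable_const (fun _ _ _ => ⟨zero_le_one, le_rfl⟩)
    (fun _ _ => ⟨zero_le_one, le_rfl⟩) (fun n r _ => by simp) (fun r _ => by simp) (fun r _ g => by
      obtain ⟨g', hg'⟩ := hbc r g
      simp only [mul_one, ← hg']
      exact hlim g')
  simp only [mul_one] at hone
  have hri₀ := hone.1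
  have hzi : Integrable (b.defect hT f) ((volume.restrict (Ioo 0 T)).prod π₀) := hdi₀.sub hri₀
  refine ⟨hzi, fun s t hs hst ht ψ hψ => ?_⟩
  have hψi : ∀ (μ : Measure (Curves T X)) [IsProbabilityMeasure μ], Integrable ψ μ := fun μ _ =>
    ψ.integrable μ
  -- As `ψ ≥ 1`, the normalising constants are at least `1`; with `ψ ≤ 2` the normalised weights
  -- stay below `2`.
  have hκ : ∀ (μ : Measure (Curves T X)) [IsProbabilityMeasure μ], 1 ≤ ∫ γ, ψ γ ∂μ := fun μ _ => by
    have := integral_mono (integrable_const (1 : ℝ)) (hψi μ) fun γ => (hψ γ).1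
    simpa using this
  set κ : ℕ → ℝ := fun n => ∫ γ, ψ γ ∂(π n) with hκn
  set κ₀ : ℝ := ∫ γ, ψ γ ∂π₀ with hκ₀
  have hκpos : ∀ n, 1 ≤ κ n := fun n => hκ (π n)
  have hκpos₀ : 1 ≤ κ₀ := hκ π₀
  have hκlim : Tendsto κ atTop (𝓝 κ₀) := hlim ψ
  have hwt : ∀ {c : ℝ}, 1 ≤ c → ∀ γ, 0 ≤ ψ γ / c ∧ ψ γ / c ≤ 2 := fun {c} hc γ =>
    ⟨div_nonneg (by linarith [(hψ γ).1]) (by linarith), (div_le_self (by linarith [(hψ γ).1]) hc).trans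
      (hψ γ).2⟩
  have hψm : ∀ c : ℝ, Measurable fun γ => ψ γ / c := fun c => ψ.continuous.measurable.div_const c
  have hψabs : ∀ {c : ℝ}, 1 ≤ c → ∀ γ, |ψ γ / c| ≤ 2 := fun hc γ => by
    rw [abs_of_nonneg (hwt hc γ).1]
    exact (hwt hc γ).2
  have hWm : ∀ c : ℝ, Measurable (Function.uncurry fun (r : ℝ) (γ : Curves T X) =>
      if r ∈ Ioo s t then ψ γ / c else 1) := fun c =>
    Measurable.ite (measurable_fst measurableSet_Ioo) ((hψm c).comp measurable_snd) measurable_const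
  have hWB : ∀ {c : ℝ}, 1 ≤ c → ∀ (r : ℝ) (γ : Curves T X),
      0 ≤ (if r ∈ Ioo s t then ψ γ / c else 1) ∧
        (if r ∈ Ioo s t then ψ γ / c else 1) ≤ ((2 : ℝ≥0) : ℝ) := fun hc r γ => by
    split_ifs
    · exact hwt hc γ
    · exact ⟨zero_le_one, by norm_num⟩
  -- The weight has mean one at every time: `ψ` divided by its mean on `(s,t)`, and `1` elsewhere.
  -- Subtracting the limit for the constant weight removes the other times.
  have htwo := (h.tendsto_curves hT hf (B := 2)
    (W := fun n r γ => if r ∈ Ioo s t then ψ γ / κ n else 1)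
    (W₀ := fun r γ => if r ∈ Ioo s t then ψ γ / κ₀ else 1) hK hK₀ (fun n => hWm _) (hWm _)
    (fun n => hWB (hκpos n)) (hWB hκpos₀) (fun n r _ => by
      split_ifs
      · rw [integral_div, div_self (by linarith [hκpos n])]
      · simp) (fun r _ => by
      split_ifs
      · rw [integral_div, div_self (by linarith)]
      · simp) (fun r _ g => by
      obtain ⟨g', hg'⟩ := hbc r g
      split_ifs
      · simp only [← hg', ← mul_div_assoc, integral_div]
        exact (hlim (g' * ψ)).div hκlim (by linarith)
      · simp only [mul_one, ← hg']
        exact hlim g')).2.sub hone.2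
  -- the increments of `f`
  obtain ⟨fs, hfs⟩ := hbc s (BoundedContinuousFunction.ofNormedAddCommGroup f.1 (continuous_lipB f) C hC)
  obtain ⟨ft, hft⟩ := hbc t (BoundedContinuousFunction.ofNormedAddCommGroup f.1 (continuous_lipB f) C hC)
  simp only [BoundedContinuousFunction.coe_ofNormedAddCommGroup] at hfs hft
  have hincr : ∀ {μ : Measure (Curves T X)} {G : ℝ × Curves T X → ℝ≥0∞} [IsProbabilityMeasure μ],
      HasSpeedBound hT μ G → ∀ᵐ γ : Curves T X ∂μ,
        ∫ r in Ioo s t, deriv (fun s => f.1 (IccExtend hT γ s)) r = (ft - fs) γ := by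
    intro μ G _ hG
    filter_upwards [hG.ae_isAC] with γ hγ
    rw [← integral_Ioc_eq_integral_Ioo, ← intervalIntegral.integral_of_le hst,
      hγ.integral_deriv hT hL ⟨hs, hst.trans ht⟩ ⟨hs.trans hst, ht⟩, BoundedContinuousFunction.sub_apply,
      hfs, hft]
  -- By the differential equation the integral of `b_n(f)` along a curve is an increment of `f`.
  -- This is a bounded continuous function of the curve, so the right-hand side converges.
  have hL1 : ∀ n, (∫ r in Ioo 0 T, ∫ γ : Curves T X, (bn n).rep f r (IccExtend hT γ r) *
        (if r ∈ Ioo s t then ψ γ / κ n else 1) ∂(π n)) -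
      ∫ r in Ioo 0 T, ∫ γ : Curves T X, (bn n).rep f r (IccExtend hT γ r) ∂(π n) =
      (∫ γ, (ψ * (ft - fs)) γ ∂(π n)) / κ n - ∫ γ, (ft - fs) γ ∂(π n) := fun n => by
    rw [integral_weight_sub (hri n) hs ht (hψm (κ n)) (hψabs (hκpos n)), ← integral_div, ← integral_sub
      (((ψ * (ft - fs)).integrable (π n)).div_const _) ((ft - fs).integrable (π n))]
    refine integral_congr_ae ?_
    have h1 := (Measure.ae_ae_comm (p := fun r (γ : Curves T X) =>
      HasDerivAt (fun s => f.1 (IccExtend hT γ s)) ((bn n).rep f r (IccExtend hT γ r)) r)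
      (measurableSet_hasDerivAt_extend hT (continuous_lipB f) ((bn n).measurable_rep f))).1
      (Measure.ae_ae_of_ae_prod (hode n))
    filter_upwards [h1, hincr (hG n)] with γ hγ hγ'
    rw [← hγ', BoundedContinuousFunction.mul_apply, ← hγ']
    have h2 : ∫ r in Ioo s t, (bn n).rep f r (IccExtend hT γ r) =
        ∫ r in Ioo s t, deriv (fun s => f.1 (IccExtend hT γ s)) r := by
      refine integral_congr_ae ?_
      filter_upwards [ae_restrict_of_ae_restrict_of_subset (Ioo_subset_Ioo hs ht) hγ] with r hr
      exact hr.deriv.symm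
    rw [h2]
    ring
  have hR := ((hlim (ψ * (ft - fs))).div hκlim (by linarith)).sub (hlim (ft - fs))
  have heq := tendsto_nhds_unique htwo (hR.congr fun n => (hL1 n).symm)
  rw [integral_weight_sub hri₀ hs ht (hψm κ₀) (hψabs hκpos₀)] at heq
  have hrst : ∀ {ρ : ℝ × Curves T X → ℝ}, Integrable ρ ((volume.restrict (Ioo 0 T)).prod π₀) →
      Integrable ρ ((volume.restrict (Ioo s t)).prod π₀) := fun hρ =>
    hρ.mono_measure (Measure.prod_mono (Measure.restrict_mono (Ioo_subset_Ioo hs ht) le_rfl) le_rfl)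
  have hRi : Integrable (fun γ : Curves T X => ∫ r in Ioo s t, b.rep f r (IccExtend hT γ r)) π₀ :=
    (hrst hri₀).integral_prod_right
  have hZ : ∀ᵐ γ : Curves T X ∂π₀, ∫ r in Ioo s t, b.defect hT f (r, γ) =
      (ft - fs) γ - ∫ r in Ioo s t, b.rep f r (IccExtend hT γ r) := by
    filter_upwards [hincr hG₀, (hrst hdi₀).prod_left_ae, (hrst hri₀).prod_left_ae] with γ h1 h2 h3
    rw [← h1]
    exact integral_sub h2 h3
  have hF : Integrable (fun γ => (ft - fs) γ) π₀ := (ft - fs).integrable π₀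
  have hψR : Integrable (fun γ : Curves T X => ψ γ * ∫ r in Ioo s t, b.rep f r (IccExtend hT γ r)) π₀ :=
    hRi.bdd_mul (c := 2) ψ.continuous.aestronglyMeasurable (Eventually.of_forall fun γ => by
      rw [Real.norm_eq_abs, abs_of_nonneg (by linarith [(hψ γ).1])]
      exact (hψ γ).2)
  have hψF : Integrable (fun γ => ψ γ * (ft - fs) γ) π₀ := (ψ * (ft - fs)).integrable π₀
  have e1 : ∫ γ : Curves T X, ψ γ * (∫ r in Ioo s t, b.defect hT f (r, γ)) ∂π₀ =
      ∫ γ, ψ γ * (ft - fs) γ ∂π₀ -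
        ∫ γ : Curves T X, ψ γ * (∫ r in Ioo s t, b.rep f r (IccExtend hT γ r)) ∂π₀ := by
    rw [← integral_sub hψF hψR]
    refine integral_congr_ae ?_
    filter_upwards [hZ] with γ hγ
    rw [hγ, mul_sub]
  have e2 : ∫ γ : Curves T X, (∫ r in Ioo s t, b.defect hT f (r, γ)) ∂π₀ = ∫ γ, (ft - fs) γ ∂π₀ -
      ∫ γ : Curves T X, (∫ r in Ioo s t, b.rep f r (IccExtend hT γ r)) ∂π₀ := by
    rw [← integral_sub hF hRi]
    exact integral_congr_ae hZ
  have e3 : ∫ γ : Curves T X, (ψ γ / κ₀ - 1) * (∫ r in Ioo s t, b.rep f r (IccExtend hT γ r)) ∂π₀ =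
      (∫ γ : Curves T X, ψ γ * (∫ r in Ioo s t, b.rep f r (IccExtend hT γ r)) ∂π₀) / κ₀ -
        ∫ γ : Curves T X, (∫ r in Ioo s t, b.rep f r (IccExtend hT γ r)) ∂π₀ := by
    rw [← integral_div, ← integral_sub (hψR.div_const _) hRi]
    refine integral_congr_ae (Eventually.of_forall fun γ => ?_)
    simp only
    ring
  rw [e3] at heq
  simp only [BoundedContinuousFunction.mul_apply] at heq
  rw [e1, e2]
  have hne : κ₀ ≠ 0 := by linarith
  field_simp at heq
  linarith

/-- For test functions in `D`, the defect of the limit does not depend on the curve. -/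
theorem StrongConv.ae_defect_eq_integral (h : StrongConv bn b D) {f : LipB X} (hf : f ∈ D) {K : ℝ≥0}
    (hK : ∀ n t, (π n).map (fun γ => γ t) ≤ K • mn n) (hK₀ : ∀ t, π₀.map (fun γ => γ t) ≤ K • m)
    (hlim : ∀ Φ : Curves T X →ᵇ ℝ, Tendsto (fun n => ∫ γ, Φ γ ∂(π n)) atTop (𝓝 (∫ γ, Φ γ ∂π₀)))
    {G : ℕ → ℝ × Curves T X → ℝ≥0∞} (hG : ∀ n, HasSpeedBound hT (π n) (G n))
    {G₀ : ℝ × Curves T X → ℝ≥0∞} (hG₀ : HasSpeedBound hT π₀ G₀)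
    (hode : ∀ n, ∀ᵐ p ∂((volume.restrict (Ioo 0 T)).prod (π n)),
      HasDerivAt (fun s => f.1 (IccExtend hT p.2 s)) ((bn n).rep f p.1 (IccExtend hT p.2 p.1)) p.1) :
    ∀ᵐ r ∂(volume.restrict (Ioo 0 T)), ∃ c : ℝ, ∀ᵐ γ ∂π₀, b.defect hT f (r, γ) = c := by
  obtain ⟨hzi, hψ⟩ := h.integral_mul_defect hT hf hK hK₀ hlim hG hG₀ hode
  have hrst : ∀ {s t : ℝ}, 0 ≤ s → t ≤ T →
      Integrable (b.defect hT f) ((volume.restrict (Ioo s t)).prod π₀) := fun hs ht =>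
    hzi.mono_measure (Measure.prod_mono (Measure.restrict_mono (Ioo_subset_Ioo hs ht) le_rfl) le_rfl)
  set c : ℝ → ℝ := fun r => ∫ γ, b.defect hT f (r, γ) ∂π₀ with hc
  -- the integrated defects are constant
  have hconst : ∀ s t : ℝ, 0 ≤ s → s ≤ t → t ≤ T → ∀ᵐ γ ∂π₀,
      ∫ r in Ioo s t, b.defect hT f (r, γ) = ∫ r in Ioo s t, c r := fun s t hs hst ht => by
    set Z : Curves T X → ℝ := fun γ => ∫ r in Ioo s t, b.defect hT f (r, γ) with hZ
    have hZi : Integrable Z π₀ := (hrst hs ht).integral_prod_right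
    have hEZ : ∫ r in Ioo s t, c r = ∫ γ, Z γ ∂π₀ :=
      (integral_integral_swap (f := fun r γ => b.defect hT f (r, γ)) (hrst hs ht))
    -- A function uncorrelated with all continuous weights has centred integral zero over every
    -- closed set, hence is constant a.e.
    have h0 : (fun γ => Z γ - ∫ γ, Z γ ∂π₀) =ᵐ[π₀] 0 := by
      refine ae_eq_zero_of_forall_setIntegral_isClosed_eq_zero
        (hZi.sub (integrable_const _)) fun F hF => ?_
      rcases F.eq_empty_or_nonempty with rfl | hne
      · simp
      have hlF : ∀ {U : Curves T X → ℝ}, Integrable U π₀ →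
          Tendsto (fun j => ∫ γ, (lipIndicator F j).1 γ * U γ ∂π₀) atTop (𝓝 (∫ γ in F, U γ ∂π₀)) := by
        intro U hU
        rw [← integral_indicator hF.measurableSet]
        refine tendsto_integral_of_dominated_convergence (fun γ => ‖U γ‖)
          (fun j => (continuous_lipB _).aestronglyMeasurable.mul hU.1) hU.norm
          (fun j => Eventually.of_forall fun γ => ?_) (Eventually.of_forall fun γ => ?_)
        · rw [norm_mul, Real.norm_of_nonneg (lipIndicator_nonneg F j γ)]
          exact mul_le_of_le_one_left (_root_.norm_nonneg _) (lipIndicator_le_one F j γ)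
        · have h1 := (tendsto_lipIndicator hne hF γ).mul_const (U γ)
          by_cases hγ : γ ∈ F
          · simpa [indicator_of_mem hγ] using h1
          · simpa [indicator_of_notMem hγ] using h1
      have hj : ∀ j, ∫ γ, (lipIndicator F j).1 γ * (Z γ - ∫ γ, Z γ ∂π₀) ∂π₀ = 0 := fun j => by
        set l := (lipIndicator F j).1 with hl
        have hlc : Continuous l := continuous_lipB _
        have hlb : ∀ γ, |l γ| ≤ 1 := fun γ => by
          rw [abs_of_nonneg (lipIndicator_nonneg F j γ)]
          exact lipIndicator_le_one F j γ
        -- Adding `1` brings the weight into the admissible range `[1, 2]`; the constant part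
        -- contributes nothing to the covariance.
        set ψ : Curves T X →ᵇ ℝ := 1 + BoundedContinuousFunction.ofNormedAddCommGroup l hlc 1 hlb
          with hψd
        have hψa : ∀ γ, ψ γ = 1 + l γ := fun γ => rfl
        have h1 := hψ s t hs hst ht ψ fun γ => by
          rw [hψa]
          exact ⟨by linarith [lipIndicator_nonneg F j γ], by linarith [lipIndicator_le_one F j γ]⟩
        have hli : Integrable l π₀ := Integrable.of_bound hlc.aestronglyMeasurable 1
          (Eventually.of_forall hlb)
        have hlZ : Integrable (fun γ => l γ * Z γ) π₀ :=
          hZi.bdd_mul (c := 1) hlc.aestronglyMeasurable (Eventually.of_forall hlb)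
        change ∫ γ, ψ γ * Z γ ∂π₀ = (∫ γ, ψ γ ∂π₀) * ∫ γ, Z γ ∂π₀ at h1
        simp only [hψa, add_mul, one_mul] at h1
        rw [integral_add hZi hlZ, integral_add (integrable_const _) hli, integral_const,
          probReal_univ, one_smul] at h1
        simp only [mul_sub]
        rw [integral_sub hlZ (hli.mul_const _), integral_mul_const]
        linarith
      refine tendsto_nhds_unique (hlF (hZi.sub (integrable_const _))) ?_
      exact tendsto_const_nhds.congr fun j => (hj j).symm
    filter_upwards [h0] with γ hγ
    rw [hEZ]
    have : Z γ - ∫ γ, Z γ ∂π₀ = 0 := hγ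
    linarith
  -- hence so are the defects
  have hq : ∀ᵐ γ ∂π₀, ∀ q : ℚ, (q : ℝ) ∈ Icc 0 T →
      ∫ r in Ioo 0 (q : ℝ), b.defect hT f (r, γ) = ∫ r in Ioo 0 (q : ℝ), c r :=
    ae_all_iff.2 fun q => by
      by_cases hqT : (q : ℝ) ∈ Icc 0 T
      · filter_upwards [hconst 0 q le_rfl hqT.1 hqT.2] with γ hγ _
        exact hγ
      · exact Eventually.of_forall fun γ h' => (hqT h').elim
  have hci : Integrable c (volume.restrict (Ioo 0 T)) := hzi.integral_prod_left
  have hcm : Measurable c := (b.measurable_defect hT f).stronglyMeasurable.integral_prod_right'.measurable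
  have hms : MeasurableSet {p : ℝ × Curves T X | b.defect hT f p = c p.1} :=
    measurableSet_eq_fun (b.measurable_defect hT f) (hcm.comp measurable_fst)
  have hall : ∀ᵐ r ∂(volume.restrict (Ioo 0 T)), ∀ᵐ γ ∂π₀, b.defect hT f (r, γ) = c r := by
    refine (Measure.ae_ae_comm (p := fun r γ => b.defect hT f (r, γ) = c r) hms).2 ?_
    filter_upwards [hq, hzi.prod_left_ae] with γ hγ hγi
    have hy : IntervalIntegrable (fun r => b.defect hT f (r, γ) - c r) volume 0 T := by
      rw [intervalIntegrable_iff_integrableOn_Ioo_of_le hT]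
      exact hγi.sub hci
    -- The primitive vanishes at rational times and is continuous, so it vanishes throughout;
    -- Lebesgue differentiation then gives the pointwise equality.
    have hprim : ∀ x ∈ Ioo 0 T, ∫ r in (0 : ℝ)..x, (b.defect hT f (r, γ) - c r) = 0 := by
      have hcont : ContinuousOn (fun x => ∫ r in (0 : ℝ)..x, (b.defect hT f (r, γ) - c r)) (Icc 0 T) := by
        have := intervalIntegral.continuousOn_primitive_interval' hy (left_mem_uIcc)
        rwa [uIcc_of_le hT] at this
      intro x hx
      by_contra hne
      obtain ⟨q, hqI, hq0⟩ := Rat.denseRange_cast.exists_mem_open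
        ((hcont.mono Ioo_subset_Icc_self).isOpen_inter_preimage isOpen_Ioo isOpen_compl_singleton)
        ⟨x, hx, hne⟩
      refine hq0 ?_
      have hqT := Ioo_subset_Icc_self hqI
      change ∫ r in (0 : ℝ)..(q : ℝ), (b.defect hT f (r, γ) - c r) = 0
      rw [intervalIntegral.integral_of_le hqT.1, integral_Ioc_eq_integral_Ioo,
        integral_sub, hγ q hqT, sub_self]
      · exact IntegrableOn.mono_set (t := Ioo 0 T) hγi (Ioo_subset_Ioo_right hqT.2)
      · exact IntegrableOn.mono_set (t := Ioo 0 T) hci (Ioo_subset_Ioo_right hqT.2)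
    have hae := hy.ae_hasDerivAt_integral
    refine (ae_restrict_iff' measurableSet_Ioo).2 (hae.mono fun r hr hrT => ?_)
    have h1 := hr (by rw [uIcc_of_le hT]; exact Ioo_subset_Icc_self hrT) 0 left_mem_uIcc
    have h2 : HasDerivAt (fun x => ∫ r in (0 : ℝ)..x, (b.defect hT f (r, γ) - c r)) 0 r := by
      refine (hasDerivAt_const r (0 : ℝ)).congr_of_eventuallyEq ?_
      filter_upwards [Ioo_mem_nhds hrT.1 hrT.2] with x hx
      exact hprim x hx
    linarith [h1.unique h2]
  filter_upwards [hall] with r hr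
  exact ⟨c r, hr⟩

end limitODE

/-! ### Extension to all bounded Lipschitz functions -/

section weights

variable {X : Type*} [MetricSpace X] [SecondCountableTopology X] [MeasurableSpace X] [BorelSpace X]
  {m : Measure X} [BoundedlyFinite m]

/-- The weight is split into positive and negative parts. Each, pushed to `X`, is dominated by a
multiple of `m` on the ball, so that `tendsto_integral_toLin` applies. -/
theorem tendsto_integral_mul_toLin {Ω : Type*} [MeasurableSpace Ω] {π : Measure Ω}
    [IsFiniteMeasure π] {e : Ω → X} (he : Measurable e) {K : ℝ≥0} (hK : π.map e ≤ K • m)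
    {b : LipDerivation m}
    (h : Function.Surjective (NormedSpace.inclusionInDoubleDual ℝ (H12 m)) ∨ ∃ g, b.IsDivergence g)
    (hloc : ∀ (x : X) (r : ℝ), IntegrableOn b.norm (Metric.ball x r) m)
    {w : Ω → ℝ} (hw : Measurable w) {B : ℝ≥0} (hB : ∀ ω, |w ω| ≤ B) {x : X} {R : ℝ}
    (hsupp : ∀ ω, e ω ∉ Metric.ball x R → w ω = 0) {u : ℕ → LipB X} {f : LipB X} {L : ℝ≥0}
    (hu : ∀ k, LipschitzWith L (u k).1 ∧ ∀ x, |(u k).1 x| ≤ L)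
    (hlim : ∀ᵐ x ∂m, Tendsto (fun k => (u k).1 x) atTop (𝓝 (f.1 x))) :
    Tendsto (fun k => ∫ ω, w ω * b.toLin (u k) (e ω) ∂π) atTop
      (𝓝 (∫ ω, w ω * b.toLin f (e ω) ∂π)) := by
  have key : ∀ v : Ω → ℝ, Measurable v → (∀ ω, 0 ≤ v ω) → (∀ ω, v ω ≤ B) →
      (∀ ω, e ω ∉ Metric.ball x R → v ω = 0) →
      (∀ g : LipB X, Integrable (fun ω => v ω * b.toLin g (e ω)) π) ∧
      Tendsto (fun k => ∫ ω, v ω * b.toLin (u k) (e ω) ∂π) atTop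
        (𝓝 (∫ ω, v ω * b.toLin f (e ω) ∂π)) := by
    intro v hv hv0 hvB hvs
    have hle : densMeasure π v ≤ B • π.restrict (e ⁻¹' Metric.ball x R) := by
      refine Measure.le_iff.2 fun A hA => ?_
      have hb := he (Metric.isOpen_ball (x := x) (ε := R)).measurableSet
      rw [densMeasure, withDensity_apply _ hA, Measure.smul_apply, Measure.restrict_apply hA,
        inter_comm, ← Measure.restrict_apply hb]
      calc ∫⁻ ω in A, ENNReal.ofReal (v ω) ∂π
          ≤ ∫⁻ ω in A, (e ⁻¹' Metric.ball x R).indicator (fun _ => (B : ℝ≥0∞)) ω ∂π := by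
            refine lintegral_mono fun ω => ?_
            by_cases hω : ω ∈ e ⁻¹' Metric.ball x R
            · rw [indicator_of_mem hω]
              exact (ENNReal.ofReal_le_ofReal (hvB ω)).trans_eq ENNReal.ofReal_coe_nnreal
            · rw [hvs ω hω, ENNReal.ofReal_zero]
              exact zero_le
        _ = _ := lintegral_indicator_const hb _
    have hμ : (densMeasure π v).map e ≤ (B * K) • m.restrict (Metric.ball x R) := by
      refine (Measure.map_mono hle he).trans ?_
      rw [Measure.map_smul, ← Measure.restrict_map he Metric.isOpen_ball.measurableSet, mul_smul,
        ← Measure.restrict_smul K]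
      refine Measure.le_iff'.2 fun A => ?_
      exact mul_le_mul_right (Measure.restrict_mono le_rfl hK A) (B : ℝ≥0∞)
    have hm : ∀ g : LipB X, AEStronglyMeasurable (b.toLin g) ((densMeasure π v).map e) := fun g =>
      (AEEqFun.measurable _).aestronglyMeasurable
    have heq : ∀ g : LipB X, ∫ y, b.toLin g y ∂((densMeasure π v).map e) =
        ∫ ω, v ω * b.toLin g (e ω) ∂π := fun g => by
      rw [integral_map he.aemeasurable (hm g), integral_densMeasure hv hv0]
      simp only [mul_comm]
    refine ⟨fun g => ?_, ?_⟩
    · have h1 := (integrable_map_measure (hm g) he.aemeasurable).1 (integrable_toLin hloc hμ g)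
      have h2 := (integrable_withDensity_iff_integrable_smul' hv.ennreal_ofReal
        (Eventually.of_forall fun _ => ENNReal.ofReal_lt_top)).1 h1
      simpa only [ENNReal.toReal_ofReal (hv0 _), smul_eq_mul, Function.comp_apply] using h2
    · simp only [← heq]
      exact tendsto_integral_toLin h hloc hμ hu hlim
  obtain ⟨hp1, hp2⟩ := key (fun ω => max (w ω) 0) (hw.max measurable_const)
    (fun ω => le_max_right _ _) (fun ω => max_le ((le_abs_self _).trans (hB ω)) NNReal.zero_le_coe)
    fun ω hω => by rw [hsupp ω hω, max_self]
  obtain ⟨hn1, hn2⟩ := key (fun ω => max (-w ω) 0) (hw.neg.max measurable_const)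
    (fun ω => le_max_right _ _) (fun ω => max_le ((neg_le_abs _).trans (hB ω)) NNReal.zero_le_coe)
    fun ω hω => by rw [hsupp ω hω, neg_zero, max_self]
  have hdec : ∀ g : LipB X, ∫ ω, w ω * b.toLin g (e ω) ∂π =
      (∫ ω, max (w ω) 0 * b.toLin g (e ω) ∂π) - ∫ ω, max (-w ω) 0 * b.toLin g (e ω) ∂π := fun g => by
    rw [← integral_sub (hp1 g) (hn1 g)]
    refine integral_congr_ae (Eventually.of_forall fun ω => ?_)
    change w ω * b.toLin g (e ω) = max (w ω) 0 * b.toLin g (e ω) - max (-w ω) 0 * b.toLin g (e ω)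
    rw [← sub_mul, max_zero_sub_max_neg_zero_eq_self]
  simp only [hdec]
  exact hp2.sub hn2

end weights

/-! ### Weak limits of functions with proportional sections -/

section constancy

/-- If functions `Y k`, whose sections are multiples of the sections of `h`, converge weakly to `Y`,
then so are the sections of `Y`. -/
theorem ae_mul_eq_of_tendsto {α Ω : Type*} [MeasurableSpace α] [MeasurableSpace Ω] {μ : Measure α}
    {π : Measure Ω} [IsFiniteMeasure μ] [IsProbabilityMeasure π] {h : α × Ω → ℝ} (hh : Measurable h)
    (h01 : ∀ p, 0 ≤ h p ∧ h p ≤ 1) {Y : α × Ω → ℝ} (hYm : Measurable Y) (hY : Integrable Y (μ.prod π))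
    {Yk : ℕ → α × Ω → ℝ}
    (hlim : ∀ W : α × Ω → ℝ, Measurable W → (∀ p, |W p| ≤ 1) →
      Tendsto (fun k => ∫ p, W p * Yk k p ∂(μ.prod π)) atTop (𝓝 (∫ p, W p * Y p ∂(μ.prod π))))
    (hk : ∀ k, ∀ᵐ a ∂μ, ∃ c : ℝ, ∀ᵐ ω ∂π, Yk k (a, ω) = c * h (a, ω)) :
    ∀ᵐ a ∂μ, ∀ᵐ ω ∂π, (∫ ω', h (a, ω') ∂π) * Y (a, ω) = h (a, ω) * ∫ ω', Y (a, ω') ∂π := by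
  set A : α → ℝ := fun a => ∫ ω', h (a, ω') ∂π with hA
  set I : α → ℝ := fun a => ∫ ω', Y (a, ω') ∂π with hI
  have hAm : Measurable A := hh.stronglyMeasurable.integral_prod_right'.measurable
  have hIm : Measurable I := hYm.stronglyMeasurable.integral_prod_right'.measurable
  have hmean : ∀ v : Ω → ℝ, (∀ ω, 0 ≤ v ω ∧ v ω ≤ 1) → 0 ≤ ∫ ω, v ω ∂π ∧ ∫ ω, v ω ∂π ≤ 1 := fun v hv =>
    ⟨integral_nonneg fun ω => (hv ω).1, (integral_mono_of_nonneg
      (Eventually.of_forall fun ω => (hv ω).1) (integrable_const (1 : ℝ))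
      (Eventually.of_forall fun ω => (hv ω).2)).trans_eq (by simp)⟩
  have hA01 : ∀ a, 0 ≤ A a ∧ A a ≤ 1 := fun a => hmean _ fun ω => h01 _
  have hIi : Integrable (fun p : α × Ω => I p.1) (μ.prod π) := hY.integral_prod_left.comp_fst π
  have hAbs : ∀ p, |h p| ≤ 1 := fun p => by rw [abs_of_nonneg (h01 p).1]; exact (h01 p).2
  have hAY : Integrable (fun p : α × Ω => A p.1 * Y p) (μ.prod π) :=
    hY.bdd_mul (c := 1) (hAm.comp measurable_fst).aestronglyMeasurable (Eventually.of_forall fun p => by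
      rw [Real.norm_of_nonneg (hA01 _).1]; exact (hA01 _).2)
  have hhI : Integrable (fun p : α × Ω => h p * I p.1) (μ.prod π) :=
    hIi.bdd_mul (c := 1) hh.aestronglyMeasurable (Eventually.of_forall hAbs)
  have hmain : (fun p : α × Ω => A p.1 * Y p - h p * I p.1) =ᵐ[μ.prod π] 0 := by
    refine (hAY.sub hhI).ae_eq_zero_of_forall_setIntegral_eq_zero fun U hU _ => ?_
    set χ : α × Ω → ℝ := U.indicator fun _ => 1 with hχ
    have hχm : Measurable χ := measurable_const.indicator hU
    have hχ01 : ∀ p, 0 ≤ χ p ∧ χ p ≤ 1 := fun p => by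
      by_cases hp : p ∈ U
      · simp [hχ, hp]
      · simp [hχ, hp]
    set ub : α → ℝ := fun a => ∫ ω, χ (a, ω) * h (a, ω) ∂π with hub
    have hubm : Measurable ub := (hχm.mul hh).stronglyMeasurable.integral_prod_right'.measurable
    have hub01 : ∀ a, 0 ≤ ub a ∧ ub a ≤ 1 := fun a => hmean _ fun ω =>
      ⟨mul_nonneg (hχ01 _).1 (h01 _).1, mul_le_one₀ (hχ01 _).2 (h01 _).1 (h01 _).2⟩
    -- This test function has sections orthogonal to `h (a, ·)`: the integral of `W h` is `A ub - ub
    -- A = 0`. It is therefore orthogonal to every `Yk k`, and so to `Y`.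
    set W : α × Ω → ℝ := fun p => χ p * A p.1 - ub p.1 with hW
    have hWm : Measurable W := (hχm.mul (hAm.comp measurable_fst)).sub (hubm.comp measurable_fst)
    have hW1 : ∀ p, |W p| ≤ 1 := fun p => by
      have h1 : 0 ≤ χ p * A p.1 := mul_nonneg (hχ01 _).1 (hA01 _).1
      have h2 : χ p * A p.1 ≤ 1 := mul_le_one₀ (hχ01 _).2 (hA01 _).1 (hA01 _).2
      rw [hW, abs_le]
      constructor <;> linarith [(hub01 p.1).1, (hub01 p.1).2]
    have hhi : ∀ a, Integrable (fun ω => h (a, ω)) π := fun a =>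
      Integrable.of_bound (hh.comp measurable_prodMk_left).aestronglyMeasurable 1
        (Eventually.of_forall fun ω => hAbs _)
    have hχhi : ∀ a, Integrable (fun ω => χ (a, ω) * h (a, ω)) π := fun a =>
      Integrable.of_bound ((hχm.mul hh).comp measurable_prodMk_left).aestronglyMeasurable 1
        (Eventually.of_forall fun ω => by
          rw [Real.norm_of_nonneg (mul_nonneg (hχ01 _).1 (h01 _).1)]
          exact mul_le_one₀ (hχ01 _).2 (h01 _).1 (h01 _).2)
    have hzero : ∀ k, ∫ p, W p * Yk k p ∂(μ.prod π) = 0 := fun k => by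
      -- Integrability of the approximants is not assumed; without it the integral is zero by
      -- convention.
      by_cases hi : Integrable (fun p => W p * Yk k p) (μ.prod π)
      · rw [integral_prod _ hi]
        refine integral_eq_zero_of_ae ?_
        filter_upwards [hk k] with a ha
        obtain ⟨c, hc⟩ := ha
        have h1 : ∫ ω, W (a, ω) * Yk k (a, ω) ∂π =
            ∫ ω, (c * A a * (χ (a, ω) * h (a, ω)) - c * ub a * h (a, ω)) ∂π := by
          refine integral_congr_ae ?_
          filter_upwards [hc] with ω hω
          rw [hω]
          simp only [hW]
          ring
        rw [h1, integral_sub ((hχhi a).const_mul _) ((hhi a).const_mul _), integral_const_mul,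
          integral_const_mul]
        change c * A a * ub a - c * ub a * A a = 0
        ring
      · exact integral_undef hi
    have h0 := tendsto_nhds_unique (hlim W hWm hW1)
      (tendsto_const_nhds.congr fun k => (hzero k).symm)
    have hχabs : ∀ p, ‖χ p‖ ≤ 1 := fun p => by
      rw [Real.norm_of_nonneg (hχ01 p).1]; exact (hχ01 p).2
    have i1 : Integrable (fun p => χ p * (A p.1 * Y p)) (μ.prod π) :=
      hAY.bdd_mul hχm.aestronglyMeasurable (Eventually.of_forall hχabs)
    have i2 : Integrable (fun p : α × Ω => ub p.1 * Y p) (μ.prod π) :=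
      hY.bdd_mul (c := 1) (hubm.comp measurable_fst).aestronglyMeasurable
        (Eventually.of_forall fun p => by rw [Real.norm_of_nonneg (hub01 _).1]; exact (hub01 _).2)
    have i3 : Integrable (fun p => χ p * (h p * I p.1)) (μ.prod π) :=
      hhI.bdd_mul hχm.aestronglyMeasurable (Eventually.of_forall hχabs)
    have e1 : ∫ p, W p * Y p ∂(μ.prod π) =
        ∫ p, χ p * (A p.1 * Y p) ∂(μ.prod π) - ∫ p, ub p.1 * Y p ∂(μ.prod π) := by
      rw [← integral_sub i1 i2]
      refine integral_congr_ae (Eventually.of_forall fun p => ?_)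
      simp only [hW]
      ring
    have e2 : ∫ p, ub p.1 * Y p ∂(μ.prod π) = ∫ p, χ p * (h p * I p.1) ∂(μ.prod π) := by
      rw [integral_prod _ i2, integral_prod _ i3]
      refine integral_congr_ae (Eventually.of_forall fun a => ?_)
      simp only [← mul_assoc]
      rw [integral_const_mul, integral_mul_const]
    have e3 : ∫ p in U, (A p.1 * Y p - h p * I p.1) ∂(μ.prod π) =
        ∫ p, χ p * (A p.1 * Y p) ∂(μ.prod π) - ∫ p, χ p * (h p * I p.1) ∂(μ.prod π) := by
      rw [← integral_indicator hU, ← integral_sub i1 i3]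
      refine integral_congr_ae (Eventually.of_forall fun p => ?_)
      by_cases hp : p ∈ U
      · simp [hχ, hp]
      · simp [hχ, hp]
    change ∫ p in U, (A p.1 * Y p - h p * I p.1) ∂(μ.prod π) = 0
    rw [e3, ← e2, ← e1, h0]
  filter_upwards [Measure.ae_ae_of_ae_prod hmain] with a ha
  filter_upwards [ha] with ω hω
  exact sub_eq_zero.1 hω

end constancy

/-! ### Weak convergence of derivatives along curves -/

section derivatives

variable {X : Type*} [MetricSpace X] [SecondCountableTopology X] [MeasurableSpace X] [BorelSpace X]
  {T : ℝ} {hT : 0 ≤ T} {m : Measure X} [BoundedlyFinite m] {b : TimeDerivation T m}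
  {π₀ : Measure (Curves T X)} [IsProbabilityMeasure π₀]

theorem ae_extend_tendsto (hπ : ∀ t, π₀.map (fun γ => γ t) ≪ m) {u : ℕ → LipB X} {f : LipB X}
    (hlim : ∀ᵐ x ∂m, Tendsto (fun k => (u k).1 x) atTop (𝓝 (f.1 x))) (r : ℝ) :
    ∀ᵐ γ : Curves T X ∂π₀, Tendsto (fun k => (u k).1 (IccExtend hT γ r)) atTop
      (𝓝 (f.1 (IccExtend hT γ r))) :=
  ae_of_ae_map (f := fun γ : Curves T X => γ (projIcc 0 T hT r))
    (continuous_eval_const _).measurable.aemeasurable ((hπ (projIcc 0 T hT r)).ae_le hlim)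

/-- Weak convergence of the derivatives along curves. -/
theorem HasSpeedBound.tendsto_integral_mul_deriv {G : ℝ × Curves T X → ℝ≥0∞}
    (hG : HasSpeedBound hT π₀ G) (hπ : ∀ t, π₀.map (fun γ => γ t) ≪ m)
    {u : ℕ → LipB X} {f : LipB X} {L : ℝ≥0}
    (hu : ∀ k, LipschitzWith L (u k).1 ∧ ∀ x, |(u k).1 x| ≤ L)
    (hlim : ∀ᵐ x ∂m, Tendsto (fun k => (u k).1 x) atTop (𝓝 (f.1 x)))
    {w : ℝ × Curves T X → ℝ} (hw : Measurable w) {C : ℝ} (hC : ∀ p, |w p| ≤ C) :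
    Tendsto (fun k => ∫ p, w p * deriv (fun s => (u k).1 (IccExtend hT p.2 s)) p.1
        ∂((volume.restrict (Ioo 0 T)).prod π₀)) atTop
      (𝓝 (∫ p, w p * deriv (fun s => f.1 (IccExtend hT p.2 s)) p.1
        ∂((volume.restrict (Ioo 0 T)).prod π₀))) := by
  obtain ⟨Kf, hKf⟩ := f.2.1
  have hrect : ∀ (t : ℝ) (B : Set (Curves T X)), MeasurableSet B →
      Tendsto (fun k => ∫ p in Iic t ×ˢ B, deriv (fun s => (u k).1 (IccExtend hT p.2 s)) p.1
        ∂((volume.restrict (Ioo 0 T)).prod π₀)) atTop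
      (𝓝 (∫ p in Iic t ×ˢ B, deriv (fun s => f.1 (IccExtend hT p.2 s)) p.1
        ∂((volume.restrict (Ioo 0 T)).prod π₀))) := by
    intro t B hB
    -- The right end of the time interval, clamped to `[0,T]`.
    set τ : ℝ := max 0 (min t T) with hτ
    have hτT : τ ∈ Icc 0 T := ⟨le_max_left _ _, max_le hT (min_le_right _ _)⟩
    have hset : Iic t ∩ Ioc 0 T = Ioc 0 τ := by
      ext r
      simp only [mem_inter_iff, mem_Iic, mem_Ioc, hτ, le_max_iff, le_min_iff]
      constructor
      · rintro ⟨h1, h2, h3⟩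
        exact ⟨h2, Or.inr ⟨h1, h3⟩⟩
      · rintro ⟨h1, h2 | ⟨h2, h3⟩⟩
        · exact absurd h2 (not_le.2 h1)
        · exact ⟨h2, h1, h3⟩
    -- Over a time interval starting at `0` the derivative integrates to an increment, which
    -- converges by pointwise convergence of the functions.
    have heq : ∀ {g : LipB X} {Kg : ℝ≥0}, LipschitzWith Kg g.1 →
        ∫ p in Iic t ×ˢ B, deriv (fun s => g.1 (IccExtend hT p.2 s)) p.1
          ∂((volume.restrict (Ioo 0 T)).prod π₀) =
        ∫ γ : Curves T X in B, (g.1 (IccExtend hT γ τ) - g.1 (IccExtend hT γ 0)) ∂π₀ := by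
      intro g Kg hg
      have hi := (hG.integrable_deriv hg).restrict (s := Iic t ×ˢ B)
      rw [← Measure.prod_restrict, Measure.restrict_restrict measurableSet_Iic] at hi ⊢
      rw [integral_prod_symm _ hi]
      refine integral_congr_ae ?_
      filter_upwards [ae_restrict_of_ae hG.ae_isAC] with γ hγ
      have h1 := hγ.integral_deriv hT hg (left_mem_Icc.2 hT) hτT
      rw [intervalIntegral.integral_of_le hτT.1, ← hset, ← Measure.restrict_restrict measurableSet_Iic,
        ← restrict_Ioo_eq_restrict_Ioc, Measure.restrict_restrict measurableSet_Iic] at h1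
      exact h1
    rw [heq hKf]
    refine (tendsto_integral_of_dominated_convergence (fun _ => 2 * (L : ℝ)) (fun k => ?_)
      (integrable_const _) (fun k => Eventually.of_forall fun γ => ?_) (ae_restrict_of_ae ?_)).congr
      fun k => (heq (hu k).1).symm
    · have hc : ∀ r : ℝ, Continuous fun γ : Curves T X => (u k).1 (IccExtend hT γ r) := fun r =>
        (continuous_lipB _).comp ((continuous_uncurry_extend hT).comp
          (continuous_const.prodMk continuous_id))
      exact ((hc τ).sub (hc 0)).aestronglyMeasurable
    · rw [Real.norm_eq_abs]
      refine (abs_sub _ _).trans ?_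
      linarith [(hu k).2 (IccExtend hT γ τ), (hu k).2 (IccExtend hT γ 0)]
    · filter_upwards [ae_extend_tendsto (hT := hT) hπ hlim τ, ae_extend_tendsto (hT := hT) hπ hlim 0]
        with γ h1 h2
      exact h1.sub h2
  have huniv : ((volume.restrict (Ioo 0 T)).prod π₀).restrict (Iic T ×ˢ univ) =
      (volume.restrict (Ioo 0 T)).prod π₀ := by
    rw [← Measure.prod_restrict, Measure.restrict_univ, Measure.restrict_restrict measurableSet_Iic,
      inter_eq_right.2 fun r hr => hr.2.le]
  have hdom : ∀ {g : LipB X} {Kg : ℝ≥0}, LipschitzWith Kg g.1 → Kg ≤ L + Kf →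
      ∀ᵐ p ∂((volume.restrict (Ioo 0 T)).prod π₀),
        ‖deriv (fun s => g.1 (IccExtend hT p.2 s)) p.1‖ ≤ (L + Kf : ℝ≥0) * (G p).toReal := by
    intro g Kg hg hle
    filter_upwards [hG.ae_abs_deriv_le hg] with p hp
    exact hp.2.trans (mul_le_mul_of_nonneg_right (NNReal.coe_le_coe.2 hle) ENNReal.toReal_nonneg)
  -- Products of half-lines and measurable sets of curves form a π-system generating the product
  -- σ-algebra; the speed bound is the common majorant.
  refine tendsto_integral_mul_of_isPiSystem
    (S := image2 (· ×ˢ ·) (range (Iic : ℝ → Set ℝ)) {B : Set (Curves T X) | MeasurableSet B})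
    (G := fun p => (L + Kf : ℝ≥0) * (G p).toReal) ?_ ?_
    (fun k => (measurable_deriv_extend hT (continuous_lipB _)).aestronglyMeasurable)
    (measurable_deriv_extend hT (continuous_lipB _)).aestronglyMeasurable (hG.integrable.const_mul _)
    (fun k => hdom (hu k).1 le_self_add) (hdom hKf le_add_self) ?_ ?_ hw hC
  · refine (generateFrom_eq_prod ?_ MeasurableSpace.generateFrom_measurableSet ?_ isCountablySpanning_measurableSet).symm
    · rw [← borel_eq_generateFrom_Iic, BorelSpace.measurable_eq (α := ℝ)]
    · refine ⟨fun n : ℕ => Iic (n : ℝ), fun n => mem_range_self _, eq_univ_of_forall fun x => ?_⟩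
      obtain ⟨n, hn⟩ := exists_nat_ge x
      exact mem_iUnion.2 ⟨n, hn⟩
  · exact isPiSystem_Iic.prod MeasurableSpace.isPiSystem_measurableSet
  · have h1 := hrect T univ MeasurableSet.univ
    rwa [huniv] at h1
  · rintro _ ⟨_, ⟨t, rfl⟩, B, hB, rfl⟩
    exact hrect t B hB

end derivatives

/-! ### Constancy of the defect for all bounded Lipschitz functions -/

section extension

variable {X : Type*} [MetricSpace X] [SecondCountableTopology X] [MeasurableSpace X] [BorelSpace X]
  {T : ℝ} {hT : 0 ≤ T} {m : Measure X} [BoundedlyFinite m] {b : TimeDerivation T m}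
  {π₀ : Measure (Curves T X)} [IsProbabilityMeasure π₀]

/-- If `y` is constant a.e. on each set of an exhausting sequence, it is constant a.e. -/
theorem exists_ae_eq_const_of_exhaustion {Ω : Type*} [MeasurableSpace Ω] {π : Measure Ω}
    [IsProbabilityMeasure π] {A : ℕ → Set Ω} (hA : Monotone A) (hAu : ⋃ n, A n = univ) {y : Ω → ℝ}
    (h : ∀ n, ∃ c : ℝ, π (A n) ≠ 0 → ∀ᵐ ω ∂π, ω ∈ A n → y ω = c) :
    ∃ c : ℝ, ∀ᵐ ω ∂π, y ω = c := by
  choose c hc using h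
  -- From some index on the sets have positive mass; being nested, they force their constants to
  -- agree.
  obtain ⟨N, hN⟩ : ∃ N, π (A N) ≠ 0 := by
    by_contra! h0
    have h1 : π (⋃ n, A n) = 0 := measure_iUnion_null h0
    rw [hAu, measure_univ] at h1
    exact one_ne_zero h1
  have hpos : ∀ n, N ≤ n → π (A n) ≠ 0 := fun n hn h0 => hN (measure_mono_null (hA hn) h0)
  have hall : ∀ᵐ ω ∂π, ∀ n, N ≤ n → ω ∈ A n → y ω = c n := ae_all_iff.2 fun n => by
    by_cases hn : N ≤ n
    · filter_upwards [hc n (hpos n hn)] with ω hω _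
      exact hω
    · exact Eventually.of_forall fun ω h' => absurd h' hn
  have hceq : ∀ n, N ≤ n → c n = c N := fun n hn => by
    by_contra hne
    refine hN (measure_mono_null (fun ω hω => ?_) hall)
    exact fun h' => hne ((h' n hn (hA hn hω)).symm.trans (h' N le_rfl hω))
  refine ⟨c N, ?_⟩
  filter_upwards [hall] with ω hω
  obtain ⟨n, hn⟩ := mem_iUnion.1 (hAu.symm ▸ mem_univ ω : ω ∈ ⋃ n, A n)
  rw [hω (max n N) (le_max_right _ _) (hA (le_max_left _ _) hn), hceq _ (le_max_right _ _)]

theorem lintegral_indicator_extend_le {K : ℝ≥0} (hK : ∀ t, π₀.map (fun γ => γ t) ≤ K • m)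
    {H : X → ℝ≥0∞} (hH : Measurable H) {U : Set X} (hU : MeasurableSet U) (r : ℝ) :
    ∫⁻ γ : Curves T X, U.indicator H (IccExtend hT γ r) ∂π₀ ≤ K * ∫⁻ y in U, H y ∂m := by
  have h1 : ∫⁻ γ : Curves T X, U.indicator H (IccExtend hT γ r) ∂π₀ =
      ∫⁻ y, U.indicator H y ∂(π₀.map fun γ => γ (projIcc 0 T hT r)) := by
    rw [lintegral_map (hH.indicator hU) (continuous_eval_const _).measurable]
    rfl
  rw [h1, ← lintegral_indicator hU]
  refine (lintegral_mono' (hK _) le_rfl).trans_eq ?_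
  rw [lintegral_smul_measure]
  rfl

set_option maxHeartbeats 2000000 in
/-- If the defect of test functions of a dense class does not depend on the curve, then neither does
the defect of any bounded Lipschitz function. -/
theorem ae_exists_defect_eq {G : ℝ × Curves T X → ℝ≥0∞} (hG : HasSpeedBound hT π₀ G) {K : ℝ≥0}
    (hK : ∀ t, π₀.map (fun γ => γ t) ≤ K • m) (hb : ReflexiveOrDiv b) {D : Set (LipB X)}
    (hD : FlatDense m D)
    (hz : ∀ f ∈ D, ∀ᵐ r ∂(volume.restrict (Ioo 0 T)), ∃ c : ℝ, ∀ᵐ γ ∂π₀, b.defect hT f (r, γ) = c)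
    (f : LipB X) :
    ∀ᵐ r ∂(volume.restrict (Ioo 0 T)), ∃ c : ℝ, ∀ᵐ γ ∂π₀, b.defect hT f (r, γ) = c := by
  obtain ⟨u, huD, ⟨L, hu⟩, hulim⟩ := hD f
  obtain ⟨Kf, hKf⟩ := f.2.1
  obtain ⟨γ₀⟩ : Nonempty (Curves T X) := nonempty_of_isProbabilityMeasure π₀
  set x₀ : X := γ₀ ⟨0, left_mem_Icc.2 hT⟩
  have hπ : ∀ t, π₀.map (fun γ => γ t) ≪ m := fun t =>
    Measure.absolutelyContinuous_of_le_smul (c := (K : ℝ≥0∞)) (hK t)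
  have hext : ∀ r, Measurable fun γ : Curves T X => IccExtend hT γ r := fun r =>
    (continuous_uncurry_extend hT).measurable.comp measurable_prodMk_left
  have hdiv : ∀ᵐ r ∂(volume.restrict (Ioo 0 T)),
      Function.Surjective (NormedSpace.inclusionInDoubleDual ℝ (H12 m)) ∨
        ∃ g, (b.der r).IsDivergence g := by
    rcases hb with h | ⟨g, -, hg, -⟩
    · exact Eventually.of_forall fun _ => Or.inl h
    · filter_upwards [hg] with r hr
      exact Or.inr ⟨_, hr⟩
  set ρ : LipB X → ℝ × Curves T X → ℝ := fun g p => b.rep g p.1 (IccExtend hT p.2 p.1) with hρ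
  have hρm : ∀ g, Measurable (ρ g) := fun g => measurable_rep_extend hT (b.measurable_rep g)
  -- A measurable common majorant of `b(f)` and all `b(u k)`.
  set H : ℝ × X → ℝ≥0∞ := fun p => ‖b.rep f p.1 p.2‖ₑ ⊔ ⨆ k, ‖b.rep (u k) p.1 p.2‖ₑ with hH
  have hHm : Measurable H := (b.measurable_rep f).enorm.sup
    (Measurable.iSup fun k => (b.measurable_rep (u k)).enorm)
  have hHr : ∀ r, Measurable fun y => H (r, y) := fun r => hHm.comp measurable_prodMk_left
  -- Local integrability of `|b_t|` is known at each time, with no integrability in time. Truncating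
  -- to the times `S R N` and to a ball makes everything integrable.
  set S : ℕ → ℕ → Set ℝ := fun R N => {r | ∫⁻ y in Metric.ball x₀ R, H (r, y) ∂m ≤ N} with hS
  have hSm : ∀ R N, MeasurableSet (S R N) := fun R N =>
    measurableSet_le hHm.lintegral_prod_right' measurable_const
  set V : ℕ → ℕ → Set (ℝ × Curves T X) := fun R N =>
    {p | p.1 ∈ S R N ∧ IccExtend hT p.2 p.1 ∈ Metric.ball x₀ R} with hV
  have hVm : ∀ R N, MeasurableSet (V R N) := fun R N => (measurable_fst (hSm R N)).inter
    ((continuous_uncurry_extend hT).measurable measurableSet_ball)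
  -- bounds on the truncation sets
  have hinner : ∀ R N (g : LipB X), (∀ p : ℝ × X, ‖b.rep g p.1 p.2‖ₑ ≤ H p) → ∀ r,
      ∫⁻ γ, ‖(V R N).indicator (ρ g) (r, γ)‖ₑ ∂π₀ ≤ K * N := by
    intro R N g hg r
    by_cases hr : r ∈ S R N
    · refine le_trans (lintegral_mono fun γ => ?_)
        ((lintegral_indicator_extend_le (hT := hT) hK (hHr r) measurableSet_ball r).trans
          (mul_le_mul_right hr _))
      by_cases hγ : IccExtend hT γ r ∈ Metric.ball x₀ R
      · rw [indicator_of_mem hγ, indicator_of_mem (show (r, γ) ∈ V R N from ⟨hr, hγ⟩)]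
        exact hg (r, _)
      · rw [indicator_of_notMem (fun h' : (r, γ) ∈ V R N => hγ h'.2), enorm_zero]
        exact zero_le
    · have h0 : ∀ γ, ‖(V R N).indicator (ρ g) (r, γ)‖ₑ = 0 := fun γ => by
        rw [indicator_of_notMem (fun h' : (r, γ) ∈ V R N => hr h'.1), enorm_zero]
      simp only [h0, lintegral_zero]
      exact zero_le
  have hρi : ∀ R N (g : LipB X), (∀ p : ℝ × X, ‖b.rep g p.1 p.2‖ₑ ≤ H p) →
      Integrable ((V R N).indicator (ρ g)) ((volume.restrict (Ioo 0 T)).prod π₀) := by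
    intro R N g hg
    have hm1 : Measurable ((V R N).indicator (ρ g)) := (hρm g).indicator (hVm R N)
    refine ⟨hm1.aestronglyMeasurable, ?_⟩
    rw [hasFiniteIntegral_iff_enorm, lintegral_prod _ hm1.enorm.aemeasurable]
    refine (lintegral_mono fun r => hinner R N g hg r).trans_lt ?_
    rw [lintegral_const]
    exact ENNReal.mul_lt_top (ENNReal.mul_lt_top ENNReal.coe_lt_top (ENNReal.natCast_lt_top N))
      (measure_lt_top _ _)
  have hHf : ∀ p : ℝ × X, ‖b.rep f p.1 p.2‖ₑ ≤ H p := fun p => le_sup_left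
  have hHu : ∀ k, ∀ p : ℝ × X, ‖b.rep (u k) p.1 p.2‖ₑ ≤ H p := fun k p =>
    (le_iSup (fun k => ‖b.rep (u k) p.1 p.2‖ₑ) k).trans le_sup_right
  have hmain : ∀ R N, ∀ᵐ r ∂(volume.restrict (Ioo 0 T)), ∀ᵐ γ ∂π₀,
      (∫ γ', (V R N).indicator (fun _ => (1 : ℝ)) (r, γ') ∂π₀) *
        (V R N).indicator (b.defect hT f) (r, γ) =
      (V R N).indicator (fun _ => (1 : ℝ)) (r, γ) *
        ∫ γ', (V R N).indicator (b.defect hT f) (r, γ') ∂π₀ := by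
    intro R N
    have hqi : ∀ {g : LipB X} {Kg : ℝ≥0}, LipschitzWith Kg g.1 → Integrable ((V R N).indicator
        fun p : ℝ × Curves T X => deriv (fun s => g.1 (IccExtend hT p.2 s)) p.1)
        ((volume.restrict (Ioo 0 T)).prod π₀) := fun hg => (hG.integrable_deriv hg).indicator (hVm R N)
    have hzi : ∀ {g : LipB X} {Kg : ℝ≥0}, LipschitzWith Kg g.1 →
        (∀ p : ℝ × X, ‖b.rep g p.1 p.2‖ₑ ≤ H p) → Integrable ((V R N).indicator (b.defect hT g))
        ((volume.restrict (Ioo 0 T)).prod π₀) := fun {g Kg} hg hgH => by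
      have h1 := (hqi hg).sub (hρi R N g hgH)
      rw [← indicator_sub'] at h1
      exact h1
    refine ae_mul_eq_of_tendsto (Yk := fun k => (V R N).indicator (b.defect hT (u k)))
      (measurable_const.indicator (hVm R N)) (fun p => ?_)
      ((b.measurable_defect hT f).indicator (hVm R N)) (hzi hKf hHf) (fun W hW hW1 => ?_) (fun k => ?_)
    · by_cases hp : p ∈ V R N
      · simp [indicator_of_mem hp]
      · simp [indicator_of_notMem hp]
    · have hWV : Measurable ((V R N).indicator W) := hW.indicator (hVm R N)
      have hWV1 : ∀ p, |(V R N).indicator W p| ≤ 1 := fun p => by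
        by_cases hp : p ∈ V R N
        · rw [indicator_of_mem hp]; exact hW1 p
        · rw [indicator_of_notMem hp, abs_zero]; exact zero_le_one
      have hdec : ∀ {g : LipB X} {Kg : ℝ≥0}, LipschitzWith Kg g.1 →
          (∀ p : ℝ × X, ‖b.rep g p.1 p.2‖ₑ ≤ H p) →
          ∫ p, W p * (V R N).indicator (b.defect hT g) p ∂((volume.restrict (Ioo 0 T)).prod π₀) =
          (∫ p, (V R N).indicator W p * deriv (fun s => g.1 (IccExtend hT p.2 s)) p.1
            ∂((volume.restrict (Ioo 0 T)).prod π₀)) -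
          ∫ r in Ioo 0 T, ∫ γ, W (r, γ) * (V R N).indicator (ρ g) (r, γ) ∂π₀ := by
        intro g Kg hg hgH
        have i1 : Integrable (fun p : ℝ × Curves T X => (V R N).indicator W p *
            deriv (fun s => g.1 (IccExtend hT p.2 s)) p.1) ((volume.restrict (Ioo 0 T)).prod π₀) :=
          (hG.integrable_deriv hg).bdd_mul (c := 1) hWV.aestronglyMeasurable
            (Eventually.of_forall hWV1)
        have i2 : Integrable (fun p => W p * (V R N).indicator (ρ g) p)
            ((volume.restrict (Ioo 0 T)).prod π₀) :=
          (hρi R N g hgH).bdd_mul (c := 1) hW.aestronglyMeasurable (Eventually.of_forall hW1)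
        rw [← integral_prod _ i2, ← integral_sub i1 i2]
        refine integral_congr_ae (Eventually.of_forall fun p => ?_)
        by_cases hp : p ∈ V R N
        · simp only [indicator_of_mem hp, TimeDerivation.defect, hρ]
          ring
        · simp only [indicator_of_notMem hp]
          ring
      rw [hdec hKf hHf]
      simp only [hdec (hu _).1 (hHu _)]
      refine (hG.tendsto_integral_mul_deriv hπ hu hulim hWV hWV1).sub ?_
      -- At a.e. time the spatial integrals converge by weak continuity of the derivation; the
      -- truncation bounds them by `K N`.
      refine tendsto_integral_of_dominated_convergence (fun _ => (K : ℝ) * N) (fun k => ?_)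
        (integrable_const _) (fun k => Eventually.of_forall fun r => ?_) ?_
      · exact (hW.mul ((hρm (u k)).indicator (hVm R N))).stronglyMeasurable.integral_prod_right'.aestronglyMeasurable
      · have h1 : ‖∫ γ, W (r, γ) * (V R N).indicator (ρ (u k)) (r, γ) ∂π₀‖ₑ ≤ K * N := by
          refine (enorm_integral_le_lintegral_enorm _).trans
            ((lintegral_mono fun γ => ?_).trans (hinner R N (u k) (hHu k) r))
          rw [enorm_mul]
          refine mul_le_of_le_one_left zero_le ?_
          rw [Real.enorm_eq_ofReal_abs]
          exact ENNReal.ofReal_le_one.2 (hW1 _)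
        rw [← ofReal_norm, ← ENNReal.ofReal_coe_nnreal, ← ENNReal.ofReal_natCast,
          ← ENNReal.ofReal_mul NNReal.zero_le_coe] at h1
        exact (ENNReal.ofReal_le_ofReal_iff (by positivity)).1 h1
      · filter_upwards [hdiv, ae_restrict_mem measurableSet_Ioo] with r hr hrT
        have hcongr : ∀ g : LipB X, ∫ γ, W (r, γ) * (V R N).indicator (ρ g) (r, γ) ∂π₀ =
            ∫ γ : Curves T X, (V R N).indicator W (r, γ) *
              (b.der r).toLin g (IccExtend hT γ r) ∂π₀ := fun g => by
          refine integral_congr_ae ?_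
          have h1 : ∀ᵐ γ : Curves T X ∂π₀, b.rep g r (IccExtend hT γ r) =
              (b.der r).toLin g (IccExtend hT γ r) :=
            ae_of_ae_map (f := fun γ : Curves T X => γ (projIcc 0 T hT r))
              (continuous_eval_const _).measurable.aemeasurable
              ((hπ (projIcc 0 T hT r)).ae_le (b.rep_ae g r hrT))
          filter_upwards [h1] with γ hγ
          by_cases hp : (r, γ) ∈ V R N
          · simp only [indicator_of_mem hp, hρ, hγ]
          · simp only [indicator_of_notMem hp, mul_zero, zero_mul]
        simp only [hcongr]
        refine tendsto_integral_mul_toLin (B := 1) (x := x₀) (R := R) (hext r)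
          (hK (projIcc 0 T hT r)) hr (b.locL1 r hrT) (hWV.comp measurable_prodMk_left)
          (fun γ => by simpa using hWV1 (r, γ)) (fun γ hγ => ?_) hu hulim
        exact indicator_of_notMem (fun h' : (r, γ) ∈ V R N => hγ h'.2) _
    · filter_upwards [hz (u k) (huD k)] with r hr
      obtain ⟨c, hc⟩ := hr
      refine ⟨c, ?_⟩
      filter_upwards [hc] with γ hγ
      by_cases hp : (r, γ) ∈ V R N
      · simp only [indicator_of_mem hp, hγ, mul_one]
      · simp only [indicator_of_notMem hp, mul_zero]
  filter_upwards [ae_all_iff.2 fun R => ae_all_iff.2 (hmain R), ae_restrict_mem measurableSet_Ioo]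
    with r hr hrT
  have hAm : ∀ R : ℕ, MeasurableSet {γ : Curves T X | IccExtend hT γ r ∈ Metric.ball x₀ R} := fun R =>
    hext r measurableSet_ball
  refine exists_ae_eq_const_of_exhaustion
    (A := fun R : ℕ => {γ : Curves T X | IccExtend hT γ r ∈ Metric.ball x₀ R})
    (fun R R' h γ hγ => Metric.ball_subset_ball (Nat.cast_le.2 h) hγ) ?_ fun R => ?_
  · refine eq_univ_of_forall fun γ => ?_
    obtain ⟨R, hR⟩ := exists_nat_gt (dist (IccExtend hT γ r) x₀)
    exact mem_iUnion.2 ⟨R, hR⟩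
  -- At a fixed time in `(0,T)` the majorant is integrable on each ball, being at most a multiple of
  -- `|b_r|`; so some truncation level includes this time.
  · obtain ⟨N, hN⟩ : ∃ N : ℕ, r ∈ S R N := by
      have hfin : ∫⁻ y in Metric.ball x₀ R, H (r, y) ∂m ≠ ∞ := by
        have h1 := (b.locL1 r hrT x₀ R).2
        rw [hasFiniteIntegral_iff_enorm] at h1
        have h2 : ∀ {g : LipB X} {Kg : ℝ≥0}, LipschitzWith Kg g.1 → Kg ≤ L + Kf →
            ∀ᵐ y ∂m, ‖b.rep g r y‖ₑ ≤ ((L + Kf : ℝ≥0) : ℝ≥0∞) * ‖(b.der r).norm y‖ₑ := by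
          intro g Kg hg hle
          filter_upwards [b.rep_ae g r hrT, (b.der r).abs_toLin_le g hg, (b.der r).norm_nonneg]
            with y h1 h2 h3
          rw [h1, Real.enorm_eq_ofReal_abs, Real.enorm_eq_ofReal h3, ← ENNReal.ofReal_coe_nnreal,
            ← ENNReal.ofReal_mul NNReal.zero_le_coe, mul_comm]
          exact ENNReal.ofReal_le_ofReal (h2.trans
            (mul_le_mul_of_nonneg_left (NNReal.coe_le_coe.2 hle) h3))
        have h3 : ∀ᵐ y ∂m, H (r, y) ≤ ((L + Kf : ℝ≥0) : ℝ≥0∞) * ‖(b.der r).norm y‖ₑ := by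
          filter_upwards [h2 hKf le_add_self, ae_all_iff.2 fun k => h2 (hu k).1 le_self_add]
            with y h1 h2
          exact sup_le h1 (iSup_le h2)
        refine ((lintegral_mono_ae (ae_restrict_of_ae h3)).trans_lt ?_).ne
        rw [lintegral_const_mul' _ _ ENNReal.coe_ne_top]
        exact ENNReal.mul_lt_top ENNReal.coe_lt_top h1
      obtain ⟨N, hN⟩ := ENNReal.exists_nat_gt hfin
      exact ⟨N, hN.le⟩
    have hVA : ∀ γ : Curves T X, (r, γ) ∈ V R N ↔ IccExtend hT γ r ∈ Metric.ball x₀ R := fun γ =>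
      ⟨fun h => h.2, fun h => ⟨hN, h⟩⟩
    set a : ℝ := ∫ γ', (V R N).indicator (fun _ => (1 : ℝ)) (r, γ') ∂π₀ with ha
    set I : ℝ := ∫ γ', (V R N).indicator (b.defect hT f) (r, γ') ∂π₀
    have haeq : a = π₀.real {γ : Curves T X | IccExtend hT γ r ∈ Metric.ball x₀ R} := by
      rw [← integral_indicator_one (hAm R), ha]
      refine integral_congr_ae (Eventually.of_forall fun γ => ?_)
      by_cases hγ : IccExtend hT γ r ∈ Metric.ball x₀ R
      · simp only [indicator_of_mem ((hVA γ).2 hγ)]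
        rw [indicator_of_mem (show γ ∈ {γ : Curves T X | IccExtend hT γ r ∈ Metric.ball x₀ R} from hγ)]
        rfl
      · simp only [indicator_of_notMem (fun h => hγ ((hVA γ).1 h))]
        rw [indicator_of_notMem (show γ ∉ {γ : Curves T X | IccExtend hT γ r ∈ Metric.ball x₀ R} from hγ)]
    -- On the ball the identity reads `a` times the defect equals `I`, where `a` is the probability
    -- of being in the ball.
    refine ⟨I / a, fun hpos => ?_⟩
    have ha0 : a ≠ 0 := by
      rw [haeq, measureReal_def]
      exact ENNReal.toReal_ne_zero.2 ⟨hpos, measure_ne_top _ _⟩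
    filter_upwards [hr R N] with γ hγ hγA
    have hp := (hVA γ).2 hγA
    rw [indicator_of_mem hp, indicator_of_mem hp, one_mul] at hγ
    rw [eq_div_iff ha0, mul_comm]
    exact hγ

end extension

/-! ### The limit is a regular generalized flow -/

section atoms

variable {X : Type*} [MetricSpace X] [SecondCountableTopology X] [MeasurableSpace X] [BorelSpace X]

/-- At each scale some ball around a dense point has positive mass, since these balls cover. The
measure is then concentrated on the concentric closed ball of twice the radius, and over all scales
these meet in one point. -/
theorem exists_ae_eq_of_balls [Nonempty X] {μ : Measure X} [IsProbabilityMeasure μ]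
    (h : ∀ k j : ℕ, μ (Metric.ball (TopologicalSpace.denseSeq X k) (1 / (j + 1))) = 0 ∨
      μ (Metric.closedBall (TopologicalSpace.denseSeq X k) (2 / (j + 1)))ᶜ = 0) :
    ∃ p, ∀ᵐ x ∂μ, x = p := by
  have h1 : ∀ j : ℕ, ∃ k, μ (Metric.closedBall (TopologicalSpace.denseSeq X k) (2 / (j + 1)))ᶜ = 0 := by
    intro j
    by_contra! hne
    have h0 : μ (⋃ k, Metric.ball (TopologicalSpace.denseSeq X k) (1 / (j + 1))) = 0 :=
      measure_iUnion_null fun k => (h k j).resolve_right (hne k)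
    have hun : ⋃ k, Metric.ball (TopologicalSpace.denseSeq X k) (1 / ((j : ℝ) + 1)) = univ := by
      refine eq_univ_of_forall fun x => ?_
      obtain ⟨k, hk⟩ := (TopologicalSpace.denseRange_denseSeq X).exists_dist_lt x
        (ε := 1 / ((j : ℝ) + 1)) (by positivity)
      exact mem_iUnion.2 ⟨k, hk⟩
    rw [hun, measure_univ] at h0
    exact one_ne_zero h0
  choose k hk using h1
  have hall : ∀ᵐ x ∂μ, ∀ j : ℕ,
      x ∈ Metric.closedBall (TopologicalSpace.denseSeq X (k j)) (2 / ((j : ℝ) + 1)) :=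
    ae_all_iff.2 hk
  obtain ⟨p, hp⟩ := hall.exists
  refine ⟨p, ?_⟩
  filter_upwards [hall] with x hx
  refine dist_le_zero.1 (le_of_forall_pos_le_add fun ε hε => ?_)
  obtain ⟨j, hj⟩ := exists_nat_one_div_lt (show 0 < ε / 4 by positivity)
  have h2 := Metric.mem_closedBall.1 (hx j)
  have h3 := Metric.mem_closedBall'.1 (hp j)
  have h4 := dist_triangle x (TopologicalSpace.denseSeq X (k j)) p
  have h5 : 2 / ((j : ℝ) + 1) = 2 * (1 / ((j : ℝ) + 1)) := by ring
  rw [h5] at h2 h3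
  linarith

theorem countable_atoms (m : Measure X) [SigmaFinite m] : {p : X | m {p} ≠ 0}.Countable := by
  have h := Measure.countable_meas_pos_of_disjoint_iUnion (μ := m) (As := fun p : X => {p})
    (fun p => measurableSet_singleton p) fun p q hpq => disjoint_singleton.2 hpq
  simpa only [pos_iff_ne_zero] using h

theorem of_ae_of_atom {m : Measure X} {P : X → Prop} (h : ∀ᵐ x ∂m, P x) {p : X} (hp : m {p} ≠ 0) :
    P p := by
  by_contra hne
  exact hp (measure_mono_null (singleton_subset_iff.2 hne) h)

variable {T : ℝ} {hT : 0 ≤ T} {m : Measure X} [BoundedlyFinite m] {b : TimeDerivation T m}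

/-- Regular flows do not move the atoms. -/
theorem IsRegularFlow.apply_atom {F : Icc (0 : ℝ) T → X → X} (hF : IsRegularFlow hT b F) {p : X}
    (hp : m {p} ≠ 0) (t : Icc (0 : ℝ) T) : F t p = p := by
  obtain ⟨hac, h0⟩ := of_ae_of_atom hF.ac hp
  obtain ⟨C, hC⟩ := hF.compresses
  -- Bounded compression sends atoms to atoms: otherwise a null point would have a preimage of
  -- positive measure.
  have hsub : range (fun t => F t p) ⊆ {p : X | m {p} ≠ 0} := by
    rintro _ ⟨s, rfl⟩ hs
    have hFs : Measurable (F s) := hF.measurable.comp measurable_prodMk_left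
    have h1 := hC s {F s p}
    rw [Measure.map_apply hFs (measurableSet_singleton _), Measure.smul_apply, hs, smul_zero] at h1
    exact hp (measure_mono_null (t := F s ⁻¹' {F s p}) (singleton_subset_iff.2 rfl)
      (le_antisymm h1 zero_le))
  have : PreconnectedSpace (Icc (0 : ℝ) T) := Subtype.preconnectedSpace isPreconnected_Icc
  -- A continuous curve in a countable set is constant, countable sets being totally disconnected.
  have hss := (countable_atoms m).isTotallyDisconnected _ hsub (isPreconnected_range (hac.continuous hT))
  exact (hss (mem_range_self t) (mem_range_self ⟨0, left_mem_Icc.2 hT⟩)).trans h0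

/-- The trajectory of an atom is constant, so the differential equation leaves no derivative there.
-/
theorem IsRegularFlow.ae_rep_atom_eq_zero {F : Icc (0 : ℝ) T → X → X} (hF : IsRegularFlow hT b F)
    {f : LipB X} (hf : BddSupport f.1) {p : X} (hp : m {p} ≠ 0) :
    ∀ᵐ r ∂(volume.restrict (Ioo 0 T)), b.rep f r p = 0 := by
  filter_upwards [Measure.ae_ae_of_ae_prod (hF.ode f hf)] with r hr
  have h1 := of_ae_of_atom hr hp
  simp only [hF.apply_atom hp, IccExtend, Function.comp_def] at h1
  exact h1.unique (hasDerivAt_const r _)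

end atoms

/-! ### Vanishing of defects that depend on time only -/

section genflow

variable {X : Type*} [MetricSpace X] [SecondCountableTopology X] [MeasurableSpace X] [BorelSpace X]
  {T : ℝ} {hT : 0 ≤ T} {m : Measure X} [BoundedlyFinite m] {b : TimeDerivation T m}
  {π₀ : Measure (Curves T X)} [IsProbabilityMeasure π₀]

theorem ae_defect_congr (hπ : ∀ t, π₀.map (fun γ => γ t) ≪ m) {f g : LipB X} {U : Set X}
    (hU : IsOpen U) (hfg : ∀ y ∈ U, f.1 y = g.1 y) :
    ∀ᵐ r ∂(volume.restrict (Ioo 0 T)), ∀ᵐ γ : Curves T X ∂π₀, IccExtend hT γ r ∈ U →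
      b.defect hT f (r, γ) = b.defect hT g (r, γ) := by
  filter_upwards [Measure.ae_ae_of_ae_prod (ae_rep_congr (b := b) hT hπ hU hfg)] with r hr
  filter_upwards [hr] with γ hγ hU'
  rw [TimeDerivation.defect, TimeDerivation.defect, hγ hU',
    (extend_eventuallyEq_of_mem hT hU hfg hU').deriv_eq]

theorem ae_defect_zero (hπ : ∀ t, π₀.map (fun γ => γ t) ≪ m) :
    ∀ᵐ r ∂(volume.restrict (Ioo 0 T)), ∀ᵐ γ : Curves T X ∂π₀, b.defect hT 0 (r, γ) = 0 := by
  have h1 : ∀ᵐ q ∂((volume.restrict (Ioo 0 T)).prod π₀),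
      (q.1, IccExtend hT q.2 q.1) ∈ {q : ℝ × X | b.rep 0 q.1 q.2 = 0} := by
    refine ae_extend_of_forall_ae hT hπ (measurableSet_eq_fun (b.measurable_rep 0) measurable_const)
      fun r hr => ?_
    filter_upwards [b.rep_ae 0 r hr, AEEqFun.coeFn_zero (μ := m) (β := ℝ)] with x h1 h2
    rw [h1, map_zero, h2]
    rfl
  filter_upwards [Measure.ae_ae_of_ae_prod h1] with r hr
  filter_upwards [hr] with γ hγ
  rw [TimeDerivation.defect, show b.rep 0 r (IccExtend hT γ r) = 0 from hγ, sub_zero]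
  exact deriv_const r (0 : ℝ)

set_option maxHeartbeats 1000000 in
/-- If the defects do not depend on the curve, they vanish. -/
theorem isRegularGenFlow_of_defect {G : ℝ × Curves T X → ℝ≥0∞} (hG : HasSpeedBound hT π₀ G) {K : ℝ≥0}
    (hK : ∀ t, π₀.map (fun γ => γ t) ≤ K • m)
    (hdef : ∀ f : LipB X, ∀ᵐ r ∂(volume.restrict (Ioo 0 T)), ∃ c : ℝ, ∀ᵐ γ ∂π₀,
      b.defect hT f (r, γ) = c)
    {F : Icc (0 : ℝ) T → X → X} (hF : IsRegularFlow hT b F) : IsRegularGenFlow hT b π₀ := by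
  refine ⟨inferInstance, ⟨K, hK⟩, hG.ae_isAC, fun f hf => ?_⟩
  obtain ⟨γ₀⟩ : Nonempty (Curves T X) := nonempty_of_isProbabilityMeasure π₀
  have : Nonempty X := ⟨γ₀ ⟨0, left_mem_Icc.2 hT⟩⟩
  have hπ : ∀ t, π₀.map (fun γ => γ t) ≪ m := fun t =>
    Measure.absolutelyContinuous_of_le_smul (c := (K : ℝ≥0∞)) (hK t)
  obtain ⟨Kf, hKf⟩ := f.2.1
  set z := TopologicalSpace.denseSeq X with hzd
  -- A localisation of `f`: unchanged within `1 / (j + 1)` of `z k` and zero beyond `2 / (j + 1)`.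
  set χ : ℕ → ℕ → LipB X := fun k j =>
    lipMul f (lipIndicator (Metric.closedBall (z k) (1 / (j + 1))) j) with hχ
  have hr0 : ∀ j : ℕ, (0 : ℝ) < 1 / (j + 1) := fun j => by positivity
  have hχ1 : ∀ k j : ℕ, ∀ y ∈ Metric.ball (z k) (1 / ((j : ℝ) + 1)), (χ k j).1 y = f.1 y :=
    fun k j y hy => by
      rw [hχ, lipMul_apply, lipIndicator_eq_one j (Metric.ball_subset_closedBall hy), mul_one]
  have hχ0 : ∀ k j : ℕ, ∀ y ∈ (Metric.closedBall (z k) (2 / ((j : ℝ) + 1)))ᶜ,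
      (χ k j).1 y = (0 : LipB X).1 y := fun k j y hy => by
    rw [hχ, lipMul_apply, lipIndicator_eq_zero, mul_zero]
    · rfl
    · have h1 : 2 / ((j : ℝ) + 1) < dist y (z k) := not_le.1 hy
      have h2 : 1 / ((j : ℝ) + 1) ≤
          Metric.infDist y (Metric.closedBall (z k) (1 / ((j : ℝ) + 1))) := by
        refine (Metric.le_infDist ⟨z k, Metric.mem_closedBall_self (hr0 j).le⟩).2 fun w hw => ?_
        have h3 := Metric.mem_closedBall.1 hw
        have h4 := dist_triangle y w (z k)
        have h5 : 2 / ((j : ℝ) + 1) = 1 / ((j : ℝ) + 1) + 1 / ((j : ℝ) + 1) := by ring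
        linarith
      have h6 : (0 : ℝ) < (j : ℝ) + 1 := by positivity
      have h7 := mul_le_mul_of_nonneg_left h2 h6.le
      rwa [mul_one_div_cancel h6.ne'] at h7
  have hext : ∀ r, Measurable fun γ : Curves T X => IccExtend hT γ r := fun r =>
    (continuous_uncurry_extend hT).measurable.comp measurable_prodMk_left
  -- Atoms are countably many, so one null set of times serves for all. The derivative statement
  -- comes from the level set of `f` through the value `f p`.
  have hatom : ∀ᵐ r ∂(volume.restrict (Ioo 0 T)), ∀ p ∈ {p : X | m {p} ≠ 0},
      b.rep f r p = 0 ∧ ∀ᵐ γ : Curves T X ∂π₀, IccExtend hT γ r = p →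
        deriv (fun s => f.1 (IccExtend hT γ s)) r = 0 := by
    refine (ae_ball_iff (countable_atoms m)).2 fun p hp => ?_
    have hms : MeasurableSet {q : ℝ × Curves T X | f.1 (IccExtend hT q.2 q.1) = f.1 p →
        deriv (fun s => f.1 (IccExtend hT q.2 s)) q.1 = 0} :=
      (measurableSet_eq_fun ((continuous_lipB f).comp (continuous_uncurry_extend hT)).measurable
        measurable_const).himp (measurableSet_eq_fun (measurable_deriv_extend hT (continuous_lipB f))
          measurable_const)
    have h1 := (Measure.ae_ae_comm (μ := volume.restrict (Ioo 0 T)) (ν := π₀)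
      (p := fun r (γ : Curves T X) => f.1 (IccExtend hT γ r) = f.1 p →
        deriv (fun s => f.1 (IccExtend hT γ s)) r = 0) hms).2 (by
          filter_upwards [hG.ae_isAC] with γ hγ
          exact hγ.ae_deriv_eq_zero hT hKf (f.1 p))
    filter_upwards [hF.ae_rep_atom_eq_zero hf hp, h1] with r hr1 hr2
    refine ⟨hr1, ?_⟩
    filter_upwards [hr2] with γ hγ hγp
    exact hγ (by rw [hγp])
  have hzero : ∀ᵐ r ∂(volume.restrict (Ioo 0 T)), ∀ᵐ γ ∂π₀, b.defect hT f (r, γ) = 0 := by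
    filter_upwards [hdef f, ae_all_iff.2 fun k => ae_all_iff.2 fun j => hdef (χ k j),
      ae_all_iff.2 fun k => ae_all_iff.2 fun j =>
        ae_defect_congr (b := b) hπ Metric.isOpen_ball (hχ1 k j),
      ae_all_iff.2 fun k => ae_all_iff.2 fun j =>
        ae_defect_congr (b := b) hπ Metric.isClosed_closedBall.isOpen_compl (hχ0 k j),
      ae_defect_zero (b := b) hπ, hatom] with r h1 h2 h3 h4 h5 h6
    obtain ⟨c, hc⟩ := h1
    set μ : Measure X := π₀.map fun γ : Curves T X => IccExtend hT γ r with hμ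
    have hμp : IsProbabilityMeasure μ := Measure.isProbabilityMeasure_map (hext r).aemeasurable
    have hμm : μ ≪ m := hπ (projIcc 0 T hT r)
    -- Either the law of `γ_r` is a point mass, or some small ball and the complement of its double
    -- both have positive mass.
    by_cases hall : ∀ k j : ℕ, μ (Metric.ball (z k) (1 / (j + 1))) = 0 ∨
        μ (Metric.closedBall (z k) (2 / (j + 1)))ᶜ = 0
    · obtain ⟨p, hp⟩ := exists_ae_eq_of_balls hall
      have hmp : m {p} ≠ 0 := fun h0 => by
        have h7 : μ {p} = 0 := hμm h0
        have h8 : ∀ᵐ x ∂μ, x ∉ ({p} : Set X) := measure_eq_zero_iff_ae_notMem.1 h7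
        obtain ⟨x, hx1, hx2⟩ := (hp.and h8).exists
        exact hx2 hx1
      have hγp : ∀ᵐ γ : Curves T X ∂π₀, IccExtend hT γ r = p :=
        ae_of_ae_map (hext r).aemeasurable hp
      filter_upwards [hγp, (h6 p hmp).2] with γ hγ1 hγ2
      rw [TimeDerivation.defect, hγ2 hγ1, hγ1, (h6 p hmp).1, sub_zero]
    · push Not at hall
      obtain ⟨k, j, hk1, hk2⟩ := hall
      obtain ⟨c', hc'⟩ := h2 k j
      rw [hμ, Measure.map_apply (hext r) measurableSet_ball] at hk1
      rw [hμ, Measure.map_apply (hext r) measurableSet_closedBall.compl] at hk2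
      -- With positive probability the curve is where the localised function vanishes locally and
      -- has zero defect; since its defect is constant, it is zero.
      have hc'0 : c' = 0 := by
        by_contra hne
        refine hk2 (measure_mono_null (fun γ hγ => ?_) ((hc'.and (h4 k j)).and h5))
        rintro ⟨⟨g1, g2⟩, g3⟩
        exact hne (g1.symm.trans ((g2 hγ).trans g3))
      -- With positive probability the curve is in the ball where `f` and its localisation agree, so
      -- both constants coincide.
      have hc0 : c = 0 := by
        by_contra hne
        refine hk1 (measure_mono_null (fun γ hγ => ?_) ((hc'.and (h3 k j)).and hc))
        rintro ⟨⟨g1, g2⟩, g3⟩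
        exact hne (g3.symm.trans ((g2 hγ).symm.trans (g1.trans hc'0)))
      filter_upwards [hc] with γ hγ
      rw [hγ, hc0]
  have hmz : MeasurableSet {q : ℝ × Curves T X | b.defect hT f q = 0} :=
    measurableSet_eq_fun (b.measurable_defect hT f) measurable_const
  filter_upwards [hG.ae_abs_deriv_le hKf, (Measure.ae_prod_iff_ae_ae hmz).2 hzero] with q h1 h2
  exact hasDerivAt_iff_deriv.2 ⟨h1.1, sub_eq_zero.1 h2⟩

end genflow

/-! ### Stability -/

section stability

variable {X : Type*} [MetricSpace X] [CompleteSpace X] [SecondCountableTopology X]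
  [MeasurableSpace X] [BorelSpace X] {T : ℝ} {mn : ℕ → Measure X} {m : Measure X}
  [∀ n, BoundedlyFinite (mn n)] [BoundedlyFinite m]
  {bn : ∀ n, TimeDerivation T (mn n)} {b : TimeDerivation T m} {D : Set (LipB X)}
  {Fn : ℕ → Icc (0 : ℝ) T → X → X} {F : Icc (0 : ℝ) T → X → X} {Θ : ℝ≥0 → ℝ≥0∞}

/-- Every weak limit of the measures on curves is induced by the limit flow. -/
theorem eq_map_flowMap_of_tendsto [Nonempty X] (hT : 0 < T) (hm : WeakConv mn m)
    (hD : FlatDense m D) (hbn : StrongConv bn b D) (hb : ReflexiveOrDiv b)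
    (hF : IsRegularFlow hT.le b F)
    (hind : ∀ π : Measure (Curves T X), IsRegularGenFlow hT.le b π → IsInducedBy hT.le π F)
    {π : ℕ → Measure (Curves T X)} {π₀ : Measure (Curves T X)} [∀ n, IsProbabilityMeasure (π n)]
    [IsProbabilityMeasure π₀]
    (hlim : ∀ Φ : Curves T X →ᵇ ℝ, Tendsto (fun n => ∫ γ, Φ γ ∂(π n)) atTop (𝓝 (∫ γ, Φ γ ∂π₀)))
    {K : ℝ≥0} (hK : ∀ n t, (π n).map (fun γ => γ t) ≤ K • mn n)
    {G : ℕ → ℝ × Curves T X → ℝ≥0∞} (hG : ∀ n, HasSpeedBound hT.le (π n) (G n))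
    (hUI : ∀ ε : ℝ≥0∞, ε ≠ 0 → ∃ z : ℝ≥0, ∀ n,
      ∫⁻ p, (G n p - z) ∂((volume.restrict (Ioo 0 T)).prod (π n)) ≤ ε)
    (hode : ∀ n, ∀ f : LipB X, BddSupport f.1 →
      ∀ᵐ p ∂((volume.restrict (Ioo 0 T)).prod (π n)),
        HasDerivAt (fun s => f.1 (IccExtend hT.le p.2 s))
          ((bn n).rep f p.1 (IccExtend hT.le p.2 p.1)) p.1)
    {ρ : ℕ → Measure X} {ρ₀ : Measure X} [IsProbabilityMeasure ρ₀]
    (hρ : ∀ g : X →ᵇ ℝ, Tendsto (fun n => ∫ x, g x ∂(ρ n)) atTop (𝓝 (∫ x, g x ∂ρ₀)))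
    (hρπ : ∀ n, (π n).map (fun γ => γ ⟨0, left_mem_Icc.2 hT.le⟩) = ρ n) :
    π₀ = ρ₀.map (flowMap F) := by
  have hK₀ := map_eval_le_of_tendsto hm hlim hK
  obtain ⟨G₀, hG₀⟩ := exists_hasSpeedBound_of_tendsto hlim hG hUI
  have hπac : ∀ n t, (π n).map (fun γ => γ t) ≪ mn n := fun n t =>
    Measure.absolutelyContinuous_of_le_smul (c := (K : ℝ≥0∞)) (hK n t)
  have hdef := ae_exists_defect_eq (hT := hT.le) hG₀ hK₀ hb hD fun f hf =>
    hbn.ae_defect_eq_integral hT.le hf hK hK₀ hlim hG hG₀ fun n =>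
      ode_lipB hT.le (hπac n) (hode n) f
  have hgen := isRegularGenFlow_of_defect hG₀ hK₀ hdef hF
  have hev : Continuous fun γ : Curves T X => γ ⟨0, left_mem_Icc.2 hT.le⟩ := continuous_eval_const _
  have h0 : π₀.map (fun γ => γ ⟨0, left_mem_Icc.2 hT.le⟩) = ρ₀ := by
    have := Measure.isProbabilityMeasure_map (μ := π₀) hev.aemeasurable
    refine ext_of_forall_integral_eq_of_IsFiniteMeasure fun g => ?_
    refine tendsto_nhds_unique ?_ (hρ g)
    rw [integral_map hev.aemeasurable g.continuous.measurable.aestronglyMeasurable]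
    refine (hlim (g.compContinuous ⟨_, hev⟩)).congr fun n => ?_
    rw [← hρπ n, integral_map hev.aemeasurable g.continuous.measurable.aestronglyMeasurable]
    rfl
  have h1 := hind π₀ hgen
  rw [IsInducedBy, h0] at h1
  exact h1

/-- Prokhorov's theorem gives a limit law on curves along a subsequence, and
`eq_map_flowMap_of_tendsto` leaves only one candidate. -/
theorem exists_subseq_tendsto_flowMap [Nonempty X] (hT : 0 < T) (hm : WeakConv mn m)
    (hD : FlatDense m D) (hbn : StrongConv bn b D) (hb : ReflexiveOrDiv b)
    (hFn : ∀ n, IsRegularFlow hT.le (bn n) (Fn n)) {C : ℝ≥0}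
    (hC : ∀ n, Compresses (mn n) (Fn n) C)
    (hΘ : Tendsto (fun z : ℝ≥0 => Θ z / z) atTop (𝓝 ∞))
    (hΘb : ⨆ n, ∫⁻ t in Ioo 0 T, ∫⁻ x, Θ (((bn n).der t).norm x).toNNReal ∂(mn n) < ∞)
    (hF : IsRegularFlow hT.le b F)
    (hind : ∀ π : Measure (Curves T X), IsRegularGenFlow hT.le b π → IsInducedBy hT.le π F)
    {ρ : ℕ → Measure X} {ρ₀ : Measure X} [∀ n, IsProbabilityMeasure (ρ n)]
    [IsProbabilityMeasure ρ₀] {V : ℝ≥0} (hV : ∀ n, ρ n ≤ V • mn n) (hρ₀ : ρ₀ ≪ m)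
    (hρ : ∀ g : X →ᵇ ℝ, Tendsto (fun n => ∫ x, g x ∂(ρ n)) atTop (𝓝 (∫ x, g x ∂ρ₀)))
    {x₀ : X} {R : ℝ} (hR : ∀ n, ∀ᵐ x ∂(ρ n), x ∈ Metric.closedBall x₀ R) :
    ∃ χ : ℕ → ℕ, StrictMono χ ∧ ∀ Φ : Curves T X →ᵇ ℝ,
      Tendsto (fun n => ∫ x, Φ (flowMap (Fn (χ n)) x) ∂(ρ (χ n))) atTop
        (𝓝 (∫ x, Φ (flowMap F x) ∂ρ₀)) := by
  have hmap := fun n => (hFn n).map_flowMap hT.le (hC n) (hV n)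
  set π : ℕ → Measure (Curves T X) := fun n => (ρ n).map (flowMap (Fn n)) with hπ
  have hπp : ∀ n, IsProbabilityMeasure (π n) := fun n =>
    Measure.isProbabilityMeasure_map (hmap n).1
  set G : ℕ → ℝ × Curves T X → ℝ≥0∞ := fun n p => (bn n).speed (p.1, IccExtend hT.le p.2 p.1)
    with hGd
  have hK : ∀ n t, (π n).map (fun γ => γ t) ≤ (V * C) • mn n := fun n => (hmap n).2.1
  have hUI : ∀ ε : ℝ≥0∞, ε ≠ 0 → ∃ z : ℝ≥0, ∀ n,
      ∫⁻ p, (G n p - z) ∂((volume.restrict (Ioo 0 T)).prod (π n)) ≤ ε := fun ε hε => by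
    -- The denominator absorbs the domination constant of the marginals; the extra `1` keeps it
    -- nonzero.
    obtain ⟨z, hz⟩ := exists_excess_le hΘ hΘb
      (ENNReal.div_pos hε (b := ((V * C : ℝ≥0) : ℝ≥0∞) + 1) (by finiteness)).ne'
    refine ⟨z, fun n => (lintegral_speed_sub_le hT.le (hK n) z).trans ?_⟩
    refine (mul_le_mul_right (hz n) _).trans ?_
    refine (mul_le_mul_left (le_self_add (b := (1 : ℝ≥0∞))) _).trans ?_
    exact ENNReal.mul_div_le
  have hG : ∀ n, HasSpeedBound hT.le (π n) (G n) := fun n => by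
    obtain ⟨z, hz⟩ := hUI 1 one_ne_zero
    exact hasSpeedBound_of_lintegral_speed_sub hT.le
      (ne_top_of_le_ne_top ENNReal.one_ne_top (hz n)) (hmap n).2.2.2.2
  have hev : Continuous fun γ : Curves T X => γ ⟨0, left_mem_Icc.2 hT.le⟩ := continuous_eval_const _
  have hR' : ∀ n, ∀ᵐ γ : Curves T X ∂(π n),
      γ ⟨0, left_mem_Icc.2 hT.le⟩ ∈ Metric.closedBall x₀ R := fun n => by
    have h1 := hR n
    rw [← (hmap n).2.2.2.1] at h1
    exact ae_of_ae_map hev.aemeasurable h1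
  have htight : IsTightMeasureSet (range π) :=
    isTightMeasureSet_range_of_speed hT.le hm hK hR' (fun n => (hG n).measurable)
      (fun n => (hG n).edist_le) hUI
  set P : ℕ → ProbabilityMeasure (Curves T X) := fun n => ⟨π n, hπp n⟩ with hP
  have hcomp : IsCompact (closure (range P)) := by
    refine isCompact_closure_of_isTightMeasureSet (htight.subset ?_)
    rintro _ ⟨_, ⟨n, rfl⟩, rfl⟩
    exact ⟨n, rfl⟩
  obtain ⟨P₀, -, χ, hχ, hlim⟩ := hcomp.tendsto_subseq fun n => subset_closure (mem_range_self n)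
  have hlim' := ProbabilityMeasure.tendsto_iff_forall_integral_tendsto.1 hlim
  refine ⟨χ, hχ, fun Φ => ?_⟩
  have hFc : AEMeasurable (flowMap F) ρ₀ := by
    refine aemeasurable_flowMap hF.measurable ?_
    filter_upwards [hρ₀.ae_le hF.ac] with x hx
    exact hx.1.continuous hT.le
  have heq : (P₀ : Measure (Curves T X)) = ρ₀.map (flowMap F) :=
    eq_map_flowMap_of_tendsto (mn := fun n => mn (χ n)) (bn := fun n => bn (χ n))
      (π := fun n => π (χ n)) (G := fun n => G (χ n)) (ρ := fun n => ρ (χ n)) hT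
      (fun v hv => (hm v hv).comp hχ.tendsto_atTop) hD (hbn.comp hm hT hχ) hb hF hind hlim'
      (fun n => hK (χ n)) (fun n => hG (χ n))
      (fun ε hε => (hUI ε hε).imp fun z hz n => hz (χ n))
      (fun n => (hmap (χ n)).2.2.1) (fun g => (hρ g).comp hχ.tendsto_atTop)
      (fun n => (hmap (χ n)).2.2.2.1)
  have h1 := hlim' Φ
  rw [heq, integral_map hFc Φ.continuous.measurable.aestronglyMeasurable] at h1
  refine h1.congr fun n => ?_
  exact integral_map (hmap (χ n)).1 Φ.continuous.measurable.aestronglyMeasurable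

theorem IsRegularFlow.aemeasurable_flowMap {hT : 0 ≤ T} (hF : IsRegularFlow hT b F) :
    AEMeasurable (flowMap F) m := by
  refine MetricFlow.aemeasurable_flowMap hF.measurable ?_
  filter_upwards [hF.ac] with x hx
  exact hx.1.continuous hT

theorem abs_integral_mul_le_of_nonneg {μ : Measure X} {v g : X → ℝ} (hv : Integrable v μ)
    (hv0 : ∀ x, 0 ≤ v x) {B : ℝ} (hg : ∀ x, |g x| ≤ B) :
    |∫ x, v x * g x ∂μ| ≤ B * ∫ x, v x ∂μ := by
  rw [← integral_const_mul, ← Real.norm_eq_abs]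
  refine norm_integral_le_of_norm_le (hv.const_mul B) (Eventually.of_forall fun x => ?_)
  rw [Real.norm_eq_abs, abs_mul, abs_of_nonneg (hv0 x), mul_comm]
  exact mul_le_mul_of_nonneg_right (hg x) (hv0 x)

/-- A nonnegative `v` of positive mass, once normalised, gives initial probability laws with bounded
densities and a common bounded support. Undoing the normalisation along convergent subsequences
gives the claim. -/
theorem tendsto_integral_mul_flowMap_of_nonneg [Nonempty X] (hT : 0 < T) (hm : WeakConv mn m)
    (hD : FlatDense m D) (hbn : StrongConv bn b D) (hb : ReflexiveOrDiv b)
    (hFn : ∀ n, IsRegularFlow hT.le (bn n) (Fn n)) {C : ℝ≥0}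
    (hC : ∀ n, Compresses (mn n) (Fn n) C)
    (hΘ : Tendsto (fun z : ℝ≥0 => Θ z / z) atTop (𝓝 ∞))
    (hΘb : ⨆ n, ∫⁻ t in Ioo 0 T, ∫⁻ x, Θ (((bn n).der t).norm x).toNNReal ∂(mn n) < ∞)
    (hF : IsRegularFlow hT.le b F)
    (hind : ∀ π : Measure (Curves T X), IsRegularGenFlow hT.le b π → IsInducedBy hT.le π F)
    {v : X →ᵇ ℝ} (hv : BddSupport v) (hv0 : ∀ x, 0 ≤ v x) (Φ : Curves T X →ᵇ ℝ) :
    Tendsto (fun n => ∫ x, v x * Φ (flowMap (Fn n) x) ∂(mn n)) atTop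
      (𝓝 (∫ x, v x * Φ (flowMap F x) ∂m)) := by
  have hvm : Measurable v := v.continuous.measurable
  have hvi : ∀ (μ : Measure X) [BoundedlyFinite μ], Integrable v μ := fun μ _ =>
    integrable_of_isBounded_support hvm.aestronglyMeasurable (fun x => v.norm_coe_le_norm x) hv
  have hA := hm v hv
  have hΦ : ∀ (H : X → Curves T X) (x : X), |Φ (H x)| ≤ ‖Φ‖ := fun H x => Φ.norm_coe_le_norm _
  set A : ℝ := ∫ x, v x ∂m with hAd
  have hA0 : 0 ≤ A := integral_nonneg hv0
  -- If `v` has no mass in the limit, both sides tend to zero since `Φ` is bounded.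
  rcases hA0.eq_or_lt' with h0 | hpos
  · have h1 : ∫ x, v x * Φ (flowMap F x) ∂m = 0 := by
      have h2 := abs_integral_mul_le_of_nonneg (hvi m) hv0 (hΦ (flowMap F))
      rw [← hAd, h0, mul_zero] at h2
      exact abs_nonpos_iff.1 h2
    rw [h1]
    refine squeeze_zero_norm (fun n =>
      abs_integral_mul_le_of_nonneg (hvi (mn n)) hv0 (hΦ (flowMap (Fn n)))) ?_
    have h2 := hA.const_mul ‖Φ‖
    rwa [h0, mul_zero] at h2
  refine tendsto_of_subseq_tendsto fun ns hns => ?_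
  obtain ⟨φ, hφ⟩ := strictMono_subseq_of_tendsto_atTop hns
  have hAφ : Tendsto (fun n => ∫ x, v x ∂(mn (ns (φ n)))) atTop (𝓝 A) := hA.comp hφ.2.tendsto_atTop
  -- Past `N` the masses are at least `A / 2`, which makes the normalised densities uniformly
  -- bounded.
  obtain ⟨N, hN⟩ := eventually_atTop.1 (hAφ.eventually (eventually_ge_nhds (half_lt_self hpos)))
  set ψ : ℕ → ℕ := fun n => ns (φ (n + N)) with hψd
  have hψ : StrictMono ψ := fun i j hij => hφ.2 (Nat.add_lt_add_right hij N)
  set a : ℕ → ℝ := fun n => ∫ x, v x ∂(mn (ψ n)) with had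
  have haA : ∀ n, A / 2 ≤ a n := fun n => hN _ (Nat.le_add_left _ _)
  have hA2 : 0 < A / 2 := half_pos hpos
  have ha0 : ∀ n, 0 < a n := fun n => hA2.trans_le (haA n)
  have ha : Tendsto a atTop (𝓝 A) := hA.comp hψ.tendsto_atTop
  have hdens : ∀ (μ : Measure X) [BoundedlyFinite μ] {c : ℝ}, 0 < c → ∫ x, v x ∂μ = c →
      IsProbabilityMeasure (densMeasure μ fun x => v x / c) := fun μ _ c hc hvc =>
    isProbabilityMeasure_dens ((hvi μ).div_const c) (fun x => div_nonneg (hv0 x) hc.le)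
      (by rw [integral_div, hvc, div_self hc.ne'])
  have hint : ∀ (μ : Measure X) {c : ℝ}, 0 < c → ∀ g : X → ℝ,
      ∫ x, g x ∂(densMeasure μ fun x => v x / c) = (∫ x, v x * g x ∂μ) / c := fun μ c hc g => by
    rw [integral_densMeasure (hvm.div_const c) (fun x => div_nonneg (hv0 x) hc.le), ← integral_div]
    refine integral_congr_ae (Eventually.of_forall fun x => ?_)
    simp only
    ring
  set ρ : ℕ → Measure X := fun n => densMeasure (mn (ψ n)) fun x => v x / a n with hρd
  set ρ₀ : Measure X := densMeasure m fun x => v x / A with hρ₀d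
  have hρp : ∀ n, IsProbabilityMeasure (ρ n) := fun n => hdens _ (ha0 n) rfl
  have hρ₀p : IsProbabilityMeasure ρ₀ := hdens _ hpos rfl
  have hρ : ∀ g : X →ᵇ ℝ, Tendsto (fun n => ∫ x, g x ∂(ρ n)) atTop (𝓝 (∫ x, g x ∂ρ₀)) := fun g => by
    simp only [hρd, hρ₀d, hint _ hpos, hint _ (ha0 _)]
    refine Tendsto.div ?_ ha hpos.ne'
    exact (hm (v * g) (hv.subset fun x hx hvx => hx (by simp [hvx]))).comp hψ.tendsto_atTop
  obtain ⟨x₀⟩ := ‹Nonempty X›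
  have : Nonempty X := ⟨x₀⟩
  obtain ⟨R, hR⟩ := hv.subset_closedBall x₀
  have hρR : ∀ n, ∀ᵐ x ∂(ρ n), x ∈ Metric.closedBall x₀ R := fun n => by
    rw [hρd]
    refine (ae_withDensity_iff (hvm.div_const _).ennreal_ofReal).2 (Eventually.of_forall fun x hx => ?_)
    exact hR fun hvx => hx (by simp [hvx])
  have hV : ∀ n, ρ n ≤ (‖v‖ / (A / 2)).toNNReal • mn (ψ n) := fun n => by
    have h1 : (‖v‖ / (A / 2)).toNNReal • mn (ψ n) =
        (mn (ψ n)).withDensity fun _ => ENNReal.ofReal (‖v‖ / (A / 2)) := (withDensity_const _).symm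
    rw [h1]
    refine withDensity_mono (Eventually.of_forall fun x => ENNReal.ofReal_le_ofReal ?_)
    exact div_le_div₀ (norm_nonneg _) ((le_abs_self _).trans (v.norm_coe_le_norm x)) hA2 (haA n)
  have hρ₀m : ρ₀ ≪ m := withDensity_absolutelyContinuous _ _
  obtain ⟨χ, hχ, hlim⟩ := exists_subseq_tendsto_flowMap (mn := fun n => mn (ψ n))
    (bn := fun n => bn (ψ n)) (Fn := fun n => Fn (ψ n)) hT
    (fun v hv => (hm v hv).comp hψ.tendsto_atTop) hD (hbn.comp hm hT hψ) hb (fun n => hFn (ψ n))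
    (fun n => hC (ψ n)) hΘ ((iSup_comp_le (fun n => ∫⁻ t in Ioo 0 T,
      ∫⁻ x, Θ (((bn n).der t).norm x).toNNReal ∂(mn n)) ψ).trans_lt hΘb) hF hind hV
    hρ₀m hρ hρR
  refine ⟨fun n => φ (χ n + N), ?_⟩
  have h1 := (hlim Φ).mul (ha.comp hχ.tendsto_atTop)
  simp only [hρd, hρ₀d, Function.comp_def] at h1
  rw [hint m hpos, div_mul_cancel₀ _ hpos.ne'] at h1
  refine h1.congr fun n => ?_
  rw [hint _ (ha0 _), div_mul_cancel₀ _ (ha0 _).ne']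

/-- Positive and negative parts of `v` are again continuous, bounded and of bounded support. -/
theorem tendsto_integral_mul_flowMap [Nonempty X] (hT : 0 < T) (hm : WeakConv mn m)
    (hD : FlatDense m D) (hbn : StrongConv bn b D) (hb : ReflexiveOrDiv b)
    (hFn : ∀ n, IsRegularFlow hT.le (bn n) (Fn n)) {C : ℝ≥0}
    (hC : ∀ n, Compresses (mn n) (Fn n) C)
    (hΘ : Tendsto (fun z : ℝ≥0 => Θ z / z) atTop (𝓝 ∞))
    (hΘb : ⨆ n, ∫⁻ t in Ioo 0 T, ∫⁻ x, Θ (((bn n).der t).norm x).toNNReal ∂(mn n) < ∞)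
    (hF : IsRegularFlow hT.le b F)
    (hind : ∀ π : Measure (Curves T X), IsRegularGenFlow hT.le b π → IsInducedBy hT.le π F)
    {v : X →ᵇ ℝ} (hv : BddSupport v) (Φ : Curves T X →ᵇ ℝ) :
    Tendsto (fun n => ∫ x, v x * Φ (flowMap (Fn n) x) ∂(mn n)) atTop
      (𝓝 (∫ x, v x * Φ (flowMap F x) ∂m)) := by
  have hs : ∀ w : X →ᵇ ℝ, (∀ x, v x = 0 → w x = 0) → BddSupport w := fun w hw =>
    hv.subset fun x hx hvx => hx (hw x hvx)
  set vp : X →ᵇ ℝ := v ⊔ 0 with hvp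
  set vm : X →ᵇ ℝ := (-v) ⊔ 0 with hvm
  have hp : BddSupport vp := hs _ fun x hx => by simp [hvp, hx]
  have hn : BddSupport vm := hs _ fun x hx => by simp [hvm, hx]
  have hsub : ∀ x, v x = vp x - vm x := fun x => by
    simp only [hvp, hvm, BoundedContinuousFunction.coe_sup, BoundedContinuousFunction.coe_neg,
      BoundedContinuousFunction.coe_zero, Pi.sup_apply, Pi.neg_apply, Pi.zero_apply]
    exact (posPart_sub_negPart (v x)).symm
  have hwi : ∀ (μ : Measure X) [BoundedlyFinite μ] {H : X → Curves T X}, AEMeasurable H μ →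
      ∀ w : X →ᵇ ℝ, BddSupport w → Integrable (fun x => w x * Φ (H x)) μ := fun μ _ H hH w hw =>
    (integrable_of_isBounded_support w.continuous.measurable.aestronglyMeasurable
      (fun x => w.norm_coe_le_norm x) hw).mul_bdd
      (Φ.continuous.measurable.comp_aemeasurable hH).aestronglyMeasurable
      (Eventually.of_forall fun x => Φ.norm_coe_le_norm _)
  have heq : ∀ (μ : Measure X) [BoundedlyFinite μ] {H : X → Curves T X}, AEMeasurable H μ →
      ∫ x, v x * Φ (H x) ∂μ = ∫ x, vp x * Φ (H x) ∂μ - ∫ x, vm x * Φ (H x) ∂μ := fun μ _ H hH => by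
    rw [← integral_sub (hwi μ hH vp hp) (hwi μ hH vm hn)]
    simp only [hsub, sub_mul]
  rw [heq m hF.aemeasurable_flowMap]
  simp only [fun n => heq (mn n) (hFn n).aemeasurable_flowMap]
  exact (tendsto_integral_mul_flowMap_of_nonneg hT hm hD hbn hb hFn hC hΘ hΘb hF hind hp
    (fun x => le_sup_right (a := v x)) Φ).sub
    (tendsto_integral_mul_flowMap_of_nonneg hT hm hD hbn hb hFn hC hΘ hΘb hF hind hn
    (fun x => le_sup_right (a := -v x)) Φ)

end stability

end MetricFlow

theorem mainTheorem8 {X : Type*} [MetricSpace X] [CompleteSpace X]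
    [TopologicalSpace.SeparableSpace X] [MeasurableSpace X] [BorelSpace X]
    (T : ℝ) (hT : 0 < T)
    (mn : ℕ → Measure X) (m : Measure X) [∀ n, BoundedlyFinite (mn n)] [BoundedlyFinite m]
    (hm : WeakConv mn m)
    (bn : ∀ n, TimeDerivation T (mn n)) (b : TimeDerivation T m)
    (D : Set (LipB X)) (hD : FlatDense m D) (hbn : StrongConv bn b D)
    (hb : ReflexiveOrDiv b)
    (Fn : ℕ → Icc (0 : ℝ) T → X → X) (hFn : ∀ n, IsRegularFlow hT.le (bn n) (Fn n))
    (hC : ∃ C : ℝ≥0, ∀ n, Compresses (mn n) (Fn n) C)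
    (Θ : ℝ≥0 → ℝ≥0∞) (hΘ : Tendsto (fun z : ℝ≥0 => Θ z / z) atTop (𝓝 ∞))
    (hΘb : ⨆ n, ∫⁻ t in Ioo 0 T, ∫⁻ x, Θ (((bn n).der t).norm x).toNNReal ∂(mn n) < ∞)
    (F : Icc (0 : ℝ) T → X → X) (hF : IsRegularFlow hT.le b F)
    (hind : ∀ π : Measure (Curves T X), IsRegularGenFlow hT.le b π → IsInducedBy hT.le π F) :
    ConvInMeasure mn m (fun n => flowMap (Fn n)) (flowMap F) := by
  have : SecondCountableTopology X := UniformSpace.secondCountable_of_separable X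
  refine ⟨fun n => (hFn n).aemeasurable_flowMap, hF.aemeasurable_flowMap, fun Φ v hv => ?_⟩
  rcases isEmpty_or_nonempty X with hX | hX
  · simp only [Measure.eq_zero_of_isEmpty, integral_zero_measure]
    exact tendsto_const_nhds
  · obtain ⟨C, hC⟩ := hC
    exact tendsto_integral_mul_flowMap hT hm hD hbn hb hFn hC hΘ hΘb hF hind hv Φ
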